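/- Let $\alpha>\tfrac12$, $1<q<\frac{3}{2\alpha-1}$, and let $f\in L^q(\mathbb R^3;\mathbb R^{3\times 3})$. On $\mathbb R^3\times(0,\infty)$ consider the non-local Stokes system $$\partial_t w+(-\Delta)^\alpha w+\nabla p=t^{\frac1\alpha-2}\,\mathrm{div}_x\big(f(x/t^{\frac1{2\alpha}})\big),\qquad \mathrm{div}\,w=0, \tag{S}$$ where $(\mathrm{div}\,g)_j=\sum_h\partial_h g_{hj}$, $(-\Delta)^\alpha$ is the Fourier multiplier with symbol $|\xi|^{2\alpha}$, and a vector field $w$ is called a solution on $\mathbb R^3\times(0,T)$ if (S) holds there in the sense of distributions for some scalar distribution $p$ on $\mathbb R^3\times(0,T)$. Let $\mathbb P$ be the Helmholtz projection onto divergence-free fields (symbol $\delta_{kj}-\xi_k\xi_j/|\xi|^2$), and let $e^{-\tau(-\Delta)^\alpha}\mathbb P\,\mathrm{div}$, $\tau>0$, act by convolution with the kernel $\Upsilon_{hkj}(\cdot,\tau)=\partial_h\mathcal O_{kj}(\cdot,\tau)$, where the Oseen kernel $\mathcal O_{kj}(\cdot,\tau)$ is the function with Fourier symbol $(\delta_{kj}-\xi_k\xi_j/|\xi|^2)e^{-\tau|\xi|^{2\alpha}}$.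 Then: (1) The Duhamel integral $$w(x,t)=\int_0^t e^{-(t-s)(-\Delta)^\alpha}\,\mathbb P\,\mathrm{div}_x\, s^{\frac1\alpha-2}f(\cdot/s^{\frac1{2\alpha}})\,ds$$ converges absolutely for every $t>0$ and almost every $x\in\mathbb R^3$. It is a solution of (S) on $\mathbb R^3\times(0,\infty)$, it belongs to $L^\infty(0,T;L^q(\mathbb R^3))$ for every $T<\infty$, and $\lim_{t\to0}\|w(\cdot,t)\|_{L^q(\mathbb R^3)}=0$. (2) Let $0<T\le\infty$ and $1\le q_1<\infty$, and let $v$ be a solution of (S) on $\mathbb R^3\times(0,T)$ with $v\in L^\infty(0,T';L^{q_1}(\mathbb R^3))$ for every finite $T'\le T$ and $\operatorname{ess\,lim}_{t\to0}\|v(\cdot,t)\|_{L^{q_1}(\mathbb R^3)}=0$. Then $v=w$ almost everywhere in $\mathbb R^3\times(0,T)$. In particular, for $T=\infty$, $v=w$ a.e. in $\mathbb R^3\times(0,\infty)$. -/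

import Mathlib

open MeasureTheory Set Filter Topology TopologicalSpace
open scoped LineDeriv Distributions FourierTransform NNReal ENNReal

noncomputable section

namespace NonlocalStokes

/-- Physical space `ℝ³` with its Euclidean norm. -/
abbrev E3 : Type := EuclideanSpace ℝ (Fin 3)

/-- The standard basis vectors of `ℝ³`. -/
def e (k : Fin 3) : E3 := EuclideanSpace.single k 1

/-- The symbol `|2πξ|^{2α}` of `(-Δ)^α`, for the Fourier transform
`𝓕 φ ξ = ∫ φ(x) exp(-2πi x·ξ) dx`. -/
def fracSymbol (α : ℝ) (ξ : E3) : ℝ := (2 * Real.pi * ‖ξ‖) ^ (2 * α)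

/-- The fractional Laplacian `(-Δ)^α φ` of a (smooth, compactly supported) real function `φ` on
`ℝ³`, as the Fourier multiplier with symbol `|2πξ|^{2α}`. -/
def fracLaplacian (α : ℝ) (φ : E3 → ℝ) (x : E3) : ℝ :=
  (𝓕⁻ (fun ξ : E3 => (fracSymbol α ξ : ℂ) * 𝓕 (fun y : E3 => (φ y : ℂ)) ξ) x).re

/-- The symbol `δ_{kj} - ξ_k ξ_j / |ξ|²` of the Helmholtz projection `ℙ` onto divergence-free
vector fields (its value at the single frequency `ξ = 0` is irrelevant). -/
def helmholtzSymbol (k j : Fin 3) (ξ : E3) : ℝ :=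
  (if k = j then 1 else 0) - ξ k * ξ j / ‖ξ‖ ^ 2

/-- The non-local Oseen kernel `𝒪_{kj}(x,t)`, i.e. the convolution kernel of
`e^{-t(-Δ)^α} ℙ` for `t > 0`: the inverse Fourier transform of
`(δ_{kj} - ξ_k ξ_j / |ξ|²) exp(-t |2πξ|^{2α})`. (The symbol is real and even, so the inverse
transform is real-valued.) -/
def oseen (α : ℝ) (k j : Fin 3) (x : E3) (t : ℝ) : ℝ :=
  (𝓕⁻ (fun ξ : E3 =>
    ((helmholtzSymbol k j ξ * Real.exp (-t * fracSymbol α ξ) : ℝ) : ℂ)) x).re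

/-- `Υ_{hkj}(x,t) = ∂_h 𝒪_{kj}(x,t)`, the kernel of `e^{-t(-Δ)^α} ℙ div`. -/
def oseenGrad (α : ℝ) (h k j : Fin 3) (x : E3) (t : ℝ) : ℝ :=
  lineDeriv ℝ (fun y : E3 => oseen α k j y t) x (e h)

/-- The operator `e^{-τ(-Δ)^α} ℙ div` (`τ > 0`) applied to a matrix field `g`, with
`(div g)_j = ∑_h ∂_h g_{hj}`. -/
def semigroupHelmholtzDiv (α τ : ℝ) (g : E3 → Matrix (Fin 3) (Fin 3) ℝ) (x : E3) : E3 :=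
  WithLp.toLp 2 fun k => ∫ y : E3, ∑ h, ∑ j, oseenGrad α h k j (x - y) τ * g y h j

/-- The self-similar force tensor `t^{1/α-2} f(x / t^{1/(2α)})`. -/
def forceTensor (α : ℝ) (f : E3 → Matrix (Fin 3) (Fin 3) ℝ) (t : ℝ) (x : E3) :
    Matrix (Fin 3) (Fin 3) ℝ :=
  t ^ (1 / α - 2) • f ((t ^ (1 / (2 * α)))⁻¹ • x)

/-- The Duhamel integral
`w(x,t) = ∫₀ᵗ e^{-(t-s)(-Δ)^α} ℙ div (s^{1/α-2} f(· / s^{1/(2α)})) ds`. -/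
def duhamel (α : ℝ) (f : E3 → Matrix (Fin 3) (Fin 3) ℝ) (t : ℝ) (x : E3) : E3 :=
  ∫ s in Ioo 0 t, semigroupHelmholtzDiv α (t - s) (forceTensor α f s) x

/-- The open space-time domain `(0,T) × ℝ³`, for `0 < T ≤ ∞`. -/
def spaceTime (T : EReal) : Opens (ℝ × E3) where
  carrier := {z | 0 < z.1 ∧ (z.1 : EReal) < T}
  is_open' := (isOpen_lt continuous_const continuous_fst).inter
    (isOpen_lt (continuous_coe_real_ereal.comp continuous_fst) continuous_const)

/-- `v ∈ L^∞(0,T; L^r(ℝ³))` for a finite time `T`. -/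
def MemLinftyLp (T : ℝ) (r : ℝ≥0∞) (v : ℝ → E3 → E3) : Prop :=
  AEStronglyMeasurable (fun z : ℝ × E3 => v z.1 z.2)
      (volume.restrict (spaceTime (T : EReal) : Set (ℝ × E3))) ∧
    ∃ C : ℝ≥0, ∀ᵐ t ∂(volume.restrict (Ioo 0 T)), eLpNorm (v t) r volume ≤ C

/-- `v` is a solution, on `(0,T) × ℝ³` with `0 < T ≤ ∞`, of
`∂ₜ v + (-Δ)^α v + ∇p = t^{1/α-2} div (f(x / t^{1/(2α)}))`, `div v = 0`,
in the sense of distributions, for some pressure distribution `p`; and `v` lies in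
`L^∞(0,T'; L^r(ℝ³))` for all finite `T' ≤ T`. -/
structure IsSolution (α : ℝ) (f : E3 → Matrix (Fin 3) (Fin 3) ℝ) (T : EReal) (r : ℝ≥0∞)
    (v : ℝ → E3 → E3) : Prop where
  memLinftyLp : ∀ T' : ℝ, 0 < T' → (T' : EReal) ≤ T → MemLinftyLp T' r v
  /-- `div v = 0` in the sense of distributions. -/
  divergence_free : ∀ ψ : 𝓓(spaceTime T, ℝ),
    ∫ z in (spaceTime T : Set (ℝ × E3)),
      ∑ k, v z.1 z.2 k * (∂_{((0 : ℝ), e k)} ψ) z = 0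
  /-- The `k`-th component of the momentum equation, tested against `ψ`. -/
  momentum : ∃ p : 𝓓'(spaceTime T, ℝ), ∀ (k : Fin 3) (ψ : 𝓓(spaceTime T, ℝ)),
    (∫ z in (spaceTime T : Set (ℝ × E3)), v z.1 z.2 k *
        (-(∂_{((1 : ℝ), (0 : E3))} ψ) z + fracLaplacian α (fun x => ψ (z.1, x)) z.2))
      + (∂_{((0 : ℝ), e k)} p) ψ
    = -∫ z in (spaceTime T : Set (ℝ × E3)),
        ∑ h, forceTensor α f z.1 z.2 h k * (∂_{((0 : ℝ), e h)} ψ) z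

end NonlocalStokes

end

open MeasureTheory Set Filter Topology TopologicalSpace
open scoped LineDeriv Distributions FourierTransform NNReal ENNReal

noncomputable section

namespace NonlocalStokes

/-! Existence and decay follow from scaling. The kernel of `e^{-τ(-Δ)^α} ℙ div` at time `τ` is a
dilate of the kernel at time one, so its `L¹` norm is a multiple of `τ^{-1/(2α)}`, while the force
at time `s` has `L^q` norm a multiple of `s^β` with `β = 1/α - 2 + 3/(2αq)`. A Young-type inequality
bounds the `L^q` norm of the Duhamel integral by a multiple of `∫₀ᵗ (t-s)^{-1/(2α)} s^β ds`, a Beta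
integral proportional to `t^{β+1-1/(2α)}`. The condition `α > 1/2` makes the singularity at `s = t`
integrable, and `q(2α-1) < 3` says exactly that the resulting power of `t` is positive; this forces
`β > -1` and gives the zero initial value (`lintegral_duhamelAbs_le`, `neg_one_lt_forceExp`).

Integrability of the kernels rests on one criterion, `exists_integral_norm_fourierInv_le`: if a
symbol `m` vanishes to order `a > 1/2` at the origin, with matching bounds for two derivatives and
decay at infinity, then `m` and its second derivatives are in `L²`, and Plancherel plus
Cauchy-Schwarz against `(1 + 4π²|x|²)⁻¹` puts the inverse transform in `L¹`.

The equation is obtained by duality. Fubini moves the kernel from the force to the function `-∂ₜψ +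
(-Δ)^α ψ`; on the Fourier side the time integral is then that of an exact derivative and returns `ψ`
itself (`integral_exp_mul_fourier_slice`). What is left is the multiplier `2πi ξ_h (δ_kj - ξ_k
ξ_j/|ξ|²)` acting on `ψ`. Its first term is the force, and its second is `ξ_h ξ_j/|ξ|²` acting on
`∂_k ψ`, which is the gradient of a pressure (`helmholtzGradSymbol_mul`, `momentum_duhamel`).

For uniqueness, no regularity or representation formula for `v` is available, only the
distributional equation. Taking the curl of the difference of two solutions removes both pressure
and force. Pair the curl with functions whose Fourier transform lives in an annulus, and insert `n`
powers of `|2πξ|^{2α}`: the resulting functions of time satisfy `aₙ' = -aₙ₊₁`, start from zero, and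
grow at most geometrically in `n`. Repeated passage to primitives forces `a₀ = 0`
(`integral_mul_eq_zero_of_hierarchy`). A field whose curl and divergence vanish at all nonzero
frequencies has no nonzero frequencies (`timePair_fourierInv_annular`). The frequency zero is
excluded because the difference is a sum of two fields with finite Lebesgue exponents: its pairing
tends to zero along functions that stay bounded in `L¹` and tend to zero in `L^∞`
(`IsSmall.tendsto_timePair_lowpass`). Density and mollification finish the argument. -/

/-! ### Inverse Fourier integrals: differentiation, Fubini, Plancherel. -/

open Module in
/-- Integration by parts along a direction, for a function which may be singular at the origin. -/
theorem integral_mul_hasLineDerivAt_eq_neg {f f' g g' : E3 → ℂ} {v : E3} (hv : v ≠ 0)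
    (hf'g : Integrable (fun x => f' x * g x)) (hfg' : Integrable (fun x => f x * g' x))
    (hfg : Integrable (fun x => f x * g x))
    (hf : ∀ x ≠ 0, HasLineDerivAt ℝ f (f' x) x v) (hg : ∀ x, HasLineDerivAt ℝ g (g' x) x v) :
    ∫ x, f x * g' x = - ∫ x, f' x * g x := by
  let E' := Fin 2 → ℝ
  -- Linear coordinates in which `v` is the last basis vector, so that the line derivative becomes
  -- an ordinary derivative in the last variable.
  obtain ⟨L, hL⟩ : ∃ L : E3 ≃L[ℝ] (E' × ℝ), L v = (0, 1) := by
    have h3 : finrank ℝ (E' × ℝ) = finrank ℝ E3 := by simp [E', E3]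
    have L₀ : E3 ≃L[ℝ] (E' × ℝ) := (ContinuousLinearEquiv.ofFinrankEq h3).symm
    obtain ⟨M, hM⟩ : ∃ M : (E' × ℝ) ≃L[ℝ] (E' × ℝ), M (L₀ v) = (0, 1) := by
      apply SeparatingDual.exists_continuousLinearEquiv_apply_eq
      · simpa using hv
      · simp
    exact ⟨L₀.trans M, by simp [hM]⟩
  have hLs : L.symm (0, 1) = v := by rw [← hL]; simp
  have key : ∀ {u : E3 → ℂ} {u' : ℂ} {y : E'} {t : ℝ},
      HasLineDerivAt ℝ u u' (L.symm (y, t)) v →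
      HasDerivAt (fun s : ℝ => u (L.symm (y, s))) u' t := by
    intro u u' y t h
    have h1 : HasDerivAt (fun s : ℝ => u (L.symm (y, t) + s • v)) u' (t - t) := by
      simpa [HasLineDerivAt] using h
    have h2 := h1.comp_sub_const t t
    have h4 : (fun s : ℝ => u (L.symm (y, s))) =
        fun s => u (L.symm (y, t) + (s - t) • v) := by
      funext s
      rw [← hLs, ← map_smul, ← map_add]
      simp
    rw [h4]
    exact h2
  let ν := Measure.map L (volume : Measure E3)
  have hLE : IsClosedEmbedding L.symm := L.symm.toHomeomorph.isClosedEmbedding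
  have L_emb : MeasurableEmbedding L := L.toHomeomorph.measurableEmbedding
  have hvol : (volume : Measure E3) = Measure.map L.symm ν := by
    simp [ν, Measure.map_map L.symm.continuous.measurable L.continuous.measurable]
  have tr : ∀ {u : E3 → ℂ}, Integrable u → Integrable (fun z => u (L.symm z)) ν := by
    intro u hu
    simpa [ν, L_emb.integrable_map_iff, Function.comp_def] using hu
  -- The image measure and the product Lebesgue measure are both Haar measures, hence multiples of
  -- each other; Fubini is available for the latter.
  suffices H : ∫ z, f (L.symm z) * g' (L.symm z) ∂ν = -∫ z, f' (L.symm z) * g (L.symm z) ∂ν by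
    simpa [hvol, hLE.integral_map] using H
  let μ₂ : Measure (E' × ℝ) := (volume : Measure E').prod volume
  have A : μ₂ = (Measure.addHaarScalarFactor μ₂ ν) • ν := Measure.isAddLeftInvariant_eq_smul _ _
  have tr' : ∀ {u : E3 → ℂ}, Integrable u → Integrable (fun z => u (L.symm z)) μ₂ := by
    intro u hu
    rw [A]; exact (tr hu).smul_measure_nnreal
  have B : ν = (Measure.addHaarScalarFactor ν μ₂) • μ₂ := Measure.isAddLeftInvariant_eq_smul _ _
  suffices H : ∫ z, f (L.symm z) * g' (L.symm z) ∂μ₂ = -∫ z, f' (L.symm z) * g (L.symm z) ∂μ₂ by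
    rw [B]; simp [H]
  rw [integral_prod _ (tr' hfg'), integral_prod _ (tr' hf'g), ← integral_neg]
  apply integral_congr_ae
  -- Among the lines parallel to `v` only the one over `y = 0` meets the origin, and it is
  -- negligible in the two transverse dimensions. On every other line the one-dimensional
  -- integration by parts applies.
  have hne : ∀ᵐ y : E', y ≠ 0 := by
    simp [ae_iff]
  filter_upwards [(tr' hf'g).prod_right_ae, (tr' hfg').prod_right_ae, (tr' hfg).prod_right_ae, hne]
    with y h1 h2 h3 hy
  refine integral_mul_deriv_eq_deriv_mul_of_integrable (u := fun t => f (L.symm (y, t)))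
    (v := fun t => g (L.symm (y, t))) ?_ ?_ h2 h1 h3
  · intro t _
    exact key (hf _ (by simpa using fun h => absurd h hy))
  · intro t _
    exact key (hg _)

theorem hasLineDerivAt_fourierChar (x ξ v : E3) :
    HasLineDerivAt ℝ (fun ζ : E3 => (Real.fourierChar (inner ℝ ζ x) : ℂ))
      (2 * Real.pi * Complex.I * (inner ℝ v x : ℝ) * Real.fourierChar (inner ℝ ξ x)) ξ v := by
  have h := (Real.hasDerivAt_fourierChar (inner ℝ ξ x))
  have h2 : HasDerivAt (fun t : ℝ => (inner ℝ (ξ + t • v) x : ℝ)) (inner ℝ v x) 0 := by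
    simp only [inner_add_left, inner_smul_left]
    simpa using ((hasDerivAt_id (0:ℝ)).mul_const (inner ℝ v x : ℝ)).const_add (inner ℝ ξ x : ℝ)
  have h3 := HasDerivAt.scomp_of_eq (0:ℝ) (g₁ := fun s : ℝ => (Real.fourierChar s : ℂ))
    (h := fun t : ℝ => (inner ℝ (ξ + t • v) x : ℝ)) h h2 (by simp)
  exact h3.congr_deriv (by rw [Complex.real_smul]; ring)

theorem fourierInv_eq_mul (m : E3 → ℂ) (x : E3) :
    𝓕⁻ m x = ∫ ξ, m ξ * (Real.fourierChar (inner ℝ ξ x) : ℂ) := by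
  rw [Real.fourierInv_eq]
  exact integral_congr_ae (.of_forall fun ξ => by simp [Circle.smul_def, mul_comm])

theorem norm_fourierChar (t : ℝ) : ‖(Real.fourierChar t : ℂ)‖ = 1 := Circle.norm_coe _

theorem continuous_fourierChar_inner :
    Continuous fun z : E3 × E3 => (Real.fourierChar (inner ℝ z.1 z.2) : ℂ) := by
  have := Real.continuous_fourierChar
  fun_prop

theorem integrable_mul_fourierChar {m : E3 → ℂ} (hm : Integrable m) (x : E3) :
    Integrable fun ξ => m ξ * (Real.fourierChar (inner ℝ ξ x) : ℂ) := by
  refine hm.mul_bdd (c := 1) ?_ (.of_forall fun ξ => (norm_fourierChar _).le)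
  exact (continuous_fourierChar_inner.comp (Continuous.prodMk_left x)).aestronglyMeasurable

/-- The inverse Fourier transform of a derivative, allowing a singularity at the origin. -/
theorem fourierInv_of_hasLineDerivAt {f f' : E3 → ℂ} {v : E3} (hv : v ≠ 0) (hf : Integrable f)
    (hf' : Integrable f') (h : ∀ ξ ≠ 0, HasLineDerivAt ℝ f (f' ξ) ξ v) (x : E3) :
    𝓕⁻ f' x = -(2 * Real.pi * Complex.I * (inner ℝ v x : ℝ)) * 𝓕⁻ f x := by
  have h1 := integral_mul_hasLineDerivAt_eq_neg hv (integrable_mul_fourierChar hf' x)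
    (((integrable_mul_fourierChar hf x).const_mul
      (2 * Real.pi * Complex.I * (inner ℝ v x : ℝ))).congr (.of_forall fun ξ => by ring))
    (integrable_mul_fourierChar hf x) h (fun ξ => hasLineDerivAt_fourierChar x ξ v)
  rw [fourierInv_eq_mul, fourierInv_eq_mul, ← neg_eq_iff_eq_neg.mpr h1, ← integral_const_mul,
    ← integral_neg]
  exact integral_congr_ae (.of_forall fun ξ => by ring)

theorem continuous_fourierInv {m : E3 → ℂ} (hm : Integrable m) : Continuous (𝓕⁻ m) := by
  rw [show 𝓕⁻ m = fun x => ∫ ξ, m ξ * (Real.fourierChar (inner ℝ ξ x) : ℂ) from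
    funext (fourierInv_eq_mul m)]
  refine continuous_of_dominated (bound := fun ξ => ‖m ξ‖) (fun x => ?_) (fun x => ?_) hm.norm ?_
  · exact (integrable_mul_fourierChar hm x).1
  · exact .of_forall fun ξ => by rw [norm_mul, norm_fourierChar, mul_one]
  · exact .of_forall fun ξ => continuous_const.mul
      (continuous_fourierChar_inner.comp (Continuous.prodMk_right ξ))

theorem norm_fourierInv_le (m : E3 → ℂ) (x : E3) : ‖𝓕⁻ m x‖ ≤ ∫ ξ, ‖m ξ‖ := by
  rw [fourierInv_eq_mul]
  refine (norm_integral_le_integral_norm _).trans (le_of_eq ?_)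
  simp_rw [norm_mul, norm_fourierChar, mul_one]

theorem integral_fourierInv_mul {m φ : E3 → ℂ} (hm : Integrable m) (hφ : Integrable φ) :
    ∫ x, 𝓕⁻ m x * φ x = ∫ ξ, m ξ * 𝓕⁻ φ ξ := by
  have h : Integrable (fun z : E3 × E3 => m z.1 * φ z.2 * (Real.fourierChar (inner ℝ z.1 z.2) : ℂ))
      (volume.prod volume) :=
    (hm.mul_prod hφ).mul_bdd (c := 1) continuous_fourierChar_inner.aestronglyMeasurable
      (.of_forall fun z => (norm_fourierChar _).le)
  have h2 := integral_integral_swap (f := fun ξ x => m ξ * φ x *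
    (Real.fourierChar (inner ℝ ξ x) : ℂ)) h
  simp_rw [fourierInv_eq_mul, ← integral_const_mul, ← integral_mul_const]
  refine (Eq.trans ?_ h2.symm).trans ?_
  · exact integral_congr_ae (.of_forall fun x => integral_congr_ae (.of_forall fun ξ => by
      simp only; ring))
  · refine integral_congr_ae (.of_forall fun x => integral_congr_ae (.of_forall fun ξ => ?_))
    simp only [real_inner_comm]; ring

/-- Plancherel's inequality for integrable functions. -/
theorem eLpNorm_fourierInv_le {m : E3 → ℂ} (hm : Integrable m) (hm2 : MemLp m 2) :
    eLpNorm (𝓕⁻ m) 2 volume ≤ eLpNorm m 2 volume := by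
  set F := hm2.toLp m
  have hF : (F : E3 → ℂ) =ᵐ[volume] m := hm2.coeFn_toLp
  have hcont : Continuous (𝓕⁻ m) := continuous_fourierInv hm
  -- The `L²` transform is defined by extension and the integral transform pointwise. They agree as
  -- tempered distributions, hence almost everywhere.
  have key : ((𝓕⁻ F : Lp ℂ 2 (volume : Measure E3)) : E3 → ℂ) =ᵐ[volume] 𝓕⁻ m := by
    refine ae_eq_of_integral_contDiff_smul_eq ((Lp.memLp _).locallyIntegrable (by norm_num))
      hcont.locallyIntegrable fun g hg hgc => ?_
    let φ : SchwartzMap E3 ℂ := HasCompactSupport.toSchwartzMap (f := fun x => (g x : ℂ))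
      (hgc.comp_left (g := fun r : ℝ => (r : ℂ)) (by simp))
      (Complex.ofRealCLM.contDiff.comp hg)
    have hφ : ∀ x, φ x = g x := fun x => rfl
    have h1 := congr_arg (fun T => T φ) (Lp.fourierInv_toTemperedDistribution_eq F)
    simp only [TemperedDistribution.fourierInv_apply, Lp.toTemperedDistribution_apply] at h1
    have h2 : ∫ x, (g x) • ((𝓕⁻ F : Lp ℂ 2 (volume : Measure E3)) : E3 → ℂ) x
        = ∫ x, φ x • ((𝓕⁻ F : Lp ℂ 2 (volume : Measure E3)) : E3 → ℂ) x := by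
      simp [hφ]
    rw [h2, ← h1]
    have h3 : ∫ x, (g x) • 𝓕⁻ m x = ∫ x, 𝓕⁻ m x * φ x := by
      simp [hφ, mul_comm]
    rw [h3, integral_fourierInv_mul hm φ.integrable]
    refine integral_congr_ae ?_
    filter_upwards [hF] with x hx
    rw [hx, SchwartzMap.fourierInv_coe, smul_eq_mul, mul_comm]
  rw [← eLpNorm_congr_ae key, ← eLpNorm_congr_ae hF]
  have h1 := Lp.norm_fourier_eq (𝓕⁻ F)
  rw [FourierTransform.fourier_fourierInv_eq] at h1
  rw [Lp.norm_def, Lp.norm_def] at h1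
  exact ((ENNReal.toReal_eq_toReal_iff' (Lp.eLpNorm_ne_top _) (Lp.eLpNorm_ne_top _)).1 h1).ge

/-! ### Symbols with homogeneous bounds on two derivatives. -/

/-- `m` is twice differentiable along the coordinate directions off the origin, with derivatives
of order `j` bounded by `w(‖ξ‖) ‖ξ‖ ^ (-j)`. -/
structure IsSymbol (w : ℝ → ℝ) (m : E3 → ℂ) : Prop where
  measurable : Measurable m
  deriv : ∀ i, ∃ m' m'' : E3 → ℂ, Measurable m' ∧ Measurable m'' ∧ ∀ ξ ≠ 0,
    HasLineDerivAt ℝ m (m' ξ) ξ (e i) ∧ HasLineDerivAt ℝ m' (m'' ξ) ξ (e i) ∧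
    ‖m ξ‖ ≤ w ‖ξ‖ ∧ ‖m' ξ‖ * ‖ξ‖ ≤ w ‖ξ‖ ∧ ‖m'' ξ‖ * ‖ξ‖ ^ 2 ≤ w ‖ξ‖

theorem IsSymbol.norm_le {w : ℝ → ℝ} {m : E3 → ℂ} (h : IsSymbol w m) {ξ : E3} (hξ : ξ ≠ 0) :
    ‖m ξ‖ ≤ w ‖ξ‖ := by
  obtain ⟨_, _, _, _, h⟩ := h.deriv 0
  exact (h ξ hξ).2.2.1

theorem IsSymbol.mono {w w' : ℝ → ℝ} {m : E3 → ℂ} (h : IsSymbol w m)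
    (hw : ∀ r, 0 < r → w r ≤ w' r) : IsSymbol w' m := by
  refine ⟨h.measurable, fun i => ?_⟩
  obtain ⟨m', m'', h1, h2, h3⟩ := h.deriv i
  refine ⟨m', m'', h1, h2, fun ξ hξ => ?_⟩
  obtain ⟨h4, h5, h6, h7, h8⟩ := h3 ξ hξ
  have := hw ‖ξ‖ (norm_pos_iff.2 hξ)
  exact ⟨h4, h5, h6.trans this, h7.trans this, h8.trans this⟩

/-- The constant is the sum `1 + 2 + 1` of the Leibniz coefficients of the second derivative. -/
theorem IsSymbol.mul {w₁ w₂ : ℝ → ℝ} {m₁ m₂ : E3 → ℂ} (h₁ : IsSymbol w₁ m₁)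
    (h₂ : IsSymbol w₂ m₂) : IsSymbol (fun r => 4 * (w₁ r * w₂ r)) (fun ξ => m₁ ξ * m₂ ξ) := by
  refine ⟨h₁.measurable.mul h₂.measurable, fun i => ?_⟩
  obtain ⟨a, a', ha, ha', hA⟩ := h₁.deriv i
  obtain ⟨b, b', hb, hb', hB⟩ := h₂.deriv i
  have hm₁ := h₁.measurable
  have hm₂ := h₂.measurable
  refine ⟨fun ξ => a ξ * m₂ ξ + m₁ ξ * b ξ,
    fun ξ => a' ξ * m₂ ξ + a ξ * b ξ + (a ξ * b ξ + m₁ ξ * b' ξ),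
    by fun_prop, by fun_prop, fun ξ hξ => ?_⟩
  obtain ⟨A1, A2, A3, A4, A5⟩ := hA ξ hξ
  obtain ⟨B1, B2, B3, B4, B5⟩ := hB ξ hξ
  have hr : 0 < ‖ξ‖ := norm_pos_iff.2 hξ
  have M1 : HasLineDerivAt ℝ (fun ξ => m₁ ξ * m₂ ξ) (a ξ * m₂ ξ + m₁ ξ * b ξ) ξ (e i) := by
    exact (HasDerivAt.mul A1 B1).congr_deriv (by simp)
  have M2 : HasLineDerivAt ℝ (fun ξ => a ξ * m₂ ξ + m₁ ξ * b ξ)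
      (a' ξ * m₂ ξ + a ξ * b ξ + (a ξ * b ξ + m₁ ξ * b' ξ)) ξ (e i) := by
    exact ((HasDerivAt.mul A2 B1).add (HasDerivAt.mul A1 B2)).congr_deriv (by simp)
  have k0 : 0 ≤ w₁ ‖ξ‖ := (norm_nonneg _).trans A3
  have l0 : 0 ≤ w₂ ‖ξ‖ := (norm_nonneg _).trans B3
  have p : ∀ {x y : ℝ}, 0 ≤ x → 0 ≤ y → x ≤ w₁ ‖ξ‖ → y ≤ w₂ ‖ξ‖ → x * y ≤ w₁ ‖ξ‖ * w₂ ‖ξ‖ :=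
    fun hx hy h1 h2 => mul_le_mul h1 h2 hy k0
  have q0 : 0 ≤ w₁ ‖ξ‖ * w₂ ‖ξ‖ := mul_nonneg k0 l0
  have P1 := p (norm_nonneg _) (norm_nonneg _) A3 B3
  have P2 := p (by positivity) (norm_nonneg _) A4 B3
  have P3 := p (norm_nonneg _) (by positivity) A3 B4
  have P4 := p (by positivity) (norm_nonneg _) A5 B3
  have P5 := p (by positivity) (by positivity) A4 B4
  have P6 := p (norm_nonneg _) (by positivity) A3 B5
  refine ⟨M1, M2, ?_, ?_, ?_⟩
  · rw [norm_mul]; linarith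
  · calc ‖a ξ * m₂ ξ + m₁ ξ * b ξ‖ * ‖ξ‖ ≤ (‖a ξ‖ * ‖m₂ ξ‖ + ‖m₁ ξ‖ * ‖b ξ‖) * ‖ξ‖ := by
          gcongr; exact (norm_add_le _ _).trans (by simp)
      _ = ‖a ξ‖ * ‖ξ‖ * ‖m₂ ξ‖ + ‖m₁ ξ‖ * (‖b ξ‖ * ‖ξ‖) := by ring
      _ ≤ _ := by linarith
  · calc ‖a' ξ * m₂ ξ + a ξ * b ξ + (a ξ * b ξ + m₁ ξ * b' ξ)‖ * ‖ξ‖ ^ 2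
        ≤ (‖a' ξ‖ * ‖m₂ ξ‖ + ‖a ξ‖ * ‖b ξ‖ + (‖a ξ‖ * ‖b ξ‖ + ‖m₁ ξ‖ * ‖b' ξ‖)) * ‖ξ‖ ^ 2 := by
          gcongr
          refine (norm_add_le _ _).trans (add_le_add ?_ ?_) <;>
            exact (norm_add_le _ _).trans (by simp)
      _ = ‖a' ξ‖ * ‖ξ‖ ^ 2 * ‖m₂ ξ‖ + 2 * (‖a ξ‖ * ‖ξ‖ * (‖b ξ‖ * ‖ξ‖))
          + ‖m₁ ξ‖ * (‖b' ξ‖ * ‖ξ‖ ^ 2) := by ring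
      _ ≤ _ := by linarith

theorem IsSymbol.add {w₁ w₂ : ℝ → ℝ} {m₁ m₂ : E3 → ℂ} (h₁ : IsSymbol w₁ m₁)
    (h₂ : IsSymbol w₂ m₂) : IsSymbol (fun r => w₁ r + w₂ r) (fun ξ => m₁ ξ + m₂ ξ) := by
  refine ⟨h₁.measurable.add h₂.measurable, fun i => ?_⟩
  obtain ⟨a, a', ha, ha', hA⟩ := h₁.deriv i
  obtain ⟨b, b', hb, hb', hB⟩ := h₂.deriv i
  refine ⟨fun ξ => a ξ + b ξ, fun ξ => a' ξ + b' ξ, by fun_prop, by fun_prop, fun ξ hξ => ?_⟩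
  obtain ⟨A1, A2, A3, A4, A5⟩ := hA ξ hξ
  obtain ⟨B1, B2, B3, B4, B5⟩ := hB ξ hξ
  refine ⟨HasDerivAt.add A1 B1, HasDerivAt.add A2 B2, (norm_add_le _ _).trans (add_le_add A3 B3),
    ?_, ?_⟩
  · refine le_trans (mul_le_mul_of_nonneg_right (norm_add_le _ _) (norm_nonneg _)) ?_
    linarith
  · refine le_trans (mul_le_mul_of_nonneg_right (norm_add_le _ _) (by positivity)) ?_
    linarith

theorem isSymbol_const (c : ℂ) : IsSymbol (fun _ => ‖c‖) (fun _ => c) := by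
  refine ⟨measurable_const, fun i => ⟨fun _ => 0, fun _ => 0, measurable_const, measurable_const,
    fun ξ hξ => ⟨hasDerivAt_const _ _, hasDerivAt_const _ _, le_rfl, by simp, by simp⟩⟩⟩

theorem hasLineDerivAt_coord (k i : Fin 3) (ξ : E3) :
    HasLineDerivAt ℝ (fun ξ : E3 => ξ k) ((e i) k) ξ (e i) := by
  have : HasDerivAt (fun t : ℝ => ξ k + t * (e i) k) ((e i) k) 0 := by
    simpa using ((hasDerivAt_id (0:ℝ)).mul_const ((e i) k)).const_add (ξ k)
  simpa [HasLineDerivAt] using this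

theorem norm_coord_le (ξ : E3) (k : Fin 3) : |ξ k| ≤ ‖ξ‖ := by
  simpa using PiLp.norm_apply_le ξ k

theorem isSymbol_coord (k : Fin 3) : IsSymbol (fun r => r) (fun ξ : E3 => ((ξ k : ℝ) : ℂ)) := by
  refine ⟨by fun_prop, fun i => ⟨fun _ => (((e i) k : ℝ) : ℂ), fun _ => 0, by fun_prop,
    by fun_prop, fun ξ hξ => ⟨?_, hasDerivAt_const _ _, ?_, ?_, by simp⟩⟩⟩
  · exact HasDerivAt.ofReal_comp (hasLineDerivAt_coord k i ξ)
  · simpa using norm_coord_le ξ k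
  · have : ‖((((e i) k : ℝ)) : ℂ)‖ ≤ 1 := by
      rw [Complex.norm_real]
      exact (norm_coord_le (e i) k).trans (by simp [e])
    exact (mul_le_mul_of_nonneg_right this (norm_nonneg _)).trans (by simp)

theorem hasLineDerivAt_norm {ξ : E3} (hξ : ξ ≠ 0) (i : Fin 3) :
    HasLineDerivAt ℝ (fun ξ : E3 => ‖ξ‖) (ξ i / ‖ξ‖) ξ (e i) := by
  have h := ((hasStrictFDerivAt_norm_sq ξ).hasFDerivAt.hasLineDerivAt (e i))
  have h2 := HasDerivAt.sqrt h (by simpa using hξ)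
  simp only [zero_smul, add_zero, norm_nonneg, Real.sqrt_sq] at h2
  refine HasDerivAt.congr_deriv h2 ?_
  simp [e, EuclideanSpace.inner_single_right]
  have : ‖ξ‖ ≠ 0 := by simpa using hξ
  field_simp

/-- Radial symbols. -/
theorem isSymbol_radial {g g' g'' w : ℝ → ℝ} (hg : Measurable g) (hg' : Measurable g')
    (hg'' : Measurable g'')
    (h : ∀ r, 0 < r → HasDerivAt g (g' r) r ∧ HasDerivAt g' (g'' r) r ∧ |g r| ≤ w r ∧
      |g' r| * r ≤ w r ∧ |g'' r| * r ^ 2 ≤ w r) :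
    IsSymbol (fun r => 3 * w r) (fun ξ => ((g ‖ξ‖ : ℝ) : ℂ)) := by
  refine ⟨by fun_prop, fun i => ⟨fun ξ => ((g' ‖ξ‖ * (ξ i / ‖ξ‖) : ℝ) : ℂ),
    fun ξ => ((g'' ‖ξ‖ * (ξ i / ‖ξ‖) * (ξ i / ‖ξ‖) +
      g' ‖ξ‖ * ((1 * ‖ξ‖ - ξ i * (ξ i / ‖ξ‖)) / ‖ξ‖ ^ 2) : ℝ) : ℂ), by fun_prop, by fun_prop,
      fun ξ hξ => ?_⟩⟩
  have hr : 0 < ‖ξ‖ := norm_pos_iff.2 hξ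
  obtain ⟨h1, h2, h3, h4, h5⟩ := h _ hr
  have hn := hasLineDerivAt_norm hξ i
  have hc : HasLineDerivAt ℝ (fun ξ : E3 => ξ i) 1 ξ (e i) := by
    simpa [e] using hasLineDerivAt_coord i i ξ
  have hq : |ξ i / ‖ξ‖| ≤ 1 := by
    rw [abs_div, abs_norm, div_le_one hr]; exact norm_coord_le ξ i
  have w0 : 0 ≤ w ‖ξ‖ := (abs_nonneg _).trans h3
  refine ⟨?_, ?_, ?_, ?_, ?_⟩
  · exact HasDerivAt.ofReal_comp (HasDerivAt.comp_of_eq (0:ℝ) h1 hn (by simp))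
  · have a1 := HasDerivAt.comp_of_eq (0:ℝ) h2 hn (by simp)
    have a2 := HasDerivAt.div hc hn (by simpa using hξ)
    have a3 := HasDerivAt.ofReal_comp (HasDerivAt.mul a1 a2)
    simpa [HasLineDerivAt, Function.comp_def] using a3
  · rw [Complex.norm_real, Real.norm_eq_abs]; linarith
  · rw [Complex.norm_real, Real.norm_eq_abs, abs_mul]
    nlinarith [abs_nonneg (g' ‖ξ‖), mul_nonneg (abs_nonneg (g' ‖ξ‖)) hr.le]
  · rw [Complex.norm_real, Real.norm_eq_abs]
    -- The derivative of `ξ_i/|ξ|` is `(1 - (ξ_i/|ξ|)²)/|ξ|`, whose numerator lies in `[0, 1]`.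
    have e1 : (1 * ‖ξ‖ - ξ i * (ξ i / ‖ξ‖)) / ‖ξ‖ ^ 2 = (1 - (ξ i / ‖ξ‖) ^ 2) / ‖ξ‖ := by
      field_simp
    have e2 : 0 ≤ (ξ i / ‖ξ‖) ^ 2 ∧ (ξ i / ‖ξ‖) ^ 2 ≤ 1 := ⟨sq_nonneg _, (sq_le_one_iff_abs_le_one _).2 hq⟩
    rw [e1]
    calc |g'' ‖ξ‖ * (ξ i / ‖ξ‖) * (ξ i / ‖ξ‖) + g' ‖ξ‖ * ((1 - (ξ i / ‖ξ‖) ^ 2) / ‖ξ‖)| * ‖ξ‖ ^ 2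
        ≤ (|g'' ‖ξ‖| * 1 + |g' ‖ξ‖| * (1 / ‖ξ‖)) * ‖ξ‖ ^ 2 := by
          gcongr
          refine (abs_add_le _ _).trans (add_le_add ?_ ?_)
          · rw [mul_assoc, abs_mul, ← sq, abs_of_nonneg e2.1]
            gcongr; exact e2.2
          · rw [abs_mul, abs_div, abs_norm,
              abs_of_nonneg (a := 1 - (ξ i / ‖ξ‖) ^ 2) (by linarith [e2.2])]
            gcongr; linarith [e2.1]
      _ = |g'' ‖ξ‖| * ‖ξ‖ ^ 2 + |g' ‖ξ‖| * ‖ξ‖ := by field_simp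
      _ ≤ _ := by linarith
-- Decay weights and a criterion for an integrable inverse transform.
/-- The weight `min (r ^ a) (r ^ (-b))`. -/
def decayWeight (a b r : ℝ) : ℝ := min (r ^ a) (r ^ (-b))

theorem decayWeight_nonneg {a b r : ℝ} (hr : 0 ≤ r) : 0 ≤ decayWeight a b r :=
  le_min (Real.rpow_nonneg hr _) (Real.rpow_nonneg hr _)

theorem measurable_decayWeight (a b : ℝ) : Measurable (decayWeight a b) := by
  unfold decayWeight; fun_prop

/-- In polar coordinates the density is `r²` times the weight, so the thresholds are those of
`r^{2+a}` at zero and `r^{2-b}` at infinity. -/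
theorem integrable_decayWeight {a b : ℝ} (ha : -3 < a) (hb : 3 < b) :
    Integrable (fun ξ : E3 => decayWeight a b ‖ξ‖) := by
  rw [integrable_fun_norm_addHaar volume (f := decayWeight a b)]
  have hm := measurable_decayWeight a b
  have hd : Module.finrank ℝ E3 - 1 = 2 := by simp [E3]
  rw [hd, ← Ioc_union_Ioi_eq_Ioi zero_le_one, integrableOn_union]
  have key : ∀ r : ℝ, 0 < r → ∀ s : ℝ, r ^ 2 * r ^ s = r ^ (2 + s) := by
    intro r hr s
    rw [Real.rpow_add hr]; norm_num
  constructor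
  · have h := (intervalIntegral.intervalIntegrable_rpow' (a := 0) (b := 1)
      (show -1 < 2 + a by linarith)).1
    refine Integrable.mono' h (by fun_prop) ?_
    refine (ae_restrict_iff' measurableSet_Ioc).2 (.of_forall fun r hr => ?_)
    rw [smul_eq_mul, norm_mul, Real.norm_of_nonneg (decayWeight_nonneg hr.1.le),
      Real.norm_of_nonneg (by positivity), ← key r hr.1]
    gcongr; exact min_le_left _ _
  · have h := integrableOn_Ioi_rpow_of_lt (show 2 + -b < -1 by linarith) zero_lt_one
    refine Integrable.mono' h (by fun_prop) ?_
    refine (ae_restrict_iff' measurableSet_Ioi).2 (.of_forall fun r hr => ?_)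
    have hr' : (0:ℝ) < r := zero_lt_one.trans hr
    rw [smul_eq_mul, norm_mul, Real.norm_of_nonneg (decayWeight_nonneg hr'.le),
      Real.norm_of_nonneg (by positivity), ← key r hr']
    gcongr; exact min_le_right _ _

theorem decayWeight_sq {a b r : ℝ} (hr : 0 < r) :
    decayWeight a b r ^ 2 = decayWeight (2 * a) (2 * b) r := by
  have h : ∀ s : ℝ, (r ^ s) ^ 2 = r ^ (2 * s) := fun s => by
    rw [mul_comm, Real.rpow_mul hr.le]; norm_num
  have h1 : 0 ≤ r ^ a := Real.rpow_nonneg hr.le _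
  have h2 : 0 ≤ r ^ (-b) := Real.rpow_nonneg hr.le _
  unfold decayWeight
  rw [show -(2 * b) = 2 * (-b) by ring, ← h, ← h]
  rcases le_total (r ^ a) (r ^ (-b)) with hab | hab
  · rw [min_eq_left hab, min_eq_left (by gcongr)]
  · rw [min_eq_right hab, min_eq_right (by gcongr)]

theorem decayWeight_le_of_le {a a' b r : ℝ} (hr : 0 < r) (h : a' ≤ a) (hb : -b ≤ a') :
    decayWeight a b r ≤ decayWeight a' b r := by
  unfold decayWeight
  refine le_min ?_ (min_le_right _ _)
  rcases le_total r 1 with h1 | h1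
  · exact (min_le_left _ _).trans (Real.rpow_le_rpow_of_exponent_ge hr h1 h)
  · exact (min_le_right _ _).trans (Real.rpow_le_rpow_of_exponent_le h1 hb)

theorem rpow_mul_decayWeight {a b c r : ℝ} (hr : 0 < r) :
    r ^ c * decayWeight a b r = decayWeight (c + a) (b - c) r := by
  unfold decayWeight
  rw [mul_min_of_nonneg _ _ (Real.rpow_nonneg hr.le _), ← Real.rpow_add hr, ← Real.rpow_add hr]
  congr 2; ring

/-- Taking at most two derivatives costs at most two powers at the origin, and division by `r^j`
does no harm at infinity. One weight therefore dominates the symbol together with both of its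
derivatives. -/
theorem decayWeight_div_le {a r : ℝ} (ha : 0 ≤ a) (hr : 0 < r) {j : ℕ} (hj : j ≤ 2) {x : ℝ}
    {C : ℝ} (hC : 0 ≤ C) (hx : x * r ^ j ≤ C * decayWeight a 4 r) :
    x ≤ C * decayWeight (a - 2) 4 r := by
  have h1 : r ^ (-(j:ℝ)) * decayWeight a 4 r ≤ decayWeight (a - 2) 4 r := by
    have hj' : (j : ℝ) ≤ 2 := by exact_mod_cast hj
    have hj0 : (0:ℝ) ≤ j := by positivity
    rw [rpow_mul_decayWeight hr]
    unfold decayWeight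
    rcases le_total r 1 with h1 | h1
    · refine (min_le_left _ _).trans (le_min ?_ ?_) <;>
        exact Real.rpow_le_rpow_of_exponent_ge hr h1 (by linarith)
    · refine (min_le_right _ _).trans (le_min ?_ ?_) <;>
        exact Real.rpow_le_rpow_of_exponent_le h1 (by linarith)
  calc x = (x * r ^ j) * r ^ (-(j:ℝ)) := by
        rw [Real.rpow_neg hr.le, Real.rpow_natCast]; field_simp
    _ ≤ C * decayWeight a 4 r * r ^ (-(j:ℝ)) := by gcongr
    _ = C * (r ^ (-(j:ℝ)) * decayWeight a 4 r) := by ring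
    _ ≤ _ := by gcongr

theorem ae_ne_zero : ∀ᵐ ξ : E3, ξ ≠ 0 := by simp [ae_iff]

theorem e_ne_zero (i : Fin 3) : e i ≠ 0 := by simp [e]

theorem inner_e (i : Fin 3) (x : E3) : inner ℝ (e i) x = x i := by
  simp [e, EuclideanSpace.inner_single_left]

/-- The inverse Fourier transform of a symbol which vanishes sufficiently fast at the origin and
decays at infinity is integrable, with a bound which is linear in the size of the symbol. -/
theorem exists_integral_norm_fourierInv_le {a : ℝ} (ha : 1 / 2 < a) :
    ∃ K : ℝ, 0 ≤ K ∧ ∀ (C : ℝ) (m : E3 → ℂ), 0 ≤ C →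
      IsSymbol (fun r => C * decayWeight a 4 r) m →
      Integrable m ∧ ∫ ξ, ‖m ξ‖ ≤ K * C ∧ Integrable (𝓕⁻ m) ∧ ∫ x, ‖𝓕⁻ m x‖ ≤ K * C := by
  wlog ha2 : a ≤ 2 generalizing a
  · obtain ⟨K, hK, h⟩ := this (a := 2) (by norm_num) le_rfl
    refine ⟨K, hK, fun C m hC hm => h C m hC (hm.mono fun r hr => ?_)⟩
    gcongr
    exact decayWeight_le_of_le hr (le_of_not_ge ha2) (by norm_num)
  set W : E3 → ℝ := fun ξ => decayWeight (a - 2) 4 ‖ξ‖ with hW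
  have W0 : ∀ ξ, 0 ≤ W ξ := fun ξ => decayWeight_nonneg (norm_nonneg _)
  have hWm : Measurable W := (measurable_decayWeight _ _).comp measurable_norm
  have hWi : Integrable W := integrable_decayWeight (by linarith) (by norm_num)
  -- This is where `a > 1/2` enters: the square of the weight behaves like `|ξ|^{2(a-2)}` at the
  -- origin, which is integrable in dimension three when `2(a-2) > -3`.
  have hW2 : MemLp W 2 := by
    rw [memLp_two_iff_integrable_sq hWm.aestronglyMeasurable]
    refine (integrable_decayWeight (a := 2 * (a - 2)) (b := 2 * 4) (by linarith)
      (by norm_num)).congr ?_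
    filter_upwards [ae_ne_zero] with ξ hξ
    rw [← decayWeight_sq (norm_pos_iff.2 hξ)]
  -- Multiplication by `1/ρ` on the space side corresponds to `m - Δm` on the frequency side. Since
  -- `ρ` is in `L²` of a three-dimensional space, an `L²` bound for the inverse transform of `m -
  -- Δm` (called `H` below) yields an `L¹` bound for that of `m`.
  set ρ : E3 → ℂ := fun x => (((1 + 4 * Real.pi ^ 2 * ‖x‖ ^ 2)⁻¹ : ℝ) : ℂ) with hρ
  have hpos : ∀ x : E3, 0 < 1 + 4 * Real.pi ^ 2 * ‖x‖ ^ 2 := fun x => by positivity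
  have hρc : Continuous ρ := by
    refine Complex.continuous_ofReal.comp (Continuous.inv₀ (by fun_prop) fun x => (hpos x).ne')
  have hρ2 : MemLp ρ 2 := by
    rw [memLp_two_iff_integrable_sq_norm hρc.aestronglyMeasurable]
    have h1 := integrable_rpow_neg_one_add_norm_sq (E := E3) (μ := volume) (r := 4)
      (by simp [E3]; norm_num)
    refine h1.mono' (by fun_prop) (.of_forall fun x => ?_)
    rw [hρ, Complex.norm_real, Real.norm_of_nonneg (by positivity), Real.norm_of_nonneg
      (by have := hpos x; positivity), show (-4 / 2 : ℝ) = -(2:ℕ) by norm_num,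
      Real.rpow_neg (by positivity), Real.rpow_natCast, inv_pow]
    have : 1 ≤ 4 * Real.pi ^ 2 := by nlinarith [Real.pi_gt_three]
    gcongr
    nlinarith [sq_nonneg ‖x‖]
  set A : ℝ := (eLpNorm ρ 2 volume).toReal * (4 * (eLpNorm W 2 volume).toReal) with hA
  refine ⟨(∫ ξ, W ξ) + A, add_nonneg (integral_nonneg W0) (by positivity), fun C m hC hm => ?_⟩
  have bound : ∀ f : E3 → ℂ, Measurable f → (∀ ξ ≠ 0, ‖f ξ‖ ≤ C * W ξ) →
      Integrable f ∧ ∫ ξ, ‖f ξ‖ ≤ C * ∫ ξ, W ξ ∧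
        eLpNorm (𝓕⁻ f) 2 volume ≤ ENNReal.ofReal C * eLpNorm W 2 volume := by
    intro f hf hfW
    have hae : ∀ᵐ ξ, ‖f ξ‖ ≤ C * W ξ := ae_ne_zero.mono hfW
    have hfi : Integrable f := (hWi.const_mul C).mono' hf.aestronglyMeasurable hae
    have hf2 : eLpNorm f 2 volume ≤ ENNReal.ofReal C * eLpNorm W 2 volume := by
      refine eLpNorm_le_mul_eLpNorm_of_ae_le_mul ?_ 2
      filter_upwards [hae] with ξ h
      rwa [Real.norm_of_nonneg (W0 ξ)]
    refine ⟨hfi, ?_, ?_⟩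
    · rw [← integral_const_mul]
      exact integral_mono_ae hfi.norm (hWi.const_mul C) hae
    · refine (eLpNorm_fourierInv_le hfi ⟨hf.aestronglyMeasurable, ?_⟩).trans hf2
      exact hf2.trans_lt (ENNReal.mul_lt_top ENNReal.ofReal_lt_top hW2.2)
  have a0 : 0 ≤ a := by linarith
  obtain ⟨hmi, hm1, hm2⟩ := bound m hm.measurable fun ξ hξ =>
    decayWeight_div_le (j := 0) a0 (norm_pos_iff.2 hξ) (by norm_num) hC
      (by simpa using hm.norm_le hξ)
  have hder : ∀ i, ∃ u : E3 → ℂ, Integrable u ∧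
      eLpNorm (𝓕⁻ u) 2 volume ≤ ENNReal.ofReal C * eLpNorm W 2 volume ∧
      ∀ x : E3, 𝓕⁻ u x = -(4 * Real.pi ^ 2 * (x i : ℝ) ^ 2 : ℝ) * 𝓕⁻ m x := by
    intro i
    obtain ⟨m', m'', h1, h2, h3⟩ := hm.deriv i
    obtain ⟨i1, -, -⟩ := bound m' h1 fun ξ hξ =>
      decayWeight_div_le (j := 1) a0 (norm_pos_iff.2 hξ) (by norm_num) hC
        (by simpa using (h3 ξ hξ).2.2.2.1)
    obtain ⟨i2, -, j2⟩ := bound m'' h2 fun ξ hξ =>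
      decayWeight_div_le (j := 2) a0 (norm_pos_iff.2 hξ) (by norm_num) hC
        (by simpa using (h3 ξ hξ).2.2.2.2)
    refine ⟨m'', i2, j2, fun x => ?_⟩
    rw [fourierInv_of_hasLineDerivAt (e_ne_zero i) i1 i2 (fun ξ hξ => (h3 ξ hξ).2.1),
      fourierInv_of_hasLineDerivAt (e_ne_zero i) hmi i1 (fun ξ hξ => (h3 ξ hξ).1), inner_e]
    push_cast
    linear_combination (4 * Real.pi ^ 2 * (x i : ℂ) ^ 2 * 𝓕⁻ m x) * Complex.I_sq
  choose u hui hu2 hux using hder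
  have hcont := continuous_fourierInv hmi
  set H : E3 → ℂ := fun x => 𝓕⁻ m x - (𝓕⁻ (u 0) x + 𝓕⁻ (u 1) x + 𝓕⁻ (u 2) x) with hH
  have hKH : 𝓕⁻ m = ρ * H := by
    funext x
    simp only [Pi.mul_apply, hH, hux, hρ]
    have h3 : ‖x‖ ^ 2 = x 0 ^ 2 + x 1 ^ 2 + x 2 ^ 2 := by
      rw [EuclideanSpace.norm_sq_eq, Fin.sum_univ_three]; simp
    have h4 : ((1 + 4 * Real.pi ^ 2 * ‖x‖ ^ 2 : ℝ) : ℂ) ≠ 0 := by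
      exact_mod_cast (hpos x).ne'
    rw [Complex.ofReal_inv, eq_inv_mul_iff_mul_eq₀ h4, h3]
    push_cast; ring
  have hH2 : eLpNorm H 2 volume ≤ ENNReal.ofReal C * (4 * eLpNorm W 2 volume) := by
    have c0 := hcont.aestronglyMeasurable (μ := (volume : Measure E3))
    have ci := fun i => (continuous_fourierInv (hui i)).aestronglyMeasurable
      (μ := (volume : Measure E3))
    calc eLpNorm H 2 volume
        ≤ eLpNorm (𝓕⁻ m) 2 volume + eLpNorm (𝓕⁻ (u 0) + 𝓕⁻ (u 1) + 𝓕⁻ (u 2)) 2 volume :=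
          eLpNorm_sub_le c0 (((ci 0).add (ci 1)).add (ci 2)) (by norm_num)
      _ ≤ eLpNorm (𝓕⁻ m) 2 volume + (eLpNorm (𝓕⁻ (u 0)) 2 volume + eLpNorm (𝓕⁻ (u 1)) 2 volume +
          eLpNorm (𝓕⁻ (u 2)) 2 volume) := by
          gcongr
          refine (eLpNorm_add_le ((ci 0).add (ci 1)) (ci 2) (by norm_num)).trans ?_
          gcongr
          exact eLpNorm_add_le (ci 0) (ci 1) (by norm_num)
      _ ≤ ENNReal.ofReal C * eLpNorm W 2 volume + (ENNReal.ofReal C * eLpNorm W 2 volume +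
          ENNReal.ofReal C * eLpNorm W 2 volume + ENNReal.ofReal C * eLpNorm W 2 volume) := by
          gcongr <;> apply_assumption
      _ = _ := by ring
  have h1 : eLpNorm (𝓕⁻ m) 1 volume ≤
      eLpNorm ρ 2 volume * (ENNReal.ofReal C * (4 * eLpNorm W 2 volume)) := by
    rw [hKH]
    refine (eLpNorm_smul_le_mul_eLpNorm (p := 2) (q := 2) (r := 1) (φ := ρ) (f := H) ?_
      hρc.aestronglyMeasurable).trans (by gcongr)
    exact (hcont.sub (((continuous_fourierInv (hui 0)).add (continuous_fourierInv (hui 1))).add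
      (continuous_fourierInv (hui 2)))).aestronglyMeasurable
  have htop : eLpNorm ρ 2 volume * (ENNReal.ofReal C * (4 * eLpNorm W 2 volume)) ≠ ⊤ :=
    ENNReal.mul_ne_top hρ2.2.ne (ENNReal.mul_ne_top ENNReal.ofReal_ne_top
      (ENNReal.mul_ne_top (by norm_num) hW2.2.ne))
  have hint : Integrable (𝓕⁻ m) :=
    memLp_one_iff_integrable.1 ⟨hcont.aestronglyMeasurable, h1.trans_lt htop.lt_top⟩
  refine ⟨hmi, hm1.trans ?_, hint, ?_⟩
  · rw [add_mul, mul_comm C]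
    exact le_add_of_nonneg_right (by positivity)
  · rw [integral_norm_eq_lintegral_enorm hint.1, ← eLpNorm_one_eq_lintegral_enorm]
    refine (ENNReal.toReal_mono htop h1).trans ?_
    rw [ENNReal.toReal_mul, ENNReal.toReal_mul, ENNReal.toReal_mul, ENNReal.toReal_ofReal hC,
      add_mul, hA, show (4 : ℝ≥0∞).toReal = 4 from rfl]
    have : 0 ≤ (∫ ξ, W ξ) * C := mul_nonneg (integral_nonneg W0) hC
    nlinarith

/-! ### The concrete symbols: powers, exponentials, Schwartz functions, Riesz and Helmholtz
multipliers. -/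

theorem isSymbol_norm_rpow (s : ℝ) :
    ∃ C, 0 ≤ C ∧ IsSymbol (fun r => C * r ^ s) (fun ξ : E3 => ((‖ξ‖ ^ s : ℝ) : ℂ)) := by
  refine ⟨3 * (1 + |s| + |s * (s - 1)|), by positivity, ?_⟩
  refine (isSymbol_radial (g := fun r => r ^ s) (g' := fun r => s * r ^ (s - 1))
    (g'' := fun r => s * ((s - 1) * r ^ (s - 1 - 1)))
    (w := fun r => (1 + |s| + |s * (s - 1)|) * r ^ s) (by fun_prop) (by fun_prop) (by fun_prop)
    fun r hr => ⟨Real.hasDerivAt_rpow_const (.inl hr.ne'),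
      (Real.hasDerivAt_rpow_const (.inl hr.ne')).const_mul _, ?_, ?_, ?_⟩).mono
    fun r hr => le_of_eq (by ring)
  all_goals have h0 : 0 < r ^ s := Real.rpow_pos_of_pos hr s
  · rw [abs_of_pos h0]
    nlinarith [abs_nonneg s, abs_nonneg (s * (s - 1)), mul_nonneg (abs_nonneg s) h0.le,
      mul_nonneg (abs_nonneg (s * (s - 1))) h0.le]
  · have : |s * r ^ (s - 1)| * r = |s| * r ^ s := by
      rw [abs_mul, abs_of_pos (Real.rpow_pos_of_pos hr _), mul_assoc, Real.rpow_sub_one hr.ne']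
      field_simp
    rw [this]
    nlinarith [mul_nonneg (abs_nonneg (s * (s - 1))) h0.le]
  · have : |s * ((s - 1) * r ^ (s - 1 - 1))| * r ^ 2 = |s * (s - 1)| * r ^ s := by
      rw [← mul_assoc, abs_mul, abs_of_pos (Real.rpow_pos_of_pos hr _), mul_assoc,
        Real.rpow_sub_one hr.ne', Real.rpow_sub_one hr.ne']
      field_simp
    rw [this]
    nlinarith [mul_nonneg (abs_nonneg s) h0.le]

theorem exists_rpow_mul_exp_le {c s : ℝ} (hc : 0 < c) (hs : 0 < s) {M : ℝ} (hM : 0 ≤ M) :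
    ∃ C, 0 ≤ C ∧ ∀ r, 0 < r → r ^ M * Real.exp (-(c * r ^ s)) ≤ C := by
  -- With `y = r^s` the power `r^M = y^{M/s}` is at most `1 + y^k`, and `y^k e^{-cy} ≤ k!/c^k` by a
  -- single term of the exponential series.
  obtain ⟨k, hk⟩ := exists_nat_ge (M / s)
  refine ⟨1 + k.factorial / c ^ k, by positivity, fun r hr => ?_⟩
  set y := r ^ s with hy
  have hy0 : 0 < y := Real.rpow_pos_of_pos hr s
  have h1 : r ^ M ≤ 1 + y ^ k := by
    have : r ^ M = y ^ (M / s) := by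
      rw [hy, ← Real.rpow_mul hr.le]; congr 1; field_simp
    rw [this]
    rcases le_total y 1 with h | h
    · have := Real.rpow_le_one hy0.le h (div_nonneg hM hs.le)
      linarith [pow_pos hy0 k]
    · have := Real.rpow_le_rpow_of_exponent_le h hk
      rw [Real.rpow_natCast] at this
      linarith
  have h2 : y ^ k * Real.exp (-(c * y)) ≤ k.factorial / c ^ k := by
    have h3 := Real.pow_div_factorial_le_exp (c * y) (by positivity) k
    rw [Real.exp_neg, le_div_iff₀ (by positivity), ← div_eq_mul_inv, div_mul_eq_mul_div,
      div_le_iff₀ (Real.exp_pos _)]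
    rw [div_le_iff₀ (by positivity), mul_pow] at h3
    linarith
  have h4 : Real.exp (-(c * y)) ≤ 1 := Real.exp_le_one_iff.2 (by have := mul_pos hc hy0; linarith)
  have h5 := mul_le_mul_of_nonneg_right h1 (Real.exp_pos (-(c * y))).le
  nlinarith

/-- Each differentiation of `exp(-c r^s)`, once weighted by `r`, brings down a multiple of `r^s`,
and the exponential absorbs any such power. At the origin only boundedness survives, because `r^s`
need not be smooth there. -/
theorem isSymbol_exp {c s : ℝ} (hc : 0 < c) (hs : 0 < s) {N : ℝ} (hN : 0 ≤ N) :
    ∃ C, 0 ≤ C ∧ IsSymbol (fun r => C * decayWeight 0 N r)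
      (fun ξ : E3 => ((Real.exp (-(c * ‖ξ‖ ^ s)) : ℝ) : ℂ)) := by
  have key : ∀ j : ℝ, 0 ≤ j → ∃ C, 0 ≤ C ∧ ∀ r, 0 < r →
      r ^ j * Real.exp (-(c * r ^ s)) ≤ C * decayWeight 0 N r := by
    intro j hj
    obtain ⟨C₁, h1, h1'⟩ := exists_rpow_mul_exp_le hc hs hj
    obtain ⟨C₂, h2, h2'⟩ := exists_rpow_mul_exp_le hc hs (add_nonneg hj hN)
    refine ⟨C₁ + C₂, by positivity, fun r hr => ?_⟩
    have hN' : 0 < r ^ (-N) := Real.rpow_pos_of_pos hr _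
    unfold decayWeight
    rw [mul_min_of_nonneg _ _ (by positivity), Real.rpow_zero]
    refine le_min ?_ ?_
    · linarith [h1' r hr]
    · have h3 := mul_le_mul_of_nonneg_right (h2' r hr) hN'.le
      rw [mul_right_comm, ← Real.rpow_add hr, add_neg_cancel_right] at h3
      nlinarith
  obtain ⟨C₀, p0, h0⟩ := key 0 le_rfl
  obtain ⟨C₁, p1, h1⟩ := key s hs.le
  obtain ⟨C₂, p2, h2⟩ := key (2 * s) (by positivity)
  set E : ℝ → ℝ := fun r => Real.exp (-(c * r ^ s)) with hE
  have hEd : ∀ r, 0 < r → HasDerivAt E (E r * -(c * (s * r ^ (s - 1)))) r := fun r hr =>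
    ((((Real.hasDerivAt_rpow_const (.inl hr.ne')).const_mul c).neg).exp)
  set B := C₀ + c * s * C₁ + (c * |s * (s - 1)| * C₁ + (c * s) ^ 2 * C₂) with hB
  refine ⟨3 * B, by positivity, ?_⟩
  refine (isSymbol_radial (g := E) (g' := fun r => E r * -(c * (s * r ^ (s - 1))))
    (g'' := fun r => E r * -(c * (s * r ^ (s - 1))) * -(c * (s * r ^ (s - 1))) +
      E r * -(c * (s * ((s - 1) * r ^ (s - 1 - 1)))))
    (w := fun r => B * decayWeight 0 N r) (by fun_prop) (by fun_prop) (by fun_prop)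
    fun r hr => ⟨hEd r hr, (hEd r hr).mul ((((Real.hasDerivAt_rpow_const (.inl hr.ne')).const_mul
      s).const_mul c).neg), ?_, ?_, ?_⟩).mono fun r hr => le_of_eq (by ring)
  all_goals
    have hE0 : 0 < E r := Real.exp_pos _
    have hr0 : 0 < r ^ s := Real.rpow_pos_of_pos hr s
    have d0 := decayWeight_nonneg (a := 0) (b := N) hr.le
    have q0 := h0 r hr
    have q1 := h1 r hr
    have q2 := h2 r hr
    rw [Real.rpow_zero, one_mul] at q0
    rw [two_mul, Real.rpow_add hr] at q2
    change E r ≤ _ at q0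
    change r ^ s * E r ≤ _ at q1
    change r ^ s * r ^ s * E r ≤ _ at q2
    have t1 := mul_le_mul_of_nonneg_left q1 (show 0 ≤ c * s by positivity)
    have t2 := mul_le_mul_of_nonneg_left q1 (show 0 ≤ c * |s * (s - 1)| by positivity)
    have t3 := mul_le_mul_of_nonneg_left q2 (show 0 ≤ (c * s) ^ 2 by positivity)
    have u0 : 0 ≤ C₀ * decayWeight 0 N r := mul_nonneg p0 d0
    have u1 : 0 ≤ c * s * (C₁ * decayWeight 0 N r) := by positivity
    have u2 : 0 ≤ c * |s * (s - 1)| * (C₁ * decayWeight 0 N r) := by positivity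
    have u3 : 0 ≤ (c * s) ^ 2 * (C₂ * decayWeight 0 N r) := by positivity
    have hBw : B * decayWeight 0 N r = C₀ * decayWeight 0 N r + c * s * (C₁ * decayWeight 0 N r)
      + (c * |s * (s - 1)| * (C₁ * decayWeight 0 N r) + (c * s) ^ 2 * (C₂ * decayWeight 0 N r)) := by
      rw [hB]; ring
  · rw [abs_of_pos hE0, hBw]; linarith
  · have : |E r * -(c * (s * r ^ (s - 1)))| * r = c * s * (r ^ s * E r) := by
      rw [abs_mul, abs_neg, abs_of_pos hE0, abs_of_nonneg (by positivity),
        Real.rpow_sub_one hr.ne']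
      field_simp
    rw [this, hBw]; linarith
  · have : |E r * -(c * (s * r ^ (s - 1))) * -(c * (s * r ^ (s - 1))) +
        E r * -(c * (s * ((s - 1) * r ^ (s - 1 - 1))))| * r ^ 2 ≤
        (c * s) ^ 2 * (r ^ s * r ^ s * E r) + c * |s * (s - 1)| * (r ^ s * E r) := by
      refine (mul_le_mul_of_nonneg_right (abs_add_le _ _) (by positivity)).trans (le_of_eq ?_)
      rw [add_mul]
      congr 1
      · rw [abs_of_nonneg (by rw [mul_assoc, neg_mul_neg]; positivity), Real.rpow_sub_one hr.ne']
        field_simp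
      · rw [show E r * -(c * (s * ((s - 1) * r ^ (s - 1 - 1)))) =
          -((E r * c * r ^ (s - 1 - 1)) * (s * (s - 1))) by ring, abs_neg, abs_mul,
          abs_of_nonneg (by positivity), Real.rpow_sub_one hr.ne', Real.rpow_sub_one hr.ne']
        field_simp
    rw [hBw]; linarith

/-- A continuous seminorm on Schwartz functions controlling symbol bounds of order `N`. -/
def schwartzBound (N : ℕ) : Seminorm ℂ (SchwartzMap E3 ℂ) :=
  (Finset.Iic (N + 2, 2)).sup (schwartzSeminormFamily ℂ E3 ℂ)

theorem le_schwartzBound {N k n : ℕ} (hk : k ≤ N + 2) (hn : n ≤ 2) (G : SchwartzMap E3 ℂ)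
    (x : E3) : ‖iteratedFDeriv ℝ n G x‖ * ‖x‖ ^ k ≤ schwartzBound N G := by
  rw [mul_comm]
  refine (SchwartzMap.le_seminorm ℂ k n G x).trans ?_
  exact Seminorm.le_def.1 (Finset.le_sup (f := schwartzSeminormFamily ℂ E3 ℂ) (b := (k, n))
    (Finset.mem_Iic.2 (Prod.mk_le_mk.2 ⟨hk, hn⟩))) G

theorem norm_lineDerivOp_le (G : SchwartzMap E3 ℂ) (i : Fin 3) (x : E3) :
    ‖(∂_{e i} G) x‖ ≤ ‖iteratedFDeriv ℝ 1 G x‖ := by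
  have h := SchwartzMap.iteratedLineDerivOp_eq_iteratedFDeriv (m := fun _ : Fin 1 => e i)
    (f := G) (x := x)
  have h2 : ∂_{e i} G = LineDeriv.iteratedLineDerivOp (fun _ : Fin 1 => e i) G := by simp
  rw [h2, h]
  refine (ContinuousMultilinearMap.le_opNorm _ _).trans ?_
  simp [e]

theorem norm_lineDerivOp_lineDerivOp_le (G : SchwartzMap E3 ℂ) (i : Fin 3) (x : E3) :
    ‖(∂_{e i} (∂_{e i} G)) x‖ ≤ ‖iteratedFDeriv ℝ 2 G x‖ := by
  have h := SchwartzMap.iteratedLineDerivOp_eq_iteratedFDeriv (m := fun _ : Fin 2 => e i)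
    (f := G) (x := x)
  have h2 : ∂_{e i} (∂_{e i} G) = LineDeriv.iteratedLineDerivOp (fun _ : Fin 2 => e i) G := by
    simp [LineDeriv.iteratedLineDerivOp_succ_left, Fin.tail]
  rw [h2, h]
  refine (ContinuousMultilinearMap.le_opNorm _ _).trans ?_
  simp [e]

theorem hasLineDerivAt_schwartz (G : SchwartzMap E3 ℂ) (v x : E3) :
    HasLineDerivAt ℝ G ((∂_{v} G) x) x v := by
  rw [SchwartzMap.lineDerivOp_apply_eq_fderiv]
  exact (G.hasFDerivAt x).hasLineDerivAt v

theorem isSymbol_of_schwartz {w : ℝ → ℝ} (G : SchwartzMap E3 ℂ)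
    (h : ∀ ξ ≠ 0, ‖iteratedFDeriv ℝ 0 G ξ‖ ≤ w ‖ξ‖ ∧ ‖iteratedFDeriv ℝ 1 G ξ‖ * ‖ξ‖ ≤ w ‖ξ‖ ∧
      ‖iteratedFDeriv ℝ 2 G ξ‖ * ‖ξ‖ ^ 2 ≤ w ‖ξ‖) : IsSymbol w G := by
  refine ⟨G.continuous.measurable, fun i => ⟨(∂_{e i} G : SchwartzMap E3 ℂ),
    (∂_{e i} (∂_{e i} G : SchwartzMap E3 ℂ) : SchwartzMap E3 ℂ),
    SchwartzMap.continuous _ |>.measurable, SchwartzMap.continuous _ |>.measurable,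
    fun ξ hξ => ⟨hasLineDerivAt_schwartz _ _ _, hasLineDerivAt_schwartz _ _ _, ?_, ?_, ?_⟩⟩⟩
  · simpa using (h ξ hξ).1
  · exact (mul_le_mul_of_nonneg_right (norm_lineDerivOp_le G i ξ) (norm_nonneg _)).trans (h ξ hξ).2.1
  · exact (mul_le_mul_of_nonneg_right (norm_lineDerivOp_lineDerivOp_le G i ξ)
      (by positivity)).trans (h ξ hξ).2.2

theorem le_mul_rpow_neg {x r B : ℝ} {n N : ℕ} (hr : 0 < r) (h : x * r ^ (N + n) ≤ B) :
    x * r ^ n ≤ B * r ^ (-(N : ℝ)) := by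
  rw [Real.rpow_neg hr.le, Real.rpow_natCast, ← div_eq_mul_inv, le_div_iff₀ (by positivity)]
  calc x * r ^ n * r ^ N = x * r ^ (N + n) := by ring
    _ ≤ B := h

theorem isSymbol_schwartz (N : ℕ) (G : SchwartzMap E3 ℂ) :
    IsSymbol (fun r => schwartzBound N G * decayWeight 0 N r) G := by
  have key : ∀ ξ : E3, ξ ≠ 0 → ∀ n ≤ 2, ‖iteratedFDeriv ℝ n G ξ‖ * ‖ξ‖ ^ n ≤
      schwartzBound N G * decayWeight 0 N ‖ξ‖ := by
    intro ξ hξ n hn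
    unfold decayWeight
    rw [mul_min_of_nonneg _ _ (apply_nonneg _ _), Real.rpow_zero, mul_one]
    exact le_min (le_schwartzBound (by omega) hn G ξ)
      (le_mul_rpow_neg (norm_pos_iff.2 hξ) (le_schwartzBound (by omega) hn G ξ))
  refine isSymbol_of_schwartz G fun ξ hξ => ⟨?_, ?_, key ξ hξ 2 le_rfl⟩
  · simpa using key ξ hξ 0 (by norm_num)
  · simpa using key ξ hξ 1 (by norm_num)

/-- The mean value inequality turns vanishing at the origin into one power of `|ξ|`; for the
derivatives the weight `|ξ|^n` already contains that power. This gain compensates for the Riesz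
multiplier, which has order zero and alone falls short of the order `1/2` demanded by the criterion.
-/
theorem isSymbol_schwartz_of_zero (N : ℕ) (G : SchwartzMap E3 ℂ) (h0 : G 0 = 0) :
    IsSymbol (fun r => schwartzBound N G * decayWeight 1 N r) G := by
  have hlip : ∀ ξ : E3, ‖iteratedFDeriv ℝ 0 G ξ‖ ≤ schwartzBound N G * ‖ξ‖ := by
    intro ξ
    have h1 : ∀ x ∈ (univ : Set E3), ‖fderiv ℝ G x‖ ≤ schwartzBound N G := by
      intro x _
      have := le_schwartzBound (N := N) (k := 0) (n := 1) (by omega) (by norm_num) G x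
      rw [← norm_iteratedFDeriv_one]
      simpa using this
    have h2 := convex_univ.norm_image_sub_le_of_norm_fderiv_le (fun x _ => G.differentiableAt) h1
      (mem_univ 0) (mem_univ ξ)
    simpa [h0] using h2
  have key : ∀ ξ : E3, ξ ≠ 0 → ∀ n ≤ 2, ‖iteratedFDeriv ℝ n G ξ‖ * ‖ξ‖ ^ n ≤
      schwartzBound N G * decayWeight 1 N ‖ξ‖ := by
    intro ξ hξ n hn
    unfold decayWeight
    rw [mul_min_of_nonneg _ _ (apply_nonneg _ _), Real.rpow_one]
    refine le_min ?_ (le_mul_rpow_neg (norm_pos_iff.2 hξ) (le_schwartzBound (by omega) hn G ξ))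
    rcases n with _ | n
    · simpa using hlip ξ
    · rw [pow_succ, ← mul_assoc]
      gcongr
      exact le_schwartzBound (by omega) hn G ξ
  refine isSymbol_of_schwartz G fun ξ hξ => ⟨?_, ?_, key ξ hξ 2 le_rfl⟩
  · simpa using key ξ hξ 0 (by norm_num)
  · simpa using key ξ hξ 1 (by norm_num)

/-- The symbol `ξ_k ξ_j / |ξ|²`. -/
def rieszSymbol (k j : Fin 3) (ξ : E3) : ℂ := ((ξ k * ξ j / ‖ξ‖ ^ 2 : ℝ) : ℂ)

theorem isSymbol_riesz (k j : Fin 3) : ∃ C, 0 ≤ C ∧ IsSymbol (fun _ => C) (rieszSymbol k j) := by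
  obtain ⟨C, hC, h⟩ := isSymbol_norm_rpow (-2)
  refine ⟨16 * C, by positivity, ?_⟩
  have h2 := (((isSymbol_coord k).mul (isSymbol_coord j)).mul h).mono
    (w' := fun _ => 16 * C) fun r hr => le_of_eq (by
      rw [Real.rpow_neg hr.le]; norm_num; field_simp; norm_num; ring)
  convert h2 using 2 with ξ
  rw [rieszSymbol, Real.rpow_neg (norm_nonneg _)]
  push_cast
  rw [div_eq_mul_inv]
  norm_num

theorem isSymbol_helmholtz (k j : Fin 3) :
    ∃ C, 0 ≤ C ∧ IsSymbol (fun _ => C) (fun ξ => ((helmholtzSymbol k j ξ : ℝ) : ℂ)) := by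
  obtain ⟨C, hC, h⟩ := isSymbol_riesz k j
  have h2 := (isSymbol_const (if k = j then 1 else 0)).add ((isSymbol_const (-1)).mul h)
  refine ⟨‖(if k = j then (1 : ℂ) else 0)‖ + 4 * (‖(-1 : ℂ)‖ * C), by positivity, ?_⟩
  convert h2 using 2 with ξ
  rw [helmholtzSymbol, rieszSymbol]
  push_cast
  split_ifs <;> push_cast <;> ring

theorem measurable_helmholtzSymbol (k j : Fin 3) : Measurable (helmholtzSymbol k j) := by
  unfold helmholtzSymbol; fun_prop

theorem fracSymbol_eq (α : ℝ) (ξ : E3) :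
    fracSymbol α ξ = (2 * Real.pi) ^ (2 * α) * ‖ξ‖ ^ (2 * α) := by
  rw [fracSymbol, Real.mul_rpow (by positivity) (norm_nonneg _)]

theorem fracSymbol_nonneg (α : ℝ) (ξ : E3) : 0 ≤ fracSymbol α ξ :=
  Real.rpow_nonneg (by positivity) _

theorem fracSymbol_neg (α : ℝ) (ξ : E3) : fracSymbol α (-ξ) = fracSymbol α ξ := by
  simp [fracSymbol]

theorem continuous_fracSymbol {α : ℝ} (hα : 0 < α) : Continuous (fracSymbol α) := by
  unfold fracSymbol
  exact Continuous.rpow_const (by fun_prop) fun _ => .inr (by positivity)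

theorem measurable_fracSymbol (α : ℝ) : Measurable (fracSymbol α) := by
  unfold fracSymbol; fun_prop

theorem isSymbol_fracSymbol (α : ℝ) :
    ∃ C, 0 ≤ C ∧ IsSymbol (fun r => C * r ^ (2 * α)) (fun ξ => ((fracSymbol α ξ : ℝ) : ℂ)) := by
  obtain ⟨C, hC, h⟩ := isSymbol_norm_rpow (2 * α)
  refine ⟨4 * ((2 * Real.pi) ^ (2 * α) * C), by positivity, ?_⟩
  have h2 := ((isSymbol_const (((2 * Real.pi) ^ (2 * α) : ℝ) : ℂ)).mul h).mono
    (w' := fun r => 4 * ((2 * Real.pi) ^ (2 * α) * C) * r ^ (2 * α)) fun r hr => le_of_eq (by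
      rw [Complex.norm_real, Real.norm_of_nonneg (by positivity)]; ring)
  convert h2 using 2 with ξ
  rw [fracSymbol_eq]; push_cast; rfl

theorem isSymbol_exp_fracSymbol {α t : ℝ} (hα : 0 < α) (ht : 0 < t) {N : ℝ} (hN : 0 ≤ N) :
    ∃ C, 0 ≤ C ∧ IsSymbol (fun r => C * decayWeight 0 N r)
      (fun ξ => ((Real.exp (-t * fracSymbol α ξ) : ℝ) : ℂ)) := by
  obtain ⟨C, hC, h⟩ := isSymbol_exp (c := t * (2 * Real.pi) ^ (2 * α)) (s := 2 * α) (by positivity)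
    (by positivity) hN
  refine ⟨C, hC, ?_⟩
  convert h using 4 with ξ
  rw [fracSymbol_eq]; ring

/-! ### Multipliers whose kernels are integrable. -/

/-- Both `m` and its inverse Fourier transform are integrable with `L¹` norm at most `C`. -/
structure HasFourierBound (m : E3 → ℂ) (C : ℝ) : Prop where
  integrable : Integrable m
  integral_norm_le : ∫ ξ, ‖m ξ‖ ≤ C
  integrable_fourierInv : Integrable (𝓕⁻ m)
  integral_norm_fourierInv_le : ∫ x, ‖𝓕⁻ m x‖ ≤ C

theorem exists_hasFourierBound {a : ℝ} (ha : 1 / 2 < a) :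
    ∃ K : ℝ, 0 ≤ K ∧ ∀ (C : ℝ) (m : E3 → ℂ), 0 ≤ C →
      IsSymbol (fun r => C * decayWeight a 4 r) m → HasFourierBound m (K * C) := by
  obtain ⟨K, hK, h⟩ := exists_integral_norm_fourierInv_le ha
  exact ⟨K, hK, fun C m hC hm => ⟨(h C m hC hm).1, (h C m hC hm).2.1, (h C m hC hm).2.2.1,
    (h C m hC hm).2.2.2⟩⟩

/-- The symbol of `e^{-t(-Δ)^α} ℙ div`. -/
def oseenGradSymbol (α : ℝ) (h k j : Fin 3) (t : ℝ) (ξ : E3) : ℂ :=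
  2 * Real.pi * Complex.I * ((ξ h * (helmholtzSymbol k j ξ * Real.exp (-t * fracSymbol α ξ)) : ℝ) : ℂ)

theorem exists_hasFourierBound_oseenGradSymbol {α t : ℝ} (hα : 0 < α) (ht : 0 < t) (h k j : Fin 3) :
    ∃ C, HasFourierBound (oseenGradSymbol α h k j t) C := by
  obtain ⟨K, hK, hb⟩ := exists_hasFourierBound (a := 1) (by norm_num)
  obtain ⟨C₁, h1, H1⟩ := isSymbol_helmholtz k j
  -- The factor `ξ_h` of the divergence supplies order one at the origin and costs one power of
  -- decay, so decay `5` of the exponential leaves the required `4`.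
  obtain ⟨C₂, h2, H2⟩ := isSymbol_exp_fracSymbol hα ht (N := 5) (by norm_num)
  have H := (isSymbol_const (2 * Real.pi * Complex.I)).mul ((isSymbol_coord h).mul (H1.mul H2))
  set c := ‖(2 * Real.pi * Complex.I : ℂ)‖
  have H' := H.mono (w' := fun r => 64 * c * C₁ * C₂ * decayWeight 1 4 r) fun r hr => le_of_eq (by
    have := rpow_mul_decayWeight (a := 0) (b := 5) (c := 1) hr
    rw [Real.rpow_one, add_zero, show (5:ℝ) - 1 = 4 by norm_num] at this
    rw [← this]; ring)
  refine ⟨_, hb (64 * c * C₁ * C₂) _ (by positivity) ?_⟩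
  have e : oseenGradSymbol α h k j t = fun ξ : E3 => 2 * Real.pi * Complex.I * (((ξ h : ℝ) : ℂ) *
      (((helmholtzSymbol k j ξ : ℝ) : ℂ) * ((Real.exp (-t * fracSymbol α ξ) : ℝ) : ℂ))) := by
    funext ξ
    simp only [oseenGradSymbol, Complex.ofReal_mul]
  rw [e]
  exact H'

/-- Applying `ξ_k ξ_j / |ξ|²` to a Schwartz symbol vanishing at the origin. -/
theorem exists_hasFourierBound_riesz (k j : Fin 3) : ∃ K : ℝ, 0 ≤ K ∧ ∀ G : SchwartzMap E3 ℂ,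
    G 0 = 0 → HasFourierBound (fun ξ => rieszSymbol k j ξ * G ξ) (K * schwartzBound 4 G) := by
  obtain ⟨K, hK, hb⟩ := exists_hasFourierBound (a := 1) (by norm_num)
  obtain ⟨C₁, h1, H1⟩ := isSymbol_riesz k j
  refine ⟨K * (4 * C₁), by positivity, fun G hG => ?_⟩
  rw [mul_assoc]
  refine hb _ _ (mul_nonneg (by positivity) (apply_nonneg _ _)) ?_
  exact (H1.mul (isSymbol_schwartz_of_zero 4 G hG)).mono fun r hr => le_of_eq (by push_cast; ring)

/-- Applying a multiplier of positive order to a Schwartz symbol. -/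
theorem exists_hasFourierBound_mul {m₁ : E3 → ℂ} {C₁ s : ℝ} (hs : 1 / 2 < s) (hC : 0 ≤ C₁)
    (H : IsSymbol (fun r => C₁ * r ^ s) m₁) : ∃ (K : ℝ) (N : ℕ), 0 ≤ K ∧
    ∀ G : SchwartzMap E3 ℂ, HasFourierBound (fun ξ => m₁ ξ * G ξ) (K * schwartzBound N G) := by
  obtain ⟨K, hK, hb⟩ := exists_hasFourierBound (a := min s 1) (lt_min hs (by norm_num))
  -- After multiplication by `r^s` the Schwartz symbol must still decay with exponent `4`.
  obtain ⟨N, hN⟩ := exists_nat_ge (s + 4)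
  have hs1 := min_le_left s 1
  have hs2 : 0 ≤ min s 1 := le_min (by linarith) zero_le_one
  refine ⟨K * (4 * C₁), N, by positivity, fun G => ?_⟩
  rw [mul_assoc]
  refine hb _ _ (mul_nonneg (by positivity) (apply_nonneg _ _)) ?_
  refine (H.mul (isSymbol_schwartz N G)).mono fun r hr => ?_
  have h2 : r ^ s * decayWeight 0 N r ≤ decayWeight (min s 1) 4 r := by
    rw [rpow_mul_decayWeight hr]
    unfold decayWeight
    rcases le_total r 1 with h | h
    · exact (min_le_left _ _).trans (le_min
        (Real.rpow_le_rpow_of_exponent_ge hr h (by linarith))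
        (Real.rpow_le_rpow_of_exponent_ge hr h (by linarith)))
    · exact (min_le_right _ _).trans (le_min
        (Real.rpow_le_rpow_of_exponent_le h (by linarith))
        (Real.rpow_le_rpow_of_exponent_le h (by linarith)))
  calc 4 * (C₁ * r ^ s * (schwartzBound N G * decayWeight 0 N r))
      = 4 * C₁ * schwartzBound N G * (r ^ s * decayWeight 0 N r) := by ring
    _ ≤ 4 * C₁ * schwartzBound N G * decayWeight (min s 1) 4 r :=
        mul_le_mul_of_nonneg_left h2 (mul_nonneg (by positivity) (apply_nonneg _ _))

theorem exists_hasFourierBound_frac {α : ℝ} (hα : 1 / 2 < α) : ∃ (K : ℝ) (N : ℕ), 0 ≤ K ∧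
    ∀ G : SchwartzMap E3 ℂ,
      HasFourierBound (fun ξ => (fracSymbol α ξ : ℂ) * G ξ) (K * schwartzBound N G) := by
  obtain ⟨C₁, h1, H1⟩ := isSymbol_fracSymbol α
  exact exists_hasFourierBound_mul (by linarith) h1 H1

/-! ### The gradient of the Oseen kernel: Fourier formula, scaling, `L¹` norm. -/

theorem lintegral_comp_smul (g : E3 → ℝ≥0∞) (hg : Measurable g) {r : ℝ} (hr : 0 < r) :
    ∫⁻ x, g (r • x) = ENNReal.ofReal (r ^ (-3 : ℝ)) * ∫⁻ x, g x := by
  have h := Measure.map_addHaar_smul (volume : Measure E3) hr.ne'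
  have h2 : ∫⁻ x, g (r • x) = ∫⁻ x, g x ∂(Measure.map (r • ·) (volume : Measure E3)) :=
    (lintegral_map hg (measurable_const_smul r)).symm
  have h3 : Module.finrank ℝ E3 = 3 := by simp [E3]
  rw [h2, h, lintegral_smul_measure, h3, abs_of_pos (by positivity), Real.rpow_neg hr.le, smul_eq_mul]
  norm_num

theorem integrable_of_isSymbol {a b C : ℝ} (ha : -3 < a) (hb : 3 < b) {m : E3 → ℂ}
    (hm : IsSymbol (fun r => C * decayWeight a b r) m) : Integrable m :=
  ((integrable_decayWeight ha hb).const_mul C).mono' hm.measurable.aestronglyMeasurable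
    (ae_ne_zero.mono fun _ h => hm.norm_le h)

theorem hasLineDerivAt_fourierInv {m : E3 → ℂ} {h : Fin 3} (hm : Integrable m)
    (hm' : Integrable fun ξ : E3 => 2 * Real.pi * Complex.I * ((ξ h : ℝ) : ℂ) * m ξ) (x : E3) :
    HasLineDerivAt ℝ (𝓕⁻ m)
      (𝓕⁻ (fun ξ : E3 => 2 * Real.pi * Complex.I * ((ξ h : ℝ) : ℂ) * m ξ) x) x (e h) := by
  have hch : ∀ (ξ : E3) (s : ℝ), HasDerivAt
      (fun s : ℝ => (Real.fourierChar (inner ℝ ξ (x + s • e h)) : ℂ))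
      (2 * Real.pi * Complex.I * ((ξ h : ℝ) : ℂ) * Real.fourierChar (inner ℝ ξ (x + s • e h))) s := by
    intro ξ s
    have h1 := hasLineDerivAt_fourierChar ξ (x + s • e h) (e h)
    rw [inner_e] at h1
    unfold HasLineDerivAt at h1
    have h2 : HasDerivAt (fun t : ℝ => (Real.fourierChar (inner ℝ (x + s • e h + t • e h) ξ) : ℂ))
      (2 * Real.pi * Complex.I * ((ξ h : ℝ) : ℂ) * Real.fourierChar (inner ℝ (x + s • e h) ξ))
      (s - s) := by rwa [sub_self]
    have h3 := h2.comp_sub_const s s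
    rw [real_inner_comm]
    refine h3.congr_of_eventuallyEq (.of_forall fun t => ?_)
    simp only []
    rw [real_inner_comm, add_assoc, ← add_smul, add_sub_cancel]
  have key := hasDerivAt_integral_of_dominated_loc_of_deriv_le (𝕜 := ℝ) (μ := volume) (x₀ := 0)
    (s := univ)
    (F := fun (s : ℝ) (ξ : E3) => m ξ * (Real.fourierChar (inner ℝ ξ (x + s • e h)) : ℂ))
    (F' := fun (s : ℝ) (ξ : E3) => m ξ * (2 * Real.pi * Complex.I * ((ξ h : ℝ) : ℂ) *
      Real.fourierChar (inner ℝ ξ (x + s • e h))))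
    (bound := fun ξ => ‖2 * Real.pi * Complex.I * ((ξ h : ℝ) : ℂ) * m ξ‖) univ_mem
    (.of_forall fun s => (integrable_mul_fourierChar hm _).1) (integrable_mul_fourierChar hm _)
    (((integrable_mul_fourierChar hm' (x + (0:ℝ) • e h)).congr
      (.of_forall fun ξ => by simp only []; ring)).1)
    (.of_forall fun ξ s _ => le_of_eq (by
      rw [norm_mul, norm_mul _ (Real.fourierChar _ : ℂ), norm_fourierChar, norm_mul _ (m ξ)]; ring))
    hm'.norm (.of_forall fun ξ s _ => (hch ξ s).const_mul _)
  have k2 := key.2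
  unfold HasLineDerivAt
  simp only [fourierInv_eq_mul]
  refine k2.congr_deriv (integral_congr_ae (.of_forall fun ξ => ?_))
  simp only [zero_smul, add_zero]
  ring

theorem integrable_oseenSymbol {α t : ℝ} (hα : 0 < α) (ht : 0 < t) (k j : Fin 3) :
    Integrable fun ξ : E3 =>
      ((helmholtzSymbol k j ξ * Real.exp (-t * fracSymbol α ξ) : ℝ) : ℂ) := by
  obtain ⟨C₁, h1, H1⟩ := isSymbol_helmholtz k j
  obtain ⟨C₂, h2, H2⟩ := isSymbol_exp_fracSymbol hα ht (N := 5) (by norm_num)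
  have H := (H1.mul H2).mono (w' := fun r => 4 * C₁ * C₂ * decayWeight 0 5 r)
    fun r hr => le_of_eq (by ring)
  simp only [Complex.ofReal_mul]
  exact integrable_of_isSymbol (by norm_num) (by norm_num) H

/-- The kernel `Υ_{hkj}` given directly as an inverse Fourier transform. -/
def oseenKernel (α : ℝ) (h k j : Fin 3) (x : E3) (t : ℝ) : ℝ :=
  (𝓕⁻ (oseenGradSymbol α h k j t) x).re

theorem integrable_oseenGradSymbol {α t : ℝ} (hα : 0 < α) (ht : 0 < t) (h k j : Fin 3) :
    Integrable (oseenGradSymbol α h k j t) :=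
  (exists_hasFourierBound_oseenGradSymbol hα ht h k j).choose_spec.integrable

/-- Differentiation under the Fourier integral, justified by integrability of `|ξ|` times the
symbol. Afterwards the line derivative is replaced by an explicit integral, for which joint
measurability and scaling can be read off the symbol. -/
theorem oseenGrad_eq {α t : ℝ} (hα : 0 < α) (ht : 0 < t) (h k j : Fin 3) (x : E3) :
    oseenGrad α h k j x t = oseenKernel α h k j x t := by
  have e1 : (fun ξ : E3 => 2 * Real.pi * Complex.I * ((ξ h : ℝ) : ℂ) *
      ((helmholtzSymbol k j ξ * Real.exp (-t * fracSymbol α ξ) : ℝ) : ℂ)) =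
      oseenGradSymbol α h k j t := by
    funext ξ
    simp only [oseenGradSymbol, Complex.ofReal_mul]; ring
  have h1 := hasLineDerivAt_fourierInv (h := h) (integrable_oseenSymbol hα ht k j)
    (by rw [e1]; exact integrable_oseenGradSymbol hα ht h k j) x
  rw [e1] at h1
  have h2 : HasLineDerivAt ℝ (fun y => oseen α k j y t) (oseenKernel α h k j x t) x (e h) :=
    Complex.reCLM.hasFDerivAt.comp_hasDerivAt (0:ℝ) h1
  exact h2.lineDeriv

theorem measurable_oseenGradSymbol (α : ℝ) (h k j : Fin 3) :
    Measurable fun z : ℝ × E3 => oseenGradSymbol α h k j z.1 z.2 := by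
  have h1 := measurable_helmholtzSymbol k j
  have h2 := measurable_fracSymbol α
  unfold oseenGradSymbol
  fun_prop

theorem measurable_oseenKernel (α : ℝ) (h k j : Fin 3) :
    Measurable fun z : E3 × ℝ => oseenKernel α h k j z.1 z.2 := by
  unfold oseenKernel
  simp only [fourierInv_eq_mul]
  have h1 : Measurable fun p : (E3 × ℝ) × E3 => oseenGradSymbol α h k j p.1.2 p.2 := by
    have := measurable_oseenGradSymbol α h k j
    exact this.comp (f := fun p : (E3 × ℝ) × E3 => (p.1.2, p.2)) (by fun_prop)
  have h2 : Measurable fun p : (E3 × ℝ) × E3 => (Real.fourierChar (inner ℝ p.2 p.1.1) : ℂ) := by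
    have := continuous_fourierChar_inner.measurable
    exact this.comp (f := fun p : (E3 × ℝ) × E3 => (p.2, p.1.1)) (by fun_prop)
  exact Complex.measurable_re.comp
    (StronglyMeasurable.integral_prod_right' (h1.mul h2).stronglyMeasurable).measurable

/-- Substituting `ξ = lη` gives the Jacobian `l³`; the fourth factor comes from the homogeneity of
degree one of the symbol. -/
theorem fourierInv_comp_smul_symbol {m₁ m₂ : E3 → ℂ} {l : ℝ} (hl : 0 < l)
    (h : ∀ η, m₁ (l • η) = l * m₂ η) (x : E3) : 𝓕⁻ m₁ x = l ^ 4 * 𝓕⁻ m₂ (l • x) := by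
  have h3 : Module.finrank ℝ E3 = 3 := by simp [E3]
  have h1 := Measure.integral_comp_smul (volume : Measure E3)
    (fun ξ => m₁ ξ * (Real.fourierChar (inner ℝ ξ x) : ℂ)) l
  rw [fourierInv_eq_mul, fourierInv_eq_mul]
  rw [h3, abs_of_pos (by positivity), eq_inv_smul_iff₀ (by positivity)] at h1
  rw [← h1, Complex.real_smul, ← integral_const_mul, ← integral_const_mul]
  refine integral_congr_ae (.of_forall fun η => ?_)
  simp only [h, inner_smul_left, inner_smul_right]
  push_cast
  simp
  ring

theorem oseenGradSymbol_smul {α t : ℝ} (hα : 0 < α) (ht : 0 < t) (h k j : Fin 3) (η : E3) :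
    oseenGradSymbol α h k j t (t ^ (-(1 / (2 * α))) • η) =
      ((t ^ (-(1 / (2 * α))) : ℝ) : ℂ) * oseenGradSymbol α h k j 1 η := by
  set l := t ^ (-(1 / (2 * α))) with hl
  have hl0 : 0 < l := Real.rpow_pos_of_pos ht _
  have h1 : helmholtzSymbol k j (l • η) = helmholtzSymbol k j η := by
    simp only [helmholtzSymbol, PiLp.smul_apply, smul_eq_mul, norm_smul, Real.norm_of_nonneg hl0.le]
    congr 1
    rw [mul_pow, show l * η k * (l * η j) = l ^ 2 * (η k * η j) by ring]
    exact mul_div_mul_left _ _ (by positivity)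
  have h2 : -t * fracSymbol α (l • η) = -1 * fracSymbol α η := by
    rw [fracSymbol_eq, fracSymbol_eq, norm_smul, Real.norm_of_nonneg hl0.le,
      Real.mul_rpow hl0.le (norm_nonneg _), hl, ← Real.rpow_mul ht.le,
      show -(1 / (2 * α)) * (2 * α) = -1 by field_simp, Real.rpow_neg_one]
    field_simp
  simp only [oseenGradSymbol, h1, h2, PiLp.smul_apply, smul_eq_mul]
  push_cast
  ring

/-- With `l = t^{-1/(2α)}` the kernel at time `t` is `l⁴` times the kernel at time one evaluated at
`lx`. Dilation in three dimensions contributes `l⁻³` to the integral, so a single factor `l`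
remains. -/
theorem exists_lintegral_oseenKernel {α : ℝ} (hα : 0 < α) : ∃ c : ℝ≥0, ∀ (h k j : Fin 3) (t : ℝ),
    0 < t → ∫⁻ x, ‖oseenKernel α h k j x t‖ₑ ≤ c * ENNReal.ofReal (t ^ (-(1 / (2 * α)))) := by
  have hfin : ∀ h k j, ∫⁻ x, ‖oseenKernel α h k j x 1‖ₑ < ⊤ := by
    intro h k j
    obtain ⟨C, hC⟩ := exists_hasFourierBound_oseenGradSymbol hα one_pos h k j
    exact hC.integrable_fourierInv.re.2
  refine ⟨∑ h, ∑ k, ∑ j, (∫⁻ x, ‖oseenKernel α h k j x 1‖ₑ).toNNReal, fun h k j t ht => ?_⟩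
  set l := t ^ (-(1 / (2 * α))) with hl
  have hl0 : 0 < l := Real.rpow_pos_of_pos ht _
  have h1 : ∀ x, ‖oseenKernel α h k j x t‖ₑ =
      ENNReal.ofReal (l ^ 4) * ‖oseenKernel α h k j (l • x) 1‖ₑ := by
    intro x
    unfold oseenKernel
    rw [fourierInv_comp_smul_symbol hl0 (oseenGradSymbol_smul hα ht h k j), ← Complex.ofReal_pow,
      Complex.re_ofReal_mul, enorm_mul, Real.enorm_of_nonneg (by positivity)]
  have hmeas : Measurable fun x => ‖oseenKernel α h k j x 1‖ₑ :=
    ((measurable_oseenKernel α h k j).comp (measurable_id.prodMk measurable_const)).enorm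
  have hmeas2 : Measurable fun x : E3 => ‖oseenKernel α h k j (l • x) 1‖ₑ :=
    hmeas.comp (measurable_const_smul l)
  simp_rw [h1]
  rw [lintegral_const_mul _ hmeas2,
    lintegral_comp_smul _ hmeas hl0, ← mul_assoc, ← ENNReal.ofReal_mul (by positivity)]
  have h2 : l ^ 4 * l ^ (-3 : ℝ) = l := by
    rw [← Real.rpow_natCast, ← Real.rpow_add hl0]; norm_num
  rw [h2, mul_comm]
  gcongr
  rw [← ENNReal.coe_toNNReal (hfin h k j).ne]
  norm_cast
  refine le_trans ?_ (Finset.single_le_sum (f := fun h => ∑ k, ∑ j,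
    (∫⁻ x, ‖oseenKernel α h k j x 1‖ₑ).toNNReal) (fun _ _ => zero_le) (Finset.mem_univ h))
  refine le_trans ?_ (Finset.single_le_sum (f := fun k => ∑ j,
    (∫⁻ x, ‖oseenKernel α h k j x 1‖ₑ).toNNReal) (fun _ _ => zero_le) (Finset.mem_univ k))
  exact Finset.single_le_sum (f := fun j =>
    (∫⁻ x, ‖oseenKernel α h k j x 1‖ₑ).toNNReal) (fun _ _ => zero_le) (Finset.mem_univ j)

attribute [irreducible] oseenKernel

/-! ### The `L^q` estimate of the absolute Duhamel integral. -/

/-- Jensen's inequality for powers and a finite measure. -/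
theorem lintegral_rpow_le {X : Type*} [MeasurableSpace X] (ν : Measure X) {g : X → ℝ≥0∞}
    (hg : AEMeasurable g ν) {q : ℝ} (hq : 1 ≤ q) :
    (∫⁻ z, g z ∂ν) ^ q ≤ ν univ ^ (q - 1) * ∫⁻ z, g z ^ q ∂ν := by
  have q0 : 0 < q := by linarith
  have h := ENNReal.lintegral_mul_norm_pow_le (μ := ν) (f := fun _ => 1) (g := fun z => g z ^ q)
    (p := 1 - 1 / q) (q := 1 / q) aemeasurable_const (hg.pow_const q)
    (by rw [sub_nonneg, div_le_one q0]; exact hq) (by positivity) (by ring)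
  simp only [ENNReal.one_rpow, one_mul, ← ENNReal.rpow_mul, mul_one_div_cancel q0.ne',
    ENNReal.rpow_one, lintegral_const] at h
  refine (ENNReal.rpow_le_rpow h q0.le).trans (le_of_eq ?_)
  rw [ENNReal.mul_rpow_of_nonneg _ _ q0.le, ← ENNReal.rpow_mul, ← ENNReal.rpow_mul,
    one_div_mul_cancel q0.ne', ENNReal.rpow_one]
  congr 2
  field_simp

theorem forceTensor_apply (α : ℝ) (f : E3 → Matrix (Fin 3) (Fin 3) ℝ) (t : ℝ) (x : E3)
    (h j : Fin 3) :
    forceTensor α f t x h j = t ^ (1 / α - 2) * f ((t ^ (1 / (2 * α)))⁻¹ • x) h j := rfl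

theorem measurable_forceTensor {α : ℝ} {f : E3 → Matrix (Fin 3) (Fin 3) ℝ} {h j : Fin 3}
    (hf : Measurable fun x => f x h j) :
    Measurable fun z : ℝ × E3 => forceTensor α f z.1 z.2 h j := by
  simp only [forceTensor_apply]
  refine Measurable.mul (by fun_prop) ?_
  exact hf.comp (f := fun z : ℝ × E3 => (z.1 ^ (1 / (2 * α)))⁻¹ • z.2) (by fun_prop)

/-- The exponent of the growth of `‖F(s)‖_q` for the self-similar force tensor. -/
def forceExp (α q : ℝ) : ℝ := 1 / α - 2 + 3 / (2 * α * q)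

/-- The amplitude contributes `s^{1/α-2}` and the dilation by `s^{1/(2α)}` contributes its Jacobian
`s^{3/(2α)}` to the integral of the `q`-th power; together they are the `q`-th power of `s^β`. -/
theorem lintegral_forceTensor {α q : ℝ} (hα : 0 < α) (hq : 0 < q)
    {f : E3 → Matrix (Fin 3) (Fin 3) ℝ} {h j : Fin 3} (hf : Measurable fun x => f x h j) {s : ℝ}
    (hs : 0 < s) :
    ∫⁻ y, ‖forceTensor α f s y h j‖ₑ ^ q =
      ENNReal.ofReal (s ^ forceExp α q) ^ q * ∫⁻ x, ‖f x h j‖ₑ ^ q := by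
  have hm : Measurable fun x => ‖f x h j‖ₑ ^ q := hf.enorm.pow_const q
  have hl : 0 < (s ^ (1 / (2 * α)))⁻¹ := by positivity
  have hm2 : Measurable fun x => ‖f ((s ^ (1 / (2 * α)))⁻¹ • x) h j‖ₑ ^ q :=
    hm.comp (measurable_const_smul (s ^ (1 / (2 * α)))⁻¹)
  simp_rw [forceTensor_apply, enorm_mul, ENNReal.mul_rpow_of_nonneg _ _ hq.le]
  rw [lintegral_const_mul _ hm2, lintegral_comp_smul _ hm hl, ← mul_assoc]
  congr 1
  rw [Real.enorm_of_nonneg (by positivity), ENNReal.ofReal_rpow_of_nonneg (by positivity) hq.le,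
    ENNReal.ofReal_rpow_of_nonneg (by positivity) hq.le, ← ENNReal.ofReal_mul (by positivity)]
  congr 1
  rw [← Real.rpow_neg hs.le, ← Real.rpow_mul hs.le, ← Real.rpow_mul hs.le, ← Real.rpow_mul hs.le,
    ← Real.rpow_add hs, forceExp]
  congr 1
  field_simp

/-- The time integral bounding the Duhamel operator. -/
def betaBound (α q t : ℝ) : ℝ≥0∞ :=
  ∫⁻ s in Ioo 0 t, ENNReal.ofReal ((t - s) ^ (-(1 / (2 * α)))) * ENNReal.ofReal (s ^ forceExp α q)

/-- The absolute Duhamel integral. -/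
def duhamelAbs (α : ℝ) (f : E3 → Matrix (Fin 3) (Fin 3) ℝ) (h k j : Fin 3) (t : ℝ) (x : E3) :
    ℝ≥0∞ :=
  ∫⁻ s in Ioo 0 t, ∫⁻ y : E3, ‖oseenKernel α h k j (x - y) (t - s)‖ₑ * ‖forceTensor α f s y h j‖ₑ

theorem measurable_oseenKernel_sub (α : ℝ) (h k j : Fin 3) :
    Measurable fun z : (ℝ × E3) × (ℝ × E3) =>
      oseenKernel α h k j (z.1.2 - z.2.2) (z.1.1 - z.2.1) :=
  (measurable_oseenKernel α h k j).comp
    (f := fun z : (ℝ × E3) × (ℝ × E3) => (z.1.2 - z.2.2, z.1.1 - z.2.1)) (by fun_prop)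

theorem duhamelAbs_eq {α : ℝ} {f : E3 → Matrix (Fin 3) (Fin 3) ℝ} {h j : Fin 3}
    (hf : Measurable fun x => f x h j) (k : Fin 3) (t : ℝ) (x : E3) :
    duhamelAbs α f h k j t x = ∫⁻ z, ‖oseenKernel α h k j (x - z.2) (t - z.1)‖ₑ *
      ‖forceTensor α f z.1 z.2 h j‖ₑ ∂((volume.restrict (Ioo 0 t)).prod volume) := by
  have h1 : Measurable fun z : ℝ × E3 => oseenKernel α h k j (x - z.2) (t - z.1) :=
    (measurable_oseenKernel α h k j).comp (f := fun z : ℝ × E3 => (x - z.2, t - z.1))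
      (by fun_prop)
  exact (lintegral_prod _ (h1.enorm.mul (measurable_forceTensor hf).enorm).aemeasurable).symm

/-- Minkowski's and Young's inequalities are merged into one application of Jensen's inequality in
`(s, y)`, followed by Tonelli. The reference measure has density `kernel × s^β`; its mass, and its
integral in `x` instead of `y`, are controlled by the same `L¹` bound on the kernel. -/
theorem lintegral_duhamelAbs_le {α q : ℝ} (hα : 0 < α) (hq : 1 ≤ q) {c : ℝ≥0}
    (hc : ∀ (h k j : Fin 3) (t : ℝ), 0 < t →
      ∫⁻ x, ‖oseenKernel α h k j x t‖ₑ ≤ c * ENNReal.ofReal (t ^ (-(1 / (2 * α)))))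
    {f : E3 → Matrix (Fin 3) (Fin 3) ℝ} {h j : Fin 3} (hf : Measurable fun x => f x h j)
    (k : Fin 3) (t : ℝ) :
    ∫⁻ x, duhamelAbs α f h k j t x ^ q ≤
      (c * betaBound α q t) ^ q * ∫⁻ x, ‖f x h j‖ₑ ^ q := by
  have q0 : 0 < q := by linarith
  set β := forceExp α q
  set μ := ((volume.restrict (Ioo 0 t)).prod volume : Measure (ℝ × E3)) with hμ
  set U : E3 → ℝ × E3 → ℝ≥0∞ := fun x z => ‖oseenKernel α h k j (x - z.2) (t - z.1)‖ₑ with hU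
  have hUm : Measurable fun p : E3 × (ℝ × E3) => U p.1 p.2 :=
    ((measurable_oseenKernel α h k j).comp
      (f := fun p : E3 × (ℝ × E3) => (p.1 - p.2.2, t - p.2.1)) (by fun_prop)).enorm
  have hUx : ∀ x, Measurable (U x) := fun x => hUm.comp measurable_prodMk_left
  have hUz : ∀ z, Measurable fun x => U x z := fun z => hUm.comp measurable_prodMk_right
  have hFm := (measurable_forceTensor (α := α) hf).enorm
  -- The force is divided by its own size `s^β`, so that the quotient `g` has the same `L^q` norm at
  -- every time and Jensen's inequality loses nothing at `s = 0`.
  set σ : ℝ × E3 → ℝ≥0∞ := fun z => ENNReal.ofReal (z.1 ^ β) with hσ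
  have hσm : Measurable σ := by fun_prop
  set g : ℝ × E3 → ℝ≥0∞ := fun z => ‖forceTensor α f z.1 z.2 h j‖ₑ / σ z with hg
  have hgm : Measurable g := hFm.div hσm
  have hpos : ∀ᵐ z ∂μ, z.1 ∈ Ioo 0 t := by
    rw [hμ]
    exact Measure.quasiMeasurePreserving_fst.ae (ae_restrict_mem measurableSet_Ioo)
  have hσne : ∀ z : ℝ × E3, 0 < z.1 → σ z ≠ 0 := fun z hz => by
    simp [hσ, Real.rpow_pos_of_pos hz]
  have hyint : ∀ s ∈ Ioo 0 t, ∀ x, ∫⁻ y, U x (s, y) ≤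
      c * ENNReal.ofReal ((t - s) ^ (-(1 / (2 * α)))) := by
    intro s hs x
    rw [hU, lintegral_sub_left_eq_self (fun y => ‖oseenKernel α h k j y (t - s)‖ₑ) x]
    exact hc h k j (t - s) (by linarith [hs.2])
  have hxint : ∀ z : ℝ × E3, z.1 ∈ Ioo 0 t → ∫⁻ x, U x z ≤
      c * ENNReal.ofReal ((t - z.1) ^ (-(1 / (2 * α)))) := by
    intro z hs
    rw [hU, lintegral_sub_right_eq_self (fun y => ‖oseenKernel α h k j y (t - z.1)‖ₑ) z.2]
    exact hc h k j (t - z.1) (by linarith [hs.2])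
  have hcB : c * betaBound α q t = ∫⁻ s in Ioo 0 t,
      c * ENNReal.ofReal ((t - s) ^ (-(1 / (2 * α)))) * ENNReal.ofReal (s ^ β) := by
    rw [betaBound, ← lintegral_const_mul _ (by fun_prop)]
    exact lintegral_congr fun s => by rw [mul_assoc]
  have hUσ : ∀ x, Measurable fun z => U x z * σ z := fun x => (hUx x).mul hσm
  have hν : ∀ x, ∫⁻ z, U x z * σ z ∂μ ≤ c * betaBound α q t := by
    intro x
    rw [hμ, lintegral_prod _ (hUσ x).aemeasurable, hcB]
    refine setLIntegral_mono' measurableSet_Ioo fun s hs => ?_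
    have h1 : Measurable fun y => U x (s, y) := (hUx x).comp measurable_prodMk_left
    simp only [hσ]
    rw [lintegral_mul_const _ h1]
    gcongr
    exact hyint s hs x
  have hW : ∀ x, duhamelAbs α f h k j t x ^ q ≤
      (c * betaBound α q t) ^ (q - 1) * ∫⁻ z, U x z * σ z * g z ^ q ∂μ := by
    intro x
    have h1 := lintegral_rpow_le (μ.withDensity fun z => U x z * σ z) hgm.aemeasurable hq
    rw [lintegral_withDensity_eq_lintegral_mul _ (hUσ x) hgm,
      lintegral_withDensity_eq_lintegral_mul _ (hUσ x) (hgm.pow_const q),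
      withDensity_apply _ MeasurableSet.univ, setLIntegral_univ] at h1
    rw [duhamelAbs_eq hf]
    calc (∫⁻ z, ‖oseenKernel α h k j (x - z.2) (t - z.1)‖ₑ *
          ‖forceTensor α f z.1 z.2 h j‖ₑ ∂μ) ^ q
        = (∫⁻ z, ((fun z => U x z * σ z) * g) z ∂μ) ^ q := by
          congr 1
          refine lintegral_congr_ae ?_
          filter_upwards [hpos] with z hz
          simp only [Pi.mul_apply, hg]
          rw [mul_assoc, ENNReal.mul_div_cancel (hσne z hz.1) ENNReal.ofReal_ne_top]
      _ ≤ _ := h1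
      _ ≤ _ := by
          exact mul_le_mul' (ENNReal.rpow_le_rpow (hν x) (by linarith)) le_rfl
  have hgq : ∀ s ∈ Ioo 0 t, ∫⁻ y, g (s, y) ^ q = ∫⁻ x, ‖f x h j‖ₑ ^ q := by
    intro s hs
    have hs0 := hσne (s, 0) hs.1
    have e1 : ∀ y, g (s, y) ^ q = ‖forceTensor α f s y h j‖ₑ ^ q / σ (s, 0) ^ q := by
      intro y
      simp only [hg]
      rw [ENNReal.div_rpow_of_nonneg _ _ q0.le]
    simp_rw [e1, div_eq_mul_inv]
    have hF : Measurable fun y => ‖forceTensor α f s y h j‖ₑ ^ q :=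
      (hFm.comp (f := fun y : E3 => (s, y)) measurable_prodMk_left).pow_const q
    rw [lintegral_mul_const _ hF,
      lintegral_forceTensor hα q0 hf hs.1, mul_right_comm, ENNReal.mul_inv_cancel, one_mul]
    · exact (ENNReal.rpow_pos (pos_iff_ne_zero.2 hs0) ENNReal.ofReal_ne_top).ne'
    · exact ENNReal.rpow_ne_top_of_nonneg q0.le ENNReal.ofReal_ne_top
  have hfin : ∫⁻ x, ∫⁻ z, U x z * σ z * g z ^ q ∂μ ≤
      c * betaBound α q t * ∫⁻ x, ‖f x h j‖ₑ ^ q := by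
    have hm3 : Measurable fun p : E3 × (ℝ × E3) => U p.1 p.2 * σ p.2 * g p.2 ^ q :=
      (hUm.mul (hσm.comp measurable_snd)).mul ((hgm.comp measurable_snd).pow_const q)
    rw [lintegral_lintegral_swap (f := fun x z => U x z * σ z * g z ^ q) hm3.aemeasurable]
    calc ∫⁻ z, (∫⁻ x, U x z * σ z * g z ^ q) ∂μ
        ≤ ∫⁻ z, c * ENNReal.ofReal ((t - z.1) ^ (-(1 / (2 * α)))) * σ z * g z ^ q ∂μ := by
          refine lintegral_mono_ae ?_
          filter_upwards [hpos] with z hz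
          have h1 : Measurable fun x => U x z * σ z := (hUz z).mul_const _
          rw [lintegral_mul_const _ h1, lintegral_mul_const _ (hUz z)]
          gcongr
          exact hxint z hz
      _ = ∫⁻ s in Ioo 0 t, c * ENNReal.ofReal ((t - s) ^ (-(1 / (2 * α)))) * ENNReal.ofReal (s ^ β) *
            ∫⁻ x, ‖f x h j‖ₑ ^ q := by
          have h1 : Measurable fun z : ℝ × E3 =>
              c * ENNReal.ofReal ((t - z.1) ^ (-(1 / (2 * α)))) * σ z * g z ^ q :=
            Measurable.mul (by fun_prop) (hgm.pow_const q)
          rw [hμ, lintegral_prod _ h1.aemeasurable]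
          refine setLIntegral_congr_fun measurableSet_Ioo fun s hs => ?_
          have h2 : Measurable fun y => g (s, y) ^ q :=
            (hgm.comp (f := fun y : E3 => (s, y)) measurable_prodMk_left).pow_const q
          simp only [hσ]
          rw [lintegral_const_mul _ h2, hgq s hs]
      _ = c * betaBound α q t * ∫⁻ x, ‖f x h j‖ₑ ^ q := by
          rw [hcB, lintegral_mul_const _ (by fun_prop)]
  calc ∫⁻ x, duhamelAbs α f h k j t x ^ q
      ≤ ∫⁻ x, (c * betaBound α q t) ^ (q - 1) * ∫⁻ z, U x z * σ z * g z ^ q ∂μ :=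
        lintegral_mono hW
    _ = (c * betaBound α q t) ^ (q - 1) * ∫⁻ x, ∫⁻ z, U x z * σ z * g z ^ q ∂μ := by
        refine lintegral_const_mul _ (Measurable.lintegral_prod_right'
          (f := fun p : E3 × (ℝ × E3) => U p.1 p.2 * σ p.2 * g p.2 ^ q) ?_)
        exact (hUm.mul (hσm.comp measurable_snd)).mul ((hgm.comp measurable_snd).pow_const q)
    _ ≤ (c * betaBound α q t) ^ (q - 1) * (c * betaBound α q t * ∫⁻ x, ‖f x h j‖ₑ ^ q) := by
        gcongr
    _ = _ := by
        rw [← mul_assoc]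
        congr 1
        rcases hq.eq_or_lt with rfl | hq1
        · simp
        nth_rw 2 [← ENNReal.rpow_one (c * betaBound α q t)]
        rw [← ENNReal.rpow_add_of_nonneg _ _ (by linarith) zero_le_one, sub_add_cancel]

theorem lintegral_comp_mul_left {g : ℝ → ℝ≥0∞} (hg : Measurable g) {a : ℝ} (ha : 0 < a) :
    ∫⁻ s, g s = ENNReal.ofReal a * ∫⁻ u, g (a * u) := by
  nth_rw 1 [← Real.smul_map_volume_mul_left ha.ne']
  rw [lintegral_smul_measure, lintegral_map hg (measurable_const_mul a), abs_of_pos ha, smul_eq_mul]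

/-- The growth exponent of the `L^q` norm of the Duhamel integral. -/
def duhamelExp (α q : ℝ) : ℝ := forceExp α q + 1 - 1 / (2 * α)

/-- The upper bound on `q` enters through this inequality, which is a rearrangement of `q(2α-1) <
3`. It is stronger than integrability of `s^β` at zero: it says that the power of `t` in the final
estimate is positive. -/
theorem neg_one_lt_forceExp {α q : ℝ} (hα : 1 / 2 < α) (hq : 1 < q) (hqα : q < 3 / (2 * α - 1)) :
    1 / (2 * α) - 1 < forceExp α q := by
  have h1 : 0 < 2 * α - 1 := by linarith
  have h2 : q * (2 * α - 1) < 3 := by rwa [lt_div_iff₀ h1] at hqα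
  have h3 : (2 * α - 1) / (2 * α) < 3 / (2 * α * q) := by
    rw [div_lt_div_iff₀ (by linarith) (by nlinarith)]
    nlinarith
  rw [forceExp]
  have h4 : (2 * α - 1) / (2 * α) = 1 - 1 / (2 * α) := by
    field_simp
  have h5 : 1 / α = 1 / (2 * α) + 1 / (2 * α) := by field_simp; norm_num
  linarith

/-- Substituting `s = tu` collects all powers of `t`: one from each factor of the integrand and one
from `ds`. -/
theorem betaBound_eq {α q t : ℝ} (ht : 0 < t) :
    betaBound α q t = ENNReal.ofReal (t ^ duhamelExp α q) * betaBound α q 1 := by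
  rw [betaBound, betaBound, ← lintegral_indicator measurableSet_Ioo,
    ← lintegral_indicator measurableSet_Ioo,
    lintegral_comp_mul_left (Measurable.indicator (by fun_prop) measurableSet_Ioo) ht,
    ← lintegral_const_mul' _ _ ENNReal.ofReal_ne_top,
    ← lintegral_const_mul' _ _ ENNReal.ofReal_ne_top]
  refine lintegral_congr fun u => ?_
  by_cases hu : u ∈ Ioo (0 : ℝ) 1
  · have hu' : t * u ∈ Ioo 0 t := ⟨mul_pos ht hu.1, by nlinarith [hu.2]⟩
    rw [indicator_of_mem hu, indicator_of_mem hu']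
    have h1 : 0 < 1 - u := by linarith [hu.2]
    rw [show t - t * u = t * (1 - u) by ring, Real.mul_rpow ht.le h1.le,
      Real.mul_rpow ht.le hu.1.le, ← ENNReal.ofReal_mul (by positivity),
      ← ENNReal.ofReal_mul ht.le, ← ENNReal.ofReal_mul (by have := hu.1; positivity),
      ← ENNReal.ofReal_mul (by positivity)]
    congr 1
    rw [duhamelExp, sub_eq_add_neg (forceExp α q + 1), Real.rpow_add ht, Real.rpow_add ht, Real.rpow_one]
    ring
  · have hu' : t * u ∉ Ioo 0 t := fun h => hu ⟨by nlinarith [h.1, h.2], by nlinarith [h.2]⟩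
    rw [indicator_of_notMem hu, indicator_of_notMem hu']
    simp

/-- This is Euler's Beta integral with parameters `β + 1` and `1 - 1/(2α)`; the second is positive
because `α > 1/2`. -/
theorem betaBound_one_ne_top {α q : ℝ} (hα : 1 / 2 < α) (hβ : -1 < forceExp α q) :
    betaBound α q 1 ≠ ∞ := by
  set β := forceExp α q
  have h1 : 1 / (2 * α) < 1 := by rw [div_lt_one (by linarith)]; linarith
  have h := Complex.betaIntegral_convergent (u := (β + 1 : ℝ)) (v := (1 - 1 / (2 * α) : ℝ))
    (by rw [Complex.ofReal_re]; linarith) (by rw [Complex.ofReal_re]; linarith)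
  rw [intervalIntegrable_iff_integrableOn_Ioo_of_le zero_le_one] at h
  have h2 := h.2
  rw [hasFiniteIntegral_iff_enorm] at h2
  refine ne_of_lt (lt_of_le_of_lt (le_of_eq ?_) h2)
  refine setLIntegral_congr_fun measurableSet_Ioo fun s hs => ?_
  have hs1 : 0 < 1 - s := by linarith [hs.2]
  have e1 : ((s : ℂ) ^ (((β + 1 : ℝ) : ℂ) - 1)) = ((s ^ β : ℝ) : ℂ) := by
    rw [Complex.ofReal_cpow hs.1.le]; push_cast; ring_nf
  have e2 : ((1 - s : ℂ) ^ (((1 - 1 / (2 * α) : ℝ) : ℂ) - 1)) =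
      (((1 - s) ^ (-(1 / (2 * α))) : ℝ) : ℂ) := by
    rw [Complex.ofReal_cpow hs1.le]; push_cast; ring_nf
  rw [e1, e2, ← Complex.ofReal_mul, ← ENNReal.ofReal_mul (by positivity), ← ofReal_norm,
    Complex.norm_real, Real.norm_of_nonneg (by have := hs.1; positivity), mul_comm]

/-! ### Measurability, finiteness and `L^q` norms of the Duhamel integral. -/

theorem measurable_duhamelAbs {α : ℝ} {f : E3 → Matrix (Fin 3) (Fin 3) ℝ} {h j : Fin 3}
    (hf : Measurable fun x => f x h j) (k : Fin 3) :
    Measurable fun z : ℝ × E3 => duhamelAbs α f h k j z.1 z.2 := by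
  -- The moving domain `(0, t)` is written as an indicator on the product space, so that
  -- measurability of parametrized integrals applies.
  have e1 : ∀ z : ℝ × E3, duhamelAbs α f h k j z.1 z.2 = ∫⁻ w : ℝ × E3,
      ({p : (ℝ × E3) × (ℝ × E3) | p.2.1 ∈ Ioo 0 p.1.1}.indicator fun p =>
        ‖oseenKernel α h k j (p.1.2 - p.2.2) (p.1.1 - p.2.1)‖ₑ *
          ‖forceTensor α f p.2.1 p.2.2 h j‖ₑ) (z, w) := by
    intro z
    rw [duhamelAbs_eq hf]
    have : (volume.restrict (Ioo 0 z.1)).prod (volume : Measure E3) =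
        volume.restrict (Ioo 0 z.1 ×ˢ univ) := by
      rw [Measure.volume_eq_prod, ← Measure.prod_restrict, Measure.restrict_univ]
    rw [this, ← lintegral_indicator (measurableSet_Ioo.prod MeasurableSet.univ)]
    refine lintegral_congr fun w => ?_
    simp [indicator]
  simp_rw [e1]
  refine Measurable.lintegral_prod_right' (Measurable.indicator ?_ ?_)
  · exact (measurable_oseenKernel_sub α h k j).enorm.mul
      ((measurable_forceTensor hf).comp measurable_snd).enorm
  · exact (measurableSet_lt (f := fun _ : (ℝ × E3) × (ℝ × E3) => (0 : ℝ))
      (g := fun p => p.2.1) measurable_const (by fun_prop)).inter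
      (measurableSet_lt (f := fun p : (ℝ × E3) × (ℝ × E3) => p.2.1)
      (g := fun p => p.1.1) (by fun_prop) (by fun_prop))

/-- The integrand of the Duhamel integral, written with the explicit kernel. -/
theorem semigroupHelmholtzDiv_apply {α τ : ℝ} (hα : 0 < α) (hτ : 0 < τ)
    (g : E3 → Matrix (Fin 3) (Fin 3) ℝ) (x : E3) (k : Fin 3) :
    semigroupHelmholtzDiv α τ g x k = ∫ y, ∑ h, ∑ j, oseenKernel α h k j (x - y) τ * g y h j := by
  simp only [semigroupHelmholtzDiv]
  refine integral_congr_ae (ae_of_all _ fun y => ?_)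
  simp only [oseenGrad_eq hα hτ]

theorem measurable_kernelSum {α : ℝ} {f : E3 → Matrix (Fin 3) (Fin 3) ℝ}
    (hf : ∀ h j, Measurable fun x => f x h j) (k : Fin 3) :
    Measurable fun p : (ℝ × E3) × (ℝ × E3) => ∑ h, ∑ j,
      oseenKernel α h k j (p.1.2 - p.2.2) (p.1.1 - p.2.1) * forceTensor α f p.2.1 p.2.2 h j :=
  Finset.measurable_sum _ fun h _ => Finset.measurable_sum _ fun j _ =>
    (measurable_oseenKernel_sub α h k j).mul ((measurable_forceTensor (hf h j)).comp measurable_snd)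

theorem stronglyMeasurable_duhamel {α : ℝ} (hα : 0 < α) {f : E3 → Matrix (Fin 3) (Fin 3) ℝ}
    (hf : ∀ h j, Measurable fun x => f x h j) :
    StronglyMeasurable fun z : ℝ × E3 => duhamel α f z.1 z.2 := by
  have hS : Measurable fun p : (ℝ × E3) × ℝ => (WithLp.toLp 2 fun k => ∫ y, ∑ h, ∑ j,
      oseenKernel α h k j (p.1.2 - y) (p.1.1 - p.2) * forceTensor α f p.2 y h j : E3) := by
    refine (WithLp.measurable_toLp 2 _).comp (measurable_pi_lambda _ fun k => ?_)
    refine StronglyMeasurable.measurable (StronglyMeasurable.integral_prod_right'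
      (f := fun w : ((ℝ × E3) × ℝ) × E3 => ∑ h, ∑ j,
      oseenKernel α h k j (w.1.1.2 - w.2) (w.1.1.1 - w.1.2) * forceTensor α f w.1.2 w.2 h j) ?_)
    refine Measurable.stronglyMeasurable ?_
    exact (measurable_kernelSum (α := α) hf k).comp
      (f := fun w : ((ℝ × E3) × ℝ) × E3 => (w.1.1, (w.1.2, w.2))) (by fun_prop)
  have e1 : ∀ z : ℝ × E3, duhamel α f z.1 z.2 = ∫ s,
      ({p : (ℝ × E3) × ℝ | p.2 ∈ Ioo 0 p.1.1}.indicator fun p : (ℝ × E3) × ℝ =>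
        (WithLp.toLp 2 fun k => ∫ y, ∑ h, ∑ j,
      oseenKernel α h k j (p.1.2 - y) (p.1.1 - p.2) * forceTensor α f p.2 y h j : E3)) (z, s) := by
    intro z
    rw [duhamel, ← integral_indicator measurableSet_Ioo]
    refine integral_congr_ae (ae_of_all _ fun s => ?_)
    by_cases hs : s ∈ Ioo 0 z.1
    · dsimp only
      rw [indicator_of_mem hs, indicator_of_mem (by exact hs)]
      ext k
      rw [semigroupHelmholtzDiv_apply hα (by linarith [hs.2])]
    · dsimp only
      rw [indicator_of_notMem hs, indicator_of_notMem (by exact hs)]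
  simp_rw [e1]
  refine StronglyMeasurable.integral_prod_right' (Measurable.stronglyMeasurable ?_)
  refine hS.indicator ?_
  exact (measurableSet_lt (f := fun _ : (ℝ × E3) × ℝ => (0 : ℝ))
    (g := fun p => p.2) measurable_const (by fun_prop)).inter
    (measurableSet_lt (f := fun p : (ℝ × E3) × ℝ => p.2)
    (g := fun p => p.1.1) (by fun_prop) (by fun_prop))

theorem enorm_le_sum_enorm_apply (x : E3) : ‖x‖ₑ ≤ ∑ k, ‖x k‖ₑ := by
  have h : ‖x‖ ≤ ∑ k, ‖x k‖ := by
    have := (EuclideanSpace.basisFun (Fin 3) ℝ).sum_repr x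
    conv_lhs => rw [← this]
    refine (norm_sum_le _ _).trans (Finset.sum_le_sum fun k _ => ?_)
    rw [norm_smul, OrthonormalBasis.norm_eq_one, mul_one]
    simp
  calc ‖x‖ₑ = ENNReal.ofReal ‖x‖ := (ofReal_norm x).symm
    _ ≤ ENNReal.ofReal (∑ k, ‖x k‖) := ENNReal.ofReal_le_ofReal h
    _ = ∑ k, ‖x k‖ₑ := by
      rw [ENNReal.ofReal_sum_of_nonneg fun _ _ => norm_nonneg _]
      simp_rw [ofReal_norm]

theorem enorm_duhamel_le {α : ℝ} (hα : 0 < α) {f : E3 → Matrix (Fin 3) (Fin 3) ℝ}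
    (hf : ∀ h j, Measurable fun x => f x h j) (t : ℝ) (x : E3) :
    ‖duhamel α f t x‖ₑ ≤ ∑ k, ∑ h, ∑ j, duhamelAbs α f h k j t x := by
  have hU : ∀ h k j : Fin 3, Measurable fun z : ℝ × E3 =>
      ‖oseenKernel α h k j (x - z.2) (t - z.1)‖ₑ * ‖forceTensor α f z.1 z.2 h j‖ₑ := fun h k j =>
    ((measurable_oseenKernel_sub α h k j).comp (f := fun z : ℝ × E3 => ((t, x), z))
      (by fun_prop)).enorm.mul (measurable_forceTensor (hf h j)).enorm
  have hUs : ∀ (h k j : Fin 3) (s : ℝ), Measurable fun y : E3 =>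
      ‖oseenKernel α h k j (x - y) (t - s)‖ₑ * ‖forceTensor α f s y h j‖ₑ := fun h k j s =>
    (hU h k j).comp (f := fun y : E3 => (s, y)) measurable_prodMk_left
  have hUi : ∀ h k j : Fin 3, Measurable fun s => ∫⁻ y : E3,
      ‖oseenKernel α h k j (x - y) (t - s)‖ₑ * ‖forceTensor α f s y h j‖ₑ := fun h k j =>
    (hU h k j).lintegral_prod_right'
  rw [duhamel]
  refine (enorm_integral_le_lintegral_enorm _).trans ?_
  calc ∫⁻ s in Ioo 0 t, ‖semigroupHelmholtzDiv α (t - s) (forceTensor α f s) x‖ₑ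
      ≤ ∫⁻ s in Ioo 0 t, ∑ k, ∑ h, ∑ j, ∫⁻ y : E3,
        ‖oseenKernel α h k j (x - y) (t - s)‖ₑ * ‖forceTensor α f s y h j‖ₑ := by
        refine setLIntegral_mono' measurableSet_Ioo fun s hs => ?_
        refine (enorm_le_sum_enorm_apply _).trans (Finset.sum_le_sum fun k _ => ?_)
        rw [semigroupHelmholtzDiv_apply hα (by linarith [hs.2])]
        refine (enorm_integral_le_lintegral_enorm _).trans ?_
        calc _ ≤ ∫⁻ y, ∑ h, ∑ j,
              ‖oseenKernel α h k j (x - y) (t - s)‖ₑ * ‖forceTensor α f s y h j‖ₑ := by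
              refine lintegral_mono fun y => (enorm_sum_le _ _).trans
                (Finset.sum_le_sum fun h _ => (enorm_sum_le _ _).trans
                  (Finset.sum_le_sum fun j _ => ?_))
              rw [enorm_mul]
          _ = _ := by
              rw [lintegral_finsetSum _ fun h _ => Finset.measurable_sum _ fun j _ => hUs h k j s]
              refine Finset.sum_congr rfl fun h _ => ?_
              rw [lintegral_finsetSum _ fun j _ => hUs h k j s]
    _ = _ := by
        rw [lintegral_finsetSum _ fun k _ => Finset.measurable_sum _ fun h _ =>
          Finset.measurable_sum _ fun j _ => hUi h k j]
        refine Finset.sum_congr rfl fun k _ => ?_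
        rw [lintegral_finsetSum _ fun h _ => Finset.measurable_sum _ fun j _ => hUi h k j]
        refine Finset.sum_congr rfl fun h _ => ?_
        rw [lintegral_finsetSum _ fun j _ => hUi h k j]
        rfl

theorem eLpNorm_ofReal_eq {F : Type*} [NormedAddCommGroup F] {q : ℝ} (hq : 0 < q) (u : E3 → F) :
    eLpNorm u (ENNReal.ofReal q) volume = (∫⁻ x, ‖u x‖ₑ ^ q) ^ (1 / q) := by
  rw [eLpNorm_eq_lintegral_rpow_enorm_toReal (by simpa using hq) ENNReal.ofReal_ne_top,
    ENNReal.toReal_ofReal hq.le]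

theorem lintegral_rpow_lt_top {F : Type*} [NormedAddCommGroup F] {q : ℝ} (hq : 0 < q) {u : E3 → F}
    (hu : MemLp u (ENNReal.ofReal q) volume) : ∫⁻ x, ‖u x‖ₑ ^ q < ∞ := by
  have h := hu.2
  rw [eLpNorm_ofReal_eq hq] at h
  by_contra hc
  rw [not_lt, top_le_iff] at hc
  rw [hc, ENNReal.top_rpow_of_pos (by positivity)] at h
  exact lt_irrefl _ h

theorem exists_lintegral_duhamelAbs_le {α q : ℝ} (hα : 1 / 2 < α) (hq : 1 < q)
    (hqα : q < 3 / (2 * α - 1)) {f : E3 → Matrix (Fin 3) (Fin 3) ℝ}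
    (hf : ∀ h j, Measurable fun x => f x h j)
    (hfq : ∀ h j, MemLp (fun x => f x h j) (ENNReal.ofReal q) volume) :
    ∃ C : ℝ≥0, ∀ (h k j : Fin 3) (t : ℝ), 0 < t →
      ∫⁻ x, duhamelAbs α f h k j t x ^ q ≤ C * ENNReal.ofReal (t ^ duhamelExp α q) ^ q := by
  have α0 : 0 < α := by linarith
  have q0 : 0 < q := by linarith
  have hβ := neg_one_lt_forceExp hα hq hqα
  obtain ⟨c, hc⟩ := exists_lintegral_oseenKernel α0
  have hB := betaBound_one_ne_top (q := q) hα
    (by have : 0 < 1 / (2 * α) := by positivity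
        linarith)
  set M : ℝ≥0∞ := ∑ h, ∑ j, ∫⁻ x, ‖f x h j‖ₑ ^ q with hM
  have hMt : M ≠ ∞ := by
    rw [hM]
    refine ENNReal.sum_ne_top.2 fun h _ => ENNReal.sum_ne_top.2 fun j _ => ?_
    exact (lintegral_rpow_lt_top q0 (hfq h j)).ne
  have hC : (c * betaBound α q 1) ^ q * M ≠ ∞ :=
    ENNReal.mul_ne_top (ENNReal.rpow_ne_top_of_nonneg q0.le
      (ENNReal.mul_ne_top ENNReal.coe_ne_top hB)) hMt
  refine ⟨((c * betaBound α q 1) ^ q * M).toNNReal, fun h k j t ht => ?_⟩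
  rw [ENNReal.coe_toNNReal hC]
  refine (lintegral_duhamelAbs_le α0 hq.le hc (hf h j) k t).trans ?_
  have hle : ∫⁻ x, ‖f x h j‖ₑ ^ q ≤ M :=
    (Finset.single_le_sum (f := fun j => ∫⁻ x, ‖f x h j‖ₑ ^ q) (fun _ _ => zero_le)
      (Finset.mem_univ j)).trans
    (Finset.single_le_sum (f := fun h => ∑ j, ∫⁻ x, ‖f x h j‖ₑ ^ q) (fun _ _ => zero_le)
      (Finset.mem_univ h))
  rw [betaBound_eq ht, mul_left_comm, ENNReal.mul_rpow_of_nonneg _ _ q0.le, mul_comm, mul_comm _ M,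
    mul_assoc, mul_comm (_ ^ q)]
  gcongr

theorem exists_eLpNorm_duhamel_le {α q : ℝ} (hα : 1 / 2 < α) (hq : 1 < q)
    (hqα : q < 3 / (2 * α - 1)) {f : E3 → Matrix (Fin 3) (Fin 3) ℝ}
    (hf : ∀ h j, Measurable fun x => f x h j)
    (hfq : ∀ h j, MemLp (fun x => f x h j) (ENNReal.ofReal q) volume) :
    ∃ C : ℝ≥0, ∀ t : ℝ, 0 < t → eLpNorm (duhamel α f t) (ENNReal.ofReal q) volume ≤
      C * ENNReal.ofReal (t ^ duhamelExp α q) := by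
  have q0 : 0 < q := by linarith
  obtain ⟨C, hC⟩ := exists_lintegral_duhamelAbs_le hα hq hqα hf hfq
  -- There are `27` index triples `(k, h, j)`: convexity of the `q`-th power gives `27^{q-1}`, and
  -- summing equal bounds gives the second `27`.
  refine ⟨((27 : ℝ≥0) ^ (q - 1) * (27 * C)) ^ (1 / q), fun t ht => ?_⟩
  set N := ENNReal.ofReal (t ^ duhamelExp α q)
  have h1 : ∀ x, ‖duhamel α f t x‖ₑ ^ q ≤ (27 : ℝ≥0∞) ^ (q - 1) *
      ∑ p : Fin 3 × Fin 3 × Fin 3, duhamelAbs α f p.2.1 p.1 p.2.2 t x ^ q := by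
    intro x
    have e1 : ∑ k, ∑ h, ∑ j, duhamelAbs α f h k j t x =
        ∑ p : Fin 3 × Fin 3 × Fin 3, duhamelAbs α f p.2.1 p.1 p.2.2 t x := by
      simp only [Fintype.sum_prod_type]
    refine (ENNReal.rpow_le_rpow (enorm_duhamel_le (by linarith) hf t x) q0.le).trans ?_
    rw [e1]
    refine (ENNReal.rpow_sum_le_const_mul_sum_rpow _ _ hq.le).trans (le_of_eq ?_)
    simp
  rw [eLpNorm_ofReal_eq q0]
  have h2 : ∫⁻ x, ‖duhamel α f t x‖ₑ ^ q ≤ (27 : ℝ≥0∞) ^ (q - 1) * (27 * (C * N ^ q)) := by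
    refine (lintegral_mono h1).trans ?_
    rw [lintegral_const_mul' _ _ (ENNReal.rpow_ne_top_of_nonneg (by linarith) (by norm_num)),
      lintegral_finsetSum _ fun p _ => Measurable.pow_const
        ((measurable_duhamelAbs (hf p.2.1 p.2.2) p.1).comp (f := fun x : E3 => (t, x))
          measurable_prodMk_left) q]
    gcongr
    refine (Finset.sum_le_card_nsmul _ _ (C * N ^ q) fun p _ => hC _ _ _ t ht).trans (le_of_eq ?_)
    simp
  refine (ENNReal.rpow_le_rpow h2 (by positivity)).trans (le_of_eq ?_)
  rw [show (27 : ℝ≥0∞) ^ (q - 1) * (27 * (C * N ^ q)) = (27 ^ (q - 1) * (27 * C)) * N ^ q by ring,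
    ENNReal.mul_rpow_of_nonneg _ _ (by positivity), ← ENNReal.rpow_mul, mul_one_div_cancel q0.ne',
    ENNReal.rpow_one, ENNReal.coe_rpow_of_nonneg _ (by positivity), ENNReal.coe_mul,
    ENNReal.coe_rpow_of_nonneg _ (by linarith), ENNReal.coe_mul]
  rfl

theorem duhamelExp_pos {α q : ℝ} (hα : 1 / 2 < α) (hq : 1 < q) (hqα : q < 3 / (2 * α - 1)) :
    0 < duhamelExp α q := by
  have := neg_one_lt_forceExp hα hq hqα
  rw [duhamelExp]
  linarith

theorem tendsto_eLpNorm_duhamel {α q : ℝ} (hα : 1 / 2 < α) (hq : 1 < q)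
    (hqα : q < 3 / (2 * α - 1)) {f : E3 → Matrix (Fin 3) (Fin 3) ℝ}
    (hf : ∀ h j, Measurable fun x => f x h j)
    (hfq : ∀ h j, MemLp (fun x => f x h j) (ENNReal.ofReal q) volume) :
    Tendsto (fun t => eLpNorm (duhamel α f t) (ENNReal.ofReal q) volume) (𝓝[>] 0) (𝓝 0) := by
  obtain ⟨C, hC⟩ := exists_eLpNorm_duhamel_le hα hq hqα hf hfq
  have hγ := duhamelExp_pos hα hq hqα
  have h1 : Tendsto (fun t : ℝ => C * ENNReal.ofReal (t ^ duhamelExp α q)) (𝓝[>] 0) (𝓝 0) := by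
    have h2 : Tendsto (fun t : ℝ => t ^ duhamelExp α q) (𝓝[>] 0) (𝓝 0) := by
      have := (Real.continuous_rpow_const hγ.le).tendsto 0
      rw [Real.zero_rpow hγ.ne'] at this
      exact this.mono_left nhdsWithin_le_nhds
    have h3 := ENNReal.Tendsto.const_mul (a := (C : ℝ≥0∞)) (ENNReal.tendsto_ofReal h2)
      (Or.inr ENNReal.coe_ne_top)
    simpa using h3
  refine tendsto_of_tendsto_of_tendsto_of_le_of_le' tendsto_const_nhds h1
    (Eventually.of_forall fun _ => zero_le) ?_
  filter_upwards [self_mem_nhdsWithin] with t ht using hC t ht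

theorem memLinftyLp_duhamel {α q : ℝ} (hα : 1 / 2 < α) (hq : 1 < q)
    (hqα : q < 3 / (2 * α - 1)) {f : E3 → Matrix (Fin 3) (Fin 3) ℝ}
    (hf : ∀ h j, Measurable fun x => f x h j)
    (hfq : ∀ h j, MemLp (fun x => f x h j) (ENNReal.ofReal q) volume) (T : ℝ) :
    MemLinftyLp T (ENNReal.ofReal q) (duhamel α f) := by
  obtain ⟨C, hC⟩ := exists_eLpNorm_duhamel_le hα hq hqα hf hfq
  have hγ := duhamelExp_pos hα hq hqα
  refine ⟨(stronglyMeasurable_duhamel (by linarith) hf).aestronglyMeasurable,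
    C * (T ^ duhamelExp α q).toNNReal, ?_⟩
  filter_upwards [ae_restrict_mem measurableSet_Ioo] with t ht
  refine (hC t ht.1).trans ?_
  rw [ENNReal.coe_mul]
  gcongr
  exact ENNReal.ofReal_le_ofReal (Real.rpow_le_rpow ht.1.le ht.2.le hγ.le)

theorem ae_duhamelAbs_lt_top {α q : ℝ} (hα : 1 / 2 < α) (hq : 1 < q)
    (hqα : q < 3 / (2 * α - 1)) {f : E3 → Matrix (Fin 3) (Fin 3) ℝ}
    (hf : ∀ h j, Measurable fun x => f x h j)
    (hfq : ∀ h j, MemLp (fun x => f x h j) (ENNReal.ofReal q) volume) {t : ℝ} (ht : 0 < t) :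
    ∀ᵐ x : E3, ∀ h k j : Fin 3, duhamelAbs α f h k j t x < ∞ := by
  have q0 : 0 < q := by linarith
  obtain ⟨C, hC⟩ := exists_lintegral_duhamelAbs_le hα hq hqα hf hfq
  simp only [ae_all_iff]
  intro h k j
  have h1 := ae_lt_top (Measurable.pow_const
    ((measurable_duhamelAbs (α := α) (hf h j) k).comp (f := fun x : E3 => (t, x))
          measurable_prodMk_left) q) (ne_of_lt (lt_of_le_of_lt (hC h k j t ht)
      (ENNReal.mul_lt_top ENNReal.coe_lt_top
        (ENNReal.rpow_lt_top_of_nonneg q0.le ENNReal.ofReal_ne_top))))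
  filter_upwards [h1] with x hx
  by_contra hc
  rw [not_lt, top_le_iff] at hc
  simp only [Function.comp, hc, ENNReal.top_rpow_of_pos q0] at hx
  exact lt_irrefl _ hx

theorem integrableOn_oseenKernel_mul {α : ℝ} {f : E3 → Matrix (Fin 3) (Fin 3) ℝ} {h k j : Fin 3}
    (hf : Measurable fun x => f x h j) {t : ℝ} {x : E3} (hx : duhamelAbs α f h k j t x < ∞) :
    IntegrableOn (fun w : ℝ × E3 => oseenKernel α h k j (x - w.2) (t - w.1) *
      forceTensor α f w.1 w.2 h j) (Ioo 0 t ×ˢ univ) volume := by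
  refine ⟨?_, ?_⟩
  · exact (((measurable_oseenKernel_sub α h k j).comp (f := fun w : ℝ × E3 => ((t, x), w))
      (by fun_prop)).mul (measurable_forceTensor hf)).aestronglyMeasurable
  · rw [hasFiniteIntegral_iff_enorm]
    rw [duhamelAbs_eq hf] at hx
    rw [Measure.volume_eq_prod, ← Measure.prod_restrict, Measure.restrict_univ]
    simpa only [enorm_mul] using hx

theorem integrableOn_oseenGrad_mul {α : ℝ} (hα : 0 < α) {f : E3 → Matrix (Fin 3) (Fin 3) ℝ}
    {h k j : Fin 3} (hf : Measurable fun x => f x h j) {t : ℝ} {x : E3}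
    (hx : duhamelAbs α f h k j t x < ∞) :
    IntegrableOn (fun w : ℝ × E3 => oseenGrad α h k j (x - w.2) (t - w.1) *
      forceTensor α f w.1 w.2 h j) (Ioo 0 t ×ˢ univ) volume := by
  refine (integrableOn_oseenKernel_mul hf hx).congr_fun (fun w hw => ?_)
    (measurableSet_Ioo.prod MeasurableSet.univ)
  dsimp only
  rw [oseenGrad_eq hα (by linarith [hw.1.2])]

theorem integral_apply_E3 {X : Type*} [MeasurableSpace X] {μ : Measure X} {u : X → E3}
    (hu : ∀ k, Integrable (fun z => u z k) μ) (k : Fin 3) : (∫ z, u z ∂μ) k = ∫ z, u z k ∂μ := by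
  have hi : Integrable u μ := by
    have h1 := (WithLp.linearEquiv 2 ℝ (Fin 3 → ℝ)).symm.toLinearMap.toContinuousLinearMap.integrable_comp
      (φ := fun z => (u z).ofLp) (Integrable.of_eval hu)
    exact h1
  exact ((EuclideanSpace.proj (𝕜 := ℝ) k).integral_comp_comm hi).symm

theorem duhamel_apply {α : ℝ} (hα : 0 < α) {f : E3 → Matrix (Fin 3) (Fin 3) ℝ}
    (hf : ∀ h j, Measurable fun x => f x h j) {t : ℝ} {x : E3}
    (hx : ∀ h k j, duhamelAbs α f h k j t x < ∞) (k : Fin 3) :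
    duhamel α f t x k = ∑ h, ∑ j, ∫ w in Ioo 0 t ×ˢ univ,
      oseenKernel α h k j (x - w.2) (t - w.1) * forceTensor α f w.1 w.2 h j := by
  have hi : ∀ k, Integrable (fun w : ℝ × E3 => ∑ h, ∑ j, oseenKernel α h k j (x - w.2) (t - w.1) *
      forceTensor α f w.1 w.2 h j) ((volume.restrict (Ioo 0 t)).prod volume) := by
    intro k
    have h1 := fun h j => integrableOn_oseenKernel_mul (k := k) (hf h j) (hx h k j)
    simp only [IntegrableOn, Measure.volume_eq_prod, ← Measure.prod_restrict,
      Measure.restrict_univ] at h1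
    exact integrable_finsetSum _ fun h _ => integrable_finsetSum _ fun j _ => h1 h j
  have e1 : ∀ k, ∀ s ∈ Ioo 0 t, semigroupHelmholtzDiv α (t - s) (forceTensor α f s) x k =
      ∫ y, ∑ h, ∑ j, oseenKernel α h k j (x - y) (t - s) * forceTensor α f s y h j := fun k s hs =>
    semigroupHelmholtzDiv_apply hα (by linarith [hs.2]) _ x k
  rw [duhamel, integral_apply_E3]
  · rw [setIntegral_congr_fun measurableSet_Ioo (e1 k),
      integral_integral (f := fun s y => ∑ h, ∑ j, oseenKernel α h k j (x - y) (t - s) *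
        forceTensor α f s y h j) (hi k)]
    rw [Measure.volume_eq_prod, ← Measure.prod_restrict, Measure.restrict_univ]
    have h1 := fun h j => integrableOn_oseenKernel_mul (k := k) (hf h j) (hx h k j)
    simp only [IntegrableOn, Measure.volume_eq_prod, ← Measure.prod_restrict,
      Measure.restrict_univ] at h1
    rw [integral_finsetSum _ fun h _ => integrable_finsetSum _ fun j _ => h1 h j]
    refine Finset.sum_congr rfl fun h _ => ?_
    rw [integral_finsetSum _ fun j _ => h1 h j]
  · intro k
    refine ((hi k).integral_prod_left).congr ?_
    filter_upwards [ae_restrict_mem measurableSet_Ioo] with s hs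
    exact (e1 k s hs).symm

/-! ### Space-time test functions and the Fourier transforms of their slices. -/

/-- Smooth compactly supported functions on space-time. -/
structure IsTest (ψ : ℝ × E3 → ℝ) : Prop where
  smooth : ContDiff ℝ (⊤ : ℕ∞) ψ
  compact : HasCompactSupport ψ

theorem IsTest.lineDeriv {ψ : ℝ × E3 → ℝ} (hψ : IsTest ψ) (v : ℝ × E3) :
    IsTest fun z => lineDeriv ℝ ψ z v := by
  have e1 : (fun z => _root_.lineDeriv ℝ ψ z v) = fun z => fderiv ℝ ψ z v := by
    ext z
    exact ((hψ.smooth.differentiable (by simp)).differentiableAt).lineDeriv_eq_fderiv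
  rw [e1]
  refine ⟨(hψ.smooth.fderiv_right (m := (⊤ : ℕ∞)) (by simp)).clm_apply contDiff_const, ?_⟩
  exact (hψ.compact.fderiv (𝕜 := ℝ)).mono' (fun z hz => subset_tsupport _ (fun h => hz (by simp [h])))

theorem isClosedEmbedding_slice (t : ℝ) : IsClosedEmbedding fun x : E3 => (t, x) :=
  ⟨.of_comp (by fun_prop) continuous_snd .id, by
    have : range (fun x : E3 => (t, x)) = {z | z.1 = t} := by
      ext z
      constructor
      · rintro ⟨x, rfl⟩; rfl
      · rintro rfl; exact ⟨z.2, rfl⟩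
    rw [this]
    exact isClosed_eq continuous_fst continuous_const⟩

theorem IsTest.hasCompactSupport_slice {ψ : ℝ × E3 → ℝ} (hψ : IsTest ψ) (t : ℝ) :
    HasCompactSupport fun x : E3 => (ψ (t, x) : ℂ) :=
  (hψ.compact.comp_isClosedEmbedding (isClosedEmbedding_slice t)).comp_left
    (g := fun r : ℝ => (r : ℂ)) (by simp)

theorem IsTest.contDiff_slice {ψ : ℝ × E3 → ℝ} (hψ : IsTest ψ) (t : ℝ) :
    ContDiff ℝ (⊤ : ℕ∞) fun x : E3 => (ψ (t, x) : ℂ) :=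
  Complex.ofRealCLM.contDiff.comp (hψ.smooth.comp (by fun_prop))

/-- The spatial slice of a test function, as a Schwartz function. -/
def IsTest.slice {ψ : ℝ × E3 → ℝ} (hψ : IsTest ψ) (t : ℝ) : SchwartzMap E3 ℂ :=
  (hψ.hasCompactSupport_slice t).toSchwartzMap (hψ.contDiff_slice t)

theorem IsTest.slice_apply {ψ : ℝ × E3 → ℝ} (hψ : IsTest ψ) (t : ℝ) (x : E3) :
    hψ.slice t x = ψ (t, x) := rfl

theorem norm_iteratedFDeriv_slice_le {ψ : ℝ × E3 → ℝ} (hψ : ContDiff ℝ (⊤ : ℕ∞) ψ) (n : ℕ) (t : ℝ)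
    (x : E3) : ‖iteratedFDeriv ℝ n (fun y : E3 => (ψ (t, y) : ℂ)) x‖ ≤
      ‖iteratedFDeriv ℝ n ψ (t, x)‖ := by
  have h1 : ContDiff ℝ (⊤ : ℕ∞) fun z : ℝ × E3 => ψ ((t, 0) + z) := hψ.comp (by fun_prop)
  have h2 : ContDiff ℝ (⊤ : ℕ∞) fun y : E3 => ψ (t, y) := hψ.comp (by fun_prop)
  have e1 : ‖iteratedFDeriv ℝ n (fun y : E3 => (ψ (t, y) : ℂ)) x‖ =
      ‖iteratedFDeriv ℝ n (fun y : E3 => ψ (t, y)) x‖ :=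
    LinearIsometry.norm_iteratedFDeriv_comp_left (𝕜 := ℝ) Complex.ofRealLI
      (f := fun y : E3 => ψ (t, y)) (x := x) (n := (⊤ : ℕ∞)) (h2.contDiffAt) (by exact_mod_cast le_top)
  have e2 : (fun y : E3 => ψ (t, y)) =
      (fun z : ℝ × E3 => ψ ((t, 0) + z)) ∘ ContinuousLinearMap.inr ℝ ℝ E3 := by
    ext y; simp
  rw [e1, e2, ContinuousLinearMap.iteratedFDeriv_comp_right _ h1 x (i := n)
    (by exact_mod_cast le_top), iteratedFDeriv_comp_add_left]
  refine (ContinuousMultilinearMap.norm_compContinuousLinearMap_le _ _).trans ?_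
  simp only [ContinuousLinearMap.inr_apply, Prod.mk_add_mk, add_zero, zero_add]
  refine mul_le_of_le_one_right (norm_nonneg _) ?_
  exact Finset.prod_le_one (fun _ _ => norm_nonneg _) fun _ _ =>
    ContinuousLinearMap.norm_inr_le_one ℝ ℝ E3

theorem continuous_schwartzBound (N : ℕ) : Continuous (schwartzBound N) := by
  refine Seminorm.continuous_of_le ?_ (q := ∑ i ∈ Finset.Iic (N + 2, 2),
    schwartzSeminormFamily ℂ E3 ℂ i) (Seminorm.finset_sup_le_sum _ _)
  refine Finset.sum_induction _ (fun p : Seminorm ℂ (SchwartzMap E3 ℂ) => Continuous p)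
    (fun p r hp hr => by rw [FunLike.coe_add]; exact hp.add hr)
    (by rw [FunLike.coe_zero]; exact continuous_const)
    fun i _ => (schwartz_withSeminorms ℂ E3 ℂ).continuous_seminorm i

theorem exists_schwartzBound_fourier_le (N : ℕ) : ∃ (s : Finset (ℕ × ℕ)) (C : ℝ≥0),
    ∀ G : SchwartzMap E3 ℂ, schwartzBound N (𝓕 G) ≤
      C * s.sup (schwartzSeminormFamily ℂ E3 ℂ) G := by
  obtain ⟨s, C, -, h⟩ := Seminorm.bound_of_continuous (schwartz_withSeminorms ℂ E3 ℂ)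
    ((schwartzBound N).comp (FourierTransform.fourierCLM ℂ (SchwartzMap E3 ℂ)).toLinearMap)
    ((continuous_schwartzBound N).comp (FourierTransform.fourierCLM ℂ (SchwartzMap E3 ℂ)).continuous)
  exact ⟨s, C, fun G => h G⟩

/-- Uniform Schwartz bounds for the Fourier transforms of the slices of a test function. -/
theorem exists_schwartzBound_fourier_slice_le (N : ℕ) (R : ℝ) : ∃ (n : ℕ) (C : ℝ), 0 ≤ C ∧
    ∀ (ψ : ℝ × E3 → ℝ) (hψ : IsTest ψ) (B : ℝ), (∀ z, ψ z ≠ 0 → ‖z.2‖ ≤ R) →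
      (∀ i ≤ n, ∀ z, ‖iteratedFDeriv ℝ i ψ z‖ ≤ B) →
      ∀ t, schwartzBound N (𝓕 (hψ.slice t)) ≤ C * B := by
  obtain ⟨s, C, h⟩ := exists_schwartzBound_fourier_le N
  -- The constant dominates all polynomial weights occurring in the finitely many seminorms on the
  -- ball of radius `R`; outside that ball the slice vanishes identically.
  set P : ℝ := (1 + |R|) ^ (s.sup Prod.fst) with hP
  refine ⟨s.sup Prod.snd, C * P, by positivity, fun ψ hψ B hR hB t => ?_⟩
  have hB0 : 0 ≤ B := (norm_nonneg _).trans (hB 0 (Nat.zero_le _) 0)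
  refine (h _).trans ?_
  rw [mul_assoc]
  gcongr
  refine Seminorm.finset_sup_apply_le (by positivity) fun i hi => ?_
  refine SchwartzMap.seminorm_le_bound ℂ i.1 i.2 _ (by positivity) fun x => ?_
  by_cases hx : ‖x‖ ≤ R
  · gcongr
    · calc ‖x‖ ^ i.1 ≤ (1 + |R|) ^ i.1 := by
            gcongr; exact hx.trans ((le_abs_self R).trans (by linarith))
        _ ≤ P := pow_le_pow_right₀ (by linarith [abs_nonneg R]) (Finset.le_sup (f := Prod.fst) hi)
    · exact (norm_iteratedFDeriv_slice_le hψ.smooth i.2 t x).trans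
        (hB _ (Finset.le_sup (f := Prod.snd) hi) _)
  · have h0 : iteratedFDeriv ℝ i.2 (hψ.slice t) x = 0 := by
      have hsub : Function.support (iteratedFDeriv ℝ i.2 (hψ.slice t)) ⊆ tsupport (hψ.slice t) :=
        support_iteratedFDeriv_subset i.2
      have hsub2 : tsupport (hψ.slice t) ⊆ {x : E3 | ‖x‖ ≤ R} := by
        refine closure_minimal (fun y hy => ?_) (isClosed_le continuous_norm continuous_const)
        refine hR (t, y) fun h0 => hy ?_
        rw [IsTest.slice_apply, h0, Complex.ofReal_zero]
      by_contra hne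
      exact hx (hsub2 (hsub hne))
    rw [h0, norm_zero, mul_zero]
    positivity

theorem IsTest.exists_bound {ψ : ℝ × E3 → ℝ} (hψ : IsTest ψ) (n : ℕ) :
    ∃ B, ∀ i ≤ n, ∀ z, ‖iteratedFDeriv ℝ i ψ z‖ ≤ B := by
  have h1 : ∀ i, ∃ B, ∀ z, ‖iteratedFDeriv ℝ i ψ z‖ ≤ B := fun i =>
    (hψ.smooth.continuous_iteratedFDeriv (m := i) (by exact_mod_cast le_top)).bounded_above_of_compact_support
      (hψ.compact.iteratedFDeriv i)
  choose B hB using h1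
  refine ⟨∑ i ∈ Finset.range (n + 1), |B i|, fun i hi z => (hB i z).trans ?_⟩
  exact (le_abs_self _).trans (Finset.single_le_sum (f := fun i => |B i|) (fun _ _ => abs_nonneg _)
    (Finset.mem_range.2 (by omega)))

theorem IsTest.exists_radius {ψ : ℝ × E3 → ℝ} (hψ : IsTest ψ) : ∃ R, ∀ z, ψ z ≠ 0 → ‖z‖ ≤ R := by
  obtain ⟨R, hR⟩ := hψ.compact.isBounded.exists_norm_le
  exact ⟨R, fun z hz => hR z (subset_tsupport _ hz)⟩

theorem IsTest.exists_schwartzBound {ψ : ℝ × E3 → ℝ} (hψ : IsTest ψ) (N : ℕ) :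
    ∃ B, 0 ≤ B ∧ ∀ t, schwartzBound N (𝓕 (hψ.slice t)) ≤ B := by
  obtain ⟨R, hR⟩ := hψ.exists_radius
  obtain ⟨n, C, hC, h⟩ := exists_schwartzBound_fourier_slice_le N R
  obtain ⟨B, hB⟩ := hψ.exists_bound n
  have := h ψ hψ B (fun z hz => (norm_snd_le z).trans (hR z hz)) hB
  exact ⟨C * B, (apply_nonneg _ _).trans (this 0), this⟩

theorem fourier_slice_eq {ψ : ℝ × E3 → ℝ} (hψ : IsTest ψ) (t : ℝ) (ξ : E3) :
    𝓕 (hψ.slice t) ξ = ∫ x, (Real.fourierChar (-inner ℝ x ξ) : ℂ) * (ψ (t, x) : ℂ) := by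
  rw [SchwartzMap.fourier_coe, Real.fourier_eq]
  simp_rw [Circle.smul_def, smul_eq_mul, IsTest.slice_apply]

theorem measurable_fourier_slice {ψ : ℝ × E3 → ℝ} (hψ : IsTest ψ) :
    Measurable fun z : ℝ × E3 => 𝓕 (hψ.slice z.1) z.2 := by
  simp_rw [fourier_slice_eq]
  refine StronglyMeasurable.measurable (StronglyMeasurable.integral_prod_right'
    (f := fun p : (ℝ × E3) × E3 => (Real.fourierChar (-inner ℝ p.2 p.1.2) : ℂ) *
      (ψ (p.1.1, p.2) : ℂ)) ?_)
  refine Continuous.stronglyMeasurable ?_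
  have h1 := hψ.smooth.continuous
  have h2 : Continuous fun p : (ℝ × E3) × E3 => (Real.fourierChar (-inner ℝ p.2 p.1.2) : ℂ) := by
    have := Real.continuous_fourierChar
    fun_prop
  have h3 : Continuous fun p : (ℝ × E3) × E3 => ψ (p.1.1, p.2) := by fun_prop
  fun_prop

theorem fourier_slice_neg {ψ : ℝ × E3 → ℝ} (hψ : IsTest ψ) (t : ℝ) (ξ : E3) :
    𝓕 (hψ.slice t) (-ξ) = (starRingEnd ℂ) (𝓕 (hψ.slice t) ξ) := by
  rw [fourier_slice_eq, fourier_slice_eq, ← integral_conj]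
  refine integral_congr_ae (ae_of_all _ fun x => ?_)
  simp only [inner_neg_right, neg_neg, map_mul, Complex.conj_ofReal]
  congr 1
  rw [← Circle.coe_inv_eq_conj, ← AddChar.map_neg_eq_inv, neg_neg]

theorem fourier_slice_lineDeriv {ψ : ℝ × E3 → ℝ} (hψ : IsTest ψ) (k : Fin 3) (t : ℝ) (ξ : E3) :
    𝓕 ((hψ.lineDeriv (0, e k)).slice t) ξ = 2 * Real.pi * Complex.I * ξ k * 𝓕 (hψ.slice t) ξ := by
  have h1 : (hψ.lineDeriv (0, e k)).slice t = ∂_{e k} (hψ.slice t) := by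
    ext x
    have hd : HasLineDerivAt ℝ ψ (_root_.lineDeriv ℝ ψ (t, x) (0, e k)) (t, x) (0, e k) :=
      ((hψ.smooth.differentiable (by simp)).differentiableAt).lineDifferentiableAt.hasLineDerivAt
    have h2 := hasLineDerivAt_schwartz (hψ.slice t) (e k) x
    rw [IsTest.slice_apply]
    refine HasLineDerivAt.unique ?_ h2
    rw [HasLineDerivAt] at hd ⊢
    have h5 : (fun τ : ℝ => hψ.slice t (x + τ • e k)) =
        fun τ : ℝ => ((ψ ((t, x) + τ • ((0 : ℝ), e k)) : ℝ) : ℂ) := by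
      funext τ
      rw [IsTest.slice_apply]
      simp
    rw [h5]
    exact hd.ofReal_comp
  rw [h1, SchwartzMap.fourier_lineDerivOp_eq]
  have : Function.HasTemperateGrowth fun x : E3 => inner ℝ x (e k) := by fun_prop
  simp only [smul_apply, smul_eq_mul, SchwartzMap.smulLeftCLM_apply_apply this,
    Complex.real_smul]
  rw [real_inner_comm, inner_e]
  ring

/-- Fourier side of the time integration: `ψ̂(s)` solves the backward equation. -/
theorem integral_exp_mul_fourier_slice {ψ : ℝ × E3 → ℝ} (hψ : IsTest ψ) (a s : ℝ)
    (ξ : E3) :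
    ∫ t in Ioi s, (Real.exp (-(t - s) * a) : ℂ) *
      (-𝓕 ((hψ.lineDeriv (1, 0)).slice t) ξ + a * 𝓕 (hψ.slice t) ξ) = 𝓕 (hψ.slice s) ξ := by
  set ψ' : ℝ × E3 → ℝ := fun z => lineDeriv ℝ ψ z (1, 0) with hψ'
  have hT := hψ.lineDeriv (1, 0)
  have hFc : Continuous fun x : E3 => (Real.fourierChar (-inner ℝ x ξ) : ℂ) := by
    have := Real.continuous_fourierChar
    fun_prop
  have hslice : ∀ {φ : ℝ × E3 → ℝ} (hφ : IsTest φ) (t : ℝ), Integrable fun x =>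
      (Real.fourierChar (-inner ℝ x ξ) : ℂ) * (φ (t, x) : ℂ) := fun hφ t =>
    (Continuous.mul hFc (hφ.contDiff_slice t).continuous).integrable_of_hasCompactSupport
      (hφ.hasCompactSupport_slice t).mul_left
  have e1 : ∀ t, (Real.exp (-(t - s) * a) : ℂ) *
      (-𝓕 (hT.slice t) ξ + a * 𝓕 (hψ.slice t) ξ) =
      ∫ x, (Real.fourierChar (-inner ℝ x ξ) : ℂ) *
        ((Real.exp (-(t - s) * a) * (-ψ' (t, x) + a * ψ (t, x)) : ℝ) : ℂ) := by
    intro t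
    rw [fourier_slice_eq, fourier_slice_eq, ← integral_neg, ← integral_const_mul,
      ← integral_add (f := fun x => -((Real.fourierChar (-inner ℝ x ξ) : ℂ) * (ψ' (t, x) : ℂ)))
        (hslice hT t).neg ((hslice hψ t).const_mul _), ← integral_const_mul]
    refine integral_congr_ae (ae_of_all _ fun x => ?_)
    push_cast
    ring
  simp_rw [e1]
  have hcont : Continuous fun p : ℝ × E3 => (Real.fourierChar (-inner ℝ p.2 ξ) : ℂ) *
        ((Real.exp (-(p.1 - s) * a) * (-ψ' (p.1, p.2) + a * ψ (p.1, p.2)) : ℝ) : ℂ) := by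
    have h1 := hψ.smooth.continuous
    have h2 : Continuous ψ' := hT.smooth.continuous
    have h3 : Continuous fun p : ℝ × E3 => (Real.fourierChar (-inner ℝ p.2 ξ) : ℂ) :=
      hFc.comp continuous_snd
    fun_prop
  have hsupp : HasCompactSupport fun p : ℝ × E3 => (Real.fourierChar (-inner ℝ p.2 ξ) : ℂ) *
        ((Real.exp (-(p.1 - s) * a) * (-ψ' (p.1, p.2) + a * ψ (p.1, p.2)) : ℝ) : ℂ) := by
    have h1 : HasCompactSupport fun p => -ψ' p + a * ψ p := hT.compact.neg.add hψ.compact.mul_left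
    refine HasCompactSupport.mul_left ?_
    exact (HasCompactSupport.mul_left (f := fun p : ℝ × E3 => Real.exp (-(p.1 - s) * a)) h1).comp_left
      (g := fun r : ℝ => (r : ℂ)) (by simp)
  have hint := (hcont.integrable_of_hasCompactSupport hsupp (μ := volume)).integrableOn
    (s := Ioi s ×ˢ univ)
  rw [IntegrableOn, Measure.volume_eq_prod, ← Measure.prod_restrict, Measure.restrict_univ] at hint
  rw [integral_integral_swap hint, fourier_slice_eq]
  refine integral_congr_ae (ae_of_all _ fun x => ?_)
  dsimp only
  rw [integral_const_mul, integral_complex_ofReal]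
  congr 2
  -- For fixed `x` the integrand is the exact derivative of `-e^{-(t-s)a} ψ(t,x)`, so the time
  -- integral is the boundary value at `t = s`, the one at infinity being zero by compact support.
  have hder : ∀ t ∈ Ici s, HasDerivAt (fun t => -(Real.exp (-(t - s) * a) * ψ (t, x)))
      (Real.exp (-(t - s) * a) * (-ψ' (t, x) + a * ψ (t, x))) t := by
    intro t _
    have h1 : HasDerivAt (fun t => ψ (t, x)) (ψ' (t, x)) t := by
      have hd : HasLineDerivAt ℝ ψ (ψ' (t, x)) (t, x) (1, 0) :=
        ((hψ.smooth.differentiable (by simp)).differentiableAt).lineDifferentiableAt.hasLineDerivAt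
      rw [HasLineDerivAt] at hd
      have h3 : HasDerivAt (fun τ : ℝ => τ - t) 1 t := (hasDerivAt_id t).sub_const t
      have h5 : (fun t => ψ (t, x)) =
          (fun τ : ℝ => ψ ((t, x) + τ • ((1 : ℝ), (0 : E3)))) ∘ fun τ => τ - t := by
        funext τ
        simp
      rw [h5]
      exact (HasDerivAt.scomp t (by simpa using hd) h3).congr_deriv (one_smul ℝ _)
    have h2 : HasDerivAt (fun t => Real.exp (-(t - s) * a)) (Real.exp (-(t - s) * a) * (-1 * a)) t :=
      HasDerivAt.exp ((((hasDerivAt_id t).sub_const s).neg).mul_const a)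
    exact (h2.mul h1).neg.congr_deriv (by ring)
  have hlim : Tendsto (fun t => -(Real.exp (-(t - s) * a) * ψ (t, x))) atTop (𝓝 0) := by
    obtain ⟨R, hR⟩ := hψ.exists_radius
    refine tendsto_const_nhds.congr' ?_
    filter_upwards [eventually_gt_atTop R] with t ht
    have : ψ (t, x) = 0 := by
      by_contra h0
      have h1 := (norm_fst_le (t, x)).trans (hR _ h0)
      rw [Real.norm_eq_abs] at h1
      exact absurd ((le_abs_self t).trans h1) (not_le.2 ht)
    simp [this]
  have hi2 : IntegrableOn (fun t => Real.exp (-(t - s) * a) * (-ψ' (t, x) + a * ψ (t, x)))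
      (Ioi s) := by
    have hc : IsClosedEmbedding fun t : ℝ => (t, x) :=
      ⟨.of_comp (by fun_prop) continuous_fst .id, by
        have : range (fun t : ℝ => (t, x)) = {z | z.2 = x} := by
          ext z
          constructor
          · rintro ⟨x, rfl⟩; rfl
          · rintro rfl; exact ⟨z.1, rfl⟩
        rw [this]
        exact isClosed_eq continuous_snd continuous_const⟩
    have h1 : HasCompactSupport fun p => -ψ' p + a * ψ p := hT.compact.neg.add hψ.compact.mul_left
    have h2 := (h1.comp_isClosedEmbedding hc).mul_left (f := fun t => Real.exp (-(t - s) * a))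
    refine (Continuous.integrable_of_hasCompactSupport ?_ h2).integrableOn
    have h3 := hψ.smooth.continuous
    have h4 : Continuous ψ' := hT.smooth.continuous
    simp only [Function.comp_def]
    fun_prop
  rw [integral_Ioi_of_hasDerivAt_of_tendsto' hder hi2 hlim]
  simp

/-! ### Duality between the kernel and the backward operator. -/

theorem ofReal_re_fourierInv {m : E3 → ℂ} (hm : ∀ ξ, m (-ξ) = (starRingEnd ℂ) (m ξ)) (x : E3) :
    (((𝓕⁻ m x).re : ℝ) : ℂ) = 𝓕⁻ m x := by
  -- Conjugating the integrand and reflecting `ξ` reproduces the integral, because the symbol is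
  -- Hermitian. Hence the real parts in the definitions discard nothing.
  rw [← Complex.conj_eq_iff_re, fourierInv_eq_mul, ← integral_conj, ← integral_neg_eq_self]
  refine integral_congr_ae (ae_of_all _ fun ξ => ?_)
  simp only [map_mul, hm, Complex.conj_conj, inner_neg_left]
  congr 1
  rw [← Circle.coe_inv_eq_conj, ← AddChar.map_neg_eq_inv, neg_neg]

theorem helmholtzSymbol_neg (k j : Fin 3) (ξ : E3) :
    helmholtzSymbol k j (-ξ) = helmholtzSymbol k j ξ := by
  simp [helmholtzSymbol]

theorem oseenGradSymbol_neg (α : ℝ) (h k j : Fin 3) (t : ℝ) (ξ : E3) :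
    oseenGradSymbol α h k j t (-ξ) = -oseenGradSymbol α h k j t ξ := by
  simp [oseenGradSymbol, helmholtzSymbol_neg, fracSymbol_neg]

theorem conj_oseenGradSymbol (α : ℝ) (h k j : Fin 3) (t : ℝ) (ξ : E3) :
    (starRingEnd ℂ) (oseenGradSymbol α h k j t ξ) = -oseenGradSymbol α h k j t ξ := by
  rw [oseenGradSymbol, map_mul, Complex.conj_ofReal]
  simp only [map_mul, Complex.conj_ofReal, Complex.conj_I, map_ofNat]
  ring

theorem ofReal_oseenKernel (α : ℝ) (h k j : Fin 3) (x : E3) (t : ℝ) :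
    (oseenKernel α h k j x t : ℂ) = 𝓕⁻ (oseenGradSymbol α h k j t) x := by
  unfold oseenKernel
  exact ofReal_re_fourierInv (fun ξ => by rw [oseenGradSymbol_neg, conj_oseenGradSymbol]) x

theorem fourierInv_fourierInv {G : E3 → ℂ} (hGc : Continuous G) (hG : Integrable G)
    (hGi : Integrable (𝓕⁻ G)) (ξ : E3) : 𝓕⁻ (𝓕⁻ G) ξ = G (-ξ) := by
  have h1 : Integrable (𝓕 G) := by
    have : 𝓕 G = fun x => 𝓕⁻ G (-x) := by
      ext x
      rw [Real.fourierInv_eq_fourier_neg, neg_neg]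
    rw [this]
    exact hGi.comp_neg
  rw [Real.fourierInv_eq_fourier_neg, hGc.fourier_fourierInv_eq hG h1]

/-- Convolution with the kernel on the Fourier side. -/
theorem integral_oseenKernel_mul {α τ : ℝ} (hα : 0 < α) (hτ : 0 < τ) (h k j : Fin 3) {G : E3 → ℂ}
    (hGc : Continuous G) (hG : Integrable G) (hGi : Integrable (𝓕⁻ G))
    (hGh : ∀ ξ, G (-ξ) = (starRingEnd ℂ) (G ξ)) (y : E3) :
    ((∫ x, oseenKernel α h k j (x - y) τ * (𝓕⁻ G x).re : ℝ) : ℂ) =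
      -𝓕⁻ (fun ξ => oseenGradSymbol α h k j τ ξ * G ξ) y := by
  have hm := integrable_oseenGradSymbol hα hτ h k j
  have hm' := integrable_mul_fourierChar hm (-y)
  have e1 : ∀ x, 𝓕⁻ (oseenGradSymbol α h k j τ) (x - y) =
      𝓕⁻ (fun ξ => oseenGradSymbol α h k j τ ξ * (Real.fourierChar (inner ℝ ξ (-y)) : ℂ)) x := by
    intro x
    rw [fourierInv_eq_mul, fourierInv_eq_mul]
    refine integral_congr_ae (ae_of_all _ fun ξ => ?_)
    simp only [inner_sub_right, inner_neg_right]
    rw [sub_eq_add_neg, add_comm, AddChar.map_add_eq_mul, Circle.coe_mul, mul_assoc]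
  rw [← integral_complex_ofReal]
  simp_rw [Complex.ofReal_mul, ofReal_oseenKernel, ofReal_re_fourierInv hGh, e1]
  -- Two inversions in a row give the reflection `G(-ξ)`. After substituting `-ξ`, the oddness of
  -- the kernel symbol produces the minus sign.
  rw [integral_fourierInv_mul hm' hGi, fourierInv_eq_mul, ← integral_neg,
    ← integral_neg_eq_self]
  refine integral_congr_ae (ae_of_all _ fun ξ => ?_)
  simp only [fourierInv_fourierInv hGc hG hGi, oseenGradSymbol_neg, inner_neg_neg, neg_neg]
  ring

theorem measurable_fourierInv_uncurry {X : Type*} [MeasurableSpace X] {G : X → E3 → ℂ}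
    (hG : Measurable fun z : X × E3 => G z.1 z.2) :
    Measurable fun z : X × E3 => 𝓕⁻ (G z.1) z.2 := by
  simp_rw [fourierInv_eq_mul]
  refine StronglyMeasurable.measurable (StronglyMeasurable.integral_prod_right'
    (f := fun p : (X × E3) × E3 => G p.1.1 p.2 * (Real.fourierChar (inner ℝ p.2 p.1.2) : ℂ)) ?_)
  refine Measurable.stronglyMeasurable (Measurable.mul ?_ ?_)
  · exact hG.comp (f := fun p : (X × E3) × E3 => (p.1.1, p.2)) (by fun_prop)
  · exact continuous_fourierChar_inner.measurable.comp
      (f := fun p : (X × E3) × E3 => (p.2, p.1.2)) (by fun_prop)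

theorem fourierInv_fourier_slice {ψ : ℝ × E3 → ℝ} (hψ : IsTest ψ) (t : ℝ) (x : E3) :
    𝓕⁻ (fun ξ => 𝓕 (hψ.slice t) ξ) x = ψ (t, x) := by
  have : 𝓕⁻ (𝓕 (hψ.slice t)) = hψ.slice t := FourierTransform.fourierInv_fourier_eq _
  rw [← IsTest.slice_apply hψ, ← this, SchwartzMap.fourierInv_coe, this]

theorem integrable_fourier_slice {ψ : ℝ × E3 → ℝ} (hψ : IsTest ψ) (t : ℝ) :
    Integrable fun ξ => 𝓕 (hψ.slice t) ξ := (𝓕 (hψ.slice t)).integrable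

/-- The Fourier transform of `-∂ₜψ + (-Δ)^α ψ`. -/
def backwardSymbol (α : ℝ) {ψ : ℝ × E3 → ℝ} (hψ : IsTest ψ) (t : ℝ) (ξ : E3) : ℂ :=
  -𝓕 ((hψ.lineDeriv (1, 0)).slice t) ξ + fracSymbol α ξ * 𝓕 (hψ.slice t) ξ

theorem fracLaplacian_slice (α : ℝ) {ψ : ℝ × E3 → ℝ} (hψ : IsTest ψ) (t : ℝ) (x : E3) :
    fracLaplacian α (fun x => ψ (t, x)) x =
      (𝓕⁻ (fun ξ => (fracSymbol α ξ : ℂ) * 𝓕 (hψ.slice t) ξ) x).re := rfl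

theorem fourierInv_backwardSymbol {α : ℝ} (hα : 1 / 2 < α) {ψ : ℝ × E3 → ℝ} (hψ : IsTest ψ)
    (t : ℝ) (x : E3) : 𝓕⁻ (backwardSymbol α hψ t) x = -((hψ.lineDeriv (1, 0)).slice t x) +
        𝓕⁻ (fun ξ => (fracSymbol α ξ : ℂ) * 𝓕 (hψ.slice t) ξ) x := by
  obtain ⟨K, N, hK, hF⟩ := exists_hasFourierBound_frac hα
  have h1 := integrable_mul_fourierChar (integrable_fourier_slice (hψ.lineDeriv (1, 0)) t) x
  have h2 := integrable_mul_fourierChar (hF (𝓕 (hψ.slice t))).integrable x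
  rw [IsTest.slice_apply, ← fourierInv_fourier_slice (hψ.lineDeriv (1, 0)), fourierInv_eq_mul, fourierInv_eq_mul,
    fourierInv_eq_mul, ← integral_neg, ← integral_add h1.fun_neg h2]
  refine integral_congr_ae (ae_of_all _ fun ξ => ?_)
  simp only [backwardSymbol]
  ring

theorem re_fourierInv_backwardSymbol {α : ℝ} (hα : 1 / 2 < α) {ψ : ℝ × E3 → ℝ} (hψ : IsTest ψ)
    (t : ℝ) (x : E3) : (𝓕⁻ (backwardSymbol α hψ t) x).re =
      -(lineDeriv ℝ ψ (t, x) (1, 0)) + fracLaplacian α (fun x => ψ (t, x)) x := by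
  rw [fracLaplacian_slice α hψ, fourierInv_backwardSymbol hα, IsTest.slice_apply]
  simp

theorem continuous_backwardSymbol {α : ℝ} (hα : 0 < α) {ψ : ℝ × E3 → ℝ} (hψ : IsTest ψ) (t : ℝ) :
    Continuous (backwardSymbol α hψ t) := by
  have h1 := (𝓕 ((hψ.lineDeriv (1, 0)).slice t)).continuous
  have h2 := (𝓕 (hψ.slice t)).continuous
  have h3 := continuous_fracSymbol hα
  unfold backwardSymbol
  fun_prop

theorem integrable_backwardSymbol {α : ℝ} (hα : 1 / 2 < α) {ψ : ℝ × E3 → ℝ} (hψ : IsTest ψ)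
    (t : ℝ) : Integrable (backwardSymbol α hψ t) := by
  obtain ⟨K, N, hK, hF⟩ := exists_hasFourierBound_frac hα
  exact (integrable_fourier_slice (hψ.lineDeriv (1, 0)) t).neg.add (hF (𝓕 (hψ.slice t))).integrable

theorem integrable_fourierInv_backwardSymbol {α : ℝ} (hα : 1 / 2 < α) {ψ : ℝ × E3 → ℝ}
    (hψ : IsTest ψ) (t : ℝ) : Integrable (𝓕⁻ (backwardSymbol α hψ t)) := by
  obtain ⟨K, N, hK, hF⟩ := exists_hasFourierBound_frac hα
  have e1 : 𝓕⁻ (backwardSymbol α hψ t) = fun x =>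
      -(((hψ.lineDeriv (1, 0)).slice t) x) +
        𝓕⁻ (fun ξ => (fracSymbol α ξ : ℂ) * 𝓕 (hψ.slice t) ξ) x := by
    ext x
    exact fourierInv_backwardSymbol hα hψ t x
  rw [e1]
  exact ((hψ.lineDeriv (1, 0)).slice t).integrable.neg.add
    (hF (𝓕 (hψ.slice t))).integrable_fourierInv

theorem backwardSymbol_neg (α : ℝ) {ψ : ℝ × E3 → ℝ} (hψ : IsTest ψ) (t : ℝ) (ξ : E3) :
    backwardSymbol α hψ t (-ξ) = (starRingEnd ℂ) (backwardSymbol α hψ t ξ) := by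
  simp [backwardSymbol, fourier_slice_neg, fracSymbol_neg]

theorem measurable_backwardSymbol (α : ℝ) {ψ : ℝ × E3 → ℝ} (hψ : IsTest ψ) :
    Measurable fun z : ℝ × E3 => backwardSymbol α hψ z.1 z.2 := by
  have h1 := measurable_fourier_slice (hψ.lineDeriv (1, 0))
  have h2 := measurable_fourier_slice hψ
  have h3 : Measurable fun z : ℝ × E3 => fracSymbol α z.2 :=
    (measurable_fracSymbol α).comp measurable_snd
  unfold backwardSymbol
  fun_prop

theorem slice_eq_zero {ψ : ℝ × E3 → ℝ} (hψ : IsTest ψ) {t : ℝ} (ht : ∀ x, ψ (t, x) = 0) :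
    hψ.slice t = 0 := by
  ext x
  simp [IsTest.slice_apply, ht x]

theorem IsTest.exists_time {ψ : ℝ × E3 → ℝ} (hψ : IsTest ψ) :
    ∃ b, ∀ t x, b ≤ |t| → ψ (t, x) = 0 := by
  obtain ⟨R, hR⟩ := hψ.exists_radius
  refine ⟨R + 1, fun t x ht => ?_⟩
  by_contra h0
  have h1 := (norm_fst_le (t, x)).trans (hR _ h0)
  rw [Real.norm_eq_abs] at h1
  linarith

theorem backwardSymbol_eq_zero (α : ℝ) {ψ : ℝ × E3 → ℝ} (hψ : IsTest ψ) :
    ∃ b, ∀ t ξ, b ≤ |t| → backwardSymbol α hψ t ξ = 0 := by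
  obtain ⟨b, hb⟩ := hψ.exists_time
  obtain ⟨b', hb'⟩ := (hψ.lineDeriv (1, 0)).exists_time
  refine ⟨max b b', fun t ξ ht => ?_⟩
  rw [backwardSymbol, slice_eq_zero hψ fun x => hb t x ((le_max_left _ _).trans ht),
    slice_eq_zero (hψ.lineDeriv (1, 0)) fun x => hb' t x ((le_max_right _ _).trans ht)]
  have : 𝓕 (0 : SchwartzMap E3 ℂ) = 0 := (FourierTransform.fourierCLM ℂ (SchwartzMap E3 ℂ)).map_zero
  simp [this]

theorem norm_fourier_slice_le {ψ : ℝ × E3 → ℝ} (hψ : IsTest ψ) (N : ℕ) :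
    ∃ B, 0 ≤ B ∧ ∀ t, ∀ ξ ≠ 0, ‖𝓕 (hψ.slice t) ξ‖ ≤ B * decayWeight 0 N ‖ξ‖ := by
  obtain ⟨B, hB, h⟩ := hψ.exists_schwartzBound N
  refine ⟨B, hB, fun t ξ hξ => ((isSymbol_schwartz N (𝓕 (hψ.slice t))).norm_le hξ).trans ?_⟩
  gcongr
  · exact decayWeight_nonneg (norm_nonneg _)
  · exact h t

/-- The multiplier `2πi ξ_h P_{kj}` of `∂_h ℙ_{kj}`. -/
def helmholtzGradSymbol (h k j : Fin 3) (ξ : E3) : ℂ :=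
  2 * Real.pi * Complex.I * ((ξ h * helmholtzSymbol k j ξ : ℝ) : ℂ)

theorem oseenGradSymbol_eq (α : ℝ) (h k j : Fin 3) (t : ℝ) (ξ : E3) :
    oseenGradSymbol α h k j t ξ = helmholtzGradSymbol h k j ξ * (Real.exp (-t * fracSymbol α ξ) : ℂ) := by
  rw [oseenGradSymbol, helmholtzGradSymbol]
  push_cast
  ring

theorem exists_norm_helmholtzGradSymbol_le (h k j : Fin 3) :
    ∃ C, 0 ≤ C ∧ ∀ ξ ≠ 0, ‖helmholtzGradSymbol h k j ξ‖ ≤ C * ‖ξ‖ := by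
  obtain ⟨C, hC, H⟩ := isSymbol_helmholtz k j
  refine ⟨2 * Real.pi * C, by positivity, fun ξ hξ => ?_⟩
  have h1 := H.norm_le hξ
  rw [Complex.norm_real, Real.norm_eq_abs] at h1
  rw [helmholtzGradSymbol, norm_mul, Complex.norm_real, Real.norm_eq_abs, abs_mul]
  have h2 : ‖(2 * Real.pi * Complex.I : ℂ)‖ = 2 * Real.pi := by
    simp [abs_of_pos Real.pi_pos]
  rw [h2]
  calc 2 * Real.pi * (|ξ h| * |helmholtzSymbol k j ξ|) ≤ 2 * Real.pi * (‖ξ‖ * C) := by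
        gcongr
        exact norm_coord_le ξ h
    _ = _ := by ring

/-- The extra factor `|ξ|` is the size of the multiplier of `∂_h ℙ`. Uniformity in time provides the
majorant for exchanging the time integral with the Fourier integral. -/
theorem exists_norm_backwardSymbol_le {α : ℝ} (hα : 0 < α) {ψ : ℝ × E3 → ℝ} (hψ : IsTest ψ) :
    ∃ B, 0 ≤ B ∧ ∀ t, ∀ ξ ≠ 0, ‖backwardSymbol α hψ t ξ‖ * ‖ξ‖ ≤ B * decayWeight 0 4 ‖ξ‖ := by
  obtain ⟨B₁, h1, H1⟩ := norm_fourier_slice_le (hψ.lineDeriv (1, 0)) 5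
  obtain ⟨N, hN⟩ := exists_nat_ge (5 + 2 * α)
  obtain ⟨B₂, h2, H2⟩ := norm_fourier_slice_le hψ N
  have hle : ∀ a b r : ℝ, 0 < r → 0 ≤ a → 4 ≤ b → decayWeight a b r ≤ decayWeight 0 4 r := by
    intro a b r hr ha hb
    unfold decayWeight
    rcases le_total r 1 with hr1 | hr1
    · refine le_min ((min_le_left _ _).trans ?_) ((min_le_left _ _).trans ?_)
      · exact Real.rpow_le_rpow_of_exponent_ge hr hr1 ha
      · exact Real.rpow_le_rpow_of_exponent_ge hr hr1 (by linarith)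
    · refine le_min ((min_le_right _ _).trans ?_) ((min_le_right _ _).trans ?_)
      · exact Real.rpow_le_rpow_of_exponent_le hr1 (by linarith)
      · exact Real.rpow_le_rpow_of_exponent_le hr1 (by linarith)
  refine ⟨B₁ + (2 * Real.pi) ^ (2 * α) * B₂, by positivity, fun t ξ hξ => ?_⟩
  have hr : 0 < ‖ξ‖ := norm_pos_iff.2 hξ
  have e1 : ‖ξ‖ * decayWeight 0 (5 : ℕ) ‖ξ‖ ≤ decayWeight 0 4 ‖ξ‖ := by
    have := rpow_mul_decayWeight (a := 0) (b := (5 : ℕ)) (c := 1) hr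
    rw [Real.rpow_one] at this
    rw [this]
    exact hle _ _ _ hr (by norm_num) (by norm_num)
  have e2 : ‖ξ‖ ^ (2 * α) * ‖ξ‖ * decayWeight 0 N ‖ξ‖ ≤ decayWeight 0 4 ‖ξ‖ := by
    have := rpow_mul_decayWeight (a := 0) (b := N) (c := 2 * α + 1) hr
    rw [Real.rpow_add hr, Real.rpow_one] at this
    rw [this]
    exact hle _ _ _ hr (by linarith) (by linarith)
  calc ‖backwardSymbol α hψ t ξ‖ * ‖ξ‖
      ≤ (B₁ * decayWeight 0 (5 : ℕ) ‖ξ‖ + fracSymbol α ξ * (B₂ * decayWeight 0 N ‖ξ‖)) * ‖ξ‖ := by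
        gcongr
        rw [backwardSymbol]
        refine (norm_add_le _ _).trans ?_
        rw [norm_neg, norm_mul, Complex.norm_real, Real.norm_of_nonneg (fracSymbol_nonneg _ _)]
        gcongr
        · exact H1 t ξ hξ
        · exact fracSymbol_nonneg _ _
        · exact H2 t ξ hξ
    _ = B₁ * (‖ξ‖ * decayWeight 0 (5 : ℕ) ‖ξ‖) +
        (2 * Real.pi) ^ (2 * α) * B₂ * (‖ξ‖ ^ (2 * α) * ‖ξ‖ * decayWeight 0 N ‖ξ‖) := by
        rw [fracSymbol_eq]; ring
    _ ≤ B₁ * decayWeight 0 4 ‖ξ‖ + (2 * Real.pi) ^ (2 * α) * B₂ * decayWeight 0 4 ‖ξ‖ := by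
        gcongr
    _ = _ := by ring

/-- After Fubini, each frequency separately is the scalar identity `integral_exp_mul_fourier_slice`
with `a = |2πξ|^{2α}`: the semigroup inverts the backward operator, and only the time-independent
multiplier of `∂_h ℙ` is left. -/
theorem integral_fourierInv_oseenGradSymbol {α : ℝ} (hα : 1 / 2 < α) {ψ : ℝ × E3 → ℝ}
    (hψ : IsTest ψ) (h k j : Fin 3) (s : ℝ) (y : E3) :
    ∫ t in Ioi s, 𝓕⁻ (fun ξ => oseenGradSymbol α h k j (t - s) ξ * backwardSymbol α hψ t ξ) y =
      𝓕⁻ (fun ξ => helmholtzGradSymbol h k j ξ * 𝓕 (hψ.slice s) ξ) y := by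
  have α0 : 0 < α := by linarith
  obtain ⟨B, hB, H⟩ := exists_norm_backwardSymbol_le α0 hψ
  obtain ⟨C, hC, HC⟩ := exists_norm_helmholtzGradSymbol_le h k j
  obtain ⟨b, hb⟩ := backwardSymbol_eq_zero α hψ
  have hmeas : Measurable fun z : ℝ × E3 => oseenGradSymbol α h k j (z.1 - s) z.2 *
      backwardSymbol α hψ z.1 z.2 * (Real.fourierChar (inner ℝ z.2 y) : ℂ) := by
    refine Measurable.mul (Measurable.mul ?_ (measurable_backwardSymbol α hψ)) ?_
    · exact (measurable_oseenGradSymbol α h k j).comp (f := fun z : ℝ × E3 => (z.1 - s, z.2))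
        (by fun_prop)
    · exact continuous_fourierChar_inner.measurable.comp (f := fun z : ℝ × E3 => (z.2, y))
        (by fun_prop)
  have hint : Integrable (fun z : ℝ × E3 => oseenGradSymbol α h k j (z.1 - s) z.2 *
      backwardSymbol α hψ z.1 z.2 * (Real.fourierChar (inner ℝ z.2 y) : ℂ))
      ((volume.restrict (Ioi s)).prod volume) := by
    have hdom : Integrable (fun z : ℝ × E3 => (Icc (-b) b).indicator (fun _ => (1 : ℝ)) z.1 *
        (C * B * decayWeight 0 4 ‖z.2‖)) ((volume.restrict (Ioi s)).prod volume) := by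
      refine Integrable.mul_prod (f := (Icc (-b) b).indicator (fun _ => (1 : ℝ)))
        (g := fun ξ : E3 => C * B * decayWeight 0 4 ‖ξ‖) ?_ ?_
      · refine Integrable.integrableOn ?_
        rw [integrable_indicator_iff measurableSet_Icc]
        exact integrableOn_const (by simp) (by simp)
      · exact (integrable_decayWeight (by norm_num) (by norm_num)).const_mul _
    refine hdom.mono' hmeas.aestronglyMeasurable ?_
    have hne : ∀ᵐ z : ℝ × E3 ∂((volume.restrict (Ioi s)).prod volume), z.2 ≠ 0 :=
      Measure.quasiMeasurePreserving_snd.ae ae_ne_zero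
    have hpos : ∀ᵐ z : ℝ × E3 ∂((volume.restrict (Ioi s)).prod volume), z.1 ∈ Ioi s :=
      Measure.quasiMeasurePreserving_fst.ae (ae_restrict_mem measurableSet_Ioi)
    filter_upwards [hne, hpos] with z hz hs
    rw [norm_mul, norm_fourierChar, mul_one]
    by_cases hbz : z.1 ∈ Icc (-b) b
    · rw [indicator_of_mem hbz, one_mul, oseenGradSymbol_eq, norm_mul, norm_mul,
        Complex.norm_real, Real.norm_of_nonneg (Real.exp_pos _).le]
      have he : Real.exp (-(z.1 - s) * fracSymbol α z.2) ≤ 1 := by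
        rw [Real.exp_le_one_iff]
        have := fracSymbol_nonneg α z.2
        have hs' : 0 < z.1 - s := by simpa using hs
        nlinarith
      calc ‖helmholtzGradSymbol h k j z.2‖ * Real.exp (-(z.1 - s) * fracSymbol α z.2) *
            ‖backwardSymbol α hψ z.1 z.2‖ ≤ C * ‖z.2‖ * 1 * ‖backwardSymbol α hψ z.1 z.2‖ := by
            gcongr
            exact HC z.2 hz
        _ = C * (‖backwardSymbol α hψ z.1 z.2‖ * ‖z.2‖) := by ring
        _ ≤ C * (B * decayWeight 0 4 ‖z.2‖) := by
            exact mul_le_mul_of_nonneg_left (H z.1 z.2 hz) hC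
        _ = _ := by ring
    · have h0 : backwardSymbol α hψ z.1 z.2 = 0 := by
        refine hb _ _ ?_
        by_contra hlt
        rw [not_le, abs_lt] at hlt
        exact hbz ⟨hlt.1.le, hlt.2.le⟩
      rw [indicator_of_notMem hbz, h0, mul_zero, norm_zero, zero_mul]
  simp_rw [fourierInv_eq_mul]
  rw [integral_integral_swap hint]
  refine integral_congr_ae (ae_of_all _ fun ξ => ?_)
  dsimp only
  rw [← integral_exp_mul_fourier_slice hψ (fracSymbol α ξ) s, ← integral_const_mul,
    ← integral_mul_const]
  refine integral_congr_ae (ae_of_all _ fun t => ?_)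
  simp only [oseenGradSymbol_eq, backwardSymbol]
  ring

/-! ### Pairings with functions in `L¹ ∩ L^∞`. -/

theorem le_add_rpow (D : ℝ≥0∞) {ε q : ℝ} (hε : 0 < ε) (hq : 1 ≤ q) :
    D ≤ ENNReal.ofReal ε + ENNReal.ofReal (ε ^ (1 - q)) * D ^ q := by
  -- Either `D ≤ ε`, or `D = D^{1-q} D^q ≤ ε^{1-q} D^q` because `1 - q ≤ 0`.
  rcases le_total D (ENNReal.ofReal ε) with h | h
  · exact h.trans le_self_add
  refine le_trans ?_ le_add_self
  have hp : 0 < ε ^ (1 - q) := Real.rpow_pos_of_pos hε _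
  by_cases hD : D = ∞
  · rw [hD, ENNReal.top_rpow_of_pos (by linarith), ENNReal.mul_top (by simpa using hp)]
  lift D to ℝ≥0 using hD
  have h1 : ε ≤ D := by
    rw [ENNReal.ofReal_le_iff_le_toReal ENNReal.coe_ne_top] at h
    exact h
  have hD0 : (0 : ℝ) < D := hε.trans_le h1
  rw [show ((D : ℝ≥0) : ℝ≥0∞) = ENNReal.ofReal D from (ENNReal.ofReal_coe_nnreal).symm,
    ENNReal.ofReal_rpow_of_pos hD0, ← ENNReal.ofReal_mul hp.le]
  refine ENNReal.ofReal_le_ofReal ?_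
  calc (D : ℝ) = (D : ℝ) ^ (1 - q) * (D : ℝ) ^ q := by
        rw [← Real.rpow_add hD0]; simp
    _ ≤ _ := by
        gcongr ?_ * _
        exact Real.rpow_le_rpow_of_nonpos hε h1 (by linarith)

/-- A flexible substitute for Hölder's inequality against a function in `L¹ ∩ L^∞`. -/
theorem lintegral_mul_le_add {X : Type*} [MeasurableSpace X] {μ : Measure X} {D Θ : X → ℝ≥0∞}
    {M : ℝ≥0∞} (hM : M ≠ ∞) (hΘ : ∀ᵐ x ∂μ, Θ x ≤ M) (hm : AEMeasurable Θ μ) {ε q : ℝ} (hε : 0 < ε)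
    (hq : 1 ≤ q) :
    ∫⁻ x, D x * Θ x ∂μ ≤ ENNReal.ofReal ε * ∫⁻ x, Θ x ∂μ +
      ENNReal.ofReal (ε ^ (1 - q)) * (M * ∫⁻ x, D x ^ q ∂μ) := by
  calc ∫⁻ x, D x * Θ x ∂μ
      ≤ ∫⁻ x, (ENNReal.ofReal ε * Θ x + ENNReal.ofReal (ε ^ (1 - q)) * (M * D x ^ q)) ∂μ := by
        refine lintegral_mono_ae ?_
        filter_upwards [hΘ] with x hx
        calc D x * Θ x ≤ (ENNReal.ofReal ε + ENNReal.ofReal (ε ^ (1 - q)) * D x ^ q) * Θ x := by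
              gcongr
              exact le_add_rpow _ hε hq
          _ = ENNReal.ofReal ε * Θ x + ENNReal.ofReal (ε ^ (1 - q)) * (Θ x * D x ^ q) := by ring
          _ ≤ _ := by gcongr
    _ = _ := by
        rw [lintegral_add_left' (hm.const_mul _), lintegral_const_mul' _ _ ENNReal.ofReal_ne_top,
          lintegral_const_mul' _ _ ENNReal.ofReal_ne_top, lintegral_const_mul' _ _ hM]

/-- Functions on space-time that are uniformly in `L¹ ∩ L^∞` and vanish for late times. -/
structure IsAdmissible (Θ : ℝ × E3 → ℝ) : Prop where
  measurable : Measurable Θ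
  exists_bound : ∃ C : ℝ≥0, ∀ t, ∫⁻ x, ‖Θ (t, x)‖ₑ ≤ C ∧ ∀ x, ‖Θ (t, x)‖ₑ ≤ C
  exists_time : ∃ b : ℝ, ∀ t x, b ≤ t → Θ (t, x) = 0

theorem coe_spaceTime_top : (spaceTime ⊤ : Set (ℝ × E3)) = Ioi 0 ×ˢ univ := by
  ext z
  simp [spaceTime]

theorem restrict_spaceTime_top : (volume : Measure (ℝ × E3)).restrict (spaceTime ⊤) =
    (volume.restrict (Ioi 0)).prod volume := by
  rw [coe_spaceTime_top, Measure.volume_eq_prod, ← Measure.prod_restrict, Measure.restrict_univ]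

theorem IsAdmissible.measurable_slice {Θ : ℝ × E3 → ℝ} (hΘ : IsAdmissible Θ) (t : ℝ) :
    Measurable fun x => Θ (t, x) := hΘ.measurable.comp measurable_prodMk_left

/-- Times outside `[a, b)` contribute nothing. The lower cut-off `a` is there because `D` will also
be the force, whose norm may blow up as time tends to zero. -/
theorem lintegral_mul_le_of_bounds {q : ℝ} (hq : 1 ≤ q) {D : ℝ × E3 → ℝ≥0∞}
    (hD : Measurable D) {Θ : ℝ × E3 → ℝ} (hΘ : Measurable Θ) {C C' : ℝ≥0∞} (hCt : C ≠ ∞)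
    (hC : ∀ t, ∫⁻ x, ‖Θ (t, x)‖ₑ ≤ C ∧ ∀ x, ‖Θ (t, x)‖ₑ ≤ C) {a b : ℝ}
    (ha : ∀ t x, 0 < t → t < a → Θ (t, x) = 0) (hb : ∀ t x, b ≤ t → Θ (t, x) = 0)
    (hC' : ∀ t, 0 < t → a ≤ t → t < b → ∫⁻ x, D (t, x) ^ q ≤ C') :
    ∫⁻ z in spaceTime ⊤, D z * ‖Θ z‖ₑ ≤ (C + C * C') * ENNReal.ofReal b := by
  have hm : Measurable fun z => D z * ‖Θ z‖ₑ := hD.mul hΘ.enorm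
  rw [restrict_spaceTime_top, lintegral_prod _ hm.aemeasurable]
  calc ∫⁻ t in Ioi 0, ∫⁻ x, D (t, x) * ‖Θ (t, x)‖ₑ
      ≤ ∫⁻ t in Ioi 0, (Ioo 0 b).indicator (fun _ => C + C * C') t := by
        refine setLIntegral_mono' measurableSet_Ioi fun t ht => ?_
        by_cases htb : t < b
        · rw [indicator_of_mem (show t ∈ Ioo 0 b from ⟨ht, htb⟩)]
          by_cases hta : t < a
          · simp [ha t _ ht hta]
          have hΘt : Measurable fun x => Θ (t, x) := hΘ.comp measurable_prodMk_left
          refine (lintegral_mul_le_add (M := C) hCt (ae_of_all _ (hC t).2)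
            hΘt.enorm.aemeasurable one_pos hq).trans ?_
          simp only [Real.one_rpow, ENNReal.ofReal_one, one_mul]
          gcongr
          · exact (hC t).1
          · exact hC' t ht (not_lt.1 hta) htb
        · have : ∀ x, Θ (t, x) = 0 := fun x => hb t x (not_lt.1 htb)
          simp [this]
    _ ≤ ∫⁻ t, (Ioo 0 b).indicator (fun _ => C + C * C') t := setLIntegral_le_lintegral _ _
    _ = _ := by
        rw [lintegral_indicator measurableSet_Ioo, setLIntegral_const, Real.volume_Ioo, sub_zero]

theorem lintegral_mul_admissible_lt_top {q : ℝ} (hq : 1 ≤ q) {D : ℝ × E3 → ℝ≥0∞}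
    (hD : Measurable D) {Θ : ℝ × E3 → ℝ} (hΘ : IsAdmissible Θ)
    {a : ℝ} (ha : ∀ t x, 0 < t → t < a → Θ (t, x) = 0)
    (hDq : ∀ b, ∃ C : ℝ≥0, ∀ t, 0 < t → a ≤ t → t < b → ∫⁻ x, D (t, x) ^ q ≤ C) :
    ∫⁻ z in spaceTime ⊤, D z * ‖Θ z‖ₑ < ∞ := by
  obtain ⟨C, hC⟩ := hΘ.exists_bound
  obtain ⟨b, hb⟩ := hΘ.exists_time
  obtain ⟨C', hC'⟩ := hDq b
  refine (lintegral_mul_le_of_bounds hq hD hΘ.measurable ENNReal.coe_ne_top hC ha hb hC').trans_lt ?_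
  exact ENNReal.mul_lt_top (by finiteness) ENNReal.ofReal_lt_top

/-! ### Fubini for the Duhamel integral against an admissible function. -/

section Duhamel

variable {α q : ℝ} {f : E3 → Matrix (Fin 3) (Fin 3) ℝ}

theorem exists_lintegral_forceTensor_le (hα : 0 < α) (hq : 1 < q)
    (hf : ∀ h j, Measurable fun x => f x h j)
    (hfq : ∀ h j, MemLp (fun x => f x h j) (ENNReal.ofReal q) volume) {a : ℝ} (ha : 0 < a) (b : ℝ)
    (h j : Fin 3) : ∃ C : ℝ≥0, ∀ t, 0 < t → a ≤ t → t < b →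
      ∫⁻ x, ‖forceTensor α f t x h j‖ₑ ^ q ≤ C := by
  have q0 : 0 < q := by linarith
  have hfin := (lintegral_rpow_lt_top q0 (hfq h j)).ne
  -- The sum of the powers at both endpoints bounds `t^β` on `[a, b)` whatever the sign of `β`.
  refine ⟨((ENNReal.ofReal (a ^ forceExp α q + b ^ forceExp α q)) ^ q *
    ∫⁻ x, ‖f x h j‖ₑ ^ q).toNNReal, fun t ht hta htb => ?_⟩
  rw [ENNReal.coe_toNNReal (ENNReal.mul_ne_top
    (ENNReal.rpow_ne_top_of_nonneg q0.le ENNReal.ofReal_ne_top) hfin),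
    lintegral_forceTensor hα q0 (hf h j) ht]
  gcongr
  have h1 : 0 ≤ a ^ forceExp α q := by positivity
  have h2 : 0 ≤ b ^ forceExp α q := Real.rpow_nonneg (by linarith) _
  rcases le_total 0 (forceExp α q) with h0 | h0
  · linarith [Real.rpow_le_rpow ht.le htb.le h0]
  · linarith [Real.rpow_le_rpow_of_nonpos ha hta h0]

theorem integrable_forceTensor_mul (hα : 0 < α) (hq : 1 < q)
    (hf : ∀ h j, Measurable fun x => f x h j)
    (hfq : ∀ h j, MemLp (fun x => f x h j) (ENNReal.ofReal q) volume)
    {Θ : ℝ × E3 → ℝ} (hΘ : IsAdmissible Θ) {a : ℝ} (ha0 : 0 < a)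
    (ha : ∀ t x, 0 < t → t < a → Θ (t, x) = 0) (h j : Fin 3) :
    Integrable (fun z : ℝ × E3 => forceTensor α f z.1 z.2 h j * Θ z)
      (volume.restrict (spaceTime ⊤)) := by
  have hFm := measurable_forceTensor (α := α) (hf h j)
  refine ⟨(hFm.mul hΘ.measurable).aestronglyMeasurable, ?_⟩
  rw [hasFiniteIntegral_iff_enorm]
  simp_rw [enorm_mul]
  exact lintegral_mul_admissible_lt_top hq.le hFm.enorm hΘ ha fun b =>
    exists_lintegral_forceTensor_le hα hq hf hfq ha0 b h j

theorem exists_norm_integral_forceTensor_mul_le (hα : 0 < α) (hq : 1 < q)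
    (hf : ∀ h j, Measurable fun x => f x h j)
    (hfq : ∀ h j, MemLp (fun x => f x h j) (ENNReal.ofReal q) volume) {a : ℝ} (ha0 : 0 < a) (b : ℝ)
    (h j : Fin 3) : ∃ C, 0 ≤ C ∧ ∀ (Θ : ℝ × E3 → ℝ) (B : ℝ), 0 ≤ B → Measurable Θ →
      (∀ t, ∫⁻ x, ‖Θ (t, x)‖ₑ ≤ ENNReal.ofReal B ∧ ∀ x, ‖Θ (t, x)‖ₑ ≤ ENNReal.ofReal B) →
      (∀ t x, 0 < t → t < a → Θ (t, x) = 0) → (∀ t x, b ≤ t → Θ (t, x) = 0) →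
      ‖∫ z in spaceTime ⊤, forceTensor α f z.1 z.2 h j * Θ z‖ ≤ C * B := by
  obtain ⟨C, hC⟩ := exists_lintegral_forceTensor_le hα hq hf hfq ha0 b h j
  refine ⟨(1 + C) * |b|, by positivity, fun Θ B hB hΘ hbd ha hb => ?_⟩
  have h1 := lintegral_mul_le_of_bounds hq.le (measurable_forceTensor (α := α) (hf h j)).enorm hΘ
    ENNReal.ofReal_ne_top hbd ha hb hC
  have h2 : ‖∫ z in spaceTime ⊤, forceTensor α f z.1 z.2 h j * Θ z‖ₑ ≤
      (ENNReal.ofReal B + ENNReal.ofReal B * C) * ENNReal.ofReal b := by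
    refine (enorm_integral_le_lintegral_enorm _).trans ?_
    simp_rw [enorm_mul]
    exact h1
  rw [← ENNReal.ofReal_coe_nnreal, ← ENNReal.ofReal_mul hB, ← ENNReal.ofReal_add hB (by positivity),
    ← ENNReal.ofReal_mul (by positivity), ← ofReal_norm] at h2
  have h3 : (B + B * C) * b ≤ (1 + C) * |b| * B := by
    have := mul_le_mul_of_nonneg_left (le_abs_self b) (show 0 ≤ B + B * C by positivity)
    linarith
  exact (ENNReal.ofReal_le_ofReal_iff (by positivity)).1 (h2.trans (ENNReal.ofReal_le_ofReal h3))

theorem ae_duhamelAbs_lt_top_spaceTime (hα : 1 / 2 < α) (hq : 1 < q)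
    (hqα : q < 3 / (2 * α - 1)) (hf : ∀ h j, Measurable fun x => f x h j)
    (hfq : ∀ h j, MemLp (fun x => f x h j) (ENNReal.ofReal q) volume) :
    ∀ᵐ z : ℝ × E3 ∂(volume.restrict (spaceTime ⊤)),
      ∀ h k j : Fin 3, duhamelAbs α f h k j z.1 z.2 < ∞ := by
  rw [restrict_spaceTime_top]
  have hm : MeasurableSet {z : ℝ × E3 | ∀ h k j : Fin 3, duhamelAbs α f h k j z.1 z.2 < ∞} := by
    simp only [ofPred_forall]
    refine MeasurableSet.iInter fun h => MeasurableSet.iInter fun k => MeasurableSet.iInter fun j => ?_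
    exact measurableSet_lt (measurable_duhamelAbs (hf h j) k) measurable_const
  rw [Measure.ae_prod_iff_ae_ae hm]
  filter_upwards [ae_restrict_mem measurableSet_Ioi] with t ht
  exact ae_duhamelAbs_lt_top hα hq hqα hf hfq ht

/-- The integrand of the space-time pairing of the Duhamel integral with a test function. -/
def duhamelPairing (α : ℝ) (f : E3 → Matrix (Fin 3) (Fin 3) ℝ) (h k j : Fin 3) (Θ : ℝ × E3 → ℝ) :
    (ℝ × E3) × (ℝ × E3) → ℝ :=
  {p | p.2.1 < p.1.1}.indicator fun p =>
    oseenKernel α h k j (p.1.2 - p.2.2) (p.1.1 - p.2.1) * forceTensor α f p.2.1 p.2.2 h j * Θ p.1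

theorem measurable_duhamelPairing {h j : Fin 3} (hf : Measurable fun x => f x h j) (k : Fin 3)
    {Θ : ℝ × E3 → ℝ} (hΘ : Measurable Θ) : Measurable (duhamelPairing α f h k j Θ) := by
  refine Measurable.indicator ?_ ?_
  · exact ((measurable_oseenKernel_sub α h k j).mul
      ((measurable_forceTensor hf).comp measurable_snd)).mul (hΘ.comp measurable_fst)
  · exact measurableSet_lt (f := fun p : (ℝ × E3) × (ℝ × E3) => p.2.1)
      (g := fun p => p.1.1) (by fun_prop) (by fun_prop)

theorem restrict_restrict_Ioo (t : ℝ) : ((volume.restrict (Ioi (0 : ℝ))).prod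
    (volume : Measure E3)).restrict {w | w.1 < t} = (volume.restrict (Ioo 0 t)).prod volume := by
  have h1 : {w : ℝ × E3 | w.1 < t} = Iio t ×ˢ univ := by ext; simp
  rw [h1, ← Measure.prod_restrict, Measure.restrict_univ, Measure.restrict_restrict measurableSet_Iio]
  congr 2
  ext; simp [and_comm]

theorem measurableSet_fst_lt (t : ℝ) : MeasurableSet {w : ℝ × E3 | w.1 < t} :=
  measurableSet_lt measurable_fst measurable_const

theorem integrable_duhamelPairing (hα : 1 / 2 < α) (hq : 1 < q)
    (hqα : q < 3 / (2 * α - 1)) (hf : ∀ h j, Measurable fun x => f x h j)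
    (hfq : ∀ h j, MemLp (fun x => f x h j) (ENNReal.ofReal q) volume)
    {Θ : ℝ × E3 → ℝ} (hΘ : IsAdmissible Θ) (h k j : Fin 3) :
    Integrable (duhamelPairing α f h k j Θ)
      ((volume.restrict (spaceTime ⊤ : Set (ℝ × E3))).prod (volume.restrict (spaceTime ⊤))) := by
  have q0 : 0 < q := by linarith
  have hm := measurable_duhamelPairing (α := α) (hf h j) k hΘ.measurable
  refine ⟨hm.aestronglyMeasurable, ?_⟩
  rw [hasFiniteIntegral_iff_enorm, lintegral_prod _ hm.enorm.aemeasurable]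
  have hin : ∀ z : ℝ × E3, ∫⁻ w, ‖duhamelPairing α f h k j Θ (z, w)‖ₑ
      ∂(volume.restrict (spaceTime ⊤)) = duhamelAbs α f h k j z.1 z.2 * ‖Θ z‖ₑ := by
    intro z
    rw [duhamelAbs_eq (hf h j), restrict_spaceTime_top, ← lintegral_mul_const' _ _ (by simp),
      ← restrict_restrict_Ioo, ← lintegral_indicator (measurableSet_fst_lt z.1)]
    refine lintegral_congr fun w => ?_
    by_cases hw : w.1 < z.1
    · rw [duhamelPairing, indicator_of_mem (by exact hw), indicator_of_mem (by exact hw)]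
      simp [enorm_mul]
    · rw [duhamelPairing, indicator_of_notMem (by exact hw), indicator_of_notMem (by exact hw)]
      simp
  simp_rw [hin]
  obtain ⟨C, hC⟩ := exists_lintegral_duhamelAbs_le hα hq hqα hf hfq
  -- No cut-off near time zero is needed here: unlike the force, the absolute Duhamel integral has
  -- an `L^q` norm that stays bounded as `t` tends to zero.
  refine lintegral_mul_admissible_lt_top (a := 0) hq.le (measurable_duhamelAbs (hf h j) k) hΘ
    (fun t x h1 h2 => absurd h1 (not_lt.2 h2.le)) fun b => ?_
  refine ⟨(C * ENNReal.ofReal (b ^ duhamelExp α q) ^ q).toNNReal, fun t ht _ htb => ?_⟩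
  rw [ENNReal.coe_toNNReal (ENNReal.mul_ne_top ENNReal.coe_ne_top
    (ENNReal.rpow_ne_top_of_nonneg q0.le ENNReal.ofReal_ne_top))]
  refine (hC h k j t ht).trans ?_
  have := (duhamelExp_pos hα hq hqα).le
  gcongr

theorem integral_duhamelPairing_left (h j : Fin 3) (k : Fin 3) (Θ : ℝ × E3 → ℝ) (z : ℝ × E3) :
    ∫ w, duhamelPairing α f h k j Θ (z, w) ∂(volume.restrict (spaceTime ⊤)) =
      (∫ w in Ioo 0 z.1 ×ˢ univ, oseenKernel α h k j (z.2 - w.2) (z.1 - w.1) *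
        forceTensor α f w.1 w.2 h j) * Θ z := by
  have hv : (volume : Measure (ℝ × E3)).restrict (Ioo 0 z.1 ×ˢ univ) =
      (volume.restrict (Ioo 0 z.1)).prod volume := by
    rw [Measure.volume_eq_prod, ← Measure.prod_restrict, Measure.restrict_univ]
  rw [hv, restrict_spaceTime_top, ← integral_mul_const, ← restrict_restrict_Ioo,
    ← integral_indicator (measurableSet_fst_lt z.1)]
  refine integral_congr_ae (ae_of_all _ fun w => ?_)
  dsimp only
  by_cases hw : w.1 < z.1
  · rw [duhamelPairing, indicator_of_mem (by exact hw), indicator_of_mem (by exact hw)]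
  · rw [duhamelPairing, indicator_of_notMem (by exact hw), indicator_of_notMem (by exact hw)]

theorem integral_duhamelPairing_right (h j : Fin 3) (k : Fin 3) (Θ : ℝ × E3 → ℝ) {w : ℝ × E3}
    (hw0 : 0 < w.1) (hw : Integrable (fun z => duhamelPairing α f h k j Θ (z, w))
      (volume.restrict (spaceTime ⊤))) :
    ∫ z, duhamelPairing α f h k j Θ (z, w) ∂(volume.restrict (spaceTime ⊤)) =
      forceTensor α f w.1 w.2 h j * ∫ t in Ioi w.1, ∫ x,
        oseenKernel α h k j (x - w.2) (t - w.1) * Θ (t, x) := by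
  rw [restrict_spaceTime_top] at hw ⊢
  rw [integral_prod _ hw, ← integral_const_mul, ← integral_indicator measurableSet_Ioi,
    ← integral_indicator measurableSet_Ioi]
  refine integral_congr_ae (ae_of_all _ fun t => ?_)
  by_cases ht : w.1 < t
  · rw [indicator_of_mem (by exact hw0.trans ht), indicator_of_mem (by exact ht),
      ← integral_const_mul]
    refine integral_congr_ae (ae_of_all _ fun x => ?_)
    dsimp only
    rw [duhamelPairing, indicator_of_mem (by exact ht)]
    ring
  · rw [indicator_of_notMem (s := Ioi w.1) (by exact ht)]
    refine indicator_apply_eq_zero.2 fun _ => ?_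
    refine integral_eq_zero_of_ae (ae_of_all _ fun x => ?_)
    dsimp only
    rw [duhamelPairing, indicator_of_notMem (by exact ht)]
    rfl

/-- Space-time pairing of the Duhamel integral with an admissible function. -/
theorem integral_duhamel_mul_eq_pairing (hα : 1 / 2 < α) (hq : 1 < q)
    (hqα : q < 3 / (2 * α - 1)) (hf : ∀ h j, Measurable fun x => f x h j)
    (hfq : ∀ h j, MemLp (fun x => f x h j) (ENNReal.ofReal q) volume)
    {Θ : ℝ × E3 → ℝ} (hΘ : IsAdmissible Θ) (k : Fin 3) :
    Integrable (fun z : ℝ × E3 => duhamel α f z.1 z.2 k * Θ z) (volume.restrict (spaceTime ⊤)) ∧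
    ∫ z in (spaceTime ⊤ : Set (ℝ × E3)), duhamel α f z.1 z.2 k * Θ z =
      ∑ h, ∑ j, ∫ w in (spaceTime ⊤ : Set (ℝ × E3)), ∫ z in (spaceTime ⊤ : Set (ℝ × E3)),
        duhamelPairing α f h k j Θ (z, w) := by
  have hI := fun h j => integrable_duhamelPairing hα hq hqα hf hfq hΘ h k j
  have e1 : (fun z : ℝ × E3 => duhamel α f z.1 z.2 k * Θ z) =ᵐ[volume.restrict (spaceTime ⊤)]
      fun z => ∑ h, ∑ j, ∫ w, duhamelPairing α f h k j Θ (z, w) ∂(volume.restrict (spaceTime ⊤)) := by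
    filter_upwards [ae_duhamelAbs_lt_top_spaceTime hα hq hqα hf hfq] with z hz
    rw [duhamel_apply (by linarith) hf hz, Finset.sum_mul]
    refine Finset.sum_congr rfl fun h _ => ?_
    rw [Finset.sum_mul]
    exact Finset.sum_congr rfl fun j _ => (integral_duhamelPairing_left h j k Θ z).symm
  have hsum := fun h => integrable_finsetSum Finset.univ fun j _ => (hI h j).integral_prod_left
  refine ⟨(integrable_finsetSum Finset.univ fun h _ => hsum h).congr e1.symm, ?_⟩
  rw [integral_congr_ae e1, integral_finsetSum _ fun h _ => hsum h]
  refine Finset.sum_congr rfl fun h _ => ?_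
  rw [integral_finsetSum _ fun j _ => (hI h j).integral_prod_left]
  refine Finset.sum_congr rfl fun j _ => ?_
  rw [integral_integral_swap (f := fun z w => duhamelPairing α f h k j Θ (z, w)) (hI h j)]

/-- The exchange of integrals transfers the evolution from the force to the test function, where it
runs backwards from later times `t > s`. -/
theorem integral_duhamel_mul (hα : 1 / 2 < α) (hq : 1 < q)
    (hqα : q < 3 / (2 * α - 1)) (hf : ∀ h j, Measurable fun x => f x h j)
    (hfq : ∀ h j, MemLp (fun x => f x h j) (ENNReal.ofReal q) volume)
    {Θ : ℝ × E3 → ℝ} (hΘ : IsAdmissible Θ) (k : Fin 3) :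
    ∫ z in (spaceTime ⊤ : Set (ℝ × E3)), duhamel α f z.1 z.2 k * Θ z =
      ∑ h, ∑ j, ∫ w in (spaceTime ⊤ : Set (ℝ × E3)), forceTensor α f w.1 w.2 h j *
        ∫ t in Ioi w.1, ∫ x, oseenKernel α h k j (x - w.2) (t - w.1) * Θ (t, x) := by
  rw [(integral_duhamel_mul_eq_pairing hα hq hqα hf hfq hΘ k).2]
  refine Finset.sum_congr rfl fun h _ => Finset.sum_congr rfl fun j _ => integral_congr_ae ?_
  filter_upwards [(integrable_duhamelPairing hα hq hqα hf hfq hΘ h k j).prod_left_ae,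
    ae_restrict_mem (spaceTime ⊤).isOpen.measurableSet] with w hw hw0
  exact integral_duhamelPairing_right h j k Θ hw0.1 hw

end Duhamel

/-! ### The backward operator and the divergence under the kernel. -/

theorem IsAdmissible.add {Θ₁ Θ₂ : ℝ × E3 → ℝ} (h₁ : IsAdmissible Θ₁) (h₂ : IsAdmissible Θ₂) :
    IsAdmissible fun z => Θ₁ z + Θ₂ z := by
  obtain ⟨C₁, hC₁⟩ := h₁.exists_bound
  obtain ⟨C₂, hC₂⟩ := h₂.exists_bound
  obtain ⟨b₁, hb₁⟩ := h₁.exists_time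
  obtain ⟨b₂, hb₂⟩ := h₂.exists_time
  refine ⟨h₁.measurable.add h₂.measurable, ⟨C₁ + C₂, fun t => ⟨?_, fun x => ?_⟩⟩,
    ⟨max b₁ b₂, fun t x ht => ?_⟩⟩
  · push_cast
    calc ∫⁻ x, ‖Θ₁ (t, x) + Θ₂ (t, x)‖ₑ ≤ ∫⁻ x, (‖Θ₁ (t, x)‖ₑ + ‖Θ₂ (t, x)‖ₑ) :=
          lintegral_mono fun x => enorm_add_le _ _
      _ = _ := lintegral_add_left (h₁.measurable_slice t).enorm _
      _ ≤ _ := add_le_add (hC₁ t).1 (hC₂ t).1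
  · push_cast
    exact (enorm_add_le _ _).trans (add_le_add ((hC₁ t).2 x) ((hC₂ t).2 x))
  · rw [hb₁ t x ((le_max_left _ _).trans ht), hb₂ t x ((le_max_right _ _).trans ht), add_zero]

theorem IsAdmissible.neg {Θ : ℝ × E3 → ℝ} (h : IsAdmissible Θ) : IsAdmissible fun z => -Θ z :=
  ⟨h.measurable.neg, by simpa using h.exists_bound, by simpa using h.exists_time⟩

theorem IsTest.isAdmissible {ψ : ℝ × E3 → ℝ} (hψ : IsTest ψ) : IsAdmissible ψ := by
  obtain ⟨R, hR⟩ := hψ.exists_radius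
  obtain ⟨B, hB⟩ := hψ.smooth.continuous.bounded_above_of_compact_support hψ.compact
  obtain ⟨b, hb⟩ := hψ.exists_time
  have hB' : ∀ z, ‖ψ z‖ₑ ≤ ENNReal.ofReal B := fun z => by
    rw [← ofReal_norm]
    exact ENNReal.ofReal_le_ofReal (hB z)
  have hV : volume (Metric.closedBall (0 : E3) R) ≠ ∞ := measure_closedBall_lt_top.ne
  refine ⟨hψ.smooth.continuous.measurable,
    ⟨B.toNNReal + B.toNNReal * (volume (Metric.closedBall (0 : E3) R)).toNNReal, fun t => ?_⟩,
    ⟨b, fun t x ht => hb t x (ht.trans (le_abs_self t))⟩⟩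
  push_cast
  rw [ENNReal.coe_toNNReal hV]
  refine ⟨le_trans ?_ le_add_self, fun x => (hB' _).trans le_self_add⟩
  calc ∫⁻ x, ‖ψ (t, x)‖ₑ ≤ ∫⁻ x, (Metric.closedBall (0 : E3) R).indicator
        (fun _ => ENNReal.ofReal B) x := by
        refine lintegral_mono fun x => ?_
        by_cases hx : x ∈ Metric.closedBall (0 : E3) R
        · rw [indicator_of_mem hx]; exact hB' _
        · have : ψ (t, x) = 0 := by
            by_contra h0
            exact hx (by simpa using (norm_snd_le (t, x)).trans (hR _ h0))
          simp [this]
    _ = _ := by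
        rw [lintegral_indicator Metric.isClosed_closedBall.measurableSet, setLIntegral_const]
        rfl

theorem HasFourierBound.lintegral_le {m : E3 → ℂ} {C : ℝ} (h : HasFourierBound m C) :
    ∫⁻ x, ‖(𝓕⁻ m x).re‖ₑ ≤ ENNReal.ofReal C := by
  calc ∫⁻ x, ‖(𝓕⁻ m x).re‖ₑ ≤ ∫⁻ x, ENNReal.ofReal ‖𝓕⁻ m x‖ := by
        refine lintegral_mono fun x => ?_
        rw [← ofReal_norm]
        exact ENNReal.ofReal_le_ofReal (Complex.abs_re_le_norm _)
    _ = ENNReal.ofReal (∫ x, ‖𝓕⁻ m x‖) :=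
        (ofReal_integral_eq_lintegral_ofReal h.integrable_fourierInv.norm
          (ae_of_all _ fun _ => norm_nonneg _)).symm
    _ ≤ _ := ENNReal.ofReal_le_ofReal h.integral_norm_fourierInv_le

theorem HasFourierBound.enorm_le {m : E3 → ℂ} {C : ℝ} (h : HasFourierBound m C) (x : E3) :
    ‖(𝓕⁻ m x).re‖ₑ ≤ ENNReal.ofReal C := by
  rw [← ofReal_norm]
  exact ENNReal.ofReal_le_ofReal ((Complex.abs_re_le_norm _).trans
    ((norm_fourierInv_le m x).trans h.integral_norm_le))

theorem fourierInv_zero_fun (x : E3) : 𝓕⁻ (fun _ : E3 => (0 : ℂ)) x = 0 := by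
  simp [fourierInv_eq_mul]

theorem isAdmissible_of_fourier {G : ℝ → E3 → ℂ} {C : ℝ}
    (hm : Measurable fun z : ℝ × E3 => G z.1 z.2) (hG : ∀ t, HasFourierBound (G t) C)
    {b : ℝ} (hb : ∀ t ξ, b ≤ t → G t ξ = 0) :
    IsAdmissible fun z => (𝓕⁻ (G z.1) z.2).re := by
  refine ⟨Complex.measurable_re.comp (measurable_fourierInv_uncurry hm), ⟨C.toNNReal, fun t =>
    ⟨(hG t).lintegral_le, (hG t).enorm_le⟩⟩, ⟨b, fun t x ht => ?_⟩⟩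
  have : G t = fun _ => 0 := funext fun ξ => hb t ξ ht
  dsimp only
  rw [this, fourierInv_zero_fun, Complex.zero_re]

theorem HasFourierBound.mono {m : E3 → ℂ} {C C' : ℝ} (h : HasFourierBound m C) (hC : C ≤ C') :
    HasFourierBound m C' :=
  ⟨h.1, h.2.trans hC, h.3, h.4.trans hC⟩

theorem fourier_slice_eq_zero {ψ : ℝ × E3 → ℝ} (hψ : IsTest ψ) {t : ℝ} (ht : ∀ x, ψ (t, x) = 0) :
    𝓕 (hψ.slice t) = 0 := by
  rw [slice_eq_zero hψ ht]
  exact (FourierTransform.fourierCLM ℂ (SchwartzMap E3 ℂ)).map_zero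

/-- By nonlocality `(-Δ)^α ψ` is not compactly supported in space. It is still uniformly in `L¹ ∩
L^∞`, because its symbol vanishes at the origin to order `2α > 1/2`; this is why the pairings are
set up for admissible functions rather than test functions. -/
theorem isAdmissible_fracLaplacian {α : ℝ} (hα : 1 / 2 < α) {ψ : ℝ × E3 → ℝ} (hψ : IsTest ψ) :
    IsAdmissible fun z => fracLaplacian α (fun x => ψ (z.1, x)) z.2 := by
  obtain ⟨K, N, hK, hF⟩ := exists_hasFourierBound_frac hα
  obtain ⟨B, hB, hBt⟩ := hψ.exists_schwartzBound N
  obtain ⟨b, hb⟩ := hψ.exists_time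
  refine isAdmissible_of_fourier (C := K * B) (b := b)
    (G := fun t ξ => (fracSymbol α ξ : ℂ) * 𝓕 (hψ.slice t) ξ) ?_ (fun t => ?_) fun t ξ ht => ?_
  · have h2 := measurable_fourier_slice hψ
    have h3 : Measurable fun z : ℝ × E3 => fracSymbol α z.2 :=
      (measurable_fracSymbol α).comp measurable_snd
    fun_prop
  · exact (hF _).mono (by gcongr; exact hBt t)
  · rw [fourier_slice_eq_zero hψ fun x => hb t x (ht.trans (le_abs_self t))]
    simp

/-- The backward operator `-∂ₜ + (-Δ)^α` applied to a test function. -/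
theorem isAdmissible_backward {α : ℝ} (hα : 1 / 2 < α) {ψ : ℝ × E3 → ℝ} (hψ : IsTest ψ) :
    IsAdmissible fun z => -(lineDeriv ℝ ψ z (1, 0)) +
      fracLaplacian α (fun x => ψ (z.1, x)) z.2 :=
  (hψ.lineDeriv (1, 0)).isAdmissible.neg.add (isAdmissible_fracLaplacian hα hψ)

theorem integral_kernel_backward {α : ℝ} (hα : 1 / 2 < α) {ψ : ℝ × E3 → ℝ} (hψ : IsTest ψ)
    (h k j : Fin 3) (s : ℝ) (y : E3) :
    ∫ t in Ioi s, ∫ x, oseenKernel α h k j (x - y) (t - s) * (-(lineDeriv ℝ ψ (t, x) (1, 0)) +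
      fracLaplacian α (fun x => ψ (t, x)) x) =
      -(𝓕⁻ (fun ξ => helmholtzGradSymbol h k j ξ * 𝓕 (hψ.slice s) ξ) y).re := by
  have e1 : ∀ t ∈ Ioi s, ((∫ x, oseenKernel α h k j (x - y) (t - s) *
      (-(lineDeriv ℝ ψ (t, x) (1, 0)) + fracLaplacian α (fun x => ψ (t, x)) x) : ℝ) : ℂ) =
      -𝓕⁻ (fun ξ => oseenGradSymbol α h k j (t - s) ξ * backwardSymbol α hψ t ξ) y := by
    intro t ht
    have ht' : 0 < t - s := by simpa using ht
    rw [← integral_oseenKernel_mul (by linarith) ht' h k j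
      (continuous_backwardSymbol (by linarith) hψ t) (integrable_backwardSymbol hα hψ t)
      (integrable_fourierInv_backwardSymbol hα hψ t) (backwardSymbol_neg α hψ t) y]
    simp_rw [re_fourierInv_backwardSymbol hα]
  rw [← Complex.ofReal_re (∫ t in Ioi s, _), ← integral_complex_ofReal,
    setIntegral_congr_fun measurableSet_Ioi e1, integral_neg,
    integral_fourierInv_oseenGradSymbol hα hψ, Complex.neg_re]

/-- The Helmholtz symbol is the orthogonal projection onto the complement of `ξ`, hence annihilated
by contraction with `ξ`. -/
theorem sum_mul_oseenGradSymbol (α : ℝ) (h j : Fin 3) (t : ℝ) {ξ : E3} (hξ : ξ ≠ 0) :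
    ∑ k, oseenGradSymbol α h k j t ξ * ξ k = 0 := by
  have h1 : ∑ k, ξ k * helmholtzSymbol k j ξ = 0 := by
    have hn : ‖ξ‖ ^ 2 = ∑ k, ξ k ^ 2 := by
      rw [EuclideanSpace.norm_sq_eq]; simp
    have hn0 : ‖ξ‖ ^ 2 ≠ 0 := by positivity
    simp_rw [helmholtzSymbol, mul_sub, Finset.sum_sub_distrib]
    simp only [mul_ite, mul_one, mul_zero, Finset.sum_ite_eq', Finset.mem_univ, if_true]
    have : ∑ k, ξ k * (ξ k * ξ j / ‖ξ‖ ^ 2) = (∑ k, ξ k ^ 2) * ξ j / ‖ξ‖ ^ 2 := by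
      rw [Finset.sum_mul, Finset.sum_div]
      exact Finset.sum_congr rfl fun k _ => by ring
    rw [this, ← hn]
    field_simp
    ring
  have e1 : ∀ k, oseenGradSymbol α h k j t ξ * ξ k = 2 * Real.pi * Complex.I * (ξ h : ℂ) *
      (Real.exp (-t * fracSymbol α ξ) : ℂ) * ((ξ k * helmholtzSymbol k j ξ : ℝ) : ℂ) := by
    intro k
    rw [oseenGradSymbol]
    push_cast
    ring
  simp_rw [e1]
  rw [← Finset.mul_sum, ← Complex.ofReal_sum, h1, Complex.ofReal_zero, mul_zero]

theorem sum_integral_kernel_gradient {α : ℝ} (hα : 0 < α) {ψ : ℝ × E3 → ℝ} (hψ : IsTest ψ)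
    (h j : Fin 3) {s t : ℝ} (hst : s < t) (y : E3) :
    ∑ k, ∫ x, oseenKernel α h k j (x - y) (t - s) * lineDeriv ℝ ψ (t, x) (0, e k) = 0 := by
  have hts : 0 < t - s := by linarith
  have e1 : ∀ k, ((∫ x, oseenKernel α h k j (x - y) (t - s) * lineDeriv ℝ ψ (t, x) (0, e k) : ℝ) : ℂ)
      = -𝓕⁻ (fun ξ => oseenGradSymbol α h k j (t - s) ξ *
        𝓕 ((hψ.lineDeriv (0, e k)).slice t) ξ) y := by
    intro k
    have hk := hψ.lineDeriv (0, e k)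
    have hi : 𝓕⁻ (fun ξ => 𝓕 (hk.slice t) ξ) = hk.slice t := by
      ext x
      rw [fourierInv_fourier_slice, IsTest.slice_apply]
    rw [← integral_oseenKernel_mul hα hts h k j (𝓕 (hk.slice t)).continuous
      (integrable_fourier_slice hk t) (by rw [hi]; exact (hk.slice t).integrable)
      (fourier_slice_neg hk t) y]
    simp_rw [hi, IsTest.slice_apply, Complex.ofReal_re]
  have hint : ∀ k, Integrable fun ξ => oseenGradSymbol α h k j (t - s) ξ *
      𝓕 ((hψ.lineDeriv (0, e k)).slice t) ξ * (Real.fourierChar (inner ℝ ξ y) : ℂ) := by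
    intro k
    refine integrable_mul_fourierChar ?_ y
    obtain ⟨C, hC⟩ := (𝓕 ((hψ.lineDeriv (0, e k)).slice t)).decay 0 0
    refine (integrable_oseenGradSymbol hα hts h k j).mul_bdd (c := C)
      (𝓕 ((hψ.lineDeriv (0, e k)).slice t)).continuous.aestronglyMeasurable (ae_of_all _ fun ξ => ?_)
    simpa using hC.2 ξ
  have key : ((∑ k, ∫ x, oseenKernel α h k j (x - y) (t - s) *
      lineDeriv ℝ ψ (t, x) (0, e k) : ℝ) : ℂ) = 0 := by
    rw [Complex.ofReal_sum]
    simp_rw [e1, fourierInv_eq_mul, ← integral_neg]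
    rw [← integral_finsetSum _ fun k _ => (hint k).fun_neg]
    refine integral_eq_zero_of_ae ?_
    filter_upwards [ae_ne_zero] with ξ hξ
    have h1 := sum_mul_oseenGradSymbol α h j (t - s) hξ
    have h2 : ∀ k, -(oseenGradSymbol α h k j (t - s) ξ * 𝓕 ((hψ.lineDeriv (0, e k)).slice t) ξ *
        (Real.fourierChar (inner ℝ ξ y) : ℂ)) = oseenGradSymbol α h k j (t - s) ξ * ξ k *
        (-(2 * Real.pi * Complex.I * 𝓕 (hψ.slice t) ξ * (Real.fourierChar (inner ℝ ξ y) : ℂ))) := by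
      intro k
      rw [fourier_slice_lineDeriv hψ]
      ring
    simp_rw [h2, ← Finset.sum_mul, h1, zero_mul]
    rfl
  exact_mod_cast key

/-! ### The multiplier `ξ_h ξ_j/|ξ|²` on test functions. -/

/-- A fixed Schwartz function equal to one at the origin. -/
def unitSymbol : SchwartzMap E3 ℂ :=
  HasCompactSupport.toSchwartzMap
    (f := fun ξ : E3 => (((default : ContDiffBump (0 : E3)) ξ : ℝ) : ℂ))
    ((default : ContDiffBump (0 : E3)).hasCompactSupport.comp_left (g := fun r : ℝ => (r : ℂ))
      (by simp))
    (Complex.ofRealCLM.contDiff.comp (default : ContDiffBump (0 : E3)).contDiff)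

theorem unitSymbol_zero : unitSymbol 0 = 1 := by
  have : unitSymbol 0 = (((default : ContDiffBump (0 : E3)) 0 : ℝ) : ℂ) := rfl
  rw [this, ContDiffBump.one_of_mem_closedBall, Complex.ofReal_one]
  simpa using (default : ContDiffBump (0 : E3)).rIn_pos.le

/-- The Fourier transform of a slice, corrected to vanish at the origin. -/
def centeredSymbol {φ : ℝ × E3 → ℝ} (hφ : IsTest φ) (s : ℝ) : SchwartzMap E3 ℂ :=
  𝓕 (hφ.slice s) - (𝓕 (hφ.slice s) 0) • unitSymbol

/-- Vanishing at the origin is the hypothesis of `exists_hasFourierBound_riesz`. Subtracting a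
multiple of one fixed profile secures it while keeping the construction linear in the test function.
-/
theorem centeredSymbol_zero {φ : ℝ × E3 → ℝ} (hφ : IsTest φ) (s : ℝ) : centeredSymbol hφ s 0 = 0 := by
  simp [centeredSymbol, unitSymbol_zero]

theorem schwartzBound_centeredSymbol_le {φ : ℝ × E3 → ℝ} (hφ : IsTest φ) (s : ℝ) :
    schwartzBound 4 (centeredSymbol hφ s) ≤
      (1 + schwartzBound 4 unitSymbol) * schwartzBound 4 (𝓕 (hφ.slice s)) := by
  rw [centeredSymbol]
  refine (map_sub_le_add _ _ _).trans ?_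
  rw [map_smul_eq_mul]
  have h1 : ‖𝓕 (hφ.slice s) 0‖ ≤ schwartzBound 4 (𝓕 (hφ.slice s)) := by
    have := le_schwartzBound (N := 4) (k := 0) (n := 0) (by omega) (by norm_num) (𝓕 (hφ.slice s)) 0
    simpa using this
  have h2 : 0 ≤ schwartzBound 4 unitSymbol := apply_nonneg _ _
  nlinarith

theorem measurable_centeredSymbol {φ : ℝ × E3 → ℝ} (hφ : IsTest φ) :
    Measurable fun z : ℝ × E3 => centeredSymbol hφ z.1 z.2 := by
  have h1 := measurable_fourier_slice hφ
  have h2 : Measurable fun z : ℝ × E3 => 𝓕 (hφ.slice z.1) 0 :=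
    h1.comp (f := fun z : ℝ × E3 => (z.1, (0 : E3))) (by fun_prop)
  have h3 : Measurable fun z : ℝ × E3 => unitSymbol z.2 :=
    unitSymbol.continuous.measurable.comp measurable_snd
  exact h1.sub (h2.mul h3)

/-- The double Riesz transform of a (centered) test function. -/
def rieszPotential (h j : Fin 3) {φ : ℝ × E3 → ℝ} (hφ : IsTest φ) (z : ℝ × E3) : ℝ :=
  (𝓕⁻ (fun ξ => rieszSymbol h j ξ * centeredSymbol hφ z.1 ξ) z.2).re

theorem measurable_rieszPotential (h j : Fin 3) {φ : ℝ × E3 → ℝ} (hφ : IsTest φ) :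
    Measurable (rieszPotential h j hφ) := by
  refine Complex.measurable_re.comp (measurable_fourierInv_uncurry
    (G := fun s ξ => rieszSymbol h j ξ * centeredSymbol hφ s ξ) ?_)
  obtain ⟨C, hC, H⟩ := isSymbol_riesz h j
  exact (H.measurable.comp measurable_snd).mul (measurable_centeredSymbol hφ)

theorem centeredSymbol_eq_zero {φ : ℝ × E3 → ℝ} (hφ : IsTest φ) {t : ℝ} (ht : ∀ x, φ (t, x) = 0) :
    centeredSymbol hφ t = 0 := by
  rw [centeredSymbol, fourier_slice_eq_zero hφ ht]
  simp

theorem rieszPotential_eq_zero (h j : Fin 3) {φ : ℝ × E3 → ℝ} (hφ : IsTest φ) {t : ℝ}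
    (ht : ∀ x, φ (t, x) = 0) (x : E3) : rieszPotential h j hφ (t, x) = 0 := by
  rw [rieszPotential, centeredSymbol_eq_zero hφ ht]
  simp [fourierInv_zero_fun]

/-- In the second term `ξ_h ξ_k ξ_j/|ξ|²` the derivative is attributed to `∂_k` instead of `∂_h`,
which exhibits a gradient in the index `k`. A spatial derivative has mean zero, so the centering
leaves it unchanged. -/
theorem helmholtzGradSymbol_mul (h k j : Fin 3) {ψ : ℝ × E3 → ℝ} (hψ : IsTest ψ) (s : ℝ) (ξ : E3) :
    helmholtzGradSymbol h k j ξ * 𝓕 (hψ.slice s) ξ =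
      (if k = j then 1 else 0) * 𝓕 ((hψ.lineDeriv (0, e h)).slice s) ξ -
        rieszSymbol h j ξ * centeredSymbol (hψ.lineDeriv (0, e k)) s ξ := by
  have h0 : 𝓕 ((hψ.lineDeriv (0, e k)).slice s) 0 = 0 := by
    rw [fourier_slice_lineDeriv hψ]; simp
  rw [centeredSymbol, h0, zero_smul, sub_zero, fourier_slice_lineDeriv hψ, fourier_slice_lineDeriv hψ,
    helmholtzGradSymbol, helmholtzSymbol, rieszSymbol]
  split_ifs <;> push_cast <;> ring

theorem re_fourierInv_helmholtzGradSymbol (h k j : Fin 3) {ψ : ℝ × E3 → ℝ} (hψ : IsTest ψ)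
    (z : ℝ × E3) :
    (𝓕⁻ (fun ξ => helmholtzGradSymbol h k j ξ * 𝓕 (hψ.slice z.1) ξ) z.2).re =
      (if k = j then 1 else 0) * lineDeriv ℝ ψ z (0, e h) -
        rieszPotential h j (hψ.lineDeriv (0, e k)) z := by
  obtain ⟨K, hK, hR⟩ := exists_hasFourierBound_riesz h j
  have h1 := integrable_mul_fourierChar (integrable_fourier_slice (hψ.lineDeriv (0, e h)) z.1) z.2
  have h2 := integrable_mul_fourierChar
    (hR _ (centeredSymbol_zero (hψ.lineDeriv (0, e k)) z.1)).integrable z.2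
  simp_rw [helmholtzGradSymbol_mul]
  rw [rieszPotential, fourierInv_eq_mul, fourierInv_eq_mul, ← Complex.ofReal_re (lineDeriv ℝ ψ z _),
    ← fourierInv_fourier_slice (hψ.lineDeriv (0, e h)) z.1 z.2, fourierInv_eq_mul]
  simp_rw [sub_mul]
  simp_rw [mul_assoc (if k = j then (1 : ℂ) else 0)]
  rw [integral_sub (h1.const_mul _) h2, integral_const_mul]
  split_ifs <;> simp

theorem isTest {T : EReal} (ψ : 𝓓(spaceTime T, ℝ)) : IsTest ψ :=
  ⟨ψ.contDiff, ψ.hasCompactSupport⟩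

theorem lineDerivOp_testFunction {T : EReal} (ψ : 𝓓(spaceTime T, ℝ)) (v z : ℝ × E3) :
    (∂_{v} ψ) z = lineDeriv ℝ ψ z v := by
  rw [TestFunction.lineDerivOp_eq_lineDerivCLM (𝕜 := ℝ), TestFunction.lineDerivCLM_apply]
  simp

/-- A compact subset of the open slab stays at positive distance from `t = 0`, which keeps it away
from the singularity of the force. -/
theorem exists_time_bounds {T : EReal} {K : Set (ℝ × E3)} (hK : IsCompact K)
    (hsub : K ⊆ spaceTime T) : ∃ a b : ℝ, 0 < a ∧ ∀ z ∈ K, a ≤ z.1 ∧ z.1 < b := by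
  rcases K.eq_empty_or_nonempty with rfl | hne
  · exact ⟨1, 1, one_pos, by simp⟩
  obtain ⟨z₀, hz₀, hmin⟩ := hK.exists_isMinOn hne continuous_fst.continuousOn
  obtain ⟨z₁, hz₁, hmax⟩ := hK.exists_isMaxOn hne continuous_fst.continuousOn
  exact ⟨z₀.1, z₁.1 + 1, (hsub hz₀).1, fun z hz => ⟨hmin hz, (hmax hz).trans_lt (by simp)⟩⟩

theorem exists_time_bounds_testFunction {T : EReal} (ψ : 𝓓(spaceTime T, ℝ)) :
    ∃ a b : ℝ, 0 < a ∧ ∀ t x, (t < a ∨ b ≤ t) → ψ (t, x) = 0 := by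
  obtain ⟨a, b, ha, h⟩ := exists_time_bounds ψ.hasCompactSupport ψ.tsupport_subset
  refine ⟨a, b, ha, fun t x ht => ?_⟩
  by_contra h0
  have := h (t, x) (subset_tsupport _ h0)
  rcases ht with ht | ht
  · exact absurd this.1 (not_le.2 ht)
  · exact absurd this.2 (not_lt.2 ht)

theorem isAdmissible_rieszPotential (h j : Fin 3) {φ : ℝ × E3 → ℝ} (hφ : IsTest φ) :
    IsAdmissible (rieszPotential h j hφ) := by
  obtain ⟨K, hK, hF⟩ := exists_hasFourierBound_riesz h j
  obtain ⟨B, hB, hBt⟩ := hφ.exists_schwartzBound 4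
  obtain ⟨b, hb⟩ := hφ.exists_time
  obtain ⟨C, hC, H⟩ := isSymbol_riesz h j
  refine isAdmissible_of_fourier (C := K * ((1 + schwartzBound 4 unitSymbol) * B)) (b := b)
    (G := fun t ξ => rieszSymbol h j ξ * centeredSymbol hφ t ξ)
    ((H.measurable.comp measurable_snd).mul (measurable_centeredSymbol hφ)) (fun t => ?_)
    fun t ξ ht => ?_
  · refine (hF _ (centeredSymbol_zero hφ t)).mono ?_
    gcongr
    refine (schwartzBound_centeredSymbol_le hφ t).trans ?_
    have : 0 ≤ schwartzBound 4 unitSymbol := apply_nonneg _ _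
    gcongr
    exact hBt t
  · rw [centeredSymbol_eq_zero hφ fun x => hb t x (ht.trans (le_abs_self t))]
    simp

/-! ### The pressure distribution and the weak equations for the Duhamel integral. -/

section Pressure

variable {α q : ℝ} {f : E3 → Matrix (Fin 3) (Fin 3) ℝ}

theorem integrable_forceTensor_mul_rieszPotential (hα : 0 < α) (hq : 1 < q)
    (hf : ∀ h j, Measurable fun x => f x h j)
    (hfq : ∀ h j, MemLp (fun x => f x h j) (ENNReal.ofReal q) volume) (ψ : 𝓓(spaceTime ⊤, ℝ))
    {φ : ℝ × E3 → ℝ} (hφ : IsTest φ) (hφψ : ∀ z, φ z = ψ z) (h j : Fin 3) :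
    Integrable (fun z : ℝ × E3 => forceTensor α f z.1 z.2 h j * rieszPotential h j hφ z)
      (volume.restrict (spaceTime ⊤)) := by
  obtain ⟨a, b, ha, hab⟩ := exists_time_bounds_testFunction ψ
  exact integrable_forceTensor_mul hα hq hf hfq (isAdmissible_rieszPotential h j hφ) ha
    (fun t x _ ht => rieszPotential_eq_zero h j hφ
      (fun y => by rw [hφψ]; exact hab t y (Or.inl ht)) x) h j

theorem centeredSymbol_add {φ₁ φ₂ φ₃ : ℝ × E3 → ℝ} (h₁ : IsTest φ₁) (h₂ : IsTest φ₂)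
    (h₃ : IsTest φ₃) (h : ∀ z, φ₃ z = φ₁ z + φ₂ z) (s : ℝ) :
    centeredSymbol h₃ s = centeredSymbol h₁ s + centeredSymbol h₂ s := by
  have e1 : h₃.slice s = h₁.slice s + h₂.slice s := by
    ext x
    simp [IsTest.slice_apply, h]
  have e2 : 𝓕 (h₃.slice s) = 𝓕 (h₁.slice s) + 𝓕 (h₂.slice s) := by
    rw [e1]
    exact (FourierTransform.fourierCLM ℂ (SchwartzMap E3 ℂ)).map_add _ _
  rw [centeredSymbol, centeredSymbol, centeredSymbol, e2, add_apply, add_smul]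
  abel

theorem centeredSymbol_smul {φ₁ φ₂ : ℝ × E3 → ℝ} (h₁ : IsTest φ₁) (h₂ : IsTest φ₂) (c : ℝ)
    (h : ∀ z, φ₂ z = c * φ₁ z) (s : ℝ) :
    centeredSymbol h₂ s = (c : ℂ) • centeredSymbol h₁ s := by
  have e1 : h₂.slice s = (c : ℂ) • h₁.slice s := by
    ext x
    simp [IsTest.slice_apply, h]
  have e2 : 𝓕 (h₂.slice s) = (c : ℂ) • 𝓕 (h₁.slice s) := by
    rw [e1]
    exact (FourierTransform.fourierCLM ℂ (SchwartzMap E3 ℂ)).map_smul _ _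
  rw [centeredSymbol, centeredSymbol, e2, smul_apply, smul_sub, smul_smul, smul_eq_mul]

theorem rieszPotential_add (h j : Fin 3) {φ₁ φ₂ φ₃ : ℝ × E3 → ℝ} (h₁ : IsTest φ₁) (h₂ : IsTest φ₂)
    (h₃ : IsTest φ₃) (h0 : ∀ z, φ₃ z = φ₁ z + φ₂ z) (z : ℝ × E3) :
    rieszPotential h j h₃ z = rieszPotential h j h₁ z + rieszPotential h j h₂ z := by
  obtain ⟨K, hK, hF⟩ := exists_hasFourierBound_riesz h j
  have i1 := integrable_mul_fourierChar (hF _ (centeredSymbol_zero h₁ z.1)).integrable z.2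
  have i2 := integrable_mul_fourierChar (hF _ (centeredSymbol_zero h₂ z.1)).integrable z.2
  rw [rieszPotential, rieszPotential, rieszPotential, ← Complex.add_re, fourierInv_eq_mul,
    fourierInv_eq_mul, fourierInv_eq_mul, ← integral_add i1 i2]
  congr 2
  ext ξ
  rw [centeredSymbol_add h₁ h₂ h₃ h0, add_apply]
  ring

theorem rieszPotential_smul (h j : Fin 3) {φ₁ φ₂ : ℝ × E3 → ℝ} (h₁ : IsTest φ₁) (h₂ : IsTest φ₂)
    (c : ℝ) (h0 : ∀ z, φ₂ z = c * φ₁ z) (z : ℝ × E3) :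
    rieszPotential h j h₂ z = c * rieszPotential h j h₁ z := by
  rw [rieszPotential, rieszPotential, ← Complex.re_ofReal_mul, fourierInv_eq_mul,
    fourierInv_eq_mul, ← integral_const_mul]
  congr 2
  ext ξ
  rw [centeredSymbol_smul h₁ h₂ c h0, smul_apply, smul_eq_mul]
  ring

/-- This is the continuity estimate for the pressure. Functions supported in `K` live in a fixed
time interval `[a, b)` with `a > 0` and a fixed ball, so finitely many of their derivatives control
the Schwartz bounds of all Fourier slices, hence the `L¹` and `L^∞` norms of the potential. -/
theorem exists_norm_integral_rieszPotential_le (hα : 0 < α) (hq : 1 < q)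
    (hf : ∀ h j, Measurable fun x => f x h j)
    (hfq : ∀ h j, MemLp (fun x => f x h j) (ENNReal.ofReal q) volume)
    {K : Set (ℝ × E3)} (hKc : IsCompact K) (hK : K ⊆ spaceTime ⊤) (h j : Fin 3) :
    ∃ (n : ℕ) (A : ℝ), 0 ≤ A ∧ ∀ (φ : ℝ × E3 → ℝ) (hφ : IsTest φ) (S : ℝ),
      (∀ z ∉ K, φ z = 0) → (∀ i ≤ n, ∀ z, ‖iteratedFDeriv ℝ i φ z‖ ≤ S) →
      ‖∫ z in spaceTime ⊤, forceTensor α f z.1 z.2 h j * rieszPotential h j hφ z‖ ≤ A * S := by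
  obtain ⟨a, b, ha, hab⟩ := exists_time_bounds hKc hK
  obtain ⟨R, hR⟩ := hKc.isBounded.exists_norm_le
  obtain ⟨n, C, hC, hbd⟩ := exists_schwartzBound_fourier_slice_le 4 R
  obtain ⟨A, hA, hAb⟩ := exists_norm_integral_forceTensor_mul_le hα hq hf hfq ha b h j
  obtain ⟨M, hM, hF⟩ := exists_hasFourierBound_riesz h j
  have hS : 0 ≤ schwartzBound 4 unitSymbol := apply_nonneg _ _
  refine ⟨n, A * (M * ((1 + schwartzBound 4 unitSymbol) * C)), by positivity,
    fun φ hφ S hφK hSb => ?_⟩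
  have hS0 : 0 ≤ S := (norm_nonneg _).trans (hSb 0 (Nat.zero_le _) 0)
  have hz : ∀ t x, (t < a ∨ b ≤ t) → φ (t, x) = 0 := by
    intro t x ht
    refine hφK _ fun hmem => ?_
    have := hab (t, x) hmem
    rcases ht with ht | ht
    · exact absurd this.1 (not_le.2 ht)
    · exact absurd this.2 (not_lt.2 ht)
  have hsl : ∀ t, schwartzBound 4 (𝓕 (hφ.slice t)) ≤ C * S := by
    refine hbd _ hφ S (fun z hz0 => ?_) hSb
    have hzK : z ∈ K := by
      by_contra hmem
      exact hz0 (hφK z hmem)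
    exact (norm_snd_le z).trans (hR z hzK)
  have hFb : ∀ t, HasFourierBound (fun ξ => rieszSymbol h j ξ * centeredSymbol hφ t ξ)
      (M * ((1 + schwartzBound 4 unitSymbol) * C) * S) := by
    intro t
    refine (hF _ (centeredSymbol_zero hφ t)).mono ?_
    calc M * schwartzBound 4 (centeredSymbol hφ t)
        ≤ M * ((1 + schwartzBound 4 unitSymbol) * (C * S)) := by
          gcongr
          refine (schwartzBound_centeredSymbol_le hφ t).trans ?_
          gcongr
          exact hsl t
      _ = _ := by ring
  refine (hAb _ (M * ((1 + schwartzBound 4 unitSymbol) * C) * S) (by positivity)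
    (measurable_rieszPotential h j hφ)
    (fun t => ⟨(hFb t).lintegral_le, (hFb t).enorm_le⟩)
    (fun t x _ ht => rieszPotential_eq_zero h j hφ (fun y => hz t y (Or.inl ht)) x)
    (fun t x ht => rieszPotential_eq_zero h j hφ (fun y => hz t y (Or.inr ht)) x)).trans
    (le_of_eq (by ring))

/-- The pairing of a test function with the pressure. -/
def pressurePairing (α : ℝ) (f : E3 → Matrix (Fin 3) (Fin 3) ℝ) (φ : 𝓓(spaceTime ⊤, ℝ)) : ℝ :=
  ∑ h, ∑ j, ∫ z in spaceTime ⊤, forceTensor α f z.1 z.2 h j * rieszPotential h j (isTest φ) z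

theorem pressurePairing_add (hα : 0 < α) (hq : 1 < q) (hf : ∀ h j, Measurable fun x => f x h j)
    (hfq : ∀ h j, MemLp (fun x => f x h j) (ENNReal.ofReal q) volume) (φ₁ φ₂ : 𝓓(spaceTime ⊤, ℝ)) :
    pressurePairing α f (φ₁ + φ₂) = pressurePairing α f φ₁ + pressurePairing α f φ₂ := by
  have hI := fun (φ : 𝓓(spaceTime ⊤, ℝ)) h j =>
    integrable_forceTensor_mul_rieszPotential (α := α) hα hq hf hfq φ (isTest φ) (fun _ => rfl) h j
  simp only [pressurePairing, ← Finset.sum_add_distrib]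
  refine Finset.sum_congr rfl fun h _ => Finset.sum_congr rfl fun j _ => ?_
  rw [← integral_add (hI φ₁ h j) (hI φ₂ h j)]
  refine integral_congr_ae (ae_of_all _ fun z => ?_)
  dsimp only
  rw [rieszPotential_add h j (isTest φ₁) (isTest φ₂) (isTest (φ₁ + φ₂)) fun _ => rfl, mul_add]

theorem pressurePairing_smul (c : ℝ) (φ : 𝓓(spaceTime ⊤, ℝ)) :
    pressurePairing α f (c • φ) = c • pressurePairing α f φ := by
  simp only [pressurePairing, smul_eq_mul, Finset.mul_sum, ← integral_const_mul]
  refine Finset.sum_congr rfl fun h _ => Finset.sum_congr rfl fun j _ => ?_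
  refine integral_congr_ae (ae_of_all _ fun z => ?_)
  dsimp only
  rw [rieszPotential_smul h j (isTest φ) (isTest (c • φ)) c fun _ => rfl]
  ring

/-- A bound by the suprema of finitely many derivatives gives continuity on the space of test
functions supported in a fixed compact set. -/
theorem continuous_of_norm_le_iteratedFDeriv {K : Compacts (ℝ × E3)}
    (A : ContDiffMapSupportedIn (ℝ × E3) ℝ ⊤ K → ℝ) (hadd : ∀ φ₁ φ₂, A (φ₁ + φ₂) = A φ₁ + A φ₂)
    (hsmul : ∀ (c : ℝ) φ, A (c • φ) = c • A φ) {n : ℕ} {C : ℝ} (hC : 0 ≤ C)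
    (hb : ∀ (φ : ContDiffMapSupportedIn (ℝ × E3) ℝ ⊤ K) (S : ℝ), (∀ i ≤ n, ∀ z, ‖iteratedFDeriv ℝ i φ z‖ ≤ S) → ‖A φ‖ ≤ C * S) :
    Continuous A := by
  refine (ContDiffMapSupportedIn.mkCLMtoNormedSpace ℝ A hadd hsmul
    ⟨Finset.range (n + 1), C, hC, fun φ => hb φ _ fun i hi z => ?_⟩).continuous
  refine (ContDiffMapSupportedIn.norm_iteratedFDeriv_apply_le_seminorm_top ℝ
    (f := φ) (x := z)).trans ?_
  exact Seminorm.le_def.1 (Finset.le_sup (f := fun i =>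
    ContDiffMapSupportedIn.seminorm ℝ (ℝ × E3) ℝ ⊤ K i)
    (Finset.mem_range.2 (Nat.lt_succ_of_le hi))) φ

theorem exists_norm_pressurePairing_le (hα : 0 < α) (hq : 1 < q)
    (hf : ∀ h j, Measurable fun x => f x h j)
    (hfq : ∀ h j, MemLp (fun x => f x h j) (ENNReal.ofReal q) volume) {K : Set (ℝ × E3)}
    (hKc : IsCompact K) (hK : K ⊆ (spaceTime ⊤ : Set (ℝ × E3))) :
    ∃ (n : ℕ) (A : ℝ), 0 ≤ A ∧ ∀ (φ : 𝓓(spaceTime ⊤, ℝ)) (S : ℝ), (∀ z ∉ K, φ z = 0) →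
      (∀ i ≤ n, ∀ z, ‖iteratedFDeriv ℝ i φ z‖ ≤ S) → ‖pressurePairing α f φ‖ ≤ A * S := by
  have key := fun h j => exists_norm_integral_rieszPotential_le (α := α) hα hq hf hfq hKc hK h j
  choose n A hA hAb using key
  refine ⟨∑ h, ∑ j, n h j, ∑ h, ∑ j, A h j,
    Finset.sum_nonneg fun h _ => Finset.sum_nonneg fun j _ => hA h j, fun φ S hφ hS => ?_⟩
  have hn : ∀ h j, n h j ≤ ∑ h, ∑ j, n h j := fun h j =>
    (Finset.single_le_sum (f := fun j => n h j) (fun _ _ => Nat.zero_le _)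
      (Finset.mem_univ j)).trans
    (Finset.single_le_sum (f := fun h => ∑ j, n h j) (fun _ _ => Nat.zero_le _)
      (Finset.mem_univ h))
  rw [Finset.sum_mul]
  refine (norm_sum_le _ _).trans (Finset.sum_le_sum fun h _ => ?_)
  rw [Finset.sum_mul]
  exact (norm_sum_le _ _).trans (Finset.sum_le_sum fun j _ =>
    hAb h j φ (isTest φ) S hφ fun i hi z => hS i (hi.trans (hn h j)) z)

theorem continuous_pressurePairing_comp (hα : 0 < α) (hq : 1 < q)
    (hf : ∀ h j, Measurable fun x => f x h j)
    (hfq : ∀ h j, MemLp (fun x => f x h j) (ENNReal.ofReal q) volume) (K : Compacts (ℝ × E3))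
    (hK : (K : Set (ℝ × E3)) ⊆ (spaceTime ⊤ : Set (ℝ × E3))) :
    Continuous fun φ : ContDiffMapSupportedIn (ℝ × E3) ℝ ⊤ K =>
      pressurePairing α f (TestFunction.ofSupportedIn hK φ) := by
  obtain ⟨n, A, hA, hb⟩ := exists_norm_pressurePairing_le (α := α) hα hq hf hfq K.isCompact hK
  have hadd := pressurePairing_add (α := α) hα hq hf hfq
  refine continuous_of_norm_le_iteratedFDeriv (n := n) (C := A) _ ?_ ?_ hA ?_
  · intro φ₁ φ₂
    exact hadd (TestFunction.ofSupportedIn hK φ₁) (TestFunction.ofSupportedIn hK φ₂)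
  · intro c φ
    exact pressurePairing_smul c (TestFunction.ofSupportedIn hK φ)
  · intro φ S hS
    exact hb (TestFunction.ofSupportedIn hK φ) S (fun z hz => φ.zero_on_compl hz) hS

/-- The pressure associated with the force tensor. -/
theorem exists_pressure (hα : 0 < α) (hq : 1 < q) (hf : ∀ h j, Measurable fun x => f x h j)
    (hfq : ∀ h j, MemLp (fun x => f x h j) (ENNReal.ofReal q) volume) :
    ∃ p : 𝓓'(spaceTime ⊤, ℝ), ∀ φ : 𝓓(spaceTime ⊤, ℝ), p φ = pressurePairing α f φ := by
  obtain ⟨L, hL⟩ : ∃ L : 𝓓(spaceTime ⊤, ℝ) →L[ℝ] ℝ, ∀ φ, L φ = pressurePairing α f φ :=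
    ⟨TestFunction.mkCLM ℝ (pressurePairing α f)
      (pressurePairing_add hα hq hf hfq) pressurePairing_smul
      (continuous_pressurePairing_comp hα hq hf hfq), TestFunction.mkCLM_apply _ _ _ _ _⟩
  exact ⟨L, hL⟩

theorem sum_integral_duhamelPairing_gradient (hα : 0 < α) {ψ : ℝ × E3 → ℝ} (hψ : IsTest ψ)
    (h j : Fin 3) {w : ℝ × E3} (hw : ∀ k, Integrable (fun z => duhamelPairing α f h k j
      (fun z => lineDeriv ℝ ψ z (0, e k)) (z, w)) (volume.restrict (spaceTime ⊤))) :
    ∑ k, ∫ z in (spaceTime ⊤ : Set (ℝ × E3)), duhamelPairing α f h k j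
      (fun z => lineDeriv ℝ ψ z (0, e k)) (z, w) = 0 := by
  rw [restrict_spaceTime_top] at hw ⊢
  simp_rw [fun k => integral_prod _ (hw k)]
  rw [← integral_finsetSum _ fun k _ => (hw k).integral_prod_left]
  refine integral_eq_zero_of_ae (ae_of_all _ fun t => ?_)
  by_cases ht : w.1 < t
  · have e1 : ∀ k, ∫ x, duhamelPairing α f h k j (fun z => lineDeriv ℝ ψ z (0, e k)) ((t, x), w) =
        forceTensor α f w.1 w.2 h j * ∫ x, oseenKernel α h k j (x - w.2) (t - w.1) *
          lineDeriv ℝ ψ (t, x) (0, e k) := by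
      intro k
      rw [← integral_const_mul]
      refine integral_congr_ae (ae_of_all _ fun x => ?_)
      dsimp only
      rw [duhamelPairing, indicator_of_mem (by exact ht)]
      ring
    simp_rw [e1]
    rw [← Finset.mul_sum, sum_integral_kernel_gradient hα hψ h j ht, mul_zero]
    rfl
  · refine Finset.sum_eq_zero fun k _ => integral_eq_zero_of_ae (ae_of_all _ fun x => ?_)
    dsimp only
    rw [duhamelPairing, indicator_of_notMem (by exact ht)]
    rfl

/-- After Fubini the sum over `k` is performed for each source point `w` separately, where it
vanishes because the kernel itself is divergence free. -/
theorem divergence_free_duhamel (hα : 1 / 2 < α) (hq : 1 < q)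
    (hqα : q < 3 / (2 * α - 1)) (hf : ∀ h j, Measurable fun x => f x h j)
    (hfq : ∀ h j, MemLp (fun x => f x h j) (ENNReal.ofReal q) volume) (ψ : 𝓓(spaceTime ⊤, ℝ)) :
    ∫ z in (spaceTime ⊤ : Set (ℝ × E3)),
      ∑ k, duhamel α f z.1 z.2 k * (∂_{((0 : ℝ), e k)} ψ) z = 0 := by
  have hψ := isTest ψ
  have H := fun k => integral_duhamel_mul_eq_pairing hα hq hqα hf hfq
    (hψ.lineDeriv (0, e k)).isAdmissible k
  have hI := fun h k j => integrable_duhamelPairing hα hq hqα hf hfq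
    (hψ.lineDeriv (0, e k)).isAdmissible h k j
  simp_rw [lineDerivOp_testFunction]
  rw [integral_finsetSum _ fun k _ => (H k).1]
  simp_rw [fun k => (H k).2]
  rw [Finset.sum_comm]
  refine Finset.sum_eq_zero fun h _ => ?_
  rw [Finset.sum_comm]
  refine Finset.sum_eq_zero fun j _ => ?_
  rw [← integral_finsetSum _ fun k _ => (hI h k j).integral_prod_right]
  refine integral_eq_zero_of_ae ?_
  have hall : ∀ᵐ w ∂(volume.restrict (spaceTime ⊤ : Set (ℝ × E3))), ∀ k, Integrable
      (fun z => duhamelPairing α f h k j (fun z => lineDeriv ℝ ψ z (0, e k)) (z, w))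
      (volume.restrict (spaceTime ⊤)) := ae_all_iff.2 fun k => (hI h k j).prod_left_ae
  filter_upwards [hall] with w hw
  exact sum_integral_duhamelPairing_gradient (by linarith) hψ h j hw

/-- The dual pairing yields `-δ_kj ∂_h ψ` plus the potential of `∂_k ψ`, both tested against the
force. The first sums to the right-hand side, and the second is cancelled by `(∂_k p) ψ = -p(∂_k
ψ)`. -/
theorem momentum_duhamel (hα : 1 / 2 < α) (hq : 1 < q)
    (hqα : q < 3 / (2 * α - 1)) (hf : ∀ h j, Measurable fun x => f x h j)
    (hfq : ∀ h j, MemLp (fun x => f x h j) (ENNReal.ofReal q) volume) :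
    ∃ p : 𝓓'(spaceTime ⊤, ℝ), ∀ (k : Fin 3) (ψ : 𝓓(spaceTime ⊤, ℝ)),
    (∫ z in (spaceTime ⊤ : Set (ℝ × E3)), duhamel α f z.1 z.2 k *
        (-(∂_{((1 : ℝ), (0 : E3))} ψ) z + fracLaplacian α (fun x => ψ (z.1, x)) z.2))
      + (∂_{((0 : ℝ), e k)} p) ψ
    = -∫ z in (spaceTime ⊤ : Set (ℝ × E3)),
        ∑ h, forceTensor α f z.1 z.2 h k * (∂_{((0 : ℝ), e h)} ψ) z := by
  obtain ⟨p, hp⟩ := exists_pressure (α := α) (by linarith) hq hf hfq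
  refine ⟨p, fun k ψ => ?_⟩
  have α0 : 0 < α := by linarith
  have hψ := isTest ψ
  have H := integral_duhamel_mul hα hq hqα hf hfq (isAdmissible_backward hα hψ) k
  simp_rw [lineDerivOp_testFunction]
  rw [H, Distribution.lineDerivOp_apply_apply, map_neg, hp, pressurePairing]
  simp_rw [integral_kernel_backward hα hψ]
  have i1 : ∀ h j, Integrable (fun z : ℝ × E3 => forceTensor α f z.1 z.2 h j *
      lineDeriv ℝ ψ z (0, e h)) (volume.restrict (spaceTime ⊤)) := by
    intro h j
    obtain ⟨a, b, ha, hab⟩ := exists_time_bounds_testFunction (∂_{((0 : ℝ), e h)} ψ)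
    refine integrable_forceTensor_mul α0 hq hf hfq (hψ.lineDeriv (0, e h)).isAdmissible ha
      (fun t x _ ht => ?_) h j
    rw [← lineDerivOp_testFunction]
    exact hab t x (Or.inl ht)
  have i2 := fun h j => integrable_forceTensor_mul_rieszPotential α0 hq hf hfq
    (∂_{((0 : ℝ), e k)} ψ) (hψ.lineDeriv (0, e k)) (fun z => (lineDerivOp_testFunction ψ _ z).symm) h j
  -- The two potentials belong to functions that are only pointwise equal; homogeneity with factor
  -- `1` identifies them.
  have e1 : ∀ h j z, rieszPotential h j (isTest (∂_{((0 : ℝ), e k)} ψ)) z =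
      rieszPotential h j (hψ.lineDeriv (0, e k)) z := by
    intro h j z
    have := rieszPotential_smul h j (hψ.lineDeriv (0, e k)) (isTest (∂_{((0 : ℝ), e k)} ψ)) 1
      (fun z => by rw [lineDerivOp_testFunction, one_mul]) z
    rwa [one_mul] at this
  simp_rw [e1]
  have e2 : ∀ h j, ∫ w in (spaceTime ⊤ : Set (ℝ × E3)), forceTensor α f w.1 w.2 h j *
      -(𝓕⁻ (fun ξ => helmholtzGradSymbol h k j ξ * 𝓕 (hψ.slice w.1) ξ) w.2).re =
      -((if k = j then 1 else 0) * ∫ w in (spaceTime ⊤ : Set (ℝ × E3)),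
        forceTensor α f w.1 w.2 h j * lineDeriv ℝ ψ w (0, e h)) +
      ∫ w in (spaceTime ⊤ : Set (ℝ × E3)), forceTensor α f w.1 w.2 h j *
        rieszPotential h j (hψ.lineDeriv (0, e k)) w := by
    intro h j
    rw [← integral_const_mul, ← integral_neg, ← integral_add ((i1 h j).const_mul _).fun_neg (i2 h j)]
    refine integral_congr_ae (ae_of_all _ fun w => ?_)
    dsimp only
    rw [re_fourierInv_helmholtzGradSymbol]
    ring
  simp_rw [e2, Finset.sum_add_distrib, Finset.sum_neg_distrib, ite_mul, one_mul, zero_mul]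
  simp only [Finset.sum_ite_eq, Finset.mem_univ, if_true]
  rw [integral_finsetSum _ fun h _ => i1 h k]
  ring

end Pressure

/-! ### Passage from Borel to almost everywhere defined force tensors. -/

section Existence

variable {α q : ℝ} {f f' : E3 → Matrix (Fin 3) (Fin 3) ℝ}

theorem ae_comp_smul_eq {Y : Type*} {g g' : E3 → Y} (h : ∀ᵐ x, g x = g' x) {c : ℝ} (hc : c ≠ 0) :
    ∀ᵐ x : E3, g (c • x) = g' (c • x) := by
  have := Measure.addHaar_preimage_smul (volume : Measure E3) hc {x | ¬ g x = g' x}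
  rw [ae_iff.1 h, mul_zero] at this
  exact ae_iff.2 this

theorem ae_forceTensor_eq (h : ∀ᵐ x, f x = f' x) {t : ℝ} (ht : 0 < t) :
    ∀ᵐ x, forceTensor α f t x = forceTensor α f' t x := by
  filter_upwards [ae_comp_smul_eq h (c := (t ^ (1 / (2 * α)))⁻¹)
    (inv_ne_zero (Real.rpow_pos_of_pos ht _).ne')] with x hx
  rw [forceTensor, forceTensor, hx]

theorem ae_spaceTime_forceTensor_eq (h : ∀ᵐ x, f x = f' x) :
    ∀ᵐ z : ℝ × E3 ∂(volume.restrict (spaceTime ⊤)),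
      forceTensor α f z.1 z.2 = forceTensor α f' z.1 z.2 := by
  obtain ⟨N, hN, hNm, hN0⟩ := exists_measurable_superset_of_null (ae_iff.1 h)
  rw [restrict_spaceTime_top]
  have hm : Measurable fun z : ℝ × E3 => (z.1 ^ (1 / (2 * α)))⁻¹ • z.2 := by fun_prop
  have h0 : ((volume.restrict (Ioi (0 : ℝ))).prod (volume : Measure E3))
      ((fun z : ℝ × E3 => (z.1 ^ (1 / (2 * α)))⁻¹ • z.2) ⁻¹' N) = 0 := by
    rw [Measure.measure_prod_null (hm hNm)]
    filter_upwards [ae_restrict_mem measurableSet_Ioi] with t ht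
    have := Measure.addHaar_preimage_smul (volume : Measure E3)
      (inv_ne_zero (Real.rpow_pos_of_pos (mem_Ioi.1 ht) (1 / (2 * α))).ne') N
    rw [hN0, mul_zero] at this
    exact this
  refine measure_mono_null (fun z hz => hN ?_) h0
  intro h2
  exact hz (by rw [mem_ofPred_eq, forceTensor, forceTensor, h2])

/-- The equality holds at every point, not just almost everywhere: for each `s > 0` the dilated
tensors agree for almost every `y`, and only integrals over `y` enter. A Borel representative of `f`
can thus be used throughout. -/
theorem duhamel_congr (h : ∀ᵐ x, f x = f' x) : duhamel α f = duhamel α f' := by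
  ext1 t
  ext1 x
  refine setIntegral_congr_fun measurableSet_Ioo fun s hs => ?_
  rw [semigroupHelmholtzDiv, semigroupHelmholtzDiv]
  congr 1
  ext k
  refine integral_congr_ae ?_
  filter_upwards [ae_forceTensor_eq (α := α) h hs.1] with y hy
  rw [hy]

theorem exists_measurable_entries (hf : ∀ i j, MemLp (fun x => f x i j) (ENNReal.ofReal q) volume) :
    ∃ g : E3 → Matrix (Fin 3) (Fin 3) ℝ, (∀ᵐ x, f x = g x) ∧
      (∀ i j, Measurable fun x => g x i j) ∧
      ∀ i j, MemLp (fun x => g x i j) (ENNReal.ofReal q) volume := by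
  have h := fun i j => (hf i j).1.aemeasurable
  refine ⟨fun x => Matrix.of fun i j => (h i j).mk _ x, ?_, fun i j => (h i j).measurable_mk,
    fun i j => (hf i j).ae_eq (h i j).ae_eq_mk⟩
  have : ∀ᵐ x, ∀ i j, f x i j = (h i j).mk _ x := by
    simp only [ae_all_iff]
    exact fun i j => (h i j).ae_eq_mk
  filter_upwards [this] with x hx
  ext i j
  exact hx i j

theorem ae_integrableOn_duhamel (hα : 1 / 2 < α) (hq : 1 < q) (hqα : q < 3 / (2 * α - 1))
    (hf : ∀ i j, MemLp (fun x => f x i j) (ENNReal.ofReal q) volume) {t : ℝ} (ht : 0 < t) :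
    ∀ᵐ x : E3, ∀ h k j : Fin 3, IntegrableOn (fun sy : ℝ × E3 =>
      oseenGrad α h k j (x - sy.2) (t - sy.1) * forceTensor α f sy.1 sy.2 h j)
      (Ioo 0 t ×ˢ univ) volume := by
  obtain ⟨g, hfg, hg, hgq⟩ := exists_measurable_entries hf
  filter_upwards [ae_duhamelAbs_lt_top hα hq hqα hg hgq ht] with x hx h k j
  refine (integrableOn_oseenGrad_mul (by linarith) (hg h j) (hx h k j)).congr_fun_ae ?_
  have hsub : Ioo 0 t ×ˢ (univ : Set E3) ⊆ (spaceTime ⊤ : Set (ℝ × E3)) := by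
    rw [coe_spaceTime_top]
    exact prod_mono Ioo_subset_Ioi_self le_rfl
  filter_upwards [ae_restrict_of_ae_restrict_of_subset hsub
    (ae_spaceTime_forceTensor_eq (α := α) hfg)] with w hw
  rw [hw]

theorem isSolution_duhamel (hα : 1 / 2 < α) (hq : 1 < q) (hqα : q < 3 / (2 * α - 1))
    (hf : ∀ i j, MemLp (fun x => f x i j) (ENNReal.ofReal q) volume) :
    IsSolution α f ⊤ (ENNReal.ofReal q) (duhamel α f) := by
  obtain ⟨g, hfg, hg, hgq⟩ := exists_measurable_entries hf
  rw [duhamel_congr hfg]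
  refine ⟨fun T _ _ => memLinftyLp_duhamel hα hq hqα hg hgq T,
    divergence_free_duhamel hα hq hqα hg hgq, ?_⟩
  obtain ⟨p, hp⟩ := momentum_duhamel hα hq hqα hg hgq
  refine ⟨p, fun k ψ => (hp k ψ).trans ?_⟩
  congr 1
  refine integral_congr_ae ?_
  filter_upwards [ae_spaceTime_forceTensor_eq (α := α) hfg] with z hz
  rw [hz]

theorem tendsto_eLpNorm_duhamel_zero (hα : 1 / 2 < α) (hq : 1 < q) (hqα : q < 3 / (2 * α - 1))
    (hf : ∀ i j, MemLp (fun x => f x i j) (ENNReal.ofReal q) volume) :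
    Tendsto (fun t => eLpNorm (duhamel α f t) (ENNReal.ofReal q) volume) (𝓝[>] 0) (𝓝 0) := by
  obtain ⟨g, hfg, hg, hgq⟩ := exists_measurable_entries hf
  rw [duhamel_congr hfg]
  exact tendsto_eLpNorm_duhamel hα hq hqα hg hgq

end Existence

/-! ### Density of compactly supported functions in the Schwartz space. -/

section Density

/-- For `i = 0` the Lipschitz bound gives `c|x|`; for `i ≥ 1` the chain rule gives `c^i ≤ c`. The
growth `1 + |x|` is later absorbed by a Schwartz seminorm with one more power of `|x|`. -/
theorem exists_norm_iteratedFDeriv_sub_one_le {χ : E3 → ℂ} (hχ : ContDiff ℝ (⊤ : ℕ∞) χ)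
    (hχc : HasCompactSupport χ) (hχ0 : χ 0 = 1) (i : ℕ) : ∃ C : ℝ, 0 ≤ C ∧ ∀ c : ℝ, 0 < c → c ≤ 1 →
      ∀ x, ‖iteratedFDeriv ℝ i (fun x => χ (c • x) - 1) x‖ ≤ c * (C * (1 + ‖x‖)) := by
  rcases Nat.eq_zero_or_pos i with rfl | hi
  · obtain ⟨L, hL⟩ := (hχ.of_le (m := 1) (by exact_mod_cast le_top)).lipschitzWith_of_hasCompactSupport
      hχc (by simp)
    refine ⟨L, L.2, fun c hc _ x => ?_⟩
    have h1 := hL.dist_le_mul (c • x) 0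
    rw [dist_eq_norm, hχ0, dist_zero_right, norm_smul, Real.norm_of_nonneg hc.le] at h1
    rw [norm_iteratedFDeriv_zero]
    refine h1.trans ?_
    have : (0 : ℝ) ≤ L := L.2
    have : 0 ≤ c * L := by positivity
    nlinarith
  · obtain ⟨C, hC⟩ := (hχ.continuous_iteratedFDeriv (m := i)
      (by exact_mod_cast le_top)).bounded_above_of_compact_support (hχc.iteratedFDeriv i)
    have hC0 : 0 ≤ C := (norm_nonneg _).trans (hC 0)
    refine ⟨C, hC0, fun c hc hc1 x => ?_⟩
    have hχi : ContDiff ℝ i χ := hχ.of_le (by exact_mod_cast le_top)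
    have e1 : iteratedFDeriv ℝ i (fun x => χ (c • x) - 1) x = c ^ i • iteratedFDeriv ℝ i χ (c • x) := by
      have := fun_iteratedFDeriv_add_apply (𝕜 := ℝ) (i := i) (f := fun x : E3 => χ (c • x))
        (g := fun _ => (-1 : ℂ)) (x := x)
        ((hχi.comp (contDiff_const_smul c)).contDiffAt) contDiff_const.contDiffAt
      simp only [sub_eq_add_neg]
      rw [this, iteratedFDeriv_const_of_ne (by omega), Pi.zero_apply, add_zero,
        iteratedFDeriv_comp_const_smul c hχi]
    rw [e1, norm_smul, Real.norm_of_nonneg (by positivity)]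
    have h2 : c ^ i ≤ c := by
      calc c ^ i ≤ c ^ 1 := pow_le_pow_of_le_one hc.le hc1 hi
        _ = c := pow_one c
    gcongr
    exact (hC _).trans (le_mul_of_one_le_right hC0 (by linarith [norm_nonneg x]))

/-- The cut-off of a Schwartz function. -/
def cutoff {χ : E3 → ℂ} (hχ : ContDiff ℝ (⊤ : ℕ∞) χ) (hχc : HasCompactSupport χ) (c : ℝ)
    (hc : c ≠ 0) (G : SchwartzMap E3 ℂ) : SchwartzMap E3 ℂ :=
  (show HasCompactSupport fun x => χ (c • x) * G x from
    (hχc.comp_smul hc).mul_right).toSchwartzMap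
    ((hχ.comp (contDiff_const_smul c)).mul (G.smooth _))

theorem cutoff_apply {χ : E3 → ℂ} (hχ : ContDiff ℝ (⊤ : ℕ∞) χ) (hχc : HasCompactSupport χ) {c : ℝ}
    (hc : c ≠ 0) (G : SchwartzMap E3 ℂ) (x : E3) : cutoff hχ hχc c hc G x = χ (c • x) * G x := rfl

theorem hasCompactSupport_cutoff {χ : E3 → ℂ} (hχ : ContDiff ℝ (⊤ : ℕ∞) χ)
    (hχc : HasCompactSupport χ) {c : ℝ} (hc : c ≠ 0) (G : SchwartzMap E3 ℂ) :
    HasCompactSupport (cutoff hχ hχc c hc G) :=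
  (hχc.comp_smul hc).mul_right

theorem exists_seminorm_cutoff_sub_le {χ : E3 → ℂ} (hχ : ContDiff ℝ (⊤ : ℕ∞) χ)
    (hχc : HasCompactSupport χ) (hχ0 : χ 0 = 1) (k n : ℕ) (G : SchwartzMap E3 ℂ) :
    ∃ A : ℝ, ∀ c (hc : c ≠ 0), 0 < c → c ≤ 1 →
      SchwartzMap.seminorm ℂ k n (cutoff hχ hχc c hc G - G) ≤ c * A := by
  choose C hC hCb using exists_norm_iteratedFDeriv_sub_one_le hχ hχc hχ0
  refine ⟨∑ i ∈ Finset.range (n + 1), n.choose i * (C i *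
    (SchwartzMap.seminorm ℂ k (n - i) G + SchwartzMap.seminorm ℂ (k + 1) (n - i) G)),
    fun c hc hc0 hc1 => ?_⟩
  refine SchwartzMap.seminorm_le_bound ℂ k n _ (mul_nonneg hc0.le (Finset.sum_nonneg fun i _ => ?_))
    fun x => ?_
  · exact mul_nonneg (Nat.cast_nonneg _) (mul_nonneg (hC i)
      (add_nonneg (apply_nonneg _ _) (apply_nonneg _ _)))
  have e1 : (⇑(cutoff hχ hχc c hc G - G) : E3 → ℂ) = fun y => (χ (c • y) - 1) * G y := by
    ext y
    rw [_root_.sub_apply, cutoff_apply]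
    ring
  have h1 : ContDiff ℝ (⊤ : ℕ∞) fun y : E3 => χ (c • y) - 1 :=
    (hχ.comp (contDiff_const_smul c)).sub contDiff_const
  rw [e1]
  refine (mul_le_mul_of_nonneg_left (norm_iteratedFDeriv_mul_le (N := (⊤ : ℕ∞)) h1 (G.smooth _) x
    (n := n) (by exact_mod_cast le_top)) (by positivity)).trans ?_
  rw [Finset.mul_sum, Finset.mul_sum]
  refine Finset.sum_le_sum fun i _ => ?_
  have h2 := SchwartzMap.le_seminorm ℂ k (n - i) G x
  have h3 := SchwartzMap.le_seminorm ℂ (k + 1) (n - i) G x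
  calc ‖x‖ ^ k * (n.choose i * ‖iteratedFDeriv ℝ i (fun y => χ (c • y) - 1) x‖ *
        ‖iteratedFDeriv ℝ (n - i) G x‖)
      ≤ ‖x‖ ^ k * (n.choose i * (c * (C i * (1 + ‖x‖))) * ‖iteratedFDeriv ℝ (n - i) G x‖) := by
        gcongr
        exact hCb i c hc0 hc1 x
    _ = c * (n.choose i * (C i * (‖x‖ ^ k * ‖iteratedFDeriv ℝ (n - i) G x‖ +
          ‖x‖ ^ (k + 1) * ‖iteratedFDeriv ℝ (n - i) G x‖))) := by ring
    _ ≤ _ := by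
        have := hC i
        gcongr

/-- Compactly supported functions are dense in the Schwartz space. -/
theorem eq_zero_of_forall_hasCompactSupport {X : SchwartzMap E3 ℂ → ℂ} (hX : Continuous X)
    (h : ∀ G : SchwartzMap E3 ℂ, HasCompactSupport G → X G = 0) (G : SchwartzMap E3 ℂ) : X G = 0 := by
  let χ : ContDiffBump (0 : E3) := ⟨1, 2, one_pos, one_lt_two⟩
  have hχ : ContDiff ℝ (⊤ : ℕ∞) fun x => ((χ x : ℝ) : ℂ) :=
    Complex.ofRealCLM.contDiff.comp χ.contDiff
  have hχc : HasCompactSupport fun x => ((χ x : ℝ) : ℂ) :=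
    χ.hasCompactSupport.comp_left (g := fun r : ℝ => (r : ℂ)) (by simp)
  have hχ0 : ((χ 0 : ℝ) : ℂ) = 1 := by
    rw [χ.one_of_mem_closedBall (by simp [χ.rIn_pos.le]), Complex.ofReal_one]
  have hc : ∀ n : ℕ, (1 / ((n : ℝ) + 1)) ≠ 0 := fun n => by positivity
  have hlim : Tendsto (fun n : ℕ => cutoff hχ hχc (1 / ((n : ℝ) + 1)) (hc n) G) atTop (𝓝 G) := by
    rw [(schwartz_withSeminorms ℂ E3 ℂ).tendsto_nhds]
    rintro ⟨k, n⟩ ε hε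
    obtain ⟨A, hA⟩ := exists_seminorm_cutoff_sub_le hχ hχc hχ0 k n G
    have h0 : Tendsto (fun n : ℕ => 1 / ((n : ℝ) + 1) * A) atTop (𝓝 0) := by
      simpa using tendsto_one_div_add_atTop_nhds_zero_nat.mul_const A
    filter_upwards [h0.eventually (gt_mem_nhds hε)] with j hj
    refine (hA _ (hc j) (by positivity) ?_).trans_lt hj
    rw [div_le_one (by positivity)]
    simp
  have h1 := (hX.tendsto G).comp hlim
  have h2 : (X ∘ fun n : ℕ => cutoff hχ hχc (1 / ((n : ℝ) + 1)) (hc n) G) = fun _ => 0 :=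
    funext fun n => h _ (hasCompactSupport_cutoff hχ hχc (hc n) G)
  rw [h2] at h1
  exact tendsto_nhds_unique h1 tendsto_const_nhds |>.trans rfl

end Density

/-! ### A hierarchy of ordinary differential equations in the sense of distributions. -/

section Time

/-- A smooth function on the line that vanishes on `(-∞, 1/2]` and equals `1` on `[1, ∞)`. -/
def ramp (t : ℝ) : ℝ := Real.smoothTransition (2 * t - 1)

theorem contDiff_ramp : ContDiff ℝ (⊤ : ℕ∞) ramp :=
  (Real.smoothTransition.contDiff (n := ⊤)).comp (by fun_prop)

theorem ramp_of_le {t : ℝ} (ht : t ≤ 1 / 2) : ramp t = 0 :=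
  Real.smoothTransition.zero_of_nonpos (by linarith)

theorem ramp_of_ge {t : ℝ} (ht : 1 ≤ t) : ramp t = 1 :=
  Real.smoothTransition.one_of_one_le (by linarith)

theorem norm_ramp_le (t : ℝ) : ‖ramp t‖ ≤ 1 := by
  rw [ramp, Real.norm_of_nonneg (Real.smoothTransition.nonneg _)]
  exact Real.smoothTransition.le_one _

theorem deriv_ramp_of_lt {t : ℝ} (ht : t < 1 / 2) : deriv ramp t = 0 := by
  have : ramp =ᶠ[𝓝 t] fun _ => 0 := by
    filter_upwards [Iio_mem_nhds ht] with s hs using ramp_of_le hs.le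
  rw [this.deriv_eq, deriv_const]

theorem deriv_ramp_of_gt {t : ℝ} (ht : 1 < t) : deriv ramp t = 0 := by
  have : ramp =ᶠ[𝓝 t] fun _ => 1 := by
    filter_upwards [Ioi_mem_nhds ht] with s hs using ramp_of_ge hs.le
  rw [this.deriv_eq, deriv_const]

theorem exists_norm_deriv_ramp_le : ∃ L : ℝ, 0 ≤ L ∧ ∀ t, ‖deriv ramp t‖ ≤ L := by
  have hc : HasCompactSupport (deriv ramp) := by
    refine HasCompactSupport.of_support_subset_isCompact (isCompact_Icc (a := (1 / 2 : ℝ)) (b := 1))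
      fun t ht => ?_
    by_contra h
    rw [mem_Icc, not_and_or, not_le, not_le] at h
    rcases h with h | h
    · exact ht (deriv_ramp_of_lt h)
    · exact ht (deriv_ramp_of_gt h)
  obtain ⟨L, hL⟩ := (contDiff_ramp.continuous_deriv (by simp)).bounded_above_of_compact_support hc
  exact ⟨L, (norm_nonneg _).trans (hL 0), hL⟩

theorem hasDerivAt_ramp_mul {c t : ℝ} {Φ φ : ℝ → ℝ} (hΦ : HasDerivAt Φ (-φ t) t) :
    HasDerivAt (fun t => Φ t * ramp (c * t)) (-φ t * ramp (c * t) + Φ t * (deriv ramp (c * t) * c))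
      t := by
  have h1 : HasDerivAt ramp (deriv ramp (c * t)) (c * t) :=
    (contDiff_ramp.differentiable (by simp) _).hasDerivAt
  have h2 : HasDerivAt (fun t => c * t) c t := by simpa using (hasDerivAt_id t).const_mul c
  exact hΦ.mul (h1.comp t h2)

/-- The derivative of the cut-off has size of order `c` on an interval of length at most `1/c`, so
the commutator term is bounded by the size of `a` near time zero, uniformly in `c`. -/
theorem norm_integral_deriv_ramp_le {a : ℝ → ℂ} {Φ : ℝ → ℝ} {S L ε c : ℝ} (hc : 0 < c)
    (hL : ∀ t, ‖deriv ramp t‖ ≤ L) (hS : ∀ t, 0 < t → ‖Φ t‖ ≤ S)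
    (ha : ∀ᵐ t, t < 2 / c → ‖a t‖ ≤ ε) :
    ‖∫ t, ((Φ t * (deriv ramp (c * t) * c) : ℝ) : ℂ) * a t‖ ≤ S * L * ε := by
  have hS0 : 0 ≤ S := (norm_nonneg _).trans (hS 1 one_pos)
  have hL0 : 0 ≤ L := (norm_nonneg _).trans (hL 1)
  have h1 : ∀ᵐ t, ‖((Φ t * (deriv ramp (c * t) * c) : ℝ) : ℂ) * a t‖ ≤
      (Ioc 0 (1 / c)).indicator (fun _ => S * (L * c) * ε) t := by
    filter_upwards [ha] with t ht
    by_cases h : t ∈ Ioc 0 (1 / c)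
    · rw [indicator_of_mem h, norm_mul, Complex.norm_real, norm_mul, norm_mul,
        Real.norm_of_nonneg hc.le]
      have := hS t h.1
      have := hL (c * t)
      have := ht (h.2.trans_lt (by gcongr; norm_num))
      gcongr
    · rw [indicator_of_notMem h]
      have h0 : deriv ramp (c * t) = 0 := by
        rw [mem_Ioc, not_and_or, not_lt, not_le] at h
        rcases h with h | h
        · exact deriv_ramp_of_lt (by nlinarith)
        · refine deriv_ramp_of_gt ?_
          rw [div_lt_iff₀ hc] at h
          linarith
      simp [h0]
  refine (norm_integral_le_of_norm_le ?_ h1).trans (le_of_eq ?_)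
  · rw [integrable_indicator_iff measurableSet_Ioc]
    exact integrableOn_const (by simp)
  · rw [integral_indicator measurableSet_Ioc, setIntegral_const, measureReal_def, Real.volume_Ioc,
      ENNReal.toReal_ofReal (by simp [hc.le]), smul_eq_mul]
    field_simp
    ring

theorem tendsto_integral_ramp_mul {a : ℝ → ℂ} {Φ : ℝ → ℝ} {S C b : ℝ} (ha : Measurable a)
    (hΦ : Continuous Φ) (hS : ∀ t, 0 < t → ‖Φ t‖ ≤ S) (hb : ∀ t, b ≤ t → Φ t = 0)
    (hC : ∀ᵐ t, ‖a t‖ ≤ C) (h0 : ∀ t ≤ 0, a t = 0) :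
    Integrable (fun t => (Φ t : ℂ) * a t) ∧
    (∀ c, Integrable fun t => ((Φ t * ramp (c * t) : ℝ) : ℂ) * a t) ∧
    Tendsto (fun n : ℕ => ∫ t, ((Φ t * ramp (((n : ℝ) + 1) * t) : ℝ) : ℂ) * a t) atTop
      (𝓝 (∫ t, (Φ t : ℂ) * a t)) := by
  have hr : Continuous ramp := contDiff_ramp.continuous
  have hS0 : 0 ≤ S := (norm_nonneg _).trans (hS 1 one_pos)
  have hm : ∀ c : ℝ, Measurable fun t => ((Φ t * ramp (c * t) : ℝ) : ℂ) * a t := fun c => by fun_prop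
  have hm' : Measurable fun t => (Φ t : ℂ) * a t := by fun_prop
  have hi : Integrable ((Ioo 0 b).indicator fun _ : ℝ => S * C) := by
    rw [integrable_indicator_iff measurableSet_Ioo]
    exact integrableOn_const (by simp)
  have key : ∀ᵐ t, ∀ x : ℝ, ‖x‖ ≤ 1 → ‖((Φ t * x : ℝ) : ℂ) * a t‖ ≤
      (Ioo 0 b).indicator (fun _ : ℝ => S * C) t := by
    filter_upwards [hC] with t ht x hx
    by_cases h : t ∈ Ioo 0 b
    · rw [indicator_of_mem h, norm_mul, Complex.norm_real, norm_mul]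
      have := hS t h.1
      calc ‖Φ t‖ * ‖x‖ * ‖a t‖ ≤ S * 1 * C := by gcongr
        _ = S * C := by ring
    · rw [indicator_of_notMem h]
      rw [mem_Ioo, not_and_or, not_lt, not_lt] at h
      rcases h with h | h
      · simp [h0 t h]
      · simp [hb t h]
  refine ⟨hi.mono' hm'.aestronglyMeasurable ?_, fun c => hi.mono' (hm c).aestronglyMeasurable ?_,
    tendsto_integral_of_dominated_convergence _ (fun n => (hm _).aestronglyMeasurable) hi
      (fun n => ?_) (ae_of_all _ fun t => ?_)⟩
  · filter_upwards [key] with t ht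
    simpa using ht 1 (by simp)
  · filter_upwards [key] with t ht using ht _ (norm_ramp_le _)
  · filter_upwards [key] with t ht using ht _ (norm_ramp_le _)
  · rcases le_or_gt t 0 with ht | ht
    · simp [h0 t ht]
    · refine tendsto_const_nhds.congr' ?_
      obtain ⟨N, hN⟩ := exists_nat_gt (1 / t)
      filter_upwards [eventually_ge_atTop N] with n hn
      rw [ramp_of_ge, mul_one]
      rw [div_lt_iff₀ ht] at hN
      have : (N : ℝ) ≤ n := by exact_mod_cast hn
      nlinarith

/-- If `a₀' = -a₁` on `(0, T)` in the sense of distributions and `a₀` vanishes at time zero, then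
this relation may be tested against functions that do not vanish near time zero. -/
theorem integral_mul_eq_neg_integral_primitive {a₀ a₁ : ℝ → ℂ} {T C₀ C₁ : ℝ} (hm₀ : Measurable a₀)
    (hm₁ : Measurable a₁) (h₀ : ∀ t ≤ 0, a₀ t = 0) (h₁ : ∀ t ≤ 0, a₁ t = 0)
    (hC₀ : ∀ᵐ t, ‖a₀ t‖ ≤ C₀) (hC₁ : ∀ᵐ t, ‖a₁ t‖ ≤ C₁)
    (hlim : ∀ ε > 0, ∃ δ > 0, ∀ᵐ t, t < δ → ‖a₀ t‖ ≤ ε)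
    (heq : ∀ η : ℝ → ℝ, ContDiff ℝ (⊤ : ℕ∞) η → HasCompactSupport η → tsupport η ⊆ Ioo 0 T →
      ∫ t, ((deriv η t : ℝ) : ℂ) * a₀ t = ∫ t, (η t : ℂ) * a₁ t)
    {φ Φ : ℝ → ℝ} {b S : ℝ} (hbT : b < T) (hφ : Continuous φ) (hφb : ∀ t, b ≤ t → φ t = 0)
    (hφS : ∀ t, 0 < t → ‖φ t‖ ≤ S)
    (hΦ : ContDiff ℝ (⊤ : ℕ∞) Φ) (hΦb : ∀ t, b ≤ t → Φ t = 0) (hΦS : ∀ t, 0 < t → ‖Φ t‖ ≤ S)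
    (hd : ∀ t, HasDerivAt Φ (-φ t) t) :
    ∫ t, (φ t : ℂ) * a₀ t = -∫ t, (Φ t : ℂ) * a₁ t := by
  obtain ⟨L, hL0, hL⟩ := exists_norm_deriv_ramp_le
  have hS0 : 0 ≤ S := (norm_nonneg _).trans (hφS 1 one_pos)
  obtain ⟨-, i1, l1⟩ := tendsto_integral_ramp_mul hm₀ hφ hφS hφb hC₀ h₀
  obtain ⟨-, -, l2⟩ := tendsto_integral_ramp_mul hm₁ hΦ.continuous hΦS hΦb hC₁ h₁
  have hr : Continuous (deriv ramp) := contDiff_ramp.continuous_deriv (by simp)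
  have l3 : Tendsto (fun n : ℕ => ∫ t, ((Φ t * (deriv ramp (((n : ℝ) + 1) * t) * ((n : ℝ) + 1)) : ℝ)
      : ℂ) * a₀ t) atTop (𝓝 0) := by
    rw [Metric.tendsto_atTop]
    intro ε hε
    obtain ⟨δ, hδ, hδa⟩ := hlim (ε / (S * L + 1)) (by positivity)
    obtain ⟨N, hN⟩ := exists_nat_gt (2 / δ)
    refine ⟨N, fun n hn => ?_⟩
    have hnN : (N : ℝ) ≤ n := by exact_mod_cast hn
    rw [dist_zero_right]
    refine (norm_integral_deriv_ramp_le (ε := ε / (S * L + 1)) (by positivity) hL hΦS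
      ?_).trans_lt ?_
    · filter_upwards [hδa] with t ht h
      refine ht (h.trans ?_)
      rw [div_lt_iff₀ hδ] at hN
      rw [div_lt_iff₀ (by positivity)]
      nlinarith
    · rw [mul_div_assoc', div_lt_iff₀ (by positivity)]
      nlinarith [mul_nonneg hS0 hL0]
  have hi3 : ∀ n : ℕ, Integrable fun t => ((Φ t * (deriv ramp (((n : ℝ) + 1) * t) * ((n : ℝ) + 1)) : ℝ)
      : ℂ) * a₀ t := by
    intro n
    set c : ℝ := (n : ℝ) + 1
    have hi : Integrable ((Ioo 0 b).indicator fun _ : ℝ => S * (L * c) * C₀) := by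
      rw [integrable_indicator_iff measurableSet_Ioo]
      exact integrableOn_const (by simp)
    have hΦc := hΦ.continuous
    have hm : Measurable fun t => ((Φ t * (deriv ramp (c * t) * c) : ℝ) : ℂ) * a₀ t := by fun_prop
    refine hi.mono' hm.aestronglyMeasurable ?_
    filter_upwards [hC₀] with t ht
    by_cases h : t ∈ Ioo 0 b
    · rw [indicator_of_mem h, norm_mul, Complex.norm_real, norm_mul, norm_mul,
        Real.norm_of_nonneg (show 0 ≤ c by positivity)]
      have := hΦS t h.1
      have := hL (c * t)
      gcongr
    · rw [indicator_of_notMem h]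
      rw [mem_Ioo, not_and_or, not_lt, not_lt] at h
      rcases h with h | h
      · simp [h₀ t h]
      · simp [hΦb t h]
  -- The equation is tested with `Φ(t) ramp(ct)`, which vanishes near zero. As `c` tends to infinity
  -- the term with `ramp'` disappears, because `a₀` has initial value zero.
  have hη : ∀ n : ℕ, -(∫ t, ((φ t * ramp (((n : ℝ) + 1) * t) : ℝ) : ℂ) * a₀ t) +
      ∫ t, ((Φ t * (deriv ramp (((n : ℝ) + 1) * t) * ((n : ℝ) + 1)) : ℝ) : ℂ) * a₀ t =
      ∫ t, ((Φ t * ramp (((n : ℝ) + 1) * t) : ℝ) : ℂ) * a₁ t := by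
    intro n
    set c : ℝ := (n : ℝ) + 1 with hc
    have c0 : 0 < c := by positivity
    have hsub : Function.support (fun t => Φ t * ramp (c * t)) ⊆ Icc (1 / (2 * c)) b := by
      intro t ht
      refine ⟨?_, ?_⟩
      · by_contra h
        rw [not_le, lt_div_iff₀ (by positivity)] at h
        exact ht (by simp [ramp_of_le (show c * t ≤ 1 / 2 by linarith)])
      · by_contra h
        exact ht (by simp [hΦb t (not_le.1 h).le])
    rw [← heq (fun t => Φ t * ramp (c * t)) (hΦ.mul (contDiff_ramp.comp (by fun_prop)))
      (HasCompactSupport.of_support_subset_isCompact isCompact_Icc hsub)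
      ((closure_minimal hsub isClosed_Icc).trans fun t ht =>
        ⟨lt_of_lt_of_le (by positivity) ht.1, ht.2.trans_lt hbT⟩),
      ← integral_neg, ← integral_add (i1 c).fun_neg (hi3 n)]
    refine integral_congr_ae (ae_of_all _ fun t => ?_)
    change -(((φ t * ramp (c * t) : ℝ) : ℂ) * a₀ t) +
      ((Φ t * (deriv ramp (c * t) * c) : ℝ) : ℂ) * a₀ t =
      ((deriv (fun t => Φ t * ramp (c * t)) t : ℝ) : ℂ) * a₀ t
    rw [(hasDerivAt_ramp_mul (c := c) (hd t)).deriv]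
    simp only [Complex.ofReal_add, Complex.ofReal_mul, Complex.ofReal_neg]
    ring
  have l4 := (l1.neg.add l3).congr hη
  have := tendsto_nhds_unique l4 l2
  rw [add_zero] at this
  rw [← this, neg_neg]

theorem integral_exp_sub_le {l b t : ℝ} (hl : 0 < l) :
    ∫ s in t..b, Real.exp (l * (b - s)) ≤ Real.exp (l * (b - t)) / l := by
  have h : ∀ s ∈ uIcc t b, HasDerivAt (fun s => -Real.exp (l * (b - s)) / l)
      (Real.exp (l * (b - s))) s := by
    intro s _
    have h1 : HasDerivAt (fun s => l * (b - s)) (-l) s := by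
      simpa using ((hasDerivAt_id s).const_sub b).const_mul l
    refine (h1.exp.neg.div_const l).congr_deriv ?_
    field_simp
  rw [intervalIntegral.integral_eq_sub_of_hasDerivAt h
    (Continuous.intervalIntegrable (by fun_prop) _ _)]
  have : 0 < l⁻¹ := inv_pos.2 hl
  simp only [sub_self, mul_zero, Real.exp_zero]
  rw [neg_div, neg_div]
  have : 0 < 1 / l := by positivity
  linarith

/-- A hierarchy `aₙ' = -aₙ₊₁` of geometric growth with vanishing initial values is trivial. -/
theorem integral_mul_eq_zero_of_hierarchy {a : ℕ → ℝ → ℂ} {T C M : ℝ} (hM : 0 < M)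
    (hm : ∀ n, Measurable (a n)) (h0 : ∀ n, ∀ t ≤ 0, a n t = 0)
    (hC : ∀ n, ∀ᵐ t, ‖a n t‖ ≤ C * M ^ n)
    (hlim : ∀ n, ∀ ε > 0, ∃ δ > 0, ∀ᵐ t, t < δ → ‖a n t‖ ≤ ε)
    (heq : ∀ n, ∀ η : ℝ → ℝ, ContDiff ℝ (⊤ : ℕ∞) η → HasCompactSupport η → tsupport η ⊆ Ioo 0 T →
      ∫ t, ((deriv η t : ℝ) : ℂ) * a n t = ∫ t, (η t : ℂ) * a (n + 1) t)
    {φ : ℝ → ℝ} (hφ : ContDiff ℝ (⊤ : ℕ∞) φ) {b : ℝ} (hb : 0 < b) (hbT : b < T)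
    (hφb : ∀ t, b ≤ t → φ t = 0) : ∫ t, (φ t : ℂ) * a 0 t = 0 := by
  have hC0 : 0 ≤ C := by
    obtain ⟨t, ht⟩ := (hC 0).exists
    simpa using (norm_nonneg _).trans ht
  -- In the norm weighted by `e^{l(b-t)}` a passage to the primitive gains `1/l`, while the step
  -- from `aₙ` to `aₙ₊₁` costs `M`. The choice `l = 2M` leaves a factor `1/2` per step, on an
  -- interval of arbitrary length.
  set l : ℝ := 2 * M with hl
  have l0 : 0 < l := by positivity
  have claim : ∀ m n : ℕ, ∀ (φ : ℝ → ℝ) (A : ℝ), ContDiff ℝ (⊤ : ℕ∞) φ → (∀ t, b ≤ t → φ t = 0) →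
      (∀ t, 0 ≤ t → t ≤ b → ‖φ t‖ ≤ A * Real.exp (l * (b - t))) →
      ‖∫ t, (φ t : ℂ) * a n t‖ ≤ A * Real.exp (l * b) * (C * M ^ n) * b * (1 / 2) ^ m := by
    intro m
    induction m with
    | zero =>
      intro n φ A hφ hφb hA
      have hA0 : 0 ≤ A := by
        have := (norm_nonneg _).trans (hA b hb.le le_rfl)
        simpa using this
      have h1 : ∀ᵐ t, ‖(φ t : ℂ) * a n t‖ ≤
          (Ioo 0 b).indicator (fun _ => A * Real.exp (l * b) * (C * M ^ n)) t := by
        filter_upwards [hC n] with t ht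
        by_cases h : t ∈ Ioo 0 b
        · rw [indicator_of_mem h, norm_mul, Complex.norm_real]
          gcongr
          refine (hA t h.1.le h.2.le).trans ?_
          gcongr
          linarith [h.1]
        · rw [indicator_of_notMem h]
          rw [mem_Ioo, not_and_or, not_lt, not_lt] at h
          rcases h with h | h
          · simp [h0 n t h]
          · simp [hφb t h]
      refine (norm_integral_le_of_norm_le ?_ h1).trans (le_of_eq ?_)
      · rw [integrable_indicator_iff measurableSet_Ioo]
        exact integrableOn_const (by simp)
      · rw [integral_indicator measurableSet_Ioo, setIntegral_const, measureReal_def,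
          Real.volume_Ioo, ENNReal.toReal_ofReal (by linarith), smul_eq_mul]
        ring
    | succ m ih =>
      intro n φ A hφ hφb hA
      have hA0 : 0 ≤ A := by
        have := (norm_nonneg _).trans (hA b hb.le le_rfl)
        simpa using this
      set Φ : ℝ → ℝ := fun t => ∫ s in t..b, φ s with hΦdef
      have hd : ∀ t, HasDerivAt Φ (-φ t) t := fun t =>
        intervalIntegral.integral_hasDerivAt_left (hφ.continuous.intervalIntegrable _ _)
          (hφ.continuous.stronglyMeasurableAtFilter _ _) hφ.continuous.continuousAt
      have hΦ : ContDiff ℝ (⊤ : ℕ∞) Φ := by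
        have e1 : deriv Φ = fun t => -φ t := funext fun t => (hd t).deriv
        refine contDiff_infty_iff_deriv.2 ⟨fun t => (hd t).differentiableAt, ?_⟩
        rw [e1]
        exact hφ.neg
      have hΦb : ∀ t, b ≤ t → Φ t = 0 := by
        intro t ht
        refine (intervalIntegral.integral_congr (g := fun _ => (0 : ℝ)) fun s hs => ?_).trans (by simp)
        rw [uIcc_of_ge ht] at hs
        exact hφb s hs.1
      have hΦA : ∀ t, 0 ≤ t → t ≤ b → ‖Φ t‖ ≤ A / l * Real.exp (l * (b - t)) := by
        intro t ht htb
        calc ‖Φ t‖ ≤ ∫ s in t..b, A * Real.exp (l * (b - s)) := by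
              refine intervalIntegral.norm_integral_le_of_norm_le htb ?_
                (Continuous.intervalIntegrable (by fun_prop) _ _)
              exact ae_of_all _ fun s hs => hA s (ht.trans hs.1.le) hs.2
          _ ≤ A * (Real.exp (l * (b - t)) / l) := by
              rw [intervalIntegral.integral_const_mul]
              exact mul_le_mul_of_nonneg_left (integral_exp_sub_le l0) hA0
          _ = _ := by ring
      have hbd : ∀ (g : ℝ → ℝ) (B : ℝ), 0 ≤ B → (∀ t, b ≤ t → g t = 0) →
          (∀ t, 0 ≤ t → t ≤ b → ‖g t‖ ≤ B * Real.exp (l * (b - t))) → ∀ S, B * Real.exp (l * b) ≤ S →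
          ∀ t, 0 < t → ‖g t‖ ≤ S := by
        intro g B hB hgb hg S hS t ht
        rcases le_or_gt t b with h | h
        · refine (hg t ht.le h).trans (le_trans ?_ hS)
          gcongr
          linarith
        · rw [hgb t h.le, norm_zero]
          exact le_trans (by positivity) hS
      rw [integral_mul_eq_neg_integral_primitive (hm n) (hm (n + 1)) (h0 n) (h0 (n + 1)) (hC n)
        (hC (n + 1)) (hlim n) (heq n) hbT hφ.continuous hφb
        (hbd φ A hA0 hφb hA (A * Real.exp (l * b) + A / l * Real.exp (l * b))
          (le_add_of_nonneg_right (by positivity))) hΦ hΦb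
        (hbd Φ (A / l) (by positivity) hΦb hΦA _ (le_add_of_nonneg_left (by positivity))) hd, norm_neg]
      refine (ih (n + 1) Φ (A / l) hΦ hΦb hΦA).trans (le_of_eq ?_)
      rw [hl, pow_succ, pow_succ]
      field_simp
  obtain ⟨A, hA⟩ := (isCompact_Icc (a := (0 : ℝ)) (b := b)).exists_bound_of_continuousOn
    hφ.continuous.continuousOn
  have hA0 : 0 ≤ A := (norm_nonneg _).trans (hA 0 ⟨le_rfl, hb.le⟩)
  have h1 := fun m => claim m 0 φ A hφ hφb fun t ht htb => (hA t ⟨ht, htb⟩).trans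
    (le_mul_of_one_le_right hA0 (Real.one_le_exp (mul_nonneg l0.le (by linarith))))
  have h2 : Tendsto (fun m : ℕ => A * Real.exp (l * b) * (C * M ^ 0) * b * (1 / 2 : ℝ) ^ m) atTop
      (𝓝 0) := by
    have := (tendsto_pow_atTop_nhds_zero_of_lt_one (by norm_num : (0 : ℝ) ≤ 1 / 2)
      (by norm_num)).const_mul (A * Real.exp (l * b) * (C * M ^ 0) * b)
    rwa [mul_zero] at this
  exact norm_le_zero_iff.1 (ge_of_tendsto' h2 h1)

end Time

/-! ### Multipliers for the uniqueness proof, in particular on annuli. -/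

section Symbols

/-- Bounded integrable functions, with both norms at most `C`. -/
structure IsBdd (θ : E3 → ℂ) (C : ℝ≥0) : Prop where
  measurable : Measurable θ
  lintegral_le : ∫⁻ x, ‖θ x‖ₑ ≤ C
  enorm_le : ∀ x, ‖θ x‖ₑ ≤ C

theorem HasFourierBound.isBdd {m : E3 → ℂ} {C : ℝ} (h : HasFourierBound m C) :
    IsBdd (𝓕⁻ m) C.toNNReal := by
  refine ⟨(continuous_fourierInv h.integrable).measurable, ?_, fun x => ?_⟩
  · simp_rw [← ofReal_norm]
    rw [← ofReal_integral_eq_lintegral_ofReal h.integrable_fourierInv.norm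
      (ae_of_all _ fun _ => norm_nonneg _)]
    exact ENNReal.ofReal_le_ofReal h.integral_norm_fourierInv_le
  · rw [← ofReal_norm]
    exact ENNReal.ofReal_le_ofReal ((norm_fourierInv_le m x).trans h.integral_norm_le)

theorem exists_isBdd_schwartz : ∃ K : ℝ, 0 ≤ K ∧ ∀ G : SchwartzMap E3 ℂ,
    IsBdd G (K * schwartzBound 4 G).toNNReal := by
  have hi := integrable_decayWeight (a := 0) (b := 4) (by norm_num) (by norm_num)
  set I : ℝ := ∫ ξ : E3, decayWeight 0 4 ‖ξ‖ with hI
  have hI0 : 0 ≤ I := integral_nonneg fun ξ => decayWeight_nonneg (norm_nonneg _)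
  refine ⟨1 + I, by positivity, fun G => ⟨G.continuous.measurable, ?_, fun x => ?_⟩⟩
  · have h0 : 0 ≤ schwartzBound 4 G := apply_nonneg _ _
    simp_rw [← ofReal_norm]
    rw [← ofReal_integral_eq_lintegral_ofReal G.integrable.norm
      (ae_of_all _ fun _ => norm_nonneg _)]
    refine ENNReal.ofReal_le_ofReal ?_
    calc ∫ x, ‖G x‖ ≤ ∫ x : E3, schwartzBound 4 G * decayWeight 0 4 ‖x‖ := by
          refine integral_mono_ae G.integrable.norm (hi.const_mul _) ?_
          filter_upwards [ae_ne_zero] with x hx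
          exact_mod_cast (isSymbol_schwartz 4 G).norm_le hx
      _ = schwartzBound 4 G * I := integral_const_mul _ _
      _ ≤ _ := by nlinarith
  · rw [← ofReal_norm]
    refine ENNReal.ofReal_le_ofReal ?_
    have h1 := le_schwartzBound (N := 4) (k := 0) (n := 0) (by norm_num) (by norm_num) G x
    rw [pow_zero, norm_iteratedFDeriv_zero] at h1
    have h0 : 0 ≤ schwartzBound 4 G := apply_nonneg _ _
    nlinarith

theorem isSymbol_coord_rpow (l : Fin 3) :
    IsSymbol (fun r => 1 * r ^ (1 : ℝ)) (fun ξ : E3 => ((ξ l : ℝ) : ℂ)) :=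
  (isSymbol_coord l).mono fun r _ => by rw [one_mul, Real.rpow_one]

theorem exists_isSymbol_coord_frac {α : ℝ} (l : Fin 3) : ∃ C, 0 ≤ C ∧
    IsSymbol (fun r => C * r ^ (2 * α + 1)) fun ξ : E3 => ((ξ l : ℝ) : ℂ) * (fracSymbol α ξ : ℂ) := by
  obtain ⟨C, hC, H⟩ := isSymbol_fracSymbol α
  refine ⟨4 * C, by positivity, ((isSymbol_coord l).mul H).mono fun r hr => le_of_eq ?_⟩
  rw [Real.rpow_add hr, Real.rpow_one]
  ring

theorem exists_hasFourierBound_coord (l : Fin 3) : ∃ (K : ℝ) (N : ℕ), 0 ≤ K ∧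
    ∀ G : SchwartzMap E3 ℂ,
      HasFourierBound (fun ξ => ((ξ l : ℝ) : ℂ) * G ξ) (K * schwartzBound N G) :=
  exists_hasFourierBound_mul (by norm_num) zero_le_one (isSymbol_coord_rpow l)

/-- The coordinate factor coming from the curl raises the order at the origin to `2α + 1`, which
exceeds `1/2` for every `α > 0`. -/
theorem exists_hasFourierBound_coord_frac {α : ℝ} (hα : 0 < α) (l : Fin 3) :
    ∃ (K : ℝ) (N : ℕ), 0 ≤ K ∧ ∀ G : SchwartzMap E3 ℂ,
      HasFourierBound (fun ξ => ((ξ l : ℝ) : ℂ) * (fracSymbol α ξ : ℂ) * G ξ)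
        (K * schwartzBound N G) := by
  obtain ⟨C, hC, H⟩ := exists_isSymbol_coord_frac (α := α) l
  exact exists_hasFourierBound_mul (by linarith) hC H

/-- Smooth functions whose support is compact and does not contain the origin. -/
structure IsAnnular (m : E3 → ℂ) : Prop where
  smooth : ContDiff ℝ (⊤ : ℕ∞) m
  compact : HasCompactSupport m
  notMem : (0 : E3) ∉ tsupport m

/-- A smooth annular function as a Schwartz function. -/
def IsAnnular.toSchwartz {m : E3 → ℂ} (h : IsAnnular m) : SchwartzMap E3 ℂ :=
  h.compact.toSchwartzMap h.smooth

theorem IsAnnular.coe_toSchwartz {m : E3 → ℂ} (h : IsAnnular m) : ⇑h.toSchwartz = m := rfl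

/-- Near the origin the product vanishes identically, so a singularity of `g` there is harmless. -/
theorem IsAnnular.mul {m g : E3 → ℂ} (h : IsAnnular m)
    (hg : ∀ ξ ≠ 0, ContDiffAt ℝ (⊤ : ℕ∞) g ξ) : IsAnnular fun ξ => g ξ * m ξ := by
  have hsub : tsupport (fun ξ => g ξ * m ξ) ⊆ tsupport m := tsupport_mul_subset_right
  refine ⟨contDiff_iff_contDiffAt.2 fun ξ => ?_, h.compact.mul_left, fun h0 => h.notMem (hsub h0)⟩
  rcases eq_or_ne ξ 0 with rfl | hξ
  · have : (fun ξ => g ξ * m ξ) =ᶠ[𝓝 0] fun _ => 0 := by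
      filter_upwards [notMem_tsupport_iff_eventuallyEq.1 h.notMem] with ξ hξ
      rw [hξ, Pi.zero_apply, mul_zero]
    exact contDiffAt_const.congr_of_eventuallyEq this
  · exact (hg ξ hξ).mul h.smooth.contDiffAt

theorem contDiffAt_fracSymbol (α : ℝ) {ξ : E3} (hξ : ξ ≠ 0) :
    ContDiffAt ℝ (⊤ : ℕ∞) (fun ξ : E3 => (fracSymbol α ξ : ℂ)) ξ := by
  have h1 : ContDiffAt ℝ (⊤ : ℕ∞) (fun ξ : E3 => 2 * Real.pi * ‖ξ‖) ξ :=
    contDiffAt_const.mul (contDiffAt_norm ℝ hξ)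
  have hpos : 0 < 2 * Real.pi * ‖ξ‖ := by positivity
  exact Complex.ofRealCLM.contDiff.contDiffAt.comp ξ (h1.rpow_const_of_ne hpos.ne')

theorem contDiffAt_coord_div (l : Fin 3) {ξ : E3} (hξ : ξ ≠ 0) :
    ContDiffAt ℝ (⊤ : ℕ∞) (fun ξ : E3 => ((ξ l / ‖ξ‖ ^ 2 : ℝ) : ℂ)) ξ := by
  have h1 : ContDiffAt ℝ (⊤ : ℕ∞) (fun ξ : E3 => ‖ξ‖ ^ 2) ξ := (contDiff_norm_sq ℝ).contDiffAt
  have h2 : ContDiffAt ℝ (⊤ : ℕ∞) (fun ξ : E3 => ξ l) ξ :=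
    (EuclideanSpace.proj (𝕜 := ℝ) l).contDiff.contDiffAt
  exact Complex.ofRealCLM.contDiff.contDiffAt.comp ξ (h2.div h1 (by positivity))

theorem IsAnnular.frac_pow_mul {m : E3 → ℂ} (h : IsAnnular m) (α : ℝ) (n : ℕ) :
    IsAnnular fun ξ => (fracSymbol α ξ : ℂ) ^ n * m ξ :=
  h.mul fun _ hξ => (contDiffAt_fracSymbol α hξ).pow n

/-- The derivatives are only known to exist as line derivatives; beyond radius `R` they vanish by
uniqueness of derivatives, since the open set is not left along short segments. The truncation makes
multiplication by `|ξ|^{2α}` a bounded operation. -/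
theorem IsSymbol.of_eq_zero {w : ℝ → ℝ} {m : E3 → ℂ} (h : IsSymbol w m) {R : ℝ}
    (h0 : ∀ ξ, R < ‖ξ‖ → m ξ = 0) : IsSymbol (fun r => if r ≤ R then w r else 0) m := by
  refine ⟨h.measurable, fun i => ?_⟩
  obtain ⟨m', m'', h1, h2, h3⟩ := h.deriv i
  refine ⟨m', m'', h1, h2, fun ξ hξ => ?_⟩
  obtain ⟨h4, h5, h6, h7, h8⟩ := h3 ξ hξ
  refine ⟨h4, h5, ?_⟩
  by_cases hR : ‖ξ‖ ≤ R
  · simp only [if_pos hR]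
    exact ⟨h6, h7, h8⟩
  · simp only [if_neg hR]
    have hopen : IsOpen {ξ : E3 | R < ‖ξ‖} := isOpen_lt continuous_const continuous_norm
    have hline : ∀ ξ : E3, R < ‖ξ‖ → ∀ᶠ t : ℝ in 𝓝 0, R < ‖ξ + t • e i‖ := by
      intro ξ hξR
      have hc : Continuous fun t : ℝ => ξ + t • e i := by fun_prop
      exact hc.continuousAt.eventually (hopen.mem_nhds (by simpa using hξR))
    have z1 : ∀ ξ, ξ ≠ 0 → R < ‖ξ‖ → m' ξ = 0 := by
      intro ξ hξ0 hξR
      have h9 : HasDerivAt (fun t : ℝ => m (ξ + t • e i)) 0 0 :=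
        (hasDerivAt_const (0 : ℝ) (0 : ℂ)).congr_of_eventuallyEq
          ((hline ξ hξR).mono fun t ht => h0 _ ht)
      exact HasDerivAt.unique (h3 ξ hξ0).1 h9
    have z2 : m'' ξ = 0 := by
      have hne : ∀ᶠ t : ℝ in 𝓝 0, ξ + t • e i ≠ 0 := by
        have hc : Continuous fun t : ℝ => ξ + t • e i := by fun_prop
        exact hc.continuousAt.eventually (isOpen_ne.mem_nhds (by simpa using hξ))
      have h9 : HasDerivAt (fun t : ℝ => m' (ξ + t • e i)) 0 0 :=
        (hasDerivAt_const (0 : ℝ) (0 : ℂ)).congr_of_eventuallyEq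
          (((hline ξ (not_le.1 hR)).and hne).mono fun t ht => z1 _ ht.2 ht.1)
      exact HasDerivAt.unique h5 h9
    rw [h0 ξ (not_le.1 hR), z1 ξ hξ (not_le.1 hR), z2]
    simp

/-- On the support `|ξ| ≤ R`, each multiplication by `|2πξ|^{2α}` enlarges the symbol bound by a
fixed factor, so `n` powers cost only `Mⁿ`. The coordinate factor brings order one at the origin for
the `L¹` criterion. -/
theorem IsAnnular.exists_hasFourierBound {m : E3 → ℂ} (h : IsAnnular m) {α : ℝ} (hα : 0 < α) :
    ∃ C M : ℝ, 0 ≤ C ∧ 0 < M ∧ ∀ (n : ℕ) (l : Fin 3), HasFourierBound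
      (fun ξ => ((ξ l : ℝ) : ℂ) * ((fracSymbol α ξ : ℂ) ^ n * m ξ)) (C * M ^ n) := by
  obtain ⟨K, hK, hb⟩ := NonlocalStokes.exists_hasFourierBound (a := 1) (by norm_num)
  obtain ⟨C₁, hC₁, H₁⟩ := isSymbol_fracSymbol α
  obtain ⟨R, hR⟩ := h.compact.isBounded.exists_norm_le
  set B := schwartzBound 5 h.toSchwartz with hB
  have hB0 : 0 ≤ B := apply_nonneg _ _
  have h0 : IsSymbol (fun r => if r ≤ R then B * decayWeight 0 5 r else 0) m := by
    have := (isSymbol_schwartz 5 h.toSchwartz).of_eq_zero (R := R) fun ξ hξ =>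
      image_eq_zero_of_notMem_tsupport fun hmem => absurd (hR ξ hmem) (not_le.2 hξ)
    exact_mod_cast this
  -- The `4` is the constant of the product rule for symbols, and `+ 1` ensures positivity even if
  -- `C₁ = 0` or `R = 0`.
  set M : ℝ := 4 * C₁ * |R| ^ (2 * α) + 1 with hM
  have hM0 : 0 < M := by positivity
  have hn : ∀ n : ℕ, IsSymbol (fun r => M ^ n * if r ≤ R then B * decayWeight 0 5 r else 0)
      fun ξ => (fracSymbol α ξ : ℂ) ^ n * m ξ := by
    intro n
    induction n with
    | zero => simpa using h0
    | succ n ih =>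
      have h2 := (H₁.mul ih).mono
        (w' := fun r => M ^ (n + 1) * if r ≤ R then B * decayWeight 0 5 r else 0) fun r hr => by
          split_ifs with hrR
          · have h3 : r ^ (2 * α) ≤ |R| ^ (2 * α) :=
              Real.rpow_le_rpow hr.le (hrR.trans (le_abs_self R)) (by linarith)
            have h4 : 4 * C₁ * r ^ (2 * α) ≤ M := by
              rw [hM]
              nlinarith
            have h5 : 0 ≤ M ^ n * (B * decayWeight 0 5 r) :=
              mul_nonneg (by positivity) (mul_nonneg hB0 (decayWeight_nonneg hr.le))
            calc 4 * (C₁ * r ^ (2 * α) * (M ^ n * (B * decayWeight 0 5 r)))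
                = 4 * C₁ * r ^ (2 * α) * (M ^ n * (B * decayWeight 0 5 r)) := by ring
              _ ≤ M * (M ^ n * (B * decayWeight 0 5 r)) := by gcongr
              _ = _ := by ring
          · simp
      have e1 : (fun ξ => (fracSymbol α ξ : ℂ) ^ (n + 1) * m ξ) =
          fun ξ => (fracSymbol α ξ : ℂ) * ((fracSymbol α ξ : ℂ) ^ n * m ξ) := by
        ext ξ
        ring
      rw [e1]
      exact h2
  refine ⟨K * (4 * B), M, by positivity, hM0, fun n l => ?_⟩
  rw [mul_assoc]
  refine hb _ _ (by positivity) (((isSymbol_coord l).mul (hn n)).mono fun r hr => ?_)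
  have h3 := rpow_mul_decayWeight (a := 0) (b := 5) (c := 1) hr
  rw [Real.rpow_one, add_zero, show (5 : ℝ) - 1 = 4 by norm_num] at h3
  have h4 : 0 ≤ decayWeight 1 4 r := decayWeight_nonneg hr.le
  split_ifs with hrR
  · calc 4 * (r * (M ^ n * (B * decayWeight 0 5 r))) = 4 * B * M ^ n * (r * decayWeight 0 5 r) := by
          ring
      _ ≤ _ := by rw [h3]
  · simp only [mul_zero]
    positivity

end Symbols

/-! ### Pairings of space-time fields with bounded integrable functions. -/

section Pairing

/-- Space-time fields on `(0, T) × ℝ³` whose slices are uniformly small perturbations of bounded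
functionals on `L¹ ∩ L^∞`, and tend to zero at the initial time. -/
structure IsSmall (T : ℝ) (u : ℝ × E3 → E3) : Prop where
  measurable : Measurable u
  eq_zero : ∀ t x, t ∉ Ioo 0 T → u (t, x) = 0
  bound : ∀ ε : ℝ, 0 < ε → ∃ K : ℝ≥0, ∀ᵐ t : ℝ, ∀ (B : E3 → ℝ≥0∞) (M : ℝ≥0), Measurable B →
    (∀ x, B x ≤ M) → ∫⁻ x, ‖u (t, x)‖ₑ * B x ≤ ENNReal.ofReal ε * (∫⁻ x, B x) + K * M
  initial : ∀ ε : ℝ, 0 < ε → ∃ δ : ℝ, 0 < δ ∧ ∀ᵐ t : ℝ, t < δ → ∀ (B : E3 → ℝ≥0∞) (M : ℝ≥0),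
    Measurable B → (∀ x, B x ≤ M) →
      ∫⁻ x, ‖u (t, x)‖ₑ * B x ≤ ENNReal.ofReal ε * ((∫⁻ x, B x) + M)

/-- The pairing of the `k`-th component of a field with a function, at a fixed time. -/
def pair (u : ℝ × E3 → E3) (k : Fin 3) (θ : E3 → ℂ) (t : ℝ) : ℂ := ∫ x, ((u (t, x) k : ℝ) : ℂ) * θ x

/-- The pairing of the `k`-th component of a field with `η ⊗ θ`. -/
def timePair (u : ℝ × E3 → E3) (k : Fin 3) (η : ℝ → ℝ) (θ : E3 → ℂ) : ℂ :=
  ∫ t, (η t : ℂ) * pair u k θ t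

variable {T : ℝ} {u : ℝ × E3 → E3}

theorem enorm_ofReal_coord_le (v : E3) (k : Fin 3) : ‖((v k : ℝ) : ℂ)‖ₑ ≤ ‖v‖ₑ := by
  rw [enorm_le_iff_norm_le, Complex.norm_real]
  exact PiLp.norm_apply_le v k

theorem measurable_coord_mul (hu : Measurable u) {θ : E3 → ℂ} (hθ : Measurable θ) (k : Fin 3) :
    Measurable fun z : ℝ × E3 => ((u z k : ℝ) : ℂ) * θ z.2 := by
  have h1 : Measurable fun z => u z k := (EuclideanSpace.proj (𝕜 := ℝ) k).measurable.comp hu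
  fun_prop

theorem lintegral_enorm_coord_mul_le (u : ℝ × E3 → E3) (k : Fin 3) (θ : E3 → ℂ) (t : ℝ) :
    ∫⁻ x, ‖((u (t, x) k : ℝ) : ℂ) * θ x‖ₑ ≤ ∫⁻ x, ‖u (t, x)‖ₑ * ‖θ x‖ₑ := by
  refine lintegral_mono fun x => ?_
  rw [enorm_mul]
  gcongr
  exact enorm_ofReal_coord_le _ _

theorem enorm_pair_le (u : ℝ × E3 → E3) (k : Fin 3) (θ : E3 → ℂ) (t : ℝ) :
    ‖pair u k θ t‖ₑ ≤ ∫⁻ x, ‖u (t, x)‖ₑ * ‖θ x‖ₑ :=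
  (enorm_integral_le_lintegral_enorm _).trans (lintegral_enorm_coord_mul_le u k θ t)

theorem measurable_pair (hu : Measurable u) {θ : E3 → ℂ} (hθ : Measurable θ) (k : Fin 3) :
    Measurable (pair u k θ) :=
  (StronglyMeasurable.integral_prod_right' (f := fun z : ℝ × E3 => ((u z k : ℝ) : ℂ) * θ z.2)
    (measurable_coord_mul hu hθ k).stronglyMeasurable).measurable

theorem IsSmall.pair_eq_zero (hu : IsSmall T u) (k : Fin 3) (θ : E3 → ℂ) {t : ℝ} (ht : t ∉ Ioo 0 T) :
    pair u k θ t = 0 := by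
  simp [pair, hu.eq_zero t _ ht]

/-- The exceptional set of times does not depend on `θ`, because the defining bound holds at a fixed
time for all weights at once. -/
theorem IsSmall.ae_integrable (hu : IsSmall T u) : ∀ᵐ t : ℝ, ∀ (θ : E3 → ℂ) (C : ℝ≥0), IsBdd θ C →
    ∀ k, Integrable fun x => ((u (t, x) k : ℝ) : ℂ) * θ x := by
  obtain ⟨K, hK⟩ := hu.bound 1 one_pos
  filter_upwards [hK] with t ht θ C hθ k
  refine ⟨((measurable_coord_mul hu.measurable hθ.measurable k).comp
    measurable_prodMk_left).aestronglyMeasurable, ?_⟩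
  refine (lintegral_enorm_coord_mul_le u k θ t).trans_lt
    ((ht _ C hθ.measurable.enorm hθ.enorm_le).trans_lt ?_)
  exact ENNReal.add_lt_top.2 ⟨ENNReal.mul_lt_top ENNReal.ofReal_lt_top
    (hθ.lintegral_le.trans_lt ENNReal.coe_lt_top), ENNReal.mul_lt_top ENNReal.coe_lt_top
    ENNReal.coe_lt_top⟩

theorem IsSmall.exists_norm_pair_le (hu : IsSmall T u) : ∃ K : ℝ, 0 ≤ K ∧ ∀ᵐ t : ℝ,
    ∀ (θ : E3 → ℂ) (C : ℝ≥0), IsBdd θ C → ∀ k, ‖pair u k θ t‖ ≤ K * C := by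
  obtain ⟨K, hK⟩ := hu.bound 1 one_pos
  refine ⟨1 + K, by positivity, ?_⟩
  filter_upwards [hK] with t ht θ C hθ k
  have h1 : ‖pair u k θ t‖ₑ ≤ ((1 + K) * C : ℝ≥0) := by
    refine (enorm_pair_le u k θ t).trans ((ht _ C hθ.measurable.enorm hθ.enorm_le).trans ?_)
    rw [ENNReal.ofReal_one, one_mul, add_mul, one_mul, ENNReal.coe_add, ENNReal.coe_mul]
    exact add_le_add_left hθ.lintegral_le _
  rw [enorm_eq_nnnorm, ENNReal.coe_le_coe] at h1
  exact_mod_cast h1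

theorem IsSmall.exists_norm_pair_le_initial (hu : IsSmall T u) {ε : ℝ} (hε : 0 < ε) :
    ∃ δ : ℝ, 0 < δ ∧ ∀ᵐ t : ℝ, t < δ → ∀ (θ : E3 → ℂ) (C : ℝ≥0), IsBdd θ C →
      ∀ k, ‖pair u k θ t‖ ≤ ε * C := by
  obtain ⟨δ, hδ, h⟩ := hu.initial (ε / 2) (by positivity)
  refine ⟨δ, hδ, ?_⟩
  filter_upwards [h] with t ht htδ θ C hθ k
  have h1 : ‖pair u k θ t‖ₑ ≤ ENNReal.ofReal (ε * C) := by
    refine (enorm_pair_le u k θ t).trans ((ht htδ _ C hθ.measurable.enorm hθ.enorm_le).trans ?_)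
    calc ENNReal.ofReal (ε / 2) * ((∫⁻ x, ‖θ x‖ₑ) + C) ≤ ENNReal.ofReal (ε / 2) * (C + C) := by
          exact mul_le_mul_right (add_le_add_left hθ.lintegral_le _) _
      _ = ENNReal.ofReal (ε * C) := by
          rw [← ENNReal.ofReal_coe_nnreal, ← ENNReal.ofReal_add C.coe_nonneg C.coe_nonneg,
            ← ENNReal.ofReal_mul (by positivity)]
          congr 1
          ring
  rw [← ofReal_norm] at h1
  exact (ENNReal.ofReal_le_ofReal_iff (by positivity)).1 h1

theorem IsSmall.exists_norm_timePair_le (hu : IsSmall T u) {η : ℝ → ℝ} (hη : Continuous η) :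
    ∃ A : ℝ, 0 ≤ A ∧ ∀ (θ : E3 → ℂ) (C : ℝ≥0), IsBdd θ C → ∀ k,
      Integrable (fun t => (η t : ℂ) * pair u k θ t) ∧ ‖timePair u k η θ‖ ≤ A * C := by
  obtain ⟨K, hK, h⟩ := hu.exists_norm_pair_le
  obtain ⟨S, hS⟩ := (isCompact_Icc (a := (0 : ℝ)) (b := T)).exists_bound_of_continuousOn
    hη.continuousOn
  refine ⟨(volume (Ioo 0 T)).toReal * (|S| * K), by positivity, fun θ C hθ k => ?_⟩
  have hb : ∀ᵐ t, ‖(η t : ℂ) * pair u k θ t‖ ≤ (Ioo 0 T).indicator (fun _ => |S| * (K * C)) t := by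
    filter_upwards [h] with t ht
    by_cases hT : t ∈ Ioo 0 T
    · rw [indicator_of_mem hT, norm_mul, Complex.norm_real]
      have := (hS t ⟨hT.1.le, hT.2.le⟩).trans (le_abs_self S)
      have := ht θ C hθ k
      gcongr
    · rw [indicator_of_notMem hT, hu.pair_eq_zero k θ hT, mul_zero, norm_zero]
  have hi : Integrable ((Ioo 0 T).indicator fun _ : ℝ => |S| * (K * C)) := by
    rw [integrable_indicator_iff measurableSet_Ioo]
    exact integrableOn_const (by simp)
  have hm : Measurable fun t => (η t : ℂ) * pair u k θ t :=
    Measurable.mul (by fun_prop) (measurable_pair hu.measurable hθ.measurable k)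
  refine ⟨hi.mono' hm.aestronglyMeasurable hb, (norm_integral_le_of_norm_le hi hb).trans
    (le_of_eq ?_)⟩
  rw [integral_indicator measurableSet_Ioo, setIntegral_const, measureReal_def, smul_eq_mul]
  ring

theorem IsSmall.integrable_mul_pair (hu : IsSmall T u) {η : ℝ → ℝ} (hη : Continuous η) {θ : E3 → ℂ}
    {C : ℝ≥0} (hθ : IsBdd θ C) (k : Fin 3) : Integrable fun t => (η t : ℂ) * pair u k θ t := by
  obtain ⟨A, -, h⟩ := hu.exists_norm_timePair_le hη
  exact (h θ C hθ k).1

theorem IsSmall.ae_pair_add (hu : IsSmall T u) : ∀ᵐ t : ℝ, ∀ {θ₁ θ₂ : E3 → ℂ} {C₁ C₂ : ℝ≥0},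
    IsBdd θ₁ C₁ → IsBdd θ₂ C₂ → ∀ k, pair u k (fun x => θ₁ x + θ₂ x) t =
      pair u k θ₁ t + pair u k θ₂ t := by
  filter_upwards [hu.ae_integrable] with t ht θ₁ θ₂ C₁ C₂ h₁ h₂ k
  rw [pair, pair, pair, ← integral_add (ht _ _ h₁ k) (ht _ _ h₂ k)]
  simp_rw [mul_add]

theorem IsSmall.timePair_add (hu : IsSmall T u) {η : ℝ → ℝ} (hη : Continuous η) {θ₁ θ₂ : E3 → ℂ}
    {C₁ C₂ : ℝ≥0} (h₁ : IsBdd θ₁ C₁) (h₂ : IsBdd θ₂ C₂) (k : Fin 3) :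
    timePair u k η (fun x => θ₁ x + θ₂ x) = timePair u k η θ₁ + timePair u k η θ₂ := by
  rw [timePair, timePair, timePair, ← integral_add (hu.integrable_mul_pair hη h₁ k)
    (hu.integrable_mul_pair hη h₂ k)]
  refine integral_congr_ae ?_
  filter_upwards [hu.ae_pair_add] with t ht
  rw [ht h₁ h₂, mul_add]

theorem pair_const_mul (u : ℝ × E3 → E3) (k : Fin 3) (c : ℂ) (θ : E3 → ℂ) (t : ℝ) :
    pair u k (fun x => c * θ x) t = c * pair u k θ t := by
  rw [pair, pair, ← integral_const_mul]
  refine integral_congr_ae (ae_of_all _ fun x => ?_)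
  dsimp only
  ring

theorem timePair_const_mul (u : ℝ × E3 → E3) (k : Fin 3) (η : ℝ → ℝ) (c : ℂ) (θ : E3 → ℂ) :
    timePair u k η (fun x => c * θ x) = c * timePair u k η θ := by
  rw [timePair, timePair, ← integral_const_mul]
  refine integral_congr_ae (ae_of_all _ fun t => ?_)
  dsimp only
  rw [pair_const_mul]
  ring

theorem IsSmall.timePair_sum (hu : IsSmall T u) {η : ℝ → ℝ} (hη : Continuous η) {θ : Fin 3 → E3 → ℂ}
    {C : Fin 3 → ℝ≥0} (h : ∀ l, IsBdd (θ l) (C l)) (k : Fin 3) :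
    timePair u k η (fun x => ∑ l, θ l x) = ∑ l, timePair u k η (θ l) := by
  simp only [timePair]
  rw [← integral_finsetSum _ fun l _ => hu.integrable_mul_pair hη (h l) k]
  refine integral_congr_ae ?_
  filter_upwards [hu.ae_integrable] with t ht
  rw [← Finset.mul_sum]
  congr 1
  simp only [pair]
  rw [← integral_finsetSum _ fun l _ => ht _ _ (h l) k]
  simp_rw [Finset.mul_sum]

end Pairing

/-! ### Frequencies away from the origin. -/

section Annular

/-- The difference of two solutions of the Stokes system, tested against tensor products whose
spatial factor is given by its Fourier transform. The pressure is eliminated by taking the curl. -/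
structure IsHomogeneous (α T : ℝ) (u : ℝ × E3 → E3) : Prop where
  curl : ∀ η : ℝ → ℝ, ContDiff ℝ (⊤ : ℕ∞) η → HasCompactSupport η → tsupport η ⊆ Ioo 0 T →
    ∀ (m : SchwartzMap E3 ℂ) (k l : Fin 3),
      timePair u k (deriv η) (𝓕⁻ fun ξ : E3 => ((ξ l : ℝ) : ℂ) * m ξ) -
        timePair u k η (𝓕⁻ fun ξ : E3 => ((ξ l : ℝ) : ℂ) * (fracSymbol α ξ : ℂ) * m ξ) =
      timePair u l (deriv η) (𝓕⁻ fun ξ : E3 => ((ξ k : ℝ) : ℂ) * m ξ) -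
        timePair u l η (𝓕⁻ fun ξ : E3 => ((ξ k : ℝ) : ℂ) * (fracSymbol α ξ : ℂ) * m ξ)
  div : ∀ η : ℝ → ℝ, ContDiff ℝ (⊤ : ℕ∞) η → HasCompactSupport η → tsupport η ⊆ Ioo 0 T →
    ∀ m : SchwartzMap E3 ℂ, ∑ k, timePair u k η (𝓕⁻ fun ξ : E3 => ((ξ k : ℝ) : ℂ) * m ξ) = 0

variable {α T : ℝ} {u : ℝ × E3 → E3}

theorem exists_eq_zero_of_le {φ : ℝ → ℝ} (hT : 0 < T) (hφc : HasCompactSupport φ)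
    (hφT : tsupport φ ⊆ Ioo 0 T) : ∃ b, 0 < b ∧ b < T ∧ ∀ t, b ≤ t → φ t = 0 := by
  rcases (tsupport φ).eq_empty_or_nonempty with h | h
  · exact ⟨T / 2, by positivity, by linarith, fun t _ =>
      image_eq_zero_of_notMem_tsupport (by simp [h])⟩
  · obtain ⟨s, hs, hmax⟩ := hφc.exists_isMaxOn h continuousOn_id
    have hsT := hφT hs
    refine ⟨(s + T) / 2, by linarith [hsT.1, hsT.2], by linarith [hsT.2], fun t ht =>
      image_eq_zero_of_notMem_tsupport fun hmem => ?_⟩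
    have : t ≤ s := hmax hmem
    linarith [hsT.2]

/-- Let `aₙ` be the `(k,l)` curl component paired with the symbol carrying `n` powers of
`|2πξ|^{2α}`. The homogeneous equation reads `aₙ' = -aₙ₊₁`, the annular support gives `|aₙ| ≤ C Mⁿ`,
and the initial values vanish, so the hierarchy is trivial and `a₀ = 0`. -/
theorem timePair_curl_annular (hα : 0 < α) (hT : 0 < T) (hu : IsSmall T u)
    (hH : IsHomogeneous α T u) {m : E3 → ℂ} (hm : IsAnnular m) {φ : ℝ → ℝ}
    (hφ : ContDiff ℝ (⊤ : ℕ∞) φ) (hφc : HasCompactSupport φ) (hφT : tsupport φ ⊆ Ioo 0 T)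
    (k l : Fin 3) :
    timePair u k φ (𝓕⁻ fun ξ : E3 => ((ξ l : ℝ) : ℂ) * m ξ) =
      timePair u l φ (𝓕⁻ fun ξ : E3 => ((ξ k : ℝ) : ℂ) * m ξ) := by
  obtain ⟨C, M, hC, hM, hF⟩ := hm.exists_hasFourierBound hα
  obtain ⟨K, hK, hKb⟩ := hu.exists_norm_pair_le
  obtain ⟨b, hb, hbT, hφb⟩ := exists_eq_zero_of_le hT hφc hφT
  set θ : ℕ → Fin 3 → E3 → ℂ := fun n l =>
    𝓕⁻ fun ξ : E3 => ((ξ l : ℝ) : ℂ) * ((fracSymbol α ξ : ℂ) ^ n * m ξ) with hθ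
  have hθb : ∀ n l, IsBdd (θ n l) (C * M ^ n).toNNReal := fun n l => (hF n l).isBdd
  have hco : ∀ n, (((C * M ^ n).toNNReal : ℝ≥0) : ℝ) = C * M ^ n := fun n =>
    Real.coe_toNNReal _ (by positivity)
  have hcont : ∀ {η : ℝ → ℝ}, ContDiff ℝ (⊤ : ℕ∞) η → Continuous (deriv η) := fun h =>
    h.continuous_deriv (by simp)
  have hsub : ∀ {η : ℝ → ℝ}, Continuous η → ∀ n,
      ∫ t, (η t : ℂ) * (pair u k (θ n l) t - pair u l (θ n k) t) =
        timePair u k η (θ n l) - timePair u l η (θ n k) := by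
    intro η hη n
    rw [timePair, timePair, ← integral_sub (hu.integrable_mul_pair hη (hθb n l) k)
      (hu.integrable_mul_pair hη (hθb n k) l)]
    simp_rw [mul_sub]
  have key := integral_mul_eq_zero_of_hierarchy (C := 2 * K * C) hM
    (a := fun n t => pair u k (θ n l) t - pair u l (θ n k) t)
    (fun n => (measurable_pair hu.measurable (hθb n l).measurable k).sub
      (measurable_pair hu.measurable (hθb n k).measurable l))
    (fun n t ht => by
      have ht' : t ∉ Ioo 0 T := fun h => absurd h.1 (not_lt.2 ht)
      simp only [hu.pair_eq_zero _ _ ht', sub_zero])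
    (fun n => by
      filter_upwards [hKb] with t ht
      have h1 := ht _ _ (hθb n l) k
      have h2 := ht _ _ (hθb n k) l
      rw [hco] at h1 h2
      refine (norm_sub_le _ _).trans ?_
      linarith)
    (fun n ε hε => by
      obtain ⟨δ, hδ, h⟩ := hu.exists_norm_pair_le_initial (ε := ε / (2 * (C * M ^ n) + 1))
        (by positivity)
      refine ⟨δ, hδ, ?_⟩
      filter_upwards [h] with t ht htδ
      have h1 := ht htδ _ _ (hθb n l) k
      have h2 := ht htδ _ _ (hθb n k) l
      rw [hco] at h1 h2
      refine (norm_sub_le _ _).trans ((add_le_add h1 h2).trans ?_)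
      rw [← mul_add, div_mul_eq_mul_div, div_le_iff₀ (by positivity)]
      nlinarith [mul_nonneg hC (pow_pos hM n).le])
    (fun n η hη hηc hηT => by
      rw [hsub (hcont hη), hsub hη.continuous]
      have h1 := hH.curl η hη hηc hηT (hm.frac_pow_mul α n).toSchwartz k l
      have e1 : ∀ l, θ (n + 1) l = 𝓕⁻ fun ξ : E3 => ((ξ l : ℝ) : ℂ) * (fracSymbol α ξ : ℂ) *
          (hm.frac_pow_mul α n).toSchwartz ξ := by
        intro l
        refine congrArg (fun m : E3 → ℂ => 𝓕⁻ m) (funext fun ξ => ?_)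
        rw [IsAnnular.coe_toSchwartz]
        ring
      rw [e1, e1]
      exact sub_eq_sub_iff_sub_eq_sub.1 h1)
    hφ hb hbT hφb
  rw [hsub hφ.continuous, sub_eq_zero] at key
  simpa [hθ] using key

theorem fourierInv_add_apply {m₁ m₂ : E3 → ℂ} (h₁ : Integrable m₁) (h₂ : Integrable m₂) (x : E3) :
    𝓕⁻ (fun ξ => m₁ ξ + m₂ ξ) x = 𝓕⁻ m₁ x + 𝓕⁻ m₂ x := by
  simp only [fourierInv_eq_mul]
  rw [← integral_add (integrable_mul_fourierChar h₁ x) (integrable_mul_fourierChar h₂ x)]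
  simp_rw [add_mul]

theorem fourierInv_sum_apply {m : Fin 3 → E3 → ℂ} (h : ∀ l, Integrable (m l)) (x : E3) :
    𝓕⁻ (fun ξ => ∑ l, m l ξ) x = ∑ l, 𝓕⁻ (m l) x := by
  simp only [fourierInv_eq_mul]
  rw [← integral_finsetSum _ fun l _ => integrable_mul_fourierChar (h l) x]
  simp_rw [Finset.sum_mul]

theorem sum_coord_mul_coord_div {ξ : E3} (hξ : ξ ≠ 0) :
    ∑ l, ((ξ l : ℝ) : ℂ) * ((ξ l / ‖ξ‖ ^ 2 : ℝ) : ℂ) = 1 := by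
  have h1 : ‖ξ‖ ^ 2 = ∑ l, ξ l ^ 2 := by simp [EuclideanSpace.norm_sq_eq]
  have h2 : ∑ l, ξ l * (ξ l / ‖ξ‖ ^ 2) = 1 := by
    have : ‖ξ‖ ^ 2 ≠ 0 := by positivity
    simp_rw [← mul_div_assoc, ← sq]
    rw [← Finset.sum_div, ← h1, div_self this]
  rw [← Complex.ofReal_one, ← h2]
  push_cast
  rfl

/-- This is the Biot-Savart argument. Writing `m = ∑ ξ_l (ξ_l/|ξ|²) m`, the vanishing curl permits
the exchange of the field index `k` with the derivative index `l`; the sum is then a divergence,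
tested against `(ξ_k/|ξ|²) m`, which is smooth since `m` vanishes near the origin. -/
theorem timePair_fourierInv_annular (hα : 0 < α) (hT : 0 < T) (hu : IsSmall T u)
    (hH : IsHomogeneous α T u) {m : E3 → ℂ} (hm : IsAnnular m) {φ : ℝ → ℝ}
    (hφ : ContDiff ℝ (⊤ : ℕ∞) φ) (hφc : HasCompactSupport φ) (hφT : tsupport φ ⊆ Ioo 0 T)
    (k : Fin 3) : timePair u k φ (𝓕⁻ m) = 0 := by
  have hml : ∀ l : Fin 3, IsAnnular fun ξ => ((ξ l / ‖ξ‖ ^ 2 : ℝ) : ℂ) * m ξ := fun l =>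
    hm.mul fun _ hξ => contDiffAt_coord_div l hξ
  have hF : ∀ l l' : Fin 3, ∃ C, HasFourierBound
      (fun ξ : E3 => ((ξ l : ℝ) : ℂ) * (((ξ l' / ‖ξ‖ ^ 2 : ℝ) : ℂ) * m ξ)) C := by
    intro l l'
    obtain ⟨C, M, -, -, h⟩ := (hml l').exists_hasFourierBound hα
    exact ⟨_, by simpa using h 0 l⟩
  choose C hC using hF
  have e1 : 𝓕⁻ m = fun x => ∑ l : Fin 3,
      𝓕⁻ (fun ξ : E3 => ((ξ l : ℝ) : ℂ) * (((ξ l / ‖ξ‖ ^ 2 : ℝ) : ℂ) * m ξ)) x := by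
    ext x
    rw [← fourierInv_sum_apply fun l => (hC l l).integrable]
    refine congrArg (fun m : E3 → ℂ => 𝓕⁻ m x) (funext fun ξ => ?_)
    rcases eq_or_ne ξ 0 with rfl | hξ
    · simp [image_eq_zero_of_notMem_tsupport hm.notMem]
    · simp_rw [← mul_assoc]
      rw [← Finset.sum_mul, sum_coord_mul_coord_div hξ, one_mul]
  rw [e1, hu.timePair_sum hφ.continuous (fun l => (hC l l).isBdd)]
  rw [← hH.div φ hφ hφc hφT (hml k).toSchwartz]
  refine Finset.sum_congr rfl fun l _ => ?_
  rw [timePair_curl_annular hα hT hu hH (hml l) hφ hφc hφT k l]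
  congr 2
  ext ξ
  rw [IsAnnular.coe_toSchwartz]
  push_cast
  ring

end Annular

/-! ### Frequencies near the origin. -/

section LowFrequency

theorem fourierInv_scaled {χ : E3 → ℂ} {l : ℝ} (hl : 0 < l) (x : E3) :
    𝓕⁻ (fun ξ => χ (l⁻¹ • ξ)) x = l ^ 3 * 𝓕⁻ χ (l • x) := by
  have h := fourierInv_comp_smul_symbol (m₁ := fun ξ => χ (l⁻¹ • ξ))
    (m₂ := fun ξ => (l : ℂ)⁻¹ * χ ξ) hl (fun η => by
      have : (l : ℂ) ≠ 0 := by exact_mod_cast hl.ne'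
      rw [smul_smul, inv_mul_cancel₀ hl.ne', one_smul, mul_inv_cancel_left₀ this]) x
  have h2 : ∀ y, 𝓕⁻ (fun ξ => (l : ℂ)⁻¹ * χ ξ) y = (l : ℂ)⁻¹ * 𝓕⁻ χ y := by
    intro y
    rw [fourierInv_eq_mul, fourierInv_eq_mul, ← integral_const_mul]
    simp_rw [mul_assoc]
  rw [h, h2]
  have : (l : ℂ) ≠ 0 := by exact_mod_cast hl.ne'
  field_simp

/-- Dilating a symbol dilates its kernel with preservation of the `L¹` norm. Low-pass filters are
therefore bounded on `L¹` uniformly in the cut-off frequency. -/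
theorem lintegral_fourierInv_scaled {χ : E3 → ℂ} (hχ : Integrable χ) {l : ℝ} (hl : 0 < l) :
    ∫⁻ x, ‖𝓕⁻ (fun ξ => χ (l⁻¹ • ξ)) x‖ₑ = ∫⁻ x, ‖𝓕⁻ χ x‖ₑ := by
  have hm : Measurable fun x => ‖𝓕⁻ χ x‖ₑ := (continuous_fourierInv hχ).measurable.enorm
  have h1 : ∀ x, ‖𝓕⁻ (fun ξ => χ (l⁻¹ • ξ)) x‖ₑ = ENNReal.ofReal (l ^ 3) * ‖𝓕⁻ χ (l • x)‖ₑ := by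
    intro x
    rw [fourierInv_scaled hl, enorm_mul, ← Complex.ofReal_pow, ← ofReal_norm,
      Complex.norm_real, Real.norm_of_nonneg (by positivity)]
  simp_rw [h1]
  have hm2 : Measurable fun x : E3 => ‖𝓕⁻ χ (l • x)‖ₑ := hm.comp (measurable_const_smul l)
  rw [lintegral_const_mul _ hm2, lintegral_comp_smul _ hm hl,
    ← mul_assoc, ← ENNReal.ofReal_mul (by positivity), Real.rpow_neg hl.le,
    show (3 : ℝ) = ((3 : ℕ) : ℝ) by norm_num, Real.rpow_natCast, mul_inv_cancel₀ (by positivity),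
    ENNReal.ofReal_one, one_mul]

/-- The product of symbols is written as a convolution with the kernel of `χ`, from which the `L¹`
bound follows by Tonelli. -/
theorem fourierInv_mul_fourier {χ : E3 → ℂ} (hχ : Integrable χ) (θ : SchwartzMap E3 ℂ) (x : E3) :
    𝓕⁻ (fun ξ => χ ξ * 𝓕 θ ξ) x = ∫ z, 𝓕⁻ χ (x + z) * θ (-z) := by
  have h1 := integral_fourierInv_mul (integrable_mul_fourierChar hχ x) (φ := fun z => θ (-z))
    θ.integrable.comp_neg
  have h2 : ∀ z, 𝓕⁻ (fun ξ => χ ξ * (Real.fourierChar (inner ℝ ξ x) : ℂ)) z = 𝓕⁻ χ (x + z) := by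
    intro z
    rw [fourierInv_eq_mul, fourierInv_eq_mul]
    refine integral_congr_ae (ae_of_all _ fun ξ => ?_)
    dsimp only
    rw [inner_add_right, AddChar.map_add_eq_mul, Circle.coe_mul]
    ring
  have h3 : ∀ ξ, 𝓕⁻ (fun z : E3 => θ (-z)) ξ = 𝓕 θ ξ := by
    intro ξ
    rw [SchwartzMap.fourier_coe, Real.fourier_eq, fourierInv_eq_mul, ← integral_neg_eq_self]
    refine integral_congr_ae (ae_of_all _ fun z => ?_)
    dsimp only
    rw [neg_neg, inner_neg_left, Circle.smul_def, smul_eq_mul, mul_comm]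
  simp_rw [h2, h3] at h1
  rw [h1, fourierInv_eq_mul]
  refine integral_congr_ae (ae_of_all _ fun ξ => ?_)
  dsimp only
  ring

theorem lintegral_fourierInv_mul_fourier_le {χ : E3 → ℂ} (hχ : Integrable χ) (θ : SchwartzMap E3 ℂ) :
    ∫⁻ x, ‖𝓕⁻ (fun ξ => χ ξ * 𝓕 θ ξ) x‖ₑ ≤ (∫⁻ x, ‖𝓕⁻ χ x‖ₑ) * ∫⁻ x, ‖θ x‖ₑ := by
  have hm : Measurable (𝓕⁻ χ) := (continuous_fourierInv hχ).measurable
  have hθ : Measurable θ := θ.continuous.measurable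
  have hm2 : Measurable fun w : E3 × E3 => ‖𝓕⁻ χ (w.1 + w.2)‖ₑ * ‖θ (-w.2)‖ₑ := by fun_prop
  calc ∫⁻ x, ‖𝓕⁻ (fun ξ => χ ξ * 𝓕 θ ξ) x‖ₑ
      ≤ ∫⁻ x, ∫⁻ z, ‖𝓕⁻ χ (x + z)‖ₑ * ‖θ (-z)‖ₑ := by
        refine lintegral_mono fun x => ?_
        rw [fourierInv_mul_fourier hχ]
        refine (enorm_integral_le_lintegral_enorm _).trans (le_of_eq ?_)
        simp_rw [enorm_mul]
    _ = ∫⁻ z, ∫⁻ x, ‖𝓕⁻ χ (x + z)‖ₑ * ‖θ (-z)‖ₑ := lintegral_lintegral_swap hm2.aemeasurable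
    _ = ∫⁻ z, (∫⁻ x, ‖𝓕⁻ χ x‖ₑ) * ‖θ (-z)‖ₑ := by
        refine lintegral_congr fun z => ?_
        have h1 : Measurable fun x => ‖𝓕⁻ χ (x + z)‖ₑ := by fun_prop
        rw [lintegral_mul_const _ h1, lintegral_add_right_eq_self (fun x => ‖𝓕⁻ χ x‖ₑ)]
    _ = (∫⁻ x, ‖𝓕⁻ χ x‖ₑ) * ∫⁻ z, ‖θ (-z)‖ₑ := by
        have h1 : Measurable fun z => ‖θ (-z)‖ₑ := by fun_prop
        exact lintegral_const_mul _ h1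
    _ = _ := by rw [lintegral_neg_eq_self (fun z => ‖θ z‖ₑ)]

/-- Low-pass filters are bounded on `L¹` and tend to zero from `L¹` to `L^∞`. -/
theorem exists_lowpass_le {χ : E3 → ℂ} (hχ : Integrable χ) (hχ' : Integrable (𝓕⁻ χ))
    (θ : SchwartzMap E3 ℂ) : ∃ C : ℝ≥0, ∀ l : ℝ, 0 < l →
      ∫⁻ x, ‖𝓕⁻ (fun ξ => χ (l⁻¹ • ξ) * 𝓕 θ ξ) x‖ₑ ≤ C ∧
      ∀ x, ‖𝓕⁻ (fun ξ => χ (l⁻¹ • ξ) * 𝓕 θ ξ) x‖ₑ ≤ C * ENNReal.ofReal (l ^ 3) := by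
  have hfin : (∫⁻ x, ‖𝓕⁻ χ x‖ₑ) * ∫⁻ x, ‖θ x‖ₑ < ∞ := ENNReal.mul_lt_top hχ'.2 θ.integrable.2
  set P := schwartzBound 0 (𝓕 θ)
  have hP : ∀ ξ, ‖𝓕 θ ξ‖ ≤ P := fun ξ => by
    simpa using le_schwartzBound (N := 0) (k := 0) (n := 0) (by norm_num) (by norm_num) (𝓕 θ) ξ
  have hP0 : 0 ≤ P := apply_nonneg _ _
  have h3 : Module.finrank ℝ E3 = 3 := by simp [E3]
  refine ⟨((∫⁻ x, ‖𝓕⁻ χ x‖ₑ) * ∫⁻ x, ‖θ x‖ₑ).toNNReal + (P * ∫ ξ, ‖χ ξ‖).toNNReal,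
    fun l hl => ⟨?_, fun x => ?_⟩⟩
  · have hi : Integrable fun ξ => χ (l⁻¹ • ξ) := hχ.comp_smul (inv_ne_zero hl.ne')
    refine (lintegral_fourierInv_mul_fourier_le hi θ).trans ?_
    rw [lintegral_fourierInv_scaled hχ hl, ENNReal.coe_add, ENNReal.coe_toNNReal hfin.ne]
    exact le_self_add
  · have h4 : ‖𝓕⁻ (fun ξ => χ (l⁻¹ • ξ) * 𝓕 θ ξ) x‖ ≤ P * (∫ ξ, ‖χ ξ‖) * l ^ 3 := by
      refine (norm_fourierInv_le _ _).trans ?_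
      have hi : Integrable fun ξ => ‖χ (l⁻¹ • ξ)‖ := (hχ.comp_smul (inv_ne_zero hl.ne')).norm
      calc ∫ ξ, ‖χ (l⁻¹ • ξ) * 𝓕 θ ξ‖ ≤ ∫ ξ, ‖χ (l⁻¹ • ξ)‖ * P := by
            refine integral_mono_of_nonneg (ae_of_all _ fun _ => norm_nonneg _) (hi.mul_const P)
              (ae_of_all _ fun ξ => ?_)
            dsimp only
            rw [norm_mul]
            gcongr
            exact hP ξ
        _ = _ := by
            rw [integral_mul_const, Measure.integral_comp_smul volume (fun ξ => ‖χ ξ‖), h3,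
              inv_pow, inv_inv, abs_of_pos (by positivity), smul_eq_mul]
            ring
    rw [← ofReal_norm]
    refine (ENNReal.ofReal_le_ofReal h4).trans ?_
    rw [ENNReal.ofReal_mul (mul_nonneg hP0 (integral_nonneg fun _ => norm_nonneg _)), ENNReal.coe_add]
    gcongr
    exact le_add_self

variable {α T : ℝ} {u : ℝ × E3 → E3}

/-- The constant `A` is chosen before `ε`, and only `K` depends on `ε`. The `L¹` size of the test
function can thus be made irrelevant at the price of its supremum; a nonzero constant field would
violate this. -/
theorem IsSmall.exists_norm_timePair_le_add (hu : IsSmall T u) (η : ℝ → ℝ) (hη : Continuous η) :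
    ∃ A : ℝ, 0 ≤ A ∧ ∀ ε : ℝ, 0 < ε → ∃ K : ℝ, 0 ≤ K ∧ ∀ (θ : E3 → ℂ) (C M : ℝ≥0), Measurable θ →
      ∫⁻ x, ‖θ x‖ₑ ≤ C → (∀ x, ‖θ x‖ₑ ≤ M) → ∀ k, ‖timePair u k η θ‖ ≤ A * (ε * C + K * M) := by
  obtain ⟨S, hS⟩ := (isCompact_Icc (a := (0 : ℝ)) (b := T)).exists_bound_of_continuousOn
    hη.continuousOn
  refine ⟨(volume (Ioo 0 T)).toReal * |S|, by positivity, fun ε hε => ?_⟩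
  obtain ⟨K, hK⟩ := hu.bound ε hε
  refine ⟨K, K.2, fun θ C M hθ hC hM k => ?_⟩
  have hb : ∀ᵐ t, ‖(η t : ℂ) * pair u k θ t‖ ≤
      (Ioo 0 T).indicator (fun _ => |S| * (ε * C + K * M)) t := by
    filter_upwards [hK] with t ht
    by_cases hT : t ∈ Ioo 0 T
    · rw [indicator_of_mem hT, norm_mul, Complex.norm_real]
      have h1 := (hS t ⟨hT.1.le, hT.2.le⟩).trans (le_abs_self S)
      have h2 : ‖pair u k θ t‖ ≤ ε * C + K * M := by
        have h3 := (enorm_pair_le u k θ t).trans ((ht _ M hθ.enorm hM).trans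
          (add_le_add_left (mul_le_mul_right hC _) _))
        rw [← ENNReal.ofReal_coe_nnreal (p := C), ← ENNReal.ofReal_mul hε.le, ← ENNReal.coe_mul,
          ← ENNReal.ofReal_coe_nnreal (p := K * M), ← ENNReal.ofReal_add (by positivity)
          (by positivity), ← ofReal_norm, ENNReal.ofReal_le_ofReal_iff (by positivity)] at h3
        exact_mod_cast h3
      gcongr
    · rw [indicator_of_notMem hT, hu.pair_eq_zero k θ hT, mul_zero, norm_zero]
  have hi : Integrable ((Ioo 0 T).indicator fun _ : ℝ => |S| * (ε * C + K * M)) := by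
    rw [integrable_indicator_iff measurableSet_Ioo]
    exact integrableOn_const (by simp)
  refine (norm_integral_le_of_norm_le hi hb).trans (le_of_eq ?_)
  rw [integral_indicator measurableSet_Ioo, setIntegral_const, measureReal_def, smul_eq_mul]
  ring

/-- The low-frequency part of a field does not contribute in the limit. -/
theorem IsSmall.tendsto_timePair_lowpass (hu : IsSmall T u) {η : ℝ → ℝ} (hη : Continuous η)
    {χ : E3 → ℂ} (hχ : Integrable χ) (hχ' : Integrable (𝓕⁻ χ)) (θ : SchwartzMap E3 ℂ) (k : Fin 3) :
    Tendsto (fun l : ℝ => timePair u k η (𝓕⁻ fun ξ => χ (l⁻¹ • ξ) * 𝓕 θ ξ)) (𝓝[>] 0) (𝓝 0) := by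
  obtain ⟨C, hC⟩ := exists_lowpass_le hχ hχ' θ
  obtain ⟨A, hA, hb⟩ := hu.exists_norm_timePair_le_add η hη
  rw [Metric.tendsto_nhds]
  intro ε hε
  -- The small parameter first makes the `L¹` contribution at most `ε/2` for all `l`. Then `K` is
  -- fixed, and the `L^∞` contribution tends to zero like `l³`.
  obtain ⟨K, hK, hKb⟩ := hb (ε / (2 * (A * C + 1))) (by positivity)
  have hlim : Tendsto (fun l : ℝ => A * (K * (C * l ^ 3))) (𝓝[>] 0) (𝓝 0) := by
    have : Continuous fun l : ℝ => A * (K * (C * l ^ 3)) := by fun_prop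
    have h2 := this.tendsto 0
    simp only [ne_eq, OfNat.ofNat_ne_zero, not_false_eq_true, zero_pow, mul_zero] at h2
    exact h2.mono_left nhdsWithin_le_nhds
  filter_upwards [self_mem_nhdsWithin, hlim.eventually (gt_mem_nhds (half_pos hε))] with l hl h1
  have hl0 : 0 < l := hl
  have hi : Integrable fun ξ => χ (l⁻¹ • ξ) * 𝓕 θ ξ :=
    (hχ.comp_smul (inv_ne_zero hl0.ne')).mul_bdd (c := schwartzBound 0 (𝓕 θ))
      (𝓕 θ).continuous.aestronglyMeasurable (ae_of_all _ fun ξ => by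
        simpa using le_schwartzBound (N := 0) (k := 0) (n := 0) (by norm_num) (by norm_num) (𝓕 θ) ξ)
  have h2 := hKb _ C (C * (l ^ 3).toNNReal) (continuous_fourierInv hi).measurable (hC l hl0).1
    (fun x => by
      rw [ENNReal.coe_mul]
      exact (hC l hl0).2 x) k
  rw [dist_zero_right]
  refine h2.trans_lt ?_
  rw [NNReal.coe_mul, Real.coe_toNNReal _ (by positivity), mul_add]
  have h3 : A * (ε / (2 * (A * C + 1)) * C) ≤ ε / 2 := by
    have : 0 ≤ A * C := by positivity
    rw [div_mul_eq_mul_div, mul_div_assoc', div_le_div_iff₀ (by positivity) two_pos]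
    nlinarith
  linarith

end LowFrequency

/-! ### Vanishing of the homogeneous field. -/

section Vanishing

variable {α T : ℝ} {u : ℝ × E3 → E3}

theorem continuous_of_norm_le_schwartzBound (X : SchwartzMap E3 ℂ →ₗ[ℂ] ℂ) {A : ℝ} {N : ℕ}
    (h : ∀ G, ‖X G‖ ≤ A * schwartzBound N G) : Continuous X := by
  refine continuous_of_continuousAt_zero X ?_
  rw [ContinuousAt, map_zero]
  refine squeeze_zero_norm h ?_
  have := ((continuous_schwartzBound N).tendsto 0).const_mul A
  rwa [map_zero, mul_zero] at this

/-- A linear family of bounded functions defines a continuous functional by pairing. -/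
theorem IsSmall.exists_timePair_clm (hu : IsSmall T u) {η : ℝ → ℝ} (hη : Continuous η)
    {Θ : SchwartzMap E3 ℂ → E3 → ℂ} {K : ℝ} {N : ℕ} (hK : 0 ≤ K)
    (hb : ∀ G, IsBdd (Θ G) (K * schwartzBound N G).toNNReal)
    (hadd : ∀ G H x, Θ (G + H) x = Θ G x + Θ H x) (hsmul : ∀ (c : ℂ) G x, Θ (c • G) x = c * Θ G x)
    (k : Fin 3) : ∃ L : SchwartzMap E3 ℂ →L[ℂ] ℂ, ∀ G, L G = timePair u k η (Θ G) := by
  obtain ⟨A, hA, hAb⟩ := hu.exists_norm_timePair_le hη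
  let X : SchwartzMap E3 ℂ →ₗ[ℂ] ℂ :=
    { toFun := fun G => timePair u k η (Θ G)
      map_add' := fun G H => by
        rw [← hu.timePair_add hη (hb G) (hb H), ← funext (hadd G H)]
      map_smul' := fun c G => by
        rw [RingHom.id_apply, smul_eq_mul, ← timePair_const_mul, ← funext (hsmul c G)] }
  have hX : ∀ G, ‖X G‖ ≤ A * K * schwartzBound N G := fun G => by
    have := (hAb (Θ G) _ (hb G) k).2
    rwa [Real.coe_toNNReal _ (mul_nonneg hK (apply_nonneg _ _)), ← mul_assoc] at this
  exact ⟨⟨X, continuous_of_norm_le_schwartzBound X hX⟩, fun G => rfl⟩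

/-- A smooth cut-off function near the origin. -/
def bump : ContDiffBump (0 : E3) := ⟨1, 2, one_pos, one_lt_two⟩

theorem contDiff_bump : ContDiff ℝ (⊤ : ℕ∞) fun x : E3 => ((bump x : ℝ) : ℂ) :=
  Complex.ofRealCLM.contDiff.comp bump.contDiff

theorem hasCompactSupport_bump : HasCompactSupport fun x : E3 => ((bump x : ℝ) : ℂ) :=
  bump.hasCompactSupport.comp_left (g := fun r : ℝ => (r : ℂ)) (by simp)

theorem isAnnular_highpass {m : E3 → ℂ} (hm : ContDiff ℝ (⊤ : ℕ∞) m) (hmc : HasCompactSupport m)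
    {l : ℝ} (hl : 0 < l) : IsAnnular fun ξ => (1 - ((bump (l⁻¹ • ξ) : ℝ) : ℂ)) * m ξ := by
  refine ⟨(contDiff_const.sub (contDiff_bump.comp (contDiff_const_smul _))).mul hm, hmc.mul_left, ?_⟩
  rw [notMem_tsupport_iff_eventuallyEq]
  filter_upwards [Metric.ball_mem_nhds (0 : E3) hl] with ξ hξ
  have h1 : bump (l⁻¹ • ξ) = 1 := by
    refine bump.one_of_mem_closedBall ?_
    rw [mem_closedBall_zero_iff, norm_smul, norm_inv, Real.norm_of_nonneg hl.le,
      inv_mul_le_iff₀ hl]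
    rw [mem_ball_zero_iff] at hξ
    change ‖ξ‖ ≤ l * 1
    linarith
  rw [h1]
  simp

/-- Split `θ` at frequency `l`. The high-pass part is annular and pairs to zero, so the pairing of
the low-pass part equals that of `θ` for every `l`; yet it tends to zero with `l`. -/
theorem timePair_of_hasCompactSupport_fourier (hα : 0 < α) (hT : 0 < T) (hu : IsSmall T u)
    (hH : IsHomogeneous α T u) {φ : ℝ → ℝ} (hφ : ContDiff ℝ (⊤ : ℕ∞) φ) (hφc : HasCompactSupport φ)
    (hφT : tsupport φ ⊆ Ioo 0 T) (θ : SchwartzMap E3 ℂ) (hθ : HasCompactSupport (𝓕 θ : SchwartzMap E3 ℂ)) (k : Fin 3) :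
    timePair u k φ θ = 0 := by
  obtain ⟨K, hK, hb⟩ := exists_isBdd_schwartz
  have hχ : Integrable fun x : E3 => ((bump x : ℝ) : ℂ) :=
    contDiff_bump.continuous.integrable_of_hasCompactSupport hasCompactSupport_bump
  have hχ' : Integrable (𝓕⁻ fun x : E3 => ((bump x : ℝ) : ℂ)) := by
    have := (𝓕⁻ (hasCompactSupport_bump.toSchwartzMap contDiff_bump)).integrable (μ := volume)
    rwa [SchwartzMap.fourierInv_coe] at this
  have hlim := hu.tendsto_timePair_lowpass hφ.continuous hχ hχ' θ k
  have hconst : ∀ l : ℝ, 0 < l →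
      timePair u k φ (𝓕⁻ fun ξ => ((bump (l⁻¹ • ξ) : ℝ) : ℂ) * 𝓕 θ ξ) = timePair u k φ θ := by
    intro l hl
    have ha := isAnnular_highpass (m := (𝓕 θ : SchwartzMap E3 ℂ)) ((𝓕 θ).smooth _) hθ hl
    set A := ha.toSchwartz with hA
    have h0 : timePair u k φ (𝓕⁻ A : SchwartzMap E3 ℂ) = 0 := by
      rw [SchwartzMap.fourierInv_coe, hA, IsAnnular.coe_toSchwartz]
      exact timePair_fourierInv_annular hα hT hu hH ha hφ hφc hφT k
    have e1 : 𝓕⁻ (fun ξ => ((bump (l⁻¹ • ξ) : ℝ) : ℂ) * 𝓕 θ ξ) =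
        (𝓕⁻ (𝓕 θ - A) : SchwartzMap E3 ℂ) := by
      rw [SchwartzMap.fourierInv_coe]
      refine congrArg (fun m : E3 → ℂ => 𝓕⁻ m) (funext fun ξ => ?_)
      rw [_root_.sub_apply, hA, IsAnnular.coe_toSchwartz]
      ring
    have e2 : (θ : E3 → ℂ) = fun x => (𝓕⁻ A : SchwartzMap E3 ℂ) x +
        (𝓕⁻ (𝓕 θ - A) : SchwartzMap E3 ℂ) x := by
      ext x
      rw [← _root_.add_apply, ← FourierTransform.fourierInv_add, add_sub_cancel,
        FourierTransform.fourierInv_fourier_eq]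
    rw [e1]
    conv_rhs => rw [e2, hu.timePair_add hφ.continuous (hb _) (hb _), h0, zero_add]
  refine tendsto_nhds_unique (tendsto_const_nhds.congr' ?_) hlim
  filter_upwards [self_mem_nhdsWithin] with l hl using (hconst l hl).symm

/-- The pairing is continuous in the Schwartz topology, and band-limited functions are dense because
compactly supported ones are dense on the Fourier side. -/
theorem timePair_schwartz_eq_zero (hα : 0 < α) (hT : 0 < T) (hu : IsSmall T u)
    (hH : IsHomogeneous α T u) {φ : ℝ → ℝ} (hφ : ContDiff ℝ (⊤ : ℕ∞) φ) (hφc : HasCompactSupport φ)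
    (hφT : tsupport φ ⊆ Ioo 0 T) (θ : SchwartzMap E3 ℂ) (k : Fin 3) : timePair u k φ θ = 0 := by
  obtain ⟨K, hK, hb⟩ := exists_isBdd_schwartz
  obtain ⟨L, hL⟩ := hu.exists_timePair_clm hφ.continuous hK hb (fun _ _ _ => rfl)
    (fun _ _ _ => rfl) k
  have hX : Continuous fun m : SchwartzMap E3 ℂ => L (𝓕⁻ m) :=
    L.continuous.comp (FourierTransform.fourierInvCLM ℂ (SchwartzMap E3 ℂ)).continuous
  have h0 := eq_zero_of_forall_hasCompactSupport hX (fun m hm => by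
    rw [hL]
    refine timePair_of_hasCompactSupport_fourier hα hT hu hH hφ hφc hφT _ ?_ k
    rwa [FourierTransform.fourier_fourierInv_eq]) (𝓕 θ)
  rwa [FourierTransform.fourierInv_fourier_eq, hL] at h0

theorem IsSmall.ae_pair_eq_zero (hu : IsSmall T u) {θ : SchwartzMap E3 ℂ} {k : Fin 3}
    (h : ∀ φ : ℝ → ℝ, ContDiff ℝ (⊤ : ℕ∞) φ → HasCompactSupport φ → tsupport φ ⊆ Ioo 0 T →
      timePair u k φ θ = 0) : ∀ᵐ t, pair u k θ t = 0 := by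
  obtain ⟨K, hK, hb⟩ := exists_isBdd_schwartz
  have hi : Integrable (pair u k θ) := by
    simpa using hu.integrable_mul_pair (η := fun _ => 1) continuous_const (hb θ) k
  have := isOpen_Ioo.ae_eq_zero_of_integral_contDiff_smul_eq_zero
    (hi.locallyIntegrable.locallyIntegrableOn (Ioo 0 T)) fun φ hφ hφc hφT => by
      simpa only [timePair, Complex.real_smul] using h φ hφ hφc hφT
  filter_upwards [this] with t ht
  by_cases hT : t ∈ Ioo 0 T
  · exact ht hT
  · exact hu.pair_eq_zero k _ hT

/-- A sequence of mollifiers. -/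
def mollifier (n : ℕ) : ContDiffBump (0 : E3) where
  rIn := 1 / ((n : ℝ) + 1)
  rOut := 2 / ((n : ℝ) + 1)
  rIn_pos := by positivity
  rIn_lt_rOut := by gcongr; norm_num

/-- A mollifier centered at `y`, as a Schwartz function. -/
def mollifierAt (n : ℕ) (y : E3) : SchwartzMap E3 ℂ :=
  (show HasCompactSupport fun x : E3 => (((mollifier n).normed volume (y - x) : ℝ) : ℂ) from
    ((mollifier n).hasCompactSupport_normed.comp_homeomorph (Homeomorph.subLeft y)).comp_left
      (g := fun r : ℝ => (r : ℂ)) (by simp)).toSchwartzMap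
    (Complex.ofRealCLM.contDiff.comp ((mollifier n).contDiff_normed.comp
      (contDiff_const.sub contDiff_id)))

theorem mollifierAt_apply (n : ℕ) (y x : E3) :
    mollifierAt n y x = (((mollifier n).normed volume (y - x) : ℝ) : ℂ) := rfl

theorem pair_mollifierAt (u : ℝ × E3 → E3) (k : Fin 3) (n : ℕ) (y : E3) (t : ℝ) :
    pair u k (mollifierAt n y) t = ((convolution ((mollifier n).normed volume)
      (fun x => u (t, x) k) (ContinuousLinearMap.lsmul ℝ ℝ) volume y : ℝ) : ℂ) := by
  rw [pair, convolution_def, ← integral_complex_ofReal,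
    ← integral_sub_left_eq_self (fun x => ((u (t, x) k : ℝ) : ℂ) * mollifierAt n y x) volume y]
  refine integral_congr_ae (ae_of_all _ fun x => ?_)
  dsimp only
  rw [mollifierAt_apply, sub_sub_cancel, ContinuousLinearMap.lsmul_apply, smul_eq_mul]
  push_cast
  ring

theorem measurable_pair_mollifierAt (hu : Measurable u) (k : Fin 3) (n : ℕ) :
    Measurable fun z : ℝ × E3 => pair u k (mollifierAt n z.2) z.1 := by
  have h1 : Measurable fun z => u z k := (EuclideanSpace.proj (𝕜 := ℝ) k).measurable.comp hu
  have h2 : Measurable ((mollifier n).normed (volume : Measure E3)) :=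
    ((mollifier n).contDiff_normed (n := 0)).continuous.measurable
  have h3 : Measurable fun w : (ℝ × E3) × E3 => ((u (w.1.1, w.2) k : ℝ) : ℂ) *
      (((mollifier n).normed volume (w.1.2 - w.2) : ℝ) : ℂ) := by
    have h4 : Measurable fun w : (ℝ × E3) × E3 => u (w.1.1, w.2) k :=
      h1.comp (f := fun w : (ℝ × E3) × E3 => (w.1.1, w.2)) (by fun_prop)
    have h5 : Measurable fun w : (ℝ × E3) × E3 => (mollifier n).normed volume (w.1.2 - w.2) :=
      h2.comp (f := fun w : (ℝ × E3) × E3 => w.1.2 - w.2) (by fun_prop)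
    fun_prop
  exact (StronglyMeasurable.integral_prod_right' h3.stronglyMeasurable).measurable

theorem locallyIntegrable_of_forall_isBdd {g : E3 → ℝ} (hg : ∀ (θ : E3 → ℂ) (C : ℝ≥0), IsBdd θ C →
    Integrable fun x => ((g x : ℝ) : ℂ) * θ x) : LocallyIntegrable g := by
  rw [locallyIntegrable_iff]
  intro K hK
  have hb : IsBdd (K.indicator fun _ => (1 : ℂ)) ((volume K).toNNReal + 1) := by
    refine ⟨measurable_const.indicator hK.measurableSet, ?_, fun x => ?_⟩
    · simp_rw [enorm_indicator_eq_indicator_enorm]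
      rw [lintegral_indicator hK.measurableSet, enorm_one, setLIntegral_one, ENNReal.coe_add,
        ENNReal.coe_toNNReal hK.measure_lt_top.ne]
      exact le_self_add
    · rw [enorm_indicator_eq_indicator_enorm]
      refine (indicator_le_self' (fun _ _ => zero_le) x).trans ?_
      rw [enorm_one]
      push_cast
      exact le_add_self
  have h1 := (hg _ _ hb).re
  rw [← integrable_indicator_iff hK.measurableSet]
  refine h1.congr (ae_of_all _ fun x => ?_)
  by_cases hx : x ∈ K <;> simp [hx]

/-- A field all of whose pairings with tensor products vanish is zero. -/
theorem IsSmall.ae_eq_zero (hu : IsSmall T u) (h : ∀ (k : Fin 3) (θ : SchwartzMap E3 ℂ) (φ : ℝ → ℝ),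
    ContDiff ℝ (⊤ : ℕ∞) φ → HasCompactSupport φ → tsupport φ ⊆ Ioo 0 T → timePair u k φ θ = 0) :
    ∀ᵐ z : ℝ × E3, u z = 0 := by
  have h1 : ∀ᵐ t : ℝ, ∀ (k : Fin 3) (n : ℕ), ∀ᵐ y : E3, pair u k (mollifierAt n y) t = 0 := by
    simp only [ae_all_iff]
    intro k n
    have hm := measurable_pair_mollifierAt hu.measurable k n
    -- For each centre `y` the null set of times depends on `y`. Joint measurability permits the
    -- exchange of the two almost-everywhere quantifiers, so that almost every time works for almost
    -- every centre.
    refine (Measure.ae_ae_comm (p := fun (t : ℝ) (y : E3) => pair u k (mollifierAt n y) t = 0)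
      (hm (measurableSet_singleton 0))).2 (ae_of_all _ fun y => ?_)
    exact hu.ae_pair_eq_zero (h k _)
  have hm : MeasurableSet {z | u z = 0} := hu.measurable (measurableSet_singleton 0)
  rw [Measure.volume_eq_prod, Measure.ae_prod_iff_ae_ae hm]
  filter_upwards [h1, hu.ae_integrable] with t ht hti
  have h2 : ∀ k, ∀ᵐ y, u (t, y) k = 0 := by
    intro k
    have hloc : LocallyIntegrable fun x => u (t, x) k :=
      locallyIntegrable_of_forall_isBdd fun θ C hθ => hti θ C hθ k
    -- At such a time all mollifications vanish almost everywhere, and they converge almost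
    -- everywhere to the field; the outer radii are exactly twice the inner ones, as the
    -- differentiation theorem requires.
    have hconv := ContDiffBump.ae_convolution_tendsto_right_of_locallyIntegrable (φ := mollifier)
      (l := atTop) (K := 2) (by
        have := tendsto_one_div_add_atTop_nhds_zero_nat.const_mul (2 : ℝ)
        rw [mul_zero] at this
        refine this.congr fun n => ?_
        change 2 * (1 / ((n : ℝ) + 1)) = 2 / ((n : ℝ) + 1)
        ring) (Eventually.of_forall fun n => by
          change 2 / ((n : ℝ) + 1) ≤ 2 * (1 / ((n : ℝ) + 1))
          rw [mul_one_div]) hloc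
    filter_upwards [hconv, ae_all_iff.2 (ht k)] with y hy hy0
    refine tendsto_nhds_unique (hy.congr fun n => ?_) (tendsto_const_nhds (x := (0 : ℝ)))
    have h3 := hy0 n
    rw [pair_mollifierAt] at h3
    exact_mod_cast h3
  filter_upwards [ae_all_iff.2 h2] with y hy
  ext k
  exact hy k

theorem IsHomogeneous.ae_eq_zero (hα : 0 < α) (hT : 0 < T) (hu : IsSmall T u)
    (hH : IsHomogeneous α T u) : ∀ᵐ z : ℝ × E3, u z = 0 :=
  hu.ae_eq_zero fun k θ _ hφ hφc hφT => timePair_schwartz_eq_zero hα hT hu hH hφ hφc hφT θ k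

end Vanishing

/-! ### Solutions as small fields. -/

section Small

variable {α T : ℝ} {u : ℝ × E3 → E3}

/-- Two solutions may lie in different Lebesgue spaces, and their difference in neither. Smallness,
being phrased through test weights in `L¹ ∩ L^∞`, survives subtraction. -/
theorem IsSmall.sub {u₁ u₂ : ℝ × E3 → E3} (h₁ : IsSmall T u₁) (h₂ : IsSmall T u₂) :
    IsSmall T fun z => u₁ z - u₂ z := by
  have key : ∀ t (B : E3 → ℝ≥0∞), Measurable B → ∫⁻ x, ‖u₁ (t, x) - u₂ (t, x)‖ₑ * B x ≤
      (∫⁻ x, ‖u₁ (t, x)‖ₑ * B x) + ∫⁻ x, ‖u₂ (t, x)‖ₑ * B x := by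
    intro t B hB
    have hm : Measurable fun x => ‖u₁ (t, x)‖ₑ * B x :=
      (h₁.measurable.comp measurable_prodMk_left).enorm.mul hB
    rw [← lintegral_add_left hm]
    refine lintegral_mono fun x => ?_
    rw [← add_mul]
    gcongr
    exact enorm_sub_le
  refine ⟨h₁.measurable.sub h₂.measurable, fun t x ht => by
    rw [h₁.eq_zero t x ht, h₂.eq_zero t x ht, sub_zero], fun ε hε => ?_, fun ε hε => ?_⟩
  · obtain ⟨K₁, hK₁⟩ := h₁.bound (ε / 2) (by positivity)
    obtain ⟨K₂, hK₂⟩ := h₂.bound (ε / 2) (by positivity)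
    refine ⟨K₁ + K₂, ?_⟩
    filter_upwards [hK₁, hK₂] with t ht₁ ht₂ B M hB hM
    refine (key t B hB).trans ((add_le_add (ht₁ B M hB hM) (ht₂ B M hB hM)).trans (le_of_eq ?_))
    conv_rhs => rw [← add_halves ε, ENNReal.ofReal_add (by positivity) (by positivity)]
    push_cast
    ring
  · obtain ⟨δ₁, hδ₁, hK₁⟩ := h₁.initial (ε / 2) (by positivity)
    obtain ⟨δ₂, hδ₂, hK₂⟩ := h₂.initial (ε / 2) (by positivity)
    refine ⟨min δ₁ δ₂, lt_min hδ₁ hδ₂, ?_⟩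
    filter_upwards [hK₁, hK₂] with t ht₁ ht₂ htδ B M hB hM
    refine (key t B hB).trans ((add_le_add (ht₁ (htδ.trans_le (min_le_left _ _)) B M hB hM)
      (ht₂ (htδ.trans_le (min_le_right _ _)) B M hB hM)).trans (le_of_eq ?_))
    conv_rhs => rw [← add_halves ε, ENNReal.ofReal_add (by positivity) (by positivity)]
    ring

theorem coe_spaceTime_real (T : ℝ) : (spaceTime (T : EReal) : Set (ℝ × E3)) = Ioo 0 T ×ˢ univ := by
  ext z
  simp [spaceTime]

theorem restrict_spaceTime_real (T : ℝ) : (volume : Measure (ℝ × E3)).restrict (spaceTime (T : EReal)) =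
    (volume.restrict (Ioo 0 T)).prod volume := by
  rw [coe_spaceTime_real, Measure.volume_eq_prod, ← Measure.prod_restrict, Measure.restrict_univ]

theorem lintegral_rpow_le_of_eLpNorm_le {q : ℝ} (hq : 0 < q) {v : E3 → E3} {C : ℝ≥0∞}
    (h : eLpNorm v (ENNReal.ofReal q) volume ≤ C) : ∫⁻ x, ‖v x‖ₑ ^ q ≤ C ^ q := by
  rw [eLpNorm_ofReal_eq hq] at h
  have := ENNReal.rpow_le_rpow h hq.le
  rwa [← ENNReal.rpow_mul, one_div, inv_mul_cancel₀ hq.ne', ENNReal.rpow_one] at this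

theorem exists_ae_of_eventually_initial {p : ℝ → Prop} (h : ∀ᶠ t in 𝓝[>] 0 ⊓ ae volume, p t) :
    ∃ δ : ℝ, 0 < δ ∧ ∀ᵐ t : ℝ, 0 < t → t < δ → p t := by
  obtain ⟨s, hs, s', hs', hss⟩ := mem_inf_iff_superset.1 h
  obtain ⟨δ, hδ, hsub⟩ := mem_nhdsGT_iff_exists_Ioo_subset.1 hs
  refine ⟨δ, hδ, ?_⟩
  filter_upwards [hs'] with t ht h0 h1
  exact hss ⟨hsub ⟨h0, h1⟩, ht⟩

/-- Fields in `L^∞(0, T; L^q)` that attain the initial value zero are small. -/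
theorem exists_isSmall {q : ℝ} (hq : 1 ≤ q) {v : ℝ → E3 → E3} (hv : MemLinftyLp T (ENNReal.ofReal q) v)
    (hlim : Tendsto (fun t => eLpNorm (v t) (ENNReal.ofReal q) volume) (𝓝[>] 0 ⊓ ae volume) (𝓝 0)) :
    ∃ u : ℝ × E3 → E3, IsSmall T u ∧
      ∀ᵐ z : ℝ × E3 ∂(volume.restrict (spaceTime (T : EReal))), u z = v z.1 z.2 := by
  have q0 : 0 < q := by linarith
  obtain ⟨hvm, C, hC⟩ := hv
  set g := hvm.mk (fun z : ℝ × E3 => v z.1 z.2) with hg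
  have hgm : Measurable g := hvm.stronglyMeasurable_mk.measurable
  have hS : MeasurableSet (spaceTime (T : EReal) : Set (ℝ × E3)) := (spaceTime (T : EReal)).isOpen.measurableSet
  set u : ℝ × E3 → E3 := (spaceTime (T : EReal) : Set (ℝ × E3)).indicator g with hu
  have hum : Measurable u := hgm.indicator hS
  have hae : ∀ᵐ z : ℝ × E3 ∂(volume.restrict (spaceTime (T : EReal))), u z = v z.1 z.2 := by
    filter_upwards [hvm.ae_eq_mk, ae_restrict_mem hS] with z hz hzS
    rw [hu, indicator_of_mem hzS, hg, ← hz]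
  have h0 : ∀ t x, t ∉ Ioo 0 T → u (t, x) = 0 := by
    intro t x ht
    rw [hu, indicator_of_notMem]
    rw [coe_spaceTime_real]
    exact fun h => ht h.1
  have hslice : ∀ᵐ t : ℝ, t ∈ Ioo 0 T → ∀ᵐ x, u (t, x) = v t x := by
    rw [restrict_spaceTime_real] at hae
    exact (ae_restrict_iff' measurableSet_Ioo).1 (Measure.ae_ae_of_ae_prod hae)
  have hHolder : ∀ (t ε : ℝ) (A : ℝ≥0∞) (B : E3 → ℝ≥0∞) (M : ℝ≥0), 0 < ε → Measurable B →
      (∀ x, B x ≤ M) → (∀ᵐ x, u (t, x) = v t x) → eLpNorm (v t) (ENNReal.ofReal q) volume ≤ A →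
      ∫⁻ x, ‖u (t, x)‖ₑ * B x ≤ ENNReal.ofReal ε * (∫⁻ x, B x) +
        ENNReal.ofReal (ε ^ (1 - q)) * (M * A ^ q) := by
    intro t ε A B M hε hB hM hx hA
    refine (lintegral_mul_le_add (q := q) ENNReal.coe_ne_top (ae_of_all _ hM) hB.aemeasurable hε
      hq).trans ?_
    gcongr
    refine le_trans (le_of_eq ?_) (lintegral_rpow_le_of_eLpNorm_le q0 hA)
    refine lintegral_congr_ae ?_
    filter_upwards [hx] with x hx
    rw [hx]
  refine ⟨u, ⟨hum, h0, fun ε hε => ?_, fun ε hε => ?_⟩, hae⟩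
  · have hfin : ENNReal.ofReal (ε ^ (1 - q)) * (C : ℝ≥0∞) ^ q ≠ ∞ := by
      have := ENNReal.rpow_ne_top_of_nonneg q0.le (ENNReal.coe_ne_top (r := C))
      finiteness
    refine ⟨(ENNReal.ofReal (ε ^ (1 - q)) * (C : ℝ≥0∞) ^ q).toNNReal, ?_⟩
    filter_upwards [hslice, (ae_restrict_iff' measurableSet_Ioo).1 hC] with t ht htC B M hB hM
    by_cases hT : t ∈ Ioo 0 T
    · refine (hHolder t ε C B M hε hB hM (ht hT) (htC hT)).trans (le_of_eq ?_)
      rw [ENNReal.coe_toNNReal hfin]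
      ring
    · simp [h0 t _ hT]
  · obtain ⟨δ, hδ, hp⟩ := exists_ae_of_eventually_initial
      (hlim.eventually (Iio_mem_nhds (ENNReal.ofReal_pos.2 hε)))
    refine ⟨δ, hδ, ?_⟩
    filter_upwards [hslice, hp] with t ht htp htδ B M hB hM
    by_cases hT : t ∈ Ioo 0 T
    · refine (hHolder t ε (ENNReal.ofReal ε) B M hε hB hM (ht hT) (htp hT.1 htδ).le).trans
        (le_of_eq ?_)
      -- The same `ε` serves as threshold in the splitting and as bound for the `L^q` norm, so that
      -- `ε^{1-q} ε^q = ε`.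
      have h1 : ENNReal.ofReal (ε ^ (1 - q)) * ENNReal.ofReal ε ^ q = ENNReal.ofReal ε := by
        rw [ENNReal.ofReal_rpow_of_pos hε, ← ENNReal.ofReal_mul (by positivity), ← Real.rpow_add hε]
        norm_num
      calc ENNReal.ofReal ε * (∫⁻ x, B x) + ENNReal.ofReal (ε ^ (1 - q)) * (M * ENNReal.ofReal ε ^ q)
          = ENNReal.ofReal ε * (∫⁻ x, B x) +
            ENNReal.ofReal (ε ^ (1 - q)) * ENNReal.ofReal ε ^ q * M := by ring
        _ = _ := by rw [h1]; ring
    · simp [h0 t _ hT]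

theorem IsSmall.integral_tensor (hu : IsSmall T u) {η : ℝ → ℝ} (hη : Continuous η) {θ : E3 → ℂ}
    {C : ℝ≥0} (hθ : IsBdd θ C) (k : Fin 3) :
    Integrable (fun z : ℝ × E3 => ((u z k : ℝ) : ℂ) * ((η z.1 : ℂ) * θ z.2)) ∧
    ∫ z : ℝ × E3, ((u z k : ℝ) : ℂ) * ((η z.1 : ℂ) * θ z.2) = timePair u k η θ := by
  have hm : Measurable fun z : ℝ × E3 => ((u z k : ℝ) : ℂ) * ((η z.1 : ℂ) * θ z.2) := by
    have h1 := measurable_coord_mul hu.measurable hθ.measurable k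
    have h2 : Measurable fun z : ℝ × E3 => ((η z.1 : ℝ) : ℂ) := by fun_prop
    have e1 : (fun z : ℝ × E3 => ((u z k : ℝ) : ℂ) * ((η z.1 : ℂ) * θ z.2)) =
        fun z => ((η z.1 : ℝ) : ℂ) * (((u z k : ℝ) : ℂ) * θ z.2) := funext fun z => by ring
    rw [e1]
    exact h2.mul h1
  have hi : Integrable (fun z : ℝ × E3 => ((u z k : ℝ) : ℂ) * ((η z.1 : ℂ) * θ z.2)) := by
    obtain ⟨K, hK⟩ := hu.bound 1 one_pos
    obtain ⟨S, hS⟩ := (isCompact_Icc (a := (0 : ℝ)) (b := T)).exists_bound_of_continuousOn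
      hη.continuousOn
    refine ⟨hm.aestronglyMeasurable, ?_⟩
    rw [HasFiniteIntegral, Measure.volume_eq_prod, lintegral_prod _ hm.enorm.aemeasurable]
    have hb : ∀ᵐ t : ℝ, ∫⁻ x, ‖((u (t, x) k : ℝ) : ℂ) * ((η t : ℂ) * θ x)‖ₑ ≤
        (Ioo 0 T).indicator (fun _ => ENNReal.ofReal S * (C + K * C)) t := by
      filter_upwards [hK] with t ht
      by_cases hT : t ∈ Ioo 0 T
      · rw [indicator_of_mem hT]
        have h1 := ht _ C hθ.measurable.enorm hθ.enorm_le
        rw [ENNReal.ofReal_one, one_mul] at h1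
        have h2 : ‖(η t : ℂ)‖ₑ ≤ ENNReal.ofReal S := by
          rw [← ofReal_norm, Complex.norm_real]
          exact ENNReal.ofReal_le_ofReal (hS t ⟨hT.1.le, hT.2.le⟩)
        have h3 : Measurable fun x => ‖((u (t, x) k : ℝ) : ℂ) * θ x‖ₑ :=
          ((measurable_coord_mul hu.measurable hθ.measurable k).comp measurable_prodMk_left).enorm
        calc ∫⁻ x, ‖((u (t, x) k : ℝ) : ℂ) * ((η t : ℂ) * θ x)‖ₑ
            = ∫⁻ x, ‖(η t : ℂ)‖ₑ * ‖((u (t, x) k : ℝ) : ℂ) * θ x‖ₑ := by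
              refine lintegral_congr fun x => ?_
              rw [← enorm_mul]
              congr 1
              ring
          _ = ‖(η t : ℂ)‖ₑ * ∫⁻ x, ‖((u (t, x) k : ℝ) : ℂ) * θ x‖ₑ := lintegral_const_mul _ h3
          _ ≤ ENNReal.ofReal S * (C + K * C) := by
              gcongr
              exact (lintegral_enorm_coord_mul_le u k θ t).trans
                (h1.trans (add_le_add_left hθ.lintegral_le _))
      · simp [hu.eq_zero t _ hT]
    refine (lintegral_mono_ae hb).trans_lt ?_
    rw [lintegral_indicator measurableSet_Ioo, setLIntegral_const, Real.volume_Ioo]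
    exact ENNReal.mul_lt_top (by finiteness) ENNReal.ofReal_lt_top
  refine ⟨hi, ?_⟩
  rw [Measure.volume_eq_prod] at hi ⊢
  rw [integral_prod _ hi, timePair]
  refine integral_congr_ae (ae_of_all _ fun t => ?_)
  dsimp only
  rw [pair, ← integral_const_mul]
  refine integral_congr_ae (ae_of_all _ fun x => ?_)
  dsimp only
  ring

theorem IsSmall.timePair_sub {u₁ u₂ : ℝ × E3 → E3} (h₁ : IsSmall T u₁) (h₂ : IsSmall T u₂) {η : ℝ → ℝ}
    (hη : Continuous η) {θ : E3 → ℂ} {C : ℝ≥0} (hθ : IsBdd θ C) (k : Fin 3) :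
    timePair (fun z => u₁ z - u₂ z) k η θ = timePair u₁ k η θ - timePair u₂ k η θ := by
  rw [← ((h₁.sub h₂).integral_tensor hη hθ k).2, ← (h₁.integral_tensor hη hθ k).2,
    ← (h₂.integral_tensor hη hθ k).2,
    ← integral_sub (h₁.integral_tensor hη hθ k).1 (h₂.integral_tensor hη hθ k).1]
  refine integral_congr_ae (ae_of_all _ fun z => ?_)
  dsimp only
  rw [PiLp.sub_apply]
  push_cast
  ring

end Small

/-! ### Tensor product test functions and their Fourier representation. -/

section Tensor

variable {η : ℝ → ℝ} {B : E3 → ℝ}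

/-- The tensor product of a function of time and a function of space. -/
def tensor (η : ℝ → ℝ) (B : E3 → ℝ) (z : ℝ × E3) : ℝ := η z.1 * B z.2

theorem tsupport_tensor_subset (η : ℝ → ℝ) (B : E3 → ℝ) :
    tsupport (tensor η B) ⊆ tsupport η ×ˢ tsupport B := by
  refine closure_minimal (fun z hz => ?_) ((isClosed_tsupport η).prod (isClosed_tsupport B))
  exact ⟨subset_tsupport _ (left_ne_zero_of_mul hz), subset_tsupport _ (right_ne_zero_of_mul hz)⟩

theorem isTest_tensor (hη : ContDiff ℝ (⊤ : ℕ∞) η) (hηc : HasCompactSupport η)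
    (hB : ContDiff ℝ (⊤ : ℕ∞) B) (hBc : HasCompactSupport B) : IsTest (tensor η B) :=
  ⟨(hη.comp contDiff_fst).mul (hB.comp contDiff_snd),
    (hηc.isCompact.prod hBc.isCompact).of_isClosed_subset (isClosed_tsupport _)
      (tsupport_tensor_subset η B)⟩

theorem fourierInv_const_mul (c : ℂ) (m : E3 → ℂ) (x : E3) :
    𝓕⁻ (fun ξ => c * m ξ) x = c * 𝓕⁻ m x := by
  rw [fourierInv_eq_mul, fourierInv_eq_mul, ← integral_const_mul]
  simp_rw [mul_assoc]

theorem fourier_slice_lineDeriv_tensor (hψ : IsTest (tensor η B)) {G : SchwartzMap E3 ℂ}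
    (hG : ∀ x, G x = B x) (l : Fin 3) (t : ℝ) (ξ : E3) :
    𝓕 ((hψ.lineDeriv (0, e l)).slice t) ξ =
      (η t * (2 * Real.pi * Complex.I)) * (((ξ l : ℝ) : ℂ) * 𝓕 G ξ) := by
  have h1 : hψ.slice t = (η t : ℂ) • G := by
    ext x
    rw [IsTest.slice_apply, smul_apply, hG, smul_eq_mul, tensor, Complex.ofReal_mul]
  rw [fourier_slice_lineDeriv hψ, h1, FourierTransform.fourier_smul, smul_apply, smul_eq_mul]
  ring

theorem lineDeriv_tensor (hψ : IsTest (tensor η B)) {G : SchwartzMap E3 ℂ}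
    (hG : ∀ x, G x = B x) (l : Fin 3) (t : ℝ) (x : E3) :
    ((lineDeriv ℝ (tensor η B) (t, x) (0, e l) : ℝ) : ℂ) =
      η t * (2 * Real.pi * Complex.I * 𝓕⁻ (fun ξ : E3 => ((ξ l : ℝ) : ℂ) * 𝓕 G ξ) x) := by
  refine (fourierInv_fourier_slice (hψ.lineDeriv (0, e l)) t x).symm.trans ?_
  have e1 : (fun ξ => 𝓕 ((hψ.lineDeriv (0, e l)).slice t) ξ) = fun ξ =>
      (η t * (2 * Real.pi * Complex.I)) * (((ξ l : ℝ) : ℂ) * 𝓕 G ξ) :=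
    funext (fourier_slice_lineDeriv_tensor hψ hG l t)
  rw [e1, fourierInv_const_mul, mul_assoc]

theorem fracLaplacian_lineDeriv_tensor (α : ℝ) (hψ : IsTest (tensor η B)) {G : SchwartzMap E3 ℂ}
    (hG : ∀ x, G x = B x) (l : Fin 3) (t : ℝ) (x : E3) :
    ((fracLaplacian α (fun x => lineDeriv ℝ (tensor η B) (t, x) (0, e l)) x : ℝ) : ℂ) =
      η t * (2 * Real.pi * Complex.I *
        𝓕⁻ (fun ξ : E3 => ((ξ l : ℝ) : ℂ) * (fracSymbol α ξ : ℂ) * 𝓕 G ξ) x) := by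
  rw [fracLaplacian_slice α (hψ.lineDeriv (0, e l)), ofReal_re_fourierInv fun ξ => by
    rw [fracSymbol_neg, fourier_slice_neg, map_mul, Complex.conj_ofReal]]
  have e1 : (fun ξ => (fracSymbol α ξ : ℂ) * 𝓕 ((hψ.lineDeriv (0, e l)).slice t) ξ) = fun ξ =>
      (η t * (2 * Real.pi * Complex.I)) * (((ξ l : ℝ) : ℂ) * (fracSymbol α ξ : ℂ) * 𝓕 G ξ) :=
    funext fun ξ => by
      rw [fourier_slice_lineDeriv_tensor hψ hG]
      ring
  rw [e1, fourierInv_const_mul, mul_assoc]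

theorem lineDeriv_time_lineDeriv_tensor (hη : Differentiable ℝ η) (hψ : IsTest (tensor η B))
    {G : SchwartzMap E3 ℂ} (hG : ∀ x, G x = B x) (l : Fin 3) (t : ℝ) (x : E3) :
    ((lineDeriv ℝ (fun z => lineDeriv ℝ (tensor η B) z (0, e l)) (t, x) (1, 0) : ℝ) : ℂ) =
      deriv η t * (2 * Real.pi * Complex.I * 𝓕⁻ (fun ξ : E3 => ((ξ l : ℝ) : ℂ) * 𝓕 G ξ) x) := by
  set c := 2 * Real.pi * Complex.I * 𝓕⁻ (fun ξ : E3 => ((ξ l : ℝ) : ℂ) * 𝓕 G ξ) x with hc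
  have hd : HasLineDerivAt ℝ (fun z => lineDeriv ℝ (tensor η B) z (0, e l))
      (lineDeriv ℝ (fun z => lineDeriv ℝ (tensor η B) z (0, e l)) (t, x) (1, 0)) (t, x) (1, 0) :=
    (((hψ.lineDeriv (0, e l)).smooth.differentiable
      (by simp)).differentiableAt).lineDifferentiableAt.hasLineDerivAt
  rw [HasLineDerivAt] at hd
  have h1 := hd.ofReal_comp
  have h2 : (fun τ : ℝ => ((lineDeriv ℝ (tensor η B) ((t, x) + τ • ((1 : ℝ), (0 : E3))) (0, e l) : ℝ)
      : ℂ)) = fun τ : ℝ => ((η (t + τ) : ℝ) : ℂ) * c := by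
    funext τ
    have : (t, x) + τ • ((1 : ℝ), (0 : E3)) = (t + τ, x) := by simp
    rw [this, lineDeriv_tensor hψ hG]
  rw [h2] at h1
  have h3 : HasDerivAt (fun τ : ℝ => η (t + τ)) (deriv η t) 0 := by
    have := (hη (t + 0)).hasDerivAt.comp_const_add t 0
    rwa [add_zero] at this
  exact h1.unique (h3.ofReal_comp.mul_const c)

/-- Symmetry of second derivatives is what cancels the pressure when the curl is taken. -/
theorem lineDeriv_lineDeriv_comm {ψ : ℝ × E3 → ℝ} (hψ : ContDiff ℝ (⊤ : ℕ∞) ψ) (v w z : ℝ × E3) :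
    lineDeriv ℝ (fun z => lineDeriv ℝ ψ z v) z w = lineDeriv ℝ (fun z => lineDeriv ℝ ψ z w) z v := by
  have h1 : ∀ v, (fun z => lineDeriv ℝ ψ z v) = fun z => fderiv ℝ ψ z v := fun v => funext fun z =>
    ((hψ.differentiable (by simp)).differentiableAt).lineDeriv_eq_fderiv
  have h2 : Differentiable ℝ (fderiv ℝ ψ) :=
    (hψ.fderiv_right (m := (⊤ : ℕ∞)) (by simp)).differentiable (by simp)
  have h3 : ∀ v w, lineDeriv ℝ (fun z => fderiv ℝ ψ z v) z w = fderiv ℝ (fderiv ℝ ψ) z w v := by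
    intro v w
    have h4 : HasFDerivAt (fun z => fderiv ℝ ψ z v)
        ((fderiv ℝ (fderiv ℝ ψ) z).flip v) z :=
      ((h2 z).hasFDerivAt.clm_apply (hasFDerivAt_const v z)).congr_fderiv (by ext <;> simp)
    rw [(h4.hasLineDerivAt w).lineDeriv]
    rfl
  rw [h1, h1, h3, h3]
  exact (hψ.contDiffAt.isSymmSndFDerivAt
    (by rw [minSmoothness_of_isRCLikeNormedField]; exact WithTop.coe_le_coe.2 le_top)).eq w v

end Tensor

/-! ### The weak equations tested against tensor products. -/

section Weak

variable {α r T' : ℝ} {f : E3 → Matrix (Fin 3) (Fin 3) ℝ} {T : EReal} {v : ℝ → E3 → E3}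
  {u : ℝ × E3 → E3} {η : ℝ → ℝ} {B : E3 → ℝ}

theorem spaceTime_subset (h : (T' : EReal) ≤ T) :
    (spaceTime (T' : EReal) : Set (ℝ × E3)) ⊆ spaceTime T := fun _ hz => ⟨hz.1, hz.2.trans_le h⟩

/-- The integrand is supported in the finite slab `(0, T')`, where `v` may be replaced by its
globally measurable representative `u`. This makes the integrals independent of the possibly
infinite lifespan `T`. -/
theorem setIntegral_spaceTime_eq (hT : (T' : EReal) ≤ T)
    (huv : ∀ᵐ z : ℝ × E3 ∂(volume.restrict (spaceTime (T' : EReal))), u z = v z.1 z.2)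
    {g : ℝ × E3 → E3 → ℝ} (hg : ∀ t x y, t ∉ Ioo 0 T' → g (t, x) y = 0) :
    ∫ z in (spaceTime T : Set (ℝ × E3)), g z (v z.1 z.2) = ∫ z, g z (u z) := by
  have h0 : ∀ z : ℝ × E3, z ∉ (spaceTime (T' : EReal) : Set (ℝ × E3)) → ∀ y, g z y = 0 := by
    rintro ⟨t, x⟩ hz y
    rw [coe_spaceTime_real] at hz
    exact hg t x y fun h => hz ⟨h, mem_univ x⟩
  rw [setIntegral_eq_of_subset_of_forall_sdiff_eq_zero (spaceTime T).isOpen.measurableSet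
    (spaceTime_subset hT) fun z hz => h0 z hz.2 _,
    ← setIntegral_eq_integral_of_forall_compl_eq_zero (μ := volume) (f := fun z => g z (u z))
      (s := (spaceTime (T' : EReal) : Set (ℝ × E3))) fun z hz => h0 z hz _]
  refine integral_congr_ae ?_
  filter_upwards [huv] with z hz
  rw [hz]

theorem tsupport_tensor_subset_spaceTime (hηT : tsupport η ⊆ Ioo 0 T') (hT : (T' : EReal) ≤ T)
    (B : E3 → ℝ) : tsupport (tensor η B) ⊆ spaceTime T := by
  refine (tsupport_tensor_subset η B).trans (Subset.trans ?_ (spaceTime_subset hT))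
  rw [coe_spaceTime_real]
  exact prod_mono hηT (subset_univ _)

theorem eq_zero_of_tsupport_subset (hηT : tsupport η ⊆ Ioo 0 T') {t : ℝ} (ht : t ∉ Ioo 0 T') :
    η t = 0 ∧ deriv η t = 0 :=
  ⟨image_eq_zero_of_notMem_tsupport fun h => ht (hηT h),
    image_eq_zero_of_notMem_tsupport fun h => ht (hηT (tsupport_deriv_subset h))⟩

theorem exists_isBdd_coord (G : SchwartzMap E3 ℂ) (l : Fin 3) :
    ∃ C, IsBdd (𝓕⁻ fun ξ : E3 => ((ξ l : ℝ) : ℂ) * 𝓕 G ξ) C :=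
  let ⟨_, _, _, h⟩ := exists_hasFourierBound_coord l
  ⟨_, (h (𝓕 G)).isBdd⟩

theorem exists_isBdd_coord_frac (hα : 0 < α) (G : SchwartzMap E3 ℂ) (l : Fin 3) :
    ∃ C, IsBdd (𝓕⁻ fun ξ : E3 => ((ξ l : ℝ) : ℂ) * (fracSymbol α ξ : ℂ) * 𝓕 G ξ) C :=
  let ⟨_, _, _, h⟩ := exists_hasFourierBound_coord_frac hα l
  ⟨_, (h (𝓕 G)).isBdd⟩

theorem IsSolution.sum_timePair_eq_zero (hv : IsSolution α f T (ENNReal.ofReal r) v)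
    (hT : (T' : EReal) ≤ T) (hu : IsSmall T' u)
    (huv : ∀ᵐ z : ℝ × E3 ∂(volume.restrict (spaceTime (T' : EReal))), u z = v z.1 z.2)
    (hη : ContDiff ℝ (⊤ : ℕ∞) η) (hηc : HasCompactSupport η) (hηT : tsupport η ⊆ Ioo 0 T')
    (hB : ContDiff ℝ (⊤ : ℕ∞) B) (hBc : HasCompactSupport B) {G : SchwartzMap E3 ℂ}
    (hG : ∀ x, G x = B x) :
    ∑ k, timePair u k η (𝓕⁻ fun ξ : E3 => ((ξ k : ℝ) : ℂ) * 𝓕 G ξ) = 0 := by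
  have hψ := isTest_tensor hη hηc hB hBc
  let ψ : 𝓓(spaceTime T, ℝ) :=
    ⟨tensor η B, hψ.smooth, hψ.compact, tsupport_tensor_subset_spaceTime hηT hT B⟩
  choose C hC using exists_isBdd_coord G
  have h1 := hv.divergence_free ψ
  simp_rw [lineDerivOp_testFunction] at h1
  rw [setIntegral_spaceTime_eq hT huv (g := fun z y => ∑ k, y k * lineDeriv ℝ ψ z (0, e k))
    fun t x y ht => Finset.sum_eq_zero fun k _ => by
      have := lineDeriv_tensor hψ hG k t x
      rw [(eq_zero_of_tsupport_subset hηT ht).1, Complex.ofReal_zero, zero_mul,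
        Complex.ofReal_eq_zero] at this
      exact mul_eq_zero_of_right _ this] at h1
  have h2 : ∀ z : ℝ × E3, (((∑ k, u z k * lineDeriv ℝ ψ z (0, e k) : ℝ)) : ℂ) =
      2 * Real.pi * Complex.I * ∑ k, ((u z k : ℝ) : ℂ) *
        ((η z.1 : ℂ) * (𝓕⁻ fun ξ : E3 => ((ξ k : ℝ) : ℂ) * 𝓕 G ξ) z.2) := by
    intro z
    rw [Complex.ofReal_sum, Finset.mul_sum]
    refine Finset.sum_congr rfl fun k _ => ?_
    rw [Complex.ofReal_mul]
    have := lineDeriv_tensor hψ hG k z.1 z.2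
    rw [show ((lineDeriv ℝ ψ z (0, e k) : ℝ) : ℂ) = _ from this]
    ring
  have h3 := congrArg (fun a : ℝ => (a : ℂ)) h1
  dsimp only at h3
  rw [← integral_complex_ofReal, integral_congr_ae (ae_of_all _ h2), integral_const_mul,
    integral_finsetSum _ fun k _ => (hu.integral_tensor hη.continuous (hC k) k).1,
    Finset.sum_congr rfl fun k _ => (hu.integral_tensor hη.continuous (hC k) k).2,
    Complex.ofReal_zero] at h3
  exact (mul_eq_zero.1 h3).resolve_left Complex.two_pi_I_ne_zero

/-- The left-hand side of the equation for the curl of a field. -/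
def curlPair (α : ℝ) (u : ℝ × E3 → E3) (η : ℝ → ℝ) (m : SchwartzMap E3 ℂ) (k l : Fin 3) : ℂ :=
  timePair u k (deriv η) (𝓕⁻ fun ξ : E3 => ((ξ l : ℝ) : ℂ) * m ξ) -
    timePair u k η (𝓕⁻ fun ξ : E3 => ((ξ l : ℝ) : ℂ) * (fracSymbol α ξ : ℂ) * m ξ)

/-- The contribution of the force to the equation for the curl. -/
def curlForce (α : ℝ) (f : E3 → Matrix (Fin 3) (Fin 3) ℝ) (T : ℝ) (ψ : ℝ × E3 → ℝ) (k l : Fin 3) :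
    ℝ :=
  ∫ z in (spaceTime (T : EReal) : Set (ℝ × E3)), ∑ h, forceTensor α f z.1 z.2 h k *
    lineDeriv ℝ (fun z => lineDeriv ℝ ψ z (0, e l)) z (0, e h)

theorem lineDeriv_eq_zero_of_notMem_tsupport {ψ : ℝ × E3 → ℝ} {z : ℝ × E3} (hz : z ∉ tsupport ψ)
    (w : ℝ × E3) : lineDeriv ℝ ψ z w = 0 := by
  have h : ψ =ᶠ[𝓝 z] fun _ => 0 := notMem_tsupport_iff_eventuallyEq.1 hz
  rw [h.lineDeriv_eq]
  simp [lineDeriv]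

/-- The `k`-th equation is tested with `∂_l ψ` and the `l`-th with `∂_k ψ`. On subtraction the
pressure drops out, since `∂_k ∂_l ψ = ∂_l ∂_k ψ`. The remaining force term depends neither on the
solution nor on its lifespan, so it cancels between two solutions. -/
theorem IsSolution.curlPair_sub_curlPair (hα : 0 < α) (hv : IsSolution α f T (ENNReal.ofReal r) v)
    (hT : (T' : EReal) ≤ T) (hu : IsSmall T' u)
    (huv : ∀ᵐ z : ℝ × E3 ∂(volume.restrict (spaceTime (T' : EReal))), u z = v z.1 z.2)
    (hη : ContDiff ℝ (⊤ : ℕ∞) η) (hηc : HasCompactSupport η) (hηT : tsupport η ⊆ Ioo 0 T')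
    (hB : ContDiff ℝ (⊤ : ℕ∞) B) (hBc : HasCompactSupport B) {G : SchwartzMap E3 ℂ}
    (hG : ∀ x, G x = B x) (k l : Fin 3) :
    2 * Real.pi * Complex.I * (curlPair α u η (𝓕 G) k l - curlPair α u η (𝓕 G) l k) =
      ((curlForce α f T' (tensor η B) k l - curlForce α f T' (tensor η B) l k : ℝ) : ℂ) := by
  have hψ := isTest_tensor hη hηc hB hBc
  let ψ : 𝓓(spaceTime T, ℝ) :=
    ⟨tensor η B, hψ.smooth, hψ.compact, tsupport_tensor_subset_spaceTime hηT hT B⟩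
  let ψ' (l : Fin 3) : 𝓓(spaceTime T, ℝ) := ∂_{((0 : ℝ), e l)} ψ
  have hψ' : ∀ l z, ψ' l z = lineDeriv ℝ (tensor η B) z (0, e l) := fun l z =>
    lineDerivOp_testFunction ψ _ z
  have hψ'' : ∀ l w z, (∂_{w} (ψ' l)) z =
      lineDeriv ℝ (fun z => lineDeriv ℝ (tensor η B) z (0, e l)) z w := fun l w z => by
    rw [lineDerivOp_testFunction, funext (hψ' l)]
  choose C hC using exists_isBdd_coord G
  choose C' hC' using exists_isBdd_coord_frac hα G
  obtain ⟨p, hp⟩ := hv.momentum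
  have key : ∀ k l, ((∫ z in (spaceTime T : Set (ℝ × E3)), v z.1 z.2 k *
        (-(∂_{((1 : ℝ), (0 : E3))} (ψ' l)) z + fracLaplacian α (fun x => ψ' l (z.1, x)) z.2) : ℝ) : ℂ) =
      -(2 * Real.pi * Complex.I * curlPair α u η (𝓕 G) k l) := by
    intro k l
    have e1 := lineDeriv_time_lineDeriv_tensor (hη.differentiable (by simp)) hψ hG l
    have e2 := fracLaplacian_lineDeriv_tensor α hψ hG l
    simp_rw [hψ'', hψ']
    rw [setIntegral_spaceTime_eq hT huv (g := fun z y => y k *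
      (-lineDeriv ℝ (fun z => lineDeriv ℝ (tensor η B) z (0, e l)) z (1, 0) +
        fracLaplacian α (fun x => lineDeriv ℝ (tensor η B) (z.1, x) (0, e l)) z.2))
      fun t x y ht => by
        have e3 := e1 t x
        have e4 := e2 t x
        rw [(eq_zero_of_tsupport_subset hηT ht).2, Complex.ofReal_zero, zero_mul,
          Complex.ofReal_eq_zero] at e3
        rw [(eq_zero_of_tsupport_subset hηT ht).1, Complex.ofReal_zero, zero_mul,
          Complex.ofReal_eq_zero] at e4
        dsimp only
        rw [e3, e4]
        simp]
    have h2 : ∀ z : ℝ × E3, ((u z k *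
        (-lineDeriv ℝ (fun z => lineDeriv ℝ (tensor η B) z (0, e l)) z (1, 0) +
          fracLaplacian α (fun x => lineDeriv ℝ (tensor η B) (z.1, x) (0, e l)) z.2) : ℝ) : ℂ) =
        2 * Real.pi * Complex.I * (((u z k : ℝ) : ℂ) * ((η z.1 : ℂ) *
          (𝓕⁻ fun ξ : E3 => ((ξ l : ℝ) : ℂ) * (fracSymbol α ξ : ℂ) * 𝓕 G ξ) z.2)) -
        2 * Real.pi * Complex.I * (((u z k : ℝ) : ℂ) * (((deriv η z.1 : ℝ) : ℂ) *
          (𝓕⁻ fun ξ : E3 => ((ξ l : ℝ) : ℂ) * 𝓕 G ξ) z.2)) := by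
      rintro ⟨t, x⟩
      rw [Complex.ofReal_mul, Complex.ofReal_add, Complex.ofReal_neg, e1, e2]
      ring
    have hd : Continuous (deriv η) := hη.continuous_deriv (by simp)
    rw [← integral_complex_ofReal, integral_congr_ae (ae_of_all _ h2),
      integral_sub ((hu.integral_tensor hη.continuous (hC' l) k).1.const_mul _)
        ((hu.integral_tensor hd (hC l) k).1.const_mul _), integral_const_mul, integral_const_mul,
      (hu.integral_tensor hη.continuous (hC' l) k).2, (hu.integral_tensor hd (hC l) k).2, curlPair]
    ring
  have force : ∀ k l, (∫ z in (spaceTime T : Set (ℝ × E3)), ∑ h, forceTensor α f z.1 z.2 h k *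
      (∂_{((0 : ℝ), e h)} (ψ' l)) z) = curlForce α f T' (tensor η B) k l := by
    intro k l
    simp_rw [hψ'']
    refine setIntegral_eq_of_subset_of_forall_sdiff_eq_zero (spaceTime T).isOpen.measurableSet
      (spaceTime_subset hT) fun z hz => Finset.sum_eq_zero fun h _ => ?_
    have hz' : z ∉ tsupport (tensor η B) := fun h =>
      hz.2 (tsupport_tensor_subset_spaceTime hηT le_rfl B h)
    have h0 : (fun z => lineDeriv ℝ (tensor η B) z (0, e l)) =ᶠ[𝓝 z] fun _ => 0 := by
      filter_upwards [(isClosed_tsupport _).isOpen_compl.mem_nhds hz'] with y hy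
      exact lineDeriv_eq_zero_of_notMem_tsupport hy _
    rw [h0.lineDeriv_eq]
    simp [lineDeriv]
  have hcomm : (∂_{((0 : ℝ), e k)} (ψ' l)) = ∂_{((0 : ℝ), e l)} (ψ' k) := by
    ext z
    rw [hψ'', hψ'']
    exact lineDeriv_lineDeriv_comm hψ.smooth _ _ _
  have h1 := hp k (ψ' l)
  have h2 := hp l (ψ' k)
  rw [Distribution.lineDerivOp_apply_apply, map_neg, force] at h1 h2
  rw [hcomm] at h1
  have h3 := key k l
  have h4 := key l k
  have h5 := congrArg (fun a : ℝ => (a : ℂ)) h1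
  have h6 := congrArg (fun a : ℝ => (a : ℂ)) h2
  push_cast at h5 h6 h3 h4 ⊢
  rw [h3] at h5
  rw [h4] at h6
  linear_combination h6 - h5

end Weak

/-! ### Comparison of two solutions. -/

section Uniqueness

variable {α r₁ r₂ T' : ℝ} {f : E3 → Matrix (Fin 3) (Fin 3) ℝ} {T₁ T₂ : EReal} {v₁ v₂ : ℝ → E3 → E3}
  {u u₁ u₂ : ℝ × E3 → E3}

/-- Distributional test functions are real and compactly supported. Complex linearity recovers
complex ones from real and imaginary parts, and density recovers all Schwartz functions. -/
theorem eq_zero_of_forall_real (X : SchwartzMap E3 ℂ →L[ℂ] ℂ)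
    (h : ∀ (B : E3 → ℝ) (G : SchwartzMap E3 ℂ), ContDiff ℝ (⊤ : ℕ∞) B → HasCompactSupport B →
      (∀ x, G x = B x) → X G = 0) (G : SchwartzMap E3 ℂ) : X G = 0 := by
  refine eq_zero_of_forall_hasCompactSupport X.continuous (fun G hG => ?_) G
  have hre : ContDiff ℝ (⊤ : ℕ∞) fun x => (G x).re := Complex.reCLM.contDiff.comp (G.smooth _)
  have him : ContDiff ℝ (⊤ : ℕ∞) fun x => (G x).im := Complex.imCLM.contDiff.comp (G.smooth _)
  have hrec : HasCompactSupport fun x => (G x).re := hG.comp_left (g := Complex.re) rfl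
  have himc : HasCompactSupport fun x => (G x).im := hG.comp_left (g := Complex.im) rfl
  have key : ∀ B : E3 → ℝ, ContDiff ℝ (⊤ : ℕ∞) B → HasCompactSupport B →
      ∃ H : SchwartzMap E3 ℂ, ∀ x, H x = B x := fun B hB hBc =>
    ⟨(hBc.comp_left (g := fun a : ℝ => (a : ℂ)) rfl).toSchwartzMap
      (Complex.ofRealCLM.contDiff.comp hB), fun _ => rfl⟩
  obtain ⟨H, hH⟩ := key _ hre hrec
  obtain ⟨I, hI⟩ := key _ him himc
  have hGHI : G = H + Complex.I • I := by
    ext x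
    rw [add_apply, smul_apply, hH, hI, smul_eq_mul, mul_comm, Complex.re_add_im]
  rw [hGHI, map_add, map_smul, h _ H hre hrec hH, h _ I him himc hI, smul_zero, add_zero]

theorem IsSmall.exists_coord_clm (hu : IsSmall T' u) {η : ℝ → ℝ} (hη : Continuous η) (k l : Fin 3) :
    ∃ L : SchwartzMap E3 ℂ →L[ℂ] ℂ, ∀ m : SchwartzMap E3 ℂ,
      L m = timePair u k η (𝓕⁻ fun ξ : E3 => ((ξ l : ℝ) : ℂ) * m ξ) := by
  obtain ⟨K, N, hK, hb⟩ := exists_hasFourierBound_coord l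
  refine hu.exists_timePair_clm hη hK (fun G => (hb G).isBdd) (fun G H x => ?_) (fun c G x => ?_) k
  · rw [← fourierInv_add_apply (hb G).integrable (hb H).integrable]
    simp_rw [add_apply, mul_add]
  · rw [← fourierInv_const_mul]
    refine congrArg (fun m : E3 → ℂ => 𝓕⁻ m x) (funext fun ξ => ?_)
    rw [smul_apply, smul_eq_mul]
    ring

theorem IsSmall.exists_coord_frac_clm (hα : 0 < α) (hu : IsSmall T' u) {η : ℝ → ℝ}
    (hη : Continuous η) (k l : Fin 3) :
    ∃ L : SchwartzMap E3 ℂ →L[ℂ] ℂ, ∀ m : SchwartzMap E3 ℂ, L m =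
      timePair u k η (𝓕⁻ fun ξ : E3 => ((ξ l : ℝ) : ℂ) * (fracSymbol α ξ : ℂ) * m ξ) := by
  obtain ⟨K, N, hK, hb⟩ := exists_hasFourierBound_coord_frac hα l
  refine hu.exists_timePair_clm hη hK (fun G => (hb G).isBdd) (fun G H x => ?_) (fun c G x => ?_) k
  · rw [← fourierInv_add_apply (hb G).integrable (hb H).integrable]
    simp_rw [add_apply, mul_add]
  · rw [← fourierInv_const_mul]
    refine congrArg (fun m : E3 → ℂ => 𝓕⁻ m x) (funext fun ξ => ?_)
    rw [smul_apply, smul_eq_mul]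
    ring

theorem IsSmall.exists_curlPair_clm (hα : 0 < α) (hu : IsSmall T' u) {η : ℝ → ℝ}
    (hη : ContDiff ℝ (⊤ : ℕ∞) η) (k l : Fin 3) :
    ∃ L : SchwartzMap E3 ℂ →L[ℂ] ℂ, ∀ m, L m = curlPair α u η m k l := by
  obtain ⟨L, hL⟩ := hu.exists_coord_clm (hη.continuous_deriv (by simp)) k l
  obtain ⟨L', hL'⟩ := hu.exists_coord_frac_clm hα hη.continuous k l
  exact ⟨L - L', fun m => by rw [sub_apply, hL, hL', curlPair]⟩

theorem IsSmall.curlPair_sub (hα : 0 < α) (h₁ : IsSmall T' u₁) (h₂ : IsSmall T' u₂) {η : ℝ → ℝ}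
    (hη : ContDiff ℝ (⊤ : ℕ∞) η) (m : SchwartzMap E3 ℂ) (k l : Fin 3) :
    curlPair α (fun z => u₁ z - u₂ z) η m k l = curlPair α u₁ η m k l - curlPair α u₂ η m k l := by
  obtain ⟨K, N, -, hb⟩ := exists_hasFourierBound_coord l
  obtain ⟨K', N', -, hb'⟩ := exists_hasFourierBound_coord_frac hα l
  rw [curlPair, h₁.timePair_sub h₂ (hη.continuous_deriv (by simp)) (hb m).isBdd,
    h₁.timePair_sub h₂ hη.continuous (hb' m).isBdd, curlPair, curlPair]
  ring

theorem eq_zero_of_forall_fourier_real (X : SchwartzMap E3 ℂ →L[ℂ] ℂ)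
    (h : ∀ (B : E3 → ℝ) (G : SchwartzMap E3 ℂ), ContDiff ℝ (⊤ : ℕ∞) B → HasCompactSupport B →
      (∀ x, G x = B x) → X (𝓕 G) = 0) (m : SchwartzMap E3 ℂ) : X m = 0 := by
  have := eq_zero_of_forall_real (X.comp (FourierTransform.fourierCLM ℂ (SchwartzMap E3 ℂ)))
    (fun B G hB hBc hG => h B G hB hBc hG) (𝓕⁻ m)
  have h2 : X (𝓕 (𝓕⁻ m)) = 0 := this
  rwa [FourierTransform.fourier_fourierInv_eq] at h2

/-- Both identities are known only for symbols of real test functions. Each side is a continuous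
functional of the symbol, so they extend to all Schwartz symbols, in particular to the annular ones
needed for the hierarchy. -/
theorem IsSolution.isHomogeneous_sub (hα : 0 < α)
    (hv₁ : IsSolution α f T₁ (ENNReal.ofReal r₁) v₁) (hv₂ : IsSolution α f T₂ (ENNReal.ofReal r₂) v₂)
    (hT₁ : (T' : EReal) ≤ T₁) (hT₂ : (T' : EReal) ≤ T₂) (hu₁ : IsSmall T' u₁) (hu₂ : IsSmall T' u₂)
    (huv₁ : ∀ᵐ z : ℝ × E3 ∂(volume.restrict (spaceTime (T' : EReal))), u₁ z = v₁ z.1 z.2)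
    (huv₂ : ∀ᵐ z : ℝ × E3 ∂(volume.restrict (spaceTime (T' : EReal))), u₂ z = v₂ z.1 z.2) :
    IsHomogeneous α T' fun z => u₁ z - u₂ z := by
  have hu := hu₁.sub hu₂
  refine ⟨fun η hη hηc hηT m k l => ?_, fun η hη hηc hηT m => ?_⟩
  · obtain ⟨L, hL⟩ := hu.exists_curlPair_clm hα hη k l
    obtain ⟨L', hL'⟩ := hu.exists_curlPair_clm hα hη l k
    have := eq_zero_of_forall_fourier_real (L - L') (fun B G hB hBc hG => ?_) m
    · rw [sub_apply, hL, hL', sub_eq_zero] at this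
      exact this
    · rw [sub_apply, hL, hL', hu₁.curlPair_sub hα hu₂ hη, hu₁.curlPair_sub hα hu₂ hη]
      have e1 := hv₁.curlPair_sub_curlPair hα hT₁ hu₁ huv₁ hη hηc hηT hB hBc hG k l
      have e2 := hv₂.curlPair_sub_curlPair hα hT₂ hu₂ huv₂ hη hηc hηT hB hBc hG k l
      refine (mul_eq_zero.1 ?_).resolve_left Complex.two_pi_I_ne_zero
      linear_combination e1 - e2
  · choose L hL using fun k => hu.exists_coord_clm hη.continuous k k
    have := eq_zero_of_forall_fourier_real (∑ k, L k) (fun B G hB hBc hG => ?_) m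
    · rw [sum_apply] at this
      rw [← this]
      exact Finset.sum_congr rfl fun k _ => (hL k m).symm
    · choose C hC using exists_isBdd_coord G
      rw [sum_apply]
      simp_rw [hL]
      rw [Finset.sum_congr rfl fun k _ => hu₁.timePair_sub hu₂ hη.continuous (hC k) k,
        Finset.sum_sub_distrib,
        hv₁.sum_timePair_eq_zero hT₁ hu₁ huv₁ hη hηc hηT hB hBc hG,
        hv₂.sum_timePair_eq_zero hT₂ hu₂ huv₂ hη hηc hηT hB hBc hG, sub_zero]

theorem IsSolution.ae_eq_of_real (hα : 0 < α) (hr₁ : 1 ≤ r₁) (hr₂ : 1 ≤ r₂) (hT' : 0 < T')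
    (hv₁ : IsSolution α f T₁ (ENNReal.ofReal r₁) v₁) (hv₂ : IsSolution α f T₂ (ENNReal.ofReal r₂) v₂)
    (hT₁ : (T' : EReal) ≤ T₁) (hT₂ : (T' : EReal) ≤ T₂)
    (hl₁ : Tendsto (fun t => eLpNorm (v₁ t) (ENNReal.ofReal r₁) volume) (𝓝[>] 0 ⊓ ae volume) (𝓝 0))
    (hl₂ : Tendsto (fun t => eLpNorm (v₂ t) (ENNReal.ofReal r₂) volume) (𝓝[>] 0 ⊓ ae volume) (𝓝 0)) :
    ∀ᵐ z : ℝ × E3 ∂(volume.restrict (spaceTime (T' : EReal))), v₁ z.1 z.2 = v₂ z.1 z.2 := by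
  obtain ⟨u₁, hu₁, h₁⟩ := exists_isSmall hr₁ (hv₁.memLinftyLp T' hT' hT₁) hl₁
  obtain ⟨u₂, hu₂, h₂⟩ := exists_isSmall hr₂ (hv₂.memLinftyLp T' hT' hT₂) hl₂
  have h0 := (hv₁.isHomogeneous_sub hα hv₂ hT₁ hT₂ hu₁ hu₂ h₁ h₂).ae_eq_zero hα hT' (hu₁.sub hu₂)
  filter_upwards [h₁, h₂, ae_restrict_of_ae h0] with z e1 e2 e3
  rw [← e1, ← e2]
  exact sub_eq_zero.1 e3

theorem IsSolution.ae_eq (hα : 0 < α) (hr₁ : 1 ≤ r₁) (hr₂ : 1 ≤ r₂) (hT : 0 < T₁) (hTT : T₁ ≤ T₂)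
    (hv₁ : IsSolution α f T₁ (ENNReal.ofReal r₁) v₁) (hv₂ : IsSolution α f T₂ (ENNReal.ofReal r₂) v₂)
    (hl₁ : Tendsto (fun t => eLpNorm (v₁ t) (ENNReal.ofReal r₁) volume) (𝓝[>] 0 ⊓ ae volume) (𝓝 0))
    (hl₂ : Tendsto (fun t => eLpNorm (v₂ t) (ENNReal.ofReal r₂) volume) (𝓝[>] 0 ⊓ ae volume) (𝓝 0)) :
    ∀ᵐ z : ℝ × E3 ∂(volume.restrict (spaceTime T₁)), v₁ z.1 z.2 = v₂ z.1 z.2 := by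
  induction T₁ with
  | bot => exact absurd hT (by simp)
  | coe T => exact hv₁.ae_eq_of_real hα hr₁ hr₂ (EReal.coe_pos.1 hT) hv₂ le_rfl hTT hl₁ hl₂
  | top =>
    -- For an infinite lifespan the half-space is exhausted by finite slabs; their lengths `n + 1`
    -- are all positive, as the finite-time statement demands.
    have hS : (spaceTime ⊤ : Set (ℝ × E3)) = ⋃ n : ℕ, spaceTime ((n + 1 : ℝ) : EReal) := by
      ext z
      refine ⟨fun hz => ?_, fun hz => ?_⟩
      · obtain ⟨n, hn⟩ := exists_nat_gt z.1
        exact mem_iUnion.2 ⟨n, hz.1, EReal.coe_lt_coe_iff.2 (hn.trans (lt_add_one _))⟩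
      · obtain ⟨n, hn⟩ := mem_iUnion.1 hz
        exact spaceTime_subset le_top hn
    rw [hS, ae_restrict_iUnion_iff]
    exact fun n => hv₁.ae_eq_of_real hα hr₁ hr₂ (by positivity) hv₂ le_top (le_top.trans hTT) hl₁ hl₂

end Uniqueness

end NonlocalStokes

end

theorem proposition4p1 (α q : ℝ) (hα : 1 / 2 < α) (hq : 1 < q) (hqα : q < 3 / (2 * α - 1))
    (f : NonlocalStokes.E3 → Matrix (Fin 3) (Fin 3) ℝ)
    (hf : ∀ i j, MemLp (fun x => f x i j) (ENNReal.ofReal q) volume) :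
    -- the Duhamel integral converges absolutely, for every time and almost every point
    (∀ t : ℝ, 0 < t → ∀ᵐ x : NonlocalStokes.E3, ∀ h k j : Fin 3,
      IntegrableOn (fun sy : ℝ × NonlocalStokes.E3 =>
        NonlocalStokes.oseenGrad α h k j (x - sy.2) (t - sy.1)
          * NonlocalStokes.forceTensor α f sy.1 sy.2 h j) (Ioo 0 t ×ˢ univ) volume) ∧
    -- it is a solution, bounded in `L^q` on finite time intervals
    NonlocalStokes.IsSolution α f ⊤ (ENNReal.ofReal q) (NonlocalStokes.duhamel α f) ∧
    -- which attains the initial value zero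
    Tendsto (fun t => eLpNorm (NonlocalStokes.duhamel α f t) (ENNReal.ofReal q) volume)
      (𝓝[>] 0) (𝓝 0) ∧
    -- and it is unique; the limit at time zero is an essential limit
    ∀ (T : EReal) (_ : 0 < T) (q₁ : ℝ) (_ : 1 ≤ q₁)
      (v : ℝ → NonlocalStokes.E3 → NonlocalStokes.E3),
      NonlocalStokes.IsSolution α f T (ENNReal.ofReal q₁) v →
      Tendsto (fun t => eLpNorm (v t) (ENNReal.ofReal q₁) volume)
        (𝓝[>] 0 ⊓ ae volume) (𝓝 0) →
      ∀ᵐ z ∂(volume.restrict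
          (NonlocalStokes.spaceTime T : Set (ℝ × NonlocalStokes.E3))),
        v z.1 z.2 = NonlocalStokes.duhamel α f z.1 z.2 := by
  have hα0 : 0 < α := by linarith
  have hw := NonlocalStokes.tendsto_eLpNorm_duhamel_zero hα hq hqα hf
  have hs := NonlocalStokes.isSolution_duhamel hα hq hqα hf
  exact ⟨fun t ht => NonlocalStokes.ae_integrableOn_duhamel hα hq hqα hf ht, hs, hw,
    fun T hT q₁ hq₁ v hv hlim => hv.ae_eq hα0 hq₁ hq.le hT le_top hs hlim
      (hw.mono_left inf_le_left)⟩
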